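/- **Conventions.** All equations are of the form $u''=Q\,u$ with $Q$ rational over $\mathbb C$. A rational change of variable $x=x(z)$, $u=(dx/dz)^{1/2}v$, takes $\frac{d^2u}{dx^2}=Q(x)u$ to $\frac{d^2v}{dz^2}=Vv$ with $$V=Q(x(z))\,x'(z)^2-\tfrac12\Big(\tfrac{x'''}{x'}-\tfrac32\big(\tfrac{x''}{x'}\big)^2\Big).$$ $W_{k,m}$ has the potential $\frac14-\frac kx+\frac{m^2-1/4}{x^2}$ and $DW_m$ has $\frac1x+\frac{m^2-1/4}{x^2}$ ($k,m\in\mathbb C$; both depend on $m^2$ only, and $m=a$ below means $m=\pm a$). The cover $x:\mathbb P^1\to\mathbb P^1$ has type $(\mu_1+\mu_2+\cdots|\nu_1+\nu_2+\cdots)$ if the $\mu_i$, $\nu_j$ are the multiplicities of the points over $0$, $\infty$. An equation has singularity type $(r_1)(r_2)\cdots$ if the $r_i$ are the Poincaré ranks of its singular points in $\mathbb P^1$ ($0$ for a regular singularity), where at most one apparent singularity with exponents $-\frac12,\frac32$ may be left out. *Equations of the Painlevé type* are, up to a Möbius change of $z$, those with one of the following potentials, where $A=\frac3{4(z-q)^2}$,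 the Hamiltonian system is $q'=\partial K/\partial p$, $p'=-\partial K/\partial q$, and $q$ then solves the Painlevé equation: * P1 ($q''=6q^2+t$): $4z^3+2tz+2K+A-\frac p{z-q}$, $K=\frac{p^2}2-2q^3-tq$. * P2($\alpha$) ($q''=2q^3+tq+\alpha$): $z^4+tz^2+2\alpha z+2K+A-\frac p{z-q}$, $K=\frac{p^2}2-\frac{q^4}2-\frac{tq^2}2-\alpha q$. * P34($\alpha$) ($q''=\frac{q'^2}{2q}+2q^2-tq-\frac\alpha{2q}$): $\frac z2-\frac t2+\frac{\alpha-1}{4z^2}-\frac Kz+A-\frac{pq}{z(z-q)}$, $K=-qp^2+p+\frac{q^2}2-\frac{tq}2+\frac{\alpha-1}{4q}$. * P4($\alpha,\beta$) ($q''=\frac{q'^2}{2q}+\frac32q^3+4tq^2+2(t^2-\alpha)q+\frac\beta q$): $\frac{a_0}{z^2}+\frac K{2z}+a_1+(\frac{z+2t}4)^2+A-\frac{pq}{z(z-q)}$, $K=2qp^2-2p-\frac{2a_0}q-2a_1q-2q(\frac{q+2t}4)^2$, $a_0=-\frac\beta8-\frac14$, $a_1=-\frac\alpha4$. * P3$'$($\alpha,\beta,\gamma,\delta$)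 ($q''=\frac{q'^2}q-\frac{q'}t+\frac{q^2(\alpha+\gamma q)}{4t^2}+\frac\beta{4t}+\frac\delta{4q}$, $t\ne0$): $\frac{a_0t^2}{z^4}+\frac{a_0't}{z^3}+\frac{tK}{z^2}+\frac{a_\infty'}z+a_\infty+A-\frac{pq}{z(z-q)}$, $tK=q^2p^2-qp-\frac{a_0t^2}{q^2}-\frac{a_0't}q-a_\infty'q-a_\infty q^2$, $a_0=-\frac\delta{16}$, $a_0'=-\frac\beta8$, $a_\infty=\frac\gamma{16}$, $a_\infty'=\frac\alpha8$. Type $D_6$: $\gamma\delta\ne0$. Type $D_7$: $\delta=0$, $\beta\gamma\ne0$, or $\gamma=0$, $\alpha\delta\neq0$. Type $D_8$: $\gamma=\delta=0$, $\alpha\beta\ne0$. * P5($\alpha,\beta,\gamma,\delta$) ($q''=(\frac1{2q}+\frac1{q-1})q'^2-\frac{q'}t+\frac{(q-1)^2}{t^2}(\alpha q+\frac\beta q)+\frac{\gamma q}t+\frac{\delta q(q+1)}{q-1}$, $t\ne0$, with $\delta\ne0$, or degenerate P5 with $\delta=0\ne\gamma$): $\frac{a_1t^2}{(z-1)^4}+\frac{tK}{(z-1)^2z}+\frac{a_2t}{(z-1)^3}-\frac{p(q-1)q}{z(z-1)(z-q)}+\frac{a_\infty}{(z-1)^2}+\frac{a_0}{z^2}+A$,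 $tK=q(q-1)^2\big[-\frac{a_1t^2}{(q-1)^4}-\frac{a_2t}{(q-1)^3}+p^2-(\frac1q+\frac1{q-1})p-\frac{a_\infty}{(q-1)^2}-\frac{a_0}{q^2}\big]$, $a_0=-\frac\beta2-\frac14$, $a_1=-\frac\delta2$, $a_2=-\frac\gamma2$, $a_\infty=\frac{\alpha+\beta}2-\frac34$. Here $q$ avoids $0$ for P34, P4, P3 and $0,1$ for P5. The degenerate forms at values of $t$ where $q(t)$ runs into a fixed singular point or $\infty$ also count: these are the same potentials without the terms containing $z-q$, and with a free constant in place of the coefficient containing $K$. A *confluent hypergeometric equation* is, up to a Möbius change of $z$, some $W_{k,m}$, $DW_m$, Weber equation ($V=\frac{z^2}4+c$) or Airy equation ($V=z$). **Theorem.** Let $x(z)$ be a rational function of degree at least $2$. (a) It takes $W_{k,m}$ to an equation of the Painlevé type or a confluent hypergeometric equation if and only if the case occurs in the table: | equation | cover | singularity type | result | |---|---|---|---| | $W_{k,m}$, $m\ne\frac14$ | $(2\vert2)$ | $(0)(2)$ | P4-sym | | $W_{k,1/4}$ | $(2\vert2)$ | $(2)$ | Weber | | $W_{k,1/4}$ |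 $(2\vert1+1)$ | $(1)^2$ | D6-alg | | $W_{0,1/2}$ | $(1+1\vert2)$ | $(0)(2)$ | P4-Her | | $W_{k,1/3}$ and $W_{k,1/6}$ | $(3\vert3)$ | $(3)$ | P2-sym | (b) It takes $DW_m$ to such an equation if and only if the case occurs in the table | equation | cover | singularity type | result | |---|---|---|---| | $DW_m$ | $(2\vert2)$ | $(0)(1)$; $(1)$ if $m=\frac14$ | Kummer | | $DW_m$ | $(1+1\vert2)$ | $(0)^2(1)$ | P5-rat | | $DW_{1/4}$ | $(2\vert1+1)$ | $(1/2)^2$ | D8-alg | | $DW_m$, $m\ne\frac16$ | $(3\vert3)$ | $(0)(3/2)$ | P34-sym | | $DW_{1/6}$ | $(3\vert3)$ | $(3/2)$ | Airy | | $DW_{1/4}$ | $(2+1\vert3)$ | $(0)(3/2)$ | P34-rat | | $DW_{1/6}$ | $(3\vert2+1)$ | $(1)(1/2)$ | D7-alg | | $DW_{1/6}$ | $(3+1\vert4)$ | $(0)(2)$ | P4-rat | | $DW_{1/5}$ and $DW_{1/10}$ | $(5\vert5)$ | $(5/2)$ | P1-sym | | $DW_{1/6}$ | $(3+3\vert6)$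 | $(3)$ | P2-rat | or $x=y^2/16$ with a rational function $y$ such that $y$ and $W_{0,2m}$ occur in the table of (a); in the latter case the transform of $DW_m$ by $x$ is the transform of $W_{0,2m}$ by $y$ (for every nonconstant $y$). (c) In every row the transformed equation has the stated singularity type and is of the stated kind: a linear equation of the Painlevé equation named in the row (P3 of the stated type for $D_j$), respectively a confluent hypergeometric equation for Weber, Kummer and Airy. (d) Explicitly, the following covers have the following transformed potentials. In the cases -alg, -rat and -Her these are the linear equation of the indicated solution $q(t)$, with a suitable $p(t)$, where $s$ is any holomorphic branch of the root. In the cases -sym they are its limit as $t\to0$ along a solution $q(t)$, meromorphic at $0$, with the indicated behaviour and symmetry. * P4-sym: $x=\frac{z^2}4$, $V=-k+\frac{16m^2-1}{4z^2}+\frac{z^2}{16}$; for $4m+1\ne0$: $q=2(4m+1)t+\cdots$ analytic, $q(-t)=-q(t)$, of P4$(4k,-2(4m+1)^2)$. * Weber: $m=\frac14$, $x=\frac{z^2}2$, $V=\frac{z^2}4-2k$. * D6-alg: $m=\frac14$, $s=\sqrt t$, $x=\frac{(z-s)^2}z$, $V=\frac14+\frac{t^2}{4z^4}-\frac{kt}{z^3}-\frac{8t+32ks+3}{16z^2}-\frac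 kz+\frac3{4(z+s)^2}-\frac3{4z(z+s)}$; $q=-s$ of P3$'(-8k,8k,4,-4)$. * P4-Her: $x=\frac{z(z+4t)}4$, $V=(\frac{z+2t}4)^2+\frac3{4(z+2t)^2}$; $q=-2t$ of P4$(0,-2)$, $t\ne0$. * Kummer: $x=\frac{z^2}{16}$, $V=\frac14+\frac{16m^2-1}{4z^2}$, which is $W_{0,2m}$. * P5-rat: $h\ne0$, $x=\frac{ht^2z}{4(z-1)^2}$, $V=\frac{ht^2}{(z-1)^4}+\frac{16m^2-1+ht^2}{4z(z-1)^2}-\frac3{4z}+\frac{4m^2-1}{4z^2}+\frac{3(z+2)}{4(z+1)^2}$; $q=-1$ of P5$(2m^2,-2m^2,0,-2h)$, $t\neq0$. * D8-alg: $m=\frac14$, $h\ne0$, $s=\sqrt t$, $x=\frac{h(z-s)^2}z$, $V=\frac{ht}{z^3}+\frac{32hs-3}{16z^2}+\frac hz+\frac3{4(z+s)^2}-\frac3{4z(z+s)}$; $q=-s$ of P3$'(8h,-8h,0,0)$. * P2-sym: $x=\frac{2z^3}3$; for $m=\frac13$: $V=z^4-6kz+\frac3{4z^2}$, $q$ analytic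 with $q(0)=q'(0)=0$, of P2$(-3k)$; for $m=\frac16$: $V=z^4-6kz$, $q\sim\frac1t$, of P2$(\frac12-3k)$; $q(\omega t)=\omega^2q(t)$ for $\omega^3=1$. * P34-sym: $x=\frac{z^3}{18}$, $V=\frac z2+\frac{36m^2-1}{4z^2}$; for $6m\ne1$: $q=(6m-1)t+\cdots$ analytic, $q(\omega t)=\omega q(t)$ for $\omega^3=1$, of P34$((6m-1)^2)$. * Airy: $m=\frac16$, $x=\frac{z^3}9$, $V=z$. * P34-rat: $x=\frac{z(z-3t/2)^2}{18}$, $V=\frac z2-\frac t2+\frac{t^3/4+1}{2tz}-\frac3{16z^2}+\frac3{4(z-t/2)^2}-\frac1{2t(z-t/2)}$; $q=\frac t2$ of P34$(\frac14)$, $t\ne0$. * D7-alg: $s=t^{1/3}$, $x=\frac{(z+2s)^3}{32z}$, $V=\frac t{4z^3}-\frac{16+27s^2}{72z^2}+\frac2{3sz}+\frac18+\frac3{4(z-s)^2}-\frac2{3s(z-s)}$; $q=s$ of P3$'(0,-2,2,0)$. * P4-rat: $x=\frac{z(z+8t/3)^3}{256}$, $V=-\frac2{9z^2}+\frac{2t^3}{27z}+(\frac{z+2t}4)^2+\frac{27}{4(3z+2t)^2}-\frac1{z(3z+2t)}$;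 $q=-\frac{2t}3$ of P4$(0,-\frac29)$, $t\ne0$. * P1-sym: $x=\frac{4z^5}{25}$; for $m=\frac15$: $V=\frac3{4z^2}+4z^3$, $q$ analytic with $q(0)=q'(0)=0$; for $m=\frac1{10}$: $V=4z^3$, $q\sim\frac1{t^2}$; $q(\omega t)=\omega^3q(t)$ for $\omega^5=1$. * P2-rat: $x=\frac{(z^2+t)^3}{36}$, $V=\frac3{4z^2}+tz^2+z^4$; $q=0$ of P2$(0)$. -/

import Mathlib

open Filter Topology

namespace FuchsCover

noncomputable section

open RatFunc
open scoped Classical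

/-! ### Rational changes of the independent variable -/

/-- The derivative `d/dz` on the field `ℂ(z)`. -/
def der (f : RatFunc ℂ) : RatFunc ℂ :=
  algebraMap (Polynomial ℂ) (RatFunc ℂ)
      (Polynomial.derivative f.num * f.denom - f.num * Polynomial.derivative f.denom) /
    algebraMap (Polynomial ℂ) (RatFunc ℂ) (f.denom ^ 2)

/-- The Schwarzian derivative `x'''/x' - (3/2) (x''/x')²` of `x = x(z)`. -/
def schwarzian (x : RatFunc ℂ) : RatFunc ℂ :=
  der (der (der x)) / der x - 3 / 2 * (der (der x) / der x) ^ 2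

/-- The rational function `Q(x(z))`. -/
def subst (x Q : RatFunc ℂ) : RatFunc ℂ := Q.eval RatFunc.C x

/-- The potential of the transformed equation: the substitution `x = x(z)`,
`u = (dx/dz)^{1/2} v` turns `d²u/dx² = Q(x) u` into `d²v/dz² = pullback x Q · v`. -/
def pullback (x Q : RatFunc ℂ) : RatFunc ℂ :=
  subst x Q * der x ^ 2 - 1 / 2 * schwarzian x

/-- The degree of the map `x : ℙ¹ → ℙ¹` (it is `0` for a constant). -/
def coverDegree (x : RatFunc ℂ) : ℕ := max x.num.natDegree x.denom.natDegree

/-- A coordinate change (Möbius transformation) of `ℙ¹`. -/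
def IsMobius (φ : RatFunc ℂ) : Prop := coverDegree φ = 1

/-- The multiplicities of the distinct roots of a polynomial `f` of degree at most `d`,
regarded as a form of degree `d` on `ℙ¹`; the point `∞` is a root of multiplicity
`d - deg f` if `deg f < d`. -/
def rootType (d : ℕ) (f : Polynomial ℂ) : Multiset ℕ :=
  f.roots.toFinset.val.map (fun a => f.rootMultiplicity a) +
    (if f.natDegree < d then {d - f.natDegree} else 0)

/-- The branching orders `μ₁ + μ₂ + ⋯` of `x : ℙ¹ → ℙ¹` at the points over `x = 0`. -/
def zeroType (x : RatFunc ℂ) : Multiset ℕ := rootType (coverDegree x) x.num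

/-- The branching orders `ν₁ + ν₂ + ⋯` of `x : ℙ¹ → ℙ¹` at the points over `x = ∞`. -/
def poleType (x : RatFunc ℂ) : Multiset ℕ := rootType (coverDegree x) x.denom

/-! ### Confluent hypergeometric equations -/

/-- The potential of the Whittaker equation `W_{k,m}`. -/
def W (k m : ℂ) : RatFunc ℂ := 1 / 4 - C k / X + C (m ^ 2 - 1 / 4) / X ^ 2

/-- The potential of the degenerate Whittaker equation `DW_m`. -/
def DW (m : ℂ) : RatFunc ℂ := 1 / X + C (m ^ 2 - 1 / 4) / X ^ 2

/-- `u'' = V u` is, in a suitable coordinate of `ℙ¹`, a Whittaker, degenerate Whittaker,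
Weber (parabolic cylinder) or Airy equation. -/
def IsConfluentHypergeometric (V : RatFunc ℂ) : Prop :=
  ∃ φ, IsMobius φ ∧
    ((∃ k m, pullback φ V = W k m) ∨ (∃ m, pullback φ V = DW m) ∨
      (∃ c, pullback φ V = X ^ 2 / 4 + C c) ∨ pullback φ V = X)

/-! ### Singularities of `u'' = V u` -/

/-- The order of the pole of the potential at a point of `ℙ¹`; at `∞` it is taken after the
coordinate change `z = 1/w`, that is for `V(1/w) w⁻⁴`. The point is singular for the equation
iff the order is positive, and irregular iff it is greater than `2`. -/
def poleOrder (V : RatFunc ℂ) (c : OnePoint ℂ) : ℕ :=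
  c.elim (if V = 0 then 0 else (V.intDegree + 4).toNat) (fun a => V.denom.rootMultiplicity a)

/-- The Poincaré rank of a singular point; it is `0` for a regular singularity. -/
def poincareRank (V : RatFunc ℂ) (c : OnePoint ℂ) : ℚ :=
  if 2 < poleOrder V c then (poleOrder V c : ℚ) / 2 - 1 else 0

/-- `c` is an apparent singularity of `u'' = V u` with exponents `-1/2, 3/2`: the Laurent
expansion is `V = (3/4)/(z-c)² + b/(z-c) + b² + O(z-c)`, where the equality of the constant term
with `b²` says that the solutions have no logarithm at `c`. -/
def IsApparentAt (V : RatFunc ℂ) (c : ℂ) : Prop :=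
  ∃ (b : ℂ) (r : RatFunc ℂ), r.denom.eval c ≠ 0 ∧ r.num.eval c = 0 ∧
    V = 3 / 4 / (X - C c) ^ 2 + C b / (X - C c) + C (b ^ 2) + r

/-- The same at a point of `ℙ¹`. -/
def IsApparent (V : RatFunc ℂ) (c : OnePoint ℂ) : Prop :=
  c.elim (IsApparentAt (pullback (1 / X) V) 0) (fun a => IsApparentAt V a)

/-- The singular points of `u'' = V u` in `ℙ¹`, except possibly one apparent singularity with
exponents `-1/2, 3/2`, have the Poincaré ranks listed (with repetitions) in `T`. -/
def HasSingularityType (V : RatFunc ℂ) (T : Multiset ℚ) : Prop :=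
  ∃ S A : Finset (OnePoint ℂ), Disjoint S A ∧ A.card ≤ 1 ∧ (∀ c ∈ A, IsApparent V c) ∧
    (∀ c, 0 < poleOrder V c ↔ c ∈ S ∨ c ∈ A) ∧ S.val.map (poincareRank V) = T

/-! ### Linear equations of the Painlevé type -/

/-- A Painlevé equation with fixed parameters, together with its linear equation. -/
structure PainleveFamily where
  /-- The admissible values of the independent variable `t`. -/
  times : Set ℂ
  /-- The fixed singular points of the linear equation in `ℂ`, which `q` has to avoid. -/
  fixed : Set ℂ
  /-- The potential `V(z,t)` of the linear equation, as a function of `t`, `q`, `p`. -/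
  potential : ℂ → ℂ → ℂ → RatFunc ℂ
  /-- The form of the linear equation at a value of `t` at which `q(t)` has run into a fixed
  singular point or into `∞`: the terms of the apparent singularity `z = q` have disappeared and
  the coefficient that contained the Hamiltonian is replaced by a constant. -/
  degenerate : ℂ → ℂ → RatFunc ℂ
  /-- The Hamiltonian, as a function of `t`, `q`, `p`. -/
  hamiltonian : ℂ → ℂ → ℂ → ℂ
  /-- The Painlevé equation `q'' = rhs t q q'`. -/
  rhs : ℂ → ℂ → ℂ → ℂ

/-- P1, type `(5/2)`. -/
def familyP1 : PainleveFamily :=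
  let K : ℂ → ℂ → ℂ → ℂ := fun t q p => p ^ 2 / 2 - 2 * q ^ 3 - t * q
  { times := Set.univ
    fixed := ∅
    potential := fun t q p =>
      4 * X ^ 3 + C (2 * t) * X + C (2 * K t q p) + 3 / (4 * (X - C q) ^ 2) - C p / (X - C q)
    degenerate := fun t c => 4 * X ^ 3 + C (2 * t) * X + C c
    hamiltonian := K
    rhs := fun t y _ => 6 * y ^ 2 + t }

/-- P2(α), type `(3)`. -/
def familyP2 (α : ℂ) : PainleveFamily :=
  let K : ℂ → ℂ → ℂ → ℂ := fun t q p => p ^ 2 / 2 - q ^ 4 / 2 - t * q ^ 2 / 2 - α * q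
  { times := Set.univ
    fixed := ∅
    potential := fun t q p =>
      X ^ 4 + C t * X ^ 2 + C (2 * α) * X + C (2 * K t q p) + 3 / (4 * (X - C q) ^ 2)
        - C p / (X - C q)
    degenerate := fun t c => X ^ 4 + C t * X ^ 2 + C (2 * α) * X + C c
    hamiltonian := K
    rhs := fun t y _ => 2 * y ^ 3 + t * y + α }

/-- P34(α), type `(0)(3/2)`. -/
def familyP34 (α : ℂ) : PainleveFamily :=
  let K : ℂ → ℂ → ℂ → ℂ := fun t q p =>
    -q * p ^ 2 + p + q ^ 2 / 2 - t * q / 2 + (α - 1) / (4 * q)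
  { times := Set.univ
    fixed := {0}
    potential := fun t q p =>
      X / 2 - C (t / 2) + C ((α - 1) / 4) / X ^ 2 - C (K t q p) / X + 3 / (4 * (X - C q) ^ 2)
        - C (p * q) / (X * (X - C q))
    degenerate := fun t c => X / 2 - C (t / 2) + C ((α - 1) / 4) / X ^ 2 + C c / X
    hamiltonian := K
    rhs := fun t y y' => y' ^ 2 / (2 * y) + 2 * y ^ 2 - t * y - α / (2 * y) }

/-- P4(α,β), type `(0)(2)`. -/
def familyP4 (α β : ℂ) : PainleveFamily :=
  let a₀ : ℂ := -β / 8 - 1 / 4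
  let a₁ : ℂ := -α / 4
  let K : ℂ → ℂ → ℂ → ℂ := fun t q p =>
    2 * q * p ^ 2 - 2 * p - 2 * a₀ / q - 2 * a₁ * q - 2 * q * ((q + 2 * t) / 4) ^ 2
  { times := Set.univ
    fixed := {0}
    potential := fun t q p =>
      C a₀ / X ^ 2 + C (K t q p) / (2 * X) + C a₁ + ((X + C (2 * t)) / 4) ^ 2
        + 3 / (4 * (X - C q) ^ 2) - C (p * q) / (X * (X - C q))
    degenerate := fun t c => C a₀ / X ^ 2 + C c / X + C a₁ + ((X + C (2 * t)) / 4) ^ 2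
    hamiltonian := K
    rhs := fun t y y' =>
      y' ^ 2 / (2 * y) + 3 / 2 * y ^ 3 + 4 * t * y ^ 2 + 2 * (t ^ 2 - α) * y + β / y }

/-- P3′(α,β,γ,δ), type `(1)²` if `γδ ≠ 0`, type `(1)(1/2)` if exactly one of `γ`, `δ` is zero,
and type `(1/2)²` if both are zero. -/
def familyP3 (α β γ δ : ℂ) : PainleveFamily :=
  let a₀ : ℂ := -δ / 16
  let b₀ : ℂ := -β / 8
  let a₁ : ℂ := γ / 16
  let b₁ : ℂ := α / 8
  let tK : ℂ → ℂ → ℂ → ℂ := fun t q p =>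
    q ^ 2 * p ^ 2 - q * p - a₀ * t ^ 2 / q ^ 2 - b₀ * t / q - b₁ * q - a₁ * q ^ 2
  { times := {0}ᶜ
    fixed := {0}
    potential := fun t q p =>
      C (a₀ * t ^ 2) / X ^ 4 + C (b₀ * t) / X ^ 3 + C (tK t q p) / X ^ 2 + C b₁ / X + C a₁
        + 3 / (4 * (X - C q) ^ 2) - C (p * q) / (X * (X - C q))
    degenerate := fun t c =>
      C (a₀ * t ^ 2) / X ^ 4 + C (b₀ * t) / X ^ 3 + C c / X ^ 2 + C b₁ / X + C a₁
    hamiltonian := fun t q p => tK t q p / t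
    rhs := fun t y y' =>
      y' ^ 2 / y - y' / t + y ^ 2 * (α + γ * y) / (4 * t ^ 2) + β / (4 * t) + δ / (4 * y) }

/-- P5(α,β,γ,δ), type `(0)²(1)` if `δ ≠ 0` and type `(0)²(1/2)` if `δ = 0`, `γ ≠ 0`. -/
def familyP5 (α β γ δ : ℂ) : PainleveFamily :=
  let a₀ : ℂ := -β / 2 - 1 / 4
  let a₁ : ℂ := -δ / 2
  let a₂ : ℂ := -γ / 2
  let b : ℂ := (α + β) / 2 - 3 / 4
  let tK : ℂ → ℂ → ℂ → ℂ := fun t q p =>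
    q * (q - 1) ^ 2 * (-a₁ * t ^ 2 / (q - 1) ^ 4 - a₂ * t / (q - 1) ^ 3 + p ^ 2
      - (1 / q + 1 / (q - 1)) * p - b / (q - 1) ^ 2 - a₀ / q ^ 2)
  { times := {0}ᶜ
    fixed := {0, 1}
    potential := fun t q p =>
      C (a₁ * t ^ 2) / (X - 1) ^ 4 + C (tK t q p) / ((X - 1) ^ 2 * X) + C (a₂ * t) / (X - 1) ^ 3
        - C (p * (q - 1) * q) / (X * (X - 1) * (X - C q)) + C b / (X - 1) ^ 2 + C a₀ / X ^ 2
        + 3 / (4 * (X - C q) ^ 2)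
    degenerate := fun t c =>
      C (a₁ * t ^ 2) / (X - 1) ^ 4 + C c / ((X - 1) ^ 2 * X) + C (a₂ * t) / (X - 1) ^ 3
        + C b / (X - 1) ^ 2 + C a₀ / X ^ 2
    hamiltonian := fun t q p => tK t q p / t
    rhs := fun t y y' =>
      (1 / (2 * y) + 1 / (y - 1)) * y' ^ 2 - y' / t + (y - 1) ^ 2 / t ^ 2 * (α * y + β / y)
        + γ * y / t + δ * y * (y + 1) / (y - 1) }

/-- The linear equations of the Painlevé type with an irregular singularity. -/
inductive PainleveKind
  | P1 | P2 | P34 | P4 | P3D6 | P3D7 | P3D8 | P5 | degP5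

/-- The families (one for each admissible value of the parameters) of a given kind. -/
def PainleveKind.families : PainleveKind → Set PainleveFamily
  | .P1 => {familyP1}
  | .P2 => {F | ∃ α, F = familyP2 α}
  | .P34 => {F | ∃ α, F = familyP34 α}
  | .P4 => {F | ∃ α β, F = familyP4 α β}
  | .P3D6 => {F | ∃ α β γ δ, γ ≠ 0 ∧ δ ≠ 0 ∧ F = familyP3 α β γ δ}
  | .P3D7 => {F | ∃ α β γ δ, ((δ = 0 ∧ β ≠ 0 ∧ γ ≠ 0) ∨ (γ = 0 ∧ α ≠ 0 ∧ δ ≠ 0)) ∧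
      F = familyP3 α β γ δ}
  | .P3D8 => {F | ∃ α β, α ≠ 0 ∧ β ≠ 0 ∧ F = familyP3 α β 0 0}
  | .P5 => {F | ∃ α β γ δ, δ ≠ 0 ∧ F = familyP5 α β γ δ}
  | .degP5 => {F | ∃ α β γ, γ ≠ 0 ∧ F = familyP5 α β γ 0}

/-- In a suitable coordinate of `ℙ¹`, `u'' = V u` is the linear equation of a Painlevé equation
of kind `J`, possibly at a value of `t` at which `q(t)` is a fixed singular point or `∞`. -/
def HasPainleveKind (J : PainleveKind) (V : RatFunc ℂ) : Prop :=
  ∃ F ∈ J.families, ∃ φ, IsMobius φ ∧ ∃ t ∈ F.times,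
    (∃ q p : ℂ, q ∉ F.fixed ∧ pullback φ V = F.potential t q p) ∨
      (∃ c : ℂ, pullback φ V = F.degenerate t c)

/-- What a transformed equation can be. -/
inductive Target
  | painleve (J : PainleveKind)
  | confluent

/-- The equation `u'' = V u` is of the given sort. -/
def Target.Holds : Target → RatFunc ℂ → Prop
  | .painleve J, V => HasPainleveKind J V
  | .confluent, V => IsConfluentHypergeometric V

/-- `u'' = V u` is of the Painlevé type or confluent hypergeometric. -/
def IsPainleveOrConfluent (V : RatFunc ℂ) : Prop := ∃ J : Target, J.Holds V

/-! ### The tables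

The arguments of a row are: the parameters of the starting equation, the branching type of the
cover over `0` and over `∞`, the singularity type of the transformed equation, and its sort.
`W_{k,m}` and `DW_m` depend on `m²` only. -/

/-- The covers of `W_{k,m}`. -/
inductive TableW : ℂ → ℂ → Multiset ℕ → Multiset ℕ → Multiset ℚ → Target → Prop
  | P4sym (k m : ℂ) (hm : m ^ 2 ≠ (1 / 4) ^ 2) : TableW k m {2} {2} {0, 2} (.painleve .P4)
  | Weber (k m : ℂ) (hm : m ^ 2 = (1 / 4) ^ 2) : TableW k m {2} {2} {2} .confluent
  | D6alg (k m : ℂ) (hm : m ^ 2 = (1 / 4) ^ 2) : TableW k m {2} {1, 1} {1, 1} (.painleve .P3D6)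
  | P4Her (m : ℂ) (hm : m ^ 2 = (1 / 2) ^ 2) : TableW 0 m {1, 1} {2} {0, 2} (.painleve .P4)
  | P2sym (k m : ℂ) (hm : m ^ 2 = (1 / 3) ^ 2) : TableW k m {3} {3} {3} (.painleve .P2)
  | P2sym' (k m : ℂ) (hm : m ^ 2 = (1 / 6) ^ 2) : TableW k m {3} {3} {3} (.painleve .P2)

/-- The covers of `DW_m`. -/
inductive TableDW : ℂ → Multiset ℕ → Multiset ℕ → Multiset ℚ → Target → Prop
  | Kummer (m : ℂ) (hm : m ^ 2 ≠ (1 / 4) ^ 2) : TableDW m {2} {2} {0, 1} .confluent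
  | Kummer' (m : ℂ) (hm : m ^ 2 = (1 / 4) ^ 2) : TableDW m {2} {2} {1} .confluent
  | P5rat (m : ℂ) : TableDW m {1, 1} {2} {0, 0, 1} (.painleve .P5)
  | D8alg (m : ℂ) (hm : m ^ 2 = (1 / 4) ^ 2) :
      TableDW m {2} {1, 1} {1 / 2, 1 / 2} (.painleve .P3D8)
  | P34sym (m : ℂ) (hm : m ^ 2 ≠ (1 / 6) ^ 2) : TableDW m {3} {3} {0, 3 / 2} (.painleve .P34)
  | Airy (m : ℂ) (hm : m ^ 2 = (1 / 6) ^ 2) : TableDW m {3} {3} {3 / 2} .confluent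
  | P34rat (m : ℂ) (hm : m ^ 2 = (1 / 4) ^ 2) : TableDW m {2, 1} {3} {0, 3 / 2} (.painleve .P34)
  | D7alg (m : ℂ) (hm : m ^ 2 = (1 / 6) ^ 2) : TableDW m {3} {2, 1} {1, 1 / 2} (.painleve .P3D7)
  | P4rat (m : ℂ) (hm : m ^ 2 = (1 / 6) ^ 2) : TableDW m {3, 1} {4} {0, 2} (.painleve .P4)
  | P1sym (m : ℂ) (hm : m ^ 2 = (1 / 5) ^ 2) : TableDW m {5} {5} {5 / 2} (.painleve .P1)
  | P1sym' (m : ℂ) (hm : m ^ 2 = (1 / 10) ^ 2) : TableDW m {5} {5} {5 / 2} (.painleve .P1)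
  | P2rat (m : ℂ) (hm : m ^ 2 = (1 / 6) ^ 2) : TableDW m {3, 3} {6} {3} (.painleve .P2)

/-! ### Explicit covers `x(z)` and transformed potentials `V(z,t)`

`s` stands for a branch of `√t` in the rows D6-alg and D8-alg and for a branch of `t^{1/3}` in the
row D7-alg. -/

def coverP4sym : RatFunc ℂ := X ^ 2 / 4

def potP4sym (k m : ℂ) : RatFunc ℂ :=
  -C k + C (16 * m ^ 2 - 1) / (4 * X ^ 2) + X ^ 2 / 16

def coverWeber : RatFunc ℂ := X ^ 2 / 2

def potWeber (k : ℂ) : RatFunc ℂ :=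
  X ^ 2 / 4 - C (2 * k)

def coverD6alg (s : ℂ) : RatFunc ℂ := (X - C s) ^ 2 / X

def potD6alg (k t s : ℂ) : RatFunc ℂ :=
  1 / 4 + C (t ^ 2) / (4 * X ^ 4) - C (k * t) / X ^ 3 - C (8 * t + 32 * k * s + 3) / (16 * X ^ 2)
    - C k / X + 3 / (4 * (X + C s) ^ 2) - 3 / (4 * X * (X + C s))

def coverP4Her (t : ℂ) : RatFunc ℂ := X * (X + C (4 * t)) / 4

def potP4Her (t : ℂ) : RatFunc ℂ :=
  ((X + C (2 * t)) / 4) ^ 2 + 3 / (4 * (X + C (2 * t)) ^ 2)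

def coverKummer : RatFunc ℂ := X ^ 2 / 16

def potKummer (m : ℂ) : RatFunc ℂ :=
  1 / 4 + C (16 * m ^ 2 - 1) / (4 * X ^ 2)

def coverP5rat (h t : ℂ) : RatFunc ℂ := C (h * t ^ 2) * X / (4 * (X - 1) ^ 2)

def potP5rat (m h t : ℂ) : RatFunc ℂ :=
  C (h * t ^ 2) / (X - 1) ^ 4 + C (16 * m ^ 2 - 1 + h * t ^ 2) / (4 * X * (X - 1) ^ 2)
    - 3 / (4 * X) + C (4 * m ^ 2 - 1) / (4 * X ^ 2) + 3 * (X + 2) / (4 * (X + 1) ^ 2)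

def coverD8alg (h s : ℂ) : RatFunc ℂ := C h * (X - C s) ^ 2 / X

def potD8alg (h t s : ℂ) : RatFunc ℂ :=
  C (h * t) / X ^ 3 + C (32 * h * s - 3) / (16 * X ^ 2) + C h / X
    + 3 / (4 * (X + C s) ^ 2) - 3 / (4 * X * (X + C s))

def coverP2sym : RatFunc ℂ := 2 * X ^ 3 / 3

def potP2sym (k : ℂ) : RatFunc ℂ :=
  X ^ 4 - C (6 * k) * X + 3 / (4 * X ^ 2)

def potP2sym' (k : ℂ) : RatFunc ℂ :=
  X ^ 4 - C (6 * k) * X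

def coverP34sym : RatFunc ℂ := X ^ 3 / 18

def potP34sym (m : ℂ) : RatFunc ℂ :=
  X / 2 + C (36 * m ^ 2 - 1) / (4 * X ^ 2)

def coverAiry : RatFunc ℂ := X ^ 3 / 9

def potAiry : RatFunc ℂ :=
  X

def coverP34rat (t : ℂ) : RatFunc ℂ := X * (X - C (3 * t / 2)) ^ 2 / 18

def potP34rat (t : ℂ) : RatFunc ℂ :=
  X / 2 - C (t / 2) + C ((t ^ 3 / 4 + 1) / (2 * t)) / X - 3 / (16 * X ^ 2)
    + 3 / (4 * (X - C (t / 2)) ^ 2) - C (1 / (2 * t)) / (X - C (t / 2))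

def coverD7alg (s : ℂ) : RatFunc ℂ := (X + C (2 * s)) ^ 3 / (32 * X)

def potD7alg (t s : ℂ) : RatFunc ℂ :=
  C t / (4 * X ^ 3) - C (16 + 27 * s ^ 2) / (72 * X ^ 2) + C (2 / (3 * s)) / X + 1 / 8
    + 3 / (4 * (X - C s) ^ 2) - C (2 / (3 * s)) / (X - C s)

def coverP4rat (t : ℂ) : RatFunc ℂ := X * (X + C (8 * t / 3)) ^ 3 / 256

def potP4rat (t : ℂ) : RatFunc ℂ :=
  -2 / (9 * X ^ 2) + C (2 * t ^ 3 / 27) / X + ((X + C (2 * t)) / 4) ^ 2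
    + 27 / (4 * (3 * X + C (2 * t)) ^ 2) - 1 / (X * (3 * X + C (2 * t)))

def coverP1sym : RatFunc ℂ := 4 * X ^ 5 / 25

def potP1sym : RatFunc ℂ :=
  3 / (4 * X ^ 2) + 4 * X ^ 3

def potP1sym' : RatFunc ℂ :=
  4 * X ^ 3

def coverP2rat (t : ℂ) : RatFunc ℂ := (X ^ 2 + C t) ^ 3 / 36

def potP2rat (t : ℂ) : RatFunc ℂ :=
  3 / (4 * X ^ 2) + C t * X ^ 2 + X ^ 4

/-! ### Solutions of the Painlevé equations behind the covers -/

/-- At the point `t`, `(q, p)` is admissible and solves the Hamiltonian system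
`q' = ∂K/∂p`, `p' = -∂K/∂q`, and `q` is analytic and solves the Painlevé equation. -/
def PainleveFamily.IsSolutionAt (F : PainleveFamily) (q p : ℂ → ℂ) (t : ℂ) : Prop :=
  t ∈ F.times ∧ q t ∉ F.fixed ∧ AnalyticAt ℂ q t ∧
    HasDerivAt q (deriv (fun b => F.hamiltonian t (q t) b) (p t)) t ∧
    HasDerivAt p (-deriv (fun a => F.hamiltonian t a (p t)) (q t)) t ∧
    deriv (deriv q) t = F.rhs t (q t) (deriv q t)

/-- On the open set `U` the function `q` is a solution of the Painlevé equation, and for every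
`t ∈ U` the substitution `x = x_t(z)` takes `u'' = Q u` to `v'' = V_t v`, which is the linear
equation belonging to the solution `q` at `t`. -/
def PainleveFamily.RealizedOn (F : PainleveFamily) (U : Set ℂ) (q : ℂ → ℂ) (Q : RatFunc ℂ)
    (x V : ℂ → RatFunc ℂ) : Prop :=
  ∃ p : ℂ → ℂ, ∀ t ∈ U, F.IsSolutionAt q p t ∧ pullback (x t) Q = V t ∧
    V t = F.potential t (q t) (p t)

/-- `q` is meromorphic at `0` and a solution of the Painlevé equation around `0`, invariant under
the symmetry `q(ωt) = ω^j q(t)`, `ω^n = 1`, and the linear equation belonging to it has the limit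
`v'' = V v` for `t → 0`. -/
def PainleveFamily.IsSymmetricWithLimit (F : PainleveFamily) (n j : ℕ) (q : ℂ → ℂ)
    (V : RatFunc ℂ) : Prop :=
  MeromorphicAt q 0 ∧
    (∀ ω : ℂ, ω ^ n = 1 → ∀ᶠ t in 𝓝[≠] 0, q (ω * t) = ω ^ j * q t) ∧
    ∃ p : ℂ → ℂ, MeromorphicAt p 0 ∧ (∀ᶠ t in 𝓝[≠] 0, F.IsSolutionAt q p t) ∧
      ∀ z : ℂ, z ≠ 0 →
        Tendsto (fun t => (F.potential t (q t) (p t)).eval (RingHom.id ℂ) z) (𝓝[≠] 0)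
          (𝓝 (V.eval (RingHom.id ℂ) z))

end

end FuchsCover

open FuchsCover RatFunc

/-!
The transform of `u'' = Q u` by a cover `x` is governed by local data. At a zero of `x` of order
`μ` the exponent difference `2m` of `Q` at `0` becomes `2 m μ`; at a pole of order `ν` the
potential gets a pole of order `2 ν + 2` for a Whittaker and `ν + 2` for a degenerate Whittaker
equation; a point of ramification `j + 1` elsewhere becomes a singular point with exponent
difference `j + 1` (`localForm_of_ord_pos`, `poleType_map`, `localForm_of_ord_eq_zero`). At a
simple zero the residue of the potential survives, so such a zero can become a regular point only
for `W_{0,m}`.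

*Classification.* In their own coordinate, all target equations have one or two irregular singular
points of bounded pole order, and few other singular points (`Target.Holds.exists_shape`). The
pole orders leave finitely many possibilities for the poles of `x`. By the Riemann–Hurwitz formula
(`riemann_hurwitz`) the ramification outside the fibres over `0` and `∞` is the number of points
in these fibres minus two, and every such ramified point must be one of the few singular points.
Hence the fibres are small (`ramification_of_apparent`, `ramification_of_two_singular`), almost
all zeros have to become regular, that is `2 m μ = ±1`, and a finite case distinction gives the
tables (`tableW_of_isPainleveOrConfluent`, `tableDW_of_isPainleveOrConfluent`). For the degenerate
Whittaker equations, types with only even multiplicities give `x = y² / 16` (`exists_sq_div`), and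
the transform by `y² / 16` of `DW_m` is the transform of `W_{0,2m}` by `y` (`pullback_sq_div`),
since pull-backs compose (`pullback_pullback`).

*Converse.* A cover of one of the listed types has at most three points over `0` and `∞`, which a
Möbius transformation puts into standard position; so it is one of the explicit covers
(`exists_normal_pow`, `exists_normal_two_zeros`, `exists_normal_two_poles`, `exists_normal_P5`).
Their transforms are computed, recognised as members of the families, and their singularities are
read off (`TableW.rowHolds`, `TableDW.rowHolds`). All notions involved are invariant under the
action of `GL₂(ℂ)` on `ℙ¹`.

*Solutions.* The algebraic and rational solutions are checked against the Hamiltonian systems. The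
symmetric solutions are constructed in coordinates in which the Hamiltonian system is a polynomial
system of degree two, regular at `t = 0`. Such a system has a power series solution that inherits
the diagonal symmetries (`exists_planar_solution`), and in these coordinates the limit of the
linear equation for `t → 0` is a matter of continuity. The solution of P2 with a pole is a
Bäcklund transform of a regular one (`exists_P2_chart`); the solution of P1 with a pole is `t⁻² +
t³ g(t⁵)` with a power series `g` (`exists_P1_series`).
-/

open Filter Topology
open FuchsCover RatFunc

namespace FuchsCover

noncomputable section

open scoped MatrixGroups

/-! ### The derivation of the field of rational functions -/

/-- The embedding of polynomials into rational functions. -/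
abbrev ofPoly : Polynomial ℂ →+* RatFunc ℂ := algebraMap (Polynomial ℂ) (RatFunc ℂ)

lemma ofPoly_ne_zero {p : Polynomial ℂ} (h : p ≠ 0) : ofPoly p ≠ 0 := by
  simpa using h

@[simp] lemma ofPoly_X : ofPoly Polynomial.X = X := RatFunc.algebraMap_X
@[simp] lemma ofPoly_C (a : ℂ) : ofPoly (Polynomial.C a) = C a := RatFunc.algebraMap_C a

lemma exists_div_ofPoly (f : RatFunc ℂ) :
    ∃ p q : Polynomial ℂ, q ≠ 0 ∧ f = ofPoly p / ofPoly q :=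
  ⟨f.num, f.denom, f.denom_ne_zero, (RatFunc.num_div_denom f).symm⟩

lemma num_mul_eq_mul_denom {f : RatFunc ℂ} {p q : Polynomial ℂ} (hq : q ≠ 0)
    (hf : f = ofPoly p / ofPoly q) : f.num * q = p * f.denom := by
  have h := RatFunc.num_div_denom f
  rw [eq_comm, hf, div_eq_div_iff (ofPoly_ne_zero hq) (ofPoly_ne_zero (by
    rw [← hf]; exact f.denom_ne_zero)), ← hf] at h
  apply RatFunc.algebraMap_injective ℂ
  rw [map_mul, map_mul, h]

/-- The quotient rule, for an arbitrary (not necessarily reduced) representation as a fraction. -/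
lemma der_div_ofPoly (p q : Polynomial ℂ) (hq : q ≠ 0) :
    der (ofPoly p / ofPoly q) =
      ofPoly (p.derivative * q - p * q.derivative) / ofPoly (q ^ 2) := by
  obtain ⟨f, hf⟩ : ∃ f, f = ofPoly p / ofPoly q := ⟨_, rfl⟩
  have h1 := num_mul_eq_mul_denom hq hf
  rw [← hf]
  have hd := f.denom_ne_zero
  have h2 := congrArg Polynomial.derivative h1
  simp only [Polynomial.derivative_mul] at h2
  unfold der
  rw [div_eq_div_iff (ofPoly_ne_zero (pow_ne_zero 2 hd)) (ofPoly_ne_zero (pow_ne_zero 2 hq)),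
    ← map_mul, ← map_mul]
  refine congrArg ofPoly ?_
  linear_combination q * f.denom * h2 -
    (q * f.denom.derivative + f.denom * q.derivative) * h1

lemma der_ofPoly (p : Polynomial ℂ) : der (ofPoly p) = ofPoly p.derivative := by
  simpa using der_div_ofPoly p 1 one_ne_zero

@[simp] lemma der_C (a : ℂ) : der (C a) = 0 := by
  rw [← ofPoly_C, der_ofPoly]; simp

@[simp] lemma der_X : der X = 1 := by
  rw [← ofPoly_X, der_ofPoly]; simp

lemma der_add (f g : RatFunc ℂ) : der (f + g) = der f + der g := by
  obtain ⟨p, q, hq, rfl⟩ := exists_div_ofPoly f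
  obtain ⟨r, s, hs, rfl⟩ := exists_div_ofPoly g
  have hq' := ofPoly_ne_zero hq
  have hs' := ofPoly_ne_zero hs
  rw [div_add_div _ _ hq' hs', ← map_mul, ← map_mul, ← map_mul, ← map_add,
    der_div_ofPoly _ _ (mul_ne_zero hq hs), der_div_ofPoly _ _ hq, der_div_ofPoly _ _ hs]
  simp only [Polynomial.derivative_mul, map_add, map_sub, map_mul, map_pow]
  field_simp
  ring

lemma der_mul (f g : RatFunc ℂ) : der (f * g) = der f * g + f * der g := by
  obtain ⟨p, q, hq, rfl⟩ := exists_div_ofPoly f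
  obtain ⟨r, s, hs, rfl⟩ := exists_div_ofPoly g
  have hq' := ofPoly_ne_zero hq
  have hs' := ofPoly_ne_zero hs
  rw [div_mul_div_comm, ← map_mul, ← map_mul,
    der_div_ofPoly _ _ (mul_ne_zero hq hs), der_div_ofPoly _ _ hq, der_div_ofPoly _ _ hs]
  simp only [Polynomial.derivative_mul, map_add, map_sub, map_mul, map_pow]
  field_simp
  ring

/-- Differentiation as an additive map. -/
def derHom : RatFunc ℂ →+ RatFunc ℂ := AddMonoidHom.mk' der der_add

lemma der_zero : der 0 = 0 := derHom.map_zero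
lemma der_sub (f g : RatFunc ℂ) : der (f - g) = der f - der g := derHom.map_sub f g

lemma der_natCast (n : ℕ) : der (n : RatFunc ℂ) = 0 := by
  have := der_C (n : ℂ)
  rwa [map_natCast] at this

lemma der_one : der 1 = 0 := by simpa using der_natCast 1

lemma der_ofNat (n : ℕ) [n.AtLeastTwo] : der (ofNat(n) : RatFunc ℂ) = 0 :=
  der_natCast n

lemma der_C_mul (a : ℂ) (f : RatFunc ℂ) : der (C a * f) = C a * der f := by
  rw [der_mul, der_C]; ring

lemma der_inv (f : RatFunc ℂ) : der f⁻¹ = -der f / f ^ 2 := by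
  by_cases hf : f = 0
  · subst hf; simp [der_zero]
  have h := der_mul f f⁻¹
  rw [mul_inv_cancel₀ hf, der_one] at h
  field_simp at h ⊢
  linear_combination -h

lemma der_div (f g : RatFunc ℂ) (hg : g ≠ 0) :
    der (f / g) = (der f * g - f * der g) / g ^ 2 := by
  rw [div_eq_mul_inv, der_mul, der_inv]
  field_simp
  ring

lemma der_pow (f : RatFunc ℂ) (n : ℕ) : der (f ^ n) = n * f ^ (n - 1) * der f := by
  induction n with
  | zero => simp [der_one]
  | succ n ih =>
    rw [pow_succ, der_mul, ih]
    rcases n with _ | n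
    · simp
    · simp only [Nat.add_sub_cancel, Nat.cast_add, Nat.cast_one]; ring

/-- The logarithmic derivative. -/
def dlog (f : RatFunc ℂ) : RatFunc ℂ := der f / f

lemma dlog_mul {f g : RatFunc ℂ} (hf : f ≠ 0) (hg : g ≠ 0) :
    dlog (f * g) = dlog f + dlog g := by
  unfold dlog; rw [der_mul]; field_simp

lemma dlog_inv (f : RatFunc ℂ) : dlog f⁻¹ = -dlog f := by
  by_cases hf : f = 0
  · simp [hf, dlog, der_zero]
  unfold dlog; rw [der_inv]; field_simp

lemma dlog_div {f g : RatFunc ℂ} (hf : f ≠ 0) (hg : g ≠ 0) :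
    dlog (f / g) = dlog f - dlog g := by
  rw [div_eq_mul_inv, dlog_mul hf (inv_ne_zero hg), dlog_inv]; ring

lemma dlog_pow (f : RatFunc ℂ) (n : ℕ) : dlog (f ^ n) = n * dlog f := by
  by_cases hf : f = 0
  · subst hf; rcases n with _ | n <;> simp [dlog, der_zero, der_one]
  unfold dlog; rw [der_pow]
  rcases n with _ | n
  · simp
  · simp only [Nat.add_sub_cancel]; field_simp; ring

lemma dlog_zpow (f : RatFunc ℂ) (n : ℤ) : dlog (f ^ n) = n * dlog f := by
  obtain ⟨k, rfl | rfl⟩ := n.eq_nat_or_neg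
  · simpa using dlog_pow f k
  · rw [zpow_neg, dlog_inv, zpow_natCast, dlog_pow]; push_cast; ring

lemma dlog_C (a : ℂ) : dlog (C a) = 0 := by simp [dlog]

lemma schwarzian_eq (x : RatFunc ℂ) :
    schwarzian x = der (dlog (der x)) - 1 / 2 * dlog (der x) ^ 2 := by
  unfold schwarzian dlog
  by_cases h : der x = 0
  · simp [h, der_zero]
  rw [der_div _ _ h]
  field_simp
  ring

/-! ### Substitution into rational functions -/

/-- `x` is not a constant, so that substitution of `x` is a homomorphism of fields. -/
def Nonconst (x : RatFunc ℂ) : Prop := ∀ c : ℂ, x ≠ C c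

lemma Nonconst.ne_zero {x : RatFunc ℂ} (hx : Nonconst x) : x ≠ 0 := by
  simpa using hx 0

lemma Nonconst.eval₂_ne_zero {x : RatFunc ℂ} (hx : Nonconst x) {p : Polynomial ℂ} (hp : p ≠ 0) :
    p.eval₂ C x ≠ 0 := by
  rw [(IsAlgClosed.splits p).eq_prod_roots]
  simp only [Polynomial.eval₂_mul, Polynomial.eval₂_C, Polynomial.eval₂_multiset_prod]
  refine mul_ne_zero (by simpa using hp) ?_
  apply Multiset.prod_ne_zero
  simp only [Multiset.map_map, Multiset.mem_map, not_exists, not_and]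
  intro a _ h
  simp only [Function.comp, Polynomial.eval₂_sub, Polynomial.eval₂_X, Polynomial.eval₂_C] at h
  exact hx a (sub_eq_zero.mp h)

lemma subst_div_ofPoly {x : RatFunc ℂ} (hx : Nonconst x) (p q : Polynomial ℂ) (hq : q ≠ 0) :
    subst x (ofPoly p / ofPoly q) = p.eval₂ C x / q.eval₂ C x := by
  obtain ⟨f, hf⟩ : ∃ f, f = ofPoly p / ofPoly q := ⟨_, rfl⟩
  have h2 := congrArg (Polynomial.eval₂ C x) (num_mul_eq_mul_denom hq hf)
  rw [Polynomial.eval₂_mul, Polynomial.eval₂_mul] at h2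
  rw [← hf]
  unfold subst RatFunc.eval
  rw [div_eq_div_iff (hx.eval₂_ne_zero f.denom_ne_zero) (hx.eval₂_ne_zero hq), h2]

lemma subst_ofPoly {x : RatFunc ℂ} (p : Polynomial ℂ) :
    subst x (ofPoly p) = p.eval₂ C x := by
  unfold subst; exact RatFunc.eval_algebraMap _ _ p

/-- Substitution of a nonconstant rational function, as a homomorphism of fields. -/
def substHom (x : RatFunc ℂ) (hx : Nonconst x) : RatFunc ℂ →+* RatFunc ℂ where
  toFun := subst x
  map_one' := RatFunc.eval_one _ _
  map_zero' := RatFunc.eval_zero _ _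
  map_add' f g := RatFunc.eval_add _ _ (hx.eval₂_ne_zero f.denom_ne_zero)
    (hx.eval₂_ne_zero g.denom_ne_zero)
  map_mul' f g := RatFunc.eval_mul _ _ (hx.eval₂_ne_zero f.denom_ne_zero)
    (hx.eval₂_ne_zero g.denom_ne_zero)

lemma substHom_apply {x : RatFunc ℂ} (hx : Nonconst x) (f : RatFunc ℂ) :
    substHom x hx f = subst x f := rfl

@[simp] lemma substHom_C {x : RatFunc ℂ} (hx : Nonconst x) (a : ℂ) : substHom x hx (C a) = C a :=
  RatFunc.eval_C _ _

@[simp] lemma substHom_X {x : RatFunc ℂ} (hx : Nonconst x) : substHom x hx X = x :=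
  RatFunc.eval_X _ _

lemma subst_nonconst {x f : RatFunc ℂ} (hx : Nonconst x) (hf : Nonconst f) :
    Nonconst (subst x f) := by
  intro c h
  rw [← substHom_apply hx, ← substHom_C hx] at h
  exact hf c ((substHom x hx).injective h)

lemma subst_subst {x y : RatFunc ℂ} (hx : Nonconst x) (hy : Nonconst y) (f : RatFunc ℂ) :
    subst x (subst y f) = subst (subst x y) f := by
  obtain ⟨p, q, hq, rfl⟩ := exists_div_ofPoly f
  have key : ∀ r : Polynomial ℂ, subst x (r.eval₂ C y) = r.eval₂ C (subst x y) := by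
    intro r
    rw [← substHom_apply hx, Polynomial.hom_eval₂]
    congr 1
    · ext a; simp
  rw [subst_div_ofPoly hy _ _ hq, subst_div_ofPoly (subst_nonconst hx hy) _ _ hq,
    ← substHom_apply hx, map_div₀, substHom_apply, substHom_apply, key, key]

lemma subst_X (f : RatFunc ℂ) : subst X f = f := by
  have hX : Nonconst (X : RatFunc ℂ) := by
    intro c h
    have := congrArg der h
    simp at this
  obtain ⟨p, q, hq, rfl⟩ := exists_div_ofPoly f
  have key : ∀ r : Polynomial ℂ, r.eval₂ C (X : RatFunc ℂ) = ofPoly r := by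
    intro r
    rw [← subst_ofPoly]
    conv_rhs => rw [← Polynomial.eval₂_C_X (p := r), Polynomial.hom_eval₂]
    simp [subst_ofPoly]
  rw [subst_div_ofPoly hX _ _ hq, key, key]

lemma der_eval₂ (p : Polynomial ℂ) (x : RatFunc ℂ) :
    der (p.eval₂ C x) = p.derivative.eval₂ C x * der x := by
  induction p using Polynomial.induction_on' with
  | add p q hp hq => simp only [Polynomial.eval₂_add, der_add, hp, hq, Polynomial.derivative_add]; ring
  | monomial n a =>
    simp only [Polynomial.eval₂_monomial, Polynomial.derivative_monomial, der_C_mul, der_pow]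
    push_cast [map_mul]
    rw [map_natCast]
    ring

/-- The chain rule. -/
lemma der_subst {x : RatFunc ℂ} (hx : Nonconst x) (f : RatFunc ℂ) :
    der (subst x f) = subst x (der f) * der x := by
  obtain ⟨p, q, hq, rfl⟩ := exists_div_ofPoly f
  have hq' := hx.eval₂_ne_zero hq
  rw [der_div_ofPoly _ _ hq, subst_div_ofPoly hx _ _ hq,
    subst_div_ofPoly hx _ _ (pow_ne_zero 2 hq), der_div _ _ hq', der_eval₂, der_eval₂]
  simp only [Polynomial.eval₂_sub, Polynomial.eval₂_mul, Polynomial.eval₂_pow]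
  field_simp

lemma nonconst_of_der_ne_zero {x : RatFunc ℂ} (h : der x ≠ 0) : Nonconst x := by
  rintro c rfl; simp at h

lemma der_ne_zero {x : RatFunc ℂ} (hx : Nonconst x) : der x ≠ 0 := by
  intro h
  unfold der at h
  rw [div_eq_zero_iff] at h
  have h1 : Polynomial.derivative x.num * x.denom = x.num * Polynomial.derivative x.denom := by
    rcases h with h | h
    · simpa [sub_eq_zero, -map_sub] using h
    · simp [x.denom_ne_zero] at h
  have hcop := x.isCoprime_num_denom
  have hz : ∀ p q : Polynomial ℂ, IsCoprime p q → q ≠ 0 →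
      Polynomial.derivative p * q = p * Polynomial.derivative q → Polynomial.derivative q = 0 := by
    intro p q hpq hq hd
    by_contra h0
    have hdvd : q ∣ Polynomial.derivative q :=
      hpq.symm.dvd_of_dvd_mul_left ⟨_, by rw [← hd]; ring⟩
    have := Polynomial.natDegree_le_of_dvd hdvd h0
    rcases Nat.eq_zero_or_pos q.natDegree with hq0 | hq0
    · rw [Polynomial.eq_C_of_natDegree_eq_zero hq0] at h0; simp at h0
    · have := Polynomial.natDegree_derivative_lt hq0.ne'
      omega
  have hden := Polynomial.derivative_eq_zero.mp
    (hz _ _ hcop x.denom_ne_zero h1)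
  have hnum := Polynomial.derivative_eq_zero.mp
    (hz _ _ hcop.symm (by simpa using hx.ne_zero) (by rw [mul_comm, ← h1, mul_comm]))
  apply hx (x.num.coeff 0 / x.denom.coeff 0)
  conv_lhs => rw [← RatFunc.num_div_denom x]
  rw [Polynomial.eq_C_of_natDegree_eq_zero hden, Polynomial.eq_C_of_natDegree_eq_zero hnum]
  simp

lemma schwarzian_subst {x y : RatFunc ℂ} (hx : Nonconst x) (hy : Nonconst y) :
    schwarzian (subst x y) = subst x (schwarzian y) * der x ^ 2 + schwarzian x := by
  have hdx := der_ne_zero hx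
  have hdy := der_ne_zero (subst_nonconst hx hy)
  rw [der_subst hx] at hdy
  have h0 : subst x (der y) ≠ 0 := left_ne_zero_of_mul hdy
  have hl : ∀ f, dlog (subst x f) = subst x (dlog f) * der x := by
    intro f
    unfold dlog
    rw [der_subst hx, ← substHom_apply hx, ← substHom_apply hx, ← substHom_apply hx, map_div₀]
    ring
  simp only [schwarzian_eq, der_subst hx, dlog_mul h0 hdx, hl, der_add, der_mul]
  have : ∀ f, subst x f = substHom x hx f := fun f => (substHom_apply hx f).symm
  simp only [this, map_sub, map_mul, map_pow, map_div₀, map_one, map_ofNat]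
  unfold dlog
  field_simp
  ring

/-- Successive changes of the independent variable compose. -/
lemma pullback_pullback {x y : RatFunc ℂ} (hx : Nonconst x) (hy : Nonconst y) (Q : RatFunc ℂ) :
    pullback x (pullback y Q) = pullback (subst x y) Q := by
  unfold pullback
  rw [schwarzian_subst hx hy, der_subst hx, ← subst_subst hx hy]
  have : ∀ f, subst x f = substHom x hx f := fun f => (substHom_apply hx f).symm
  simp only [this, map_sub, map_mul, map_pow, map_div₀, map_one, map_ofNat]
  ring

lemma pullback_X (Q : RatFunc ℂ) : pullback X Q = Q := by
  simp [pullback, subst_X, schwarzian_eq, dlog, der_one, der_zero]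

lemma subst_W {x : RatFunc ℂ} (hx : Nonconst x) (k m : ℂ) :
    subst x (W k m) = 1 / 4 - C k / x + C (m ^ 2 - 1 / 4) / x ^ 2 := by
  unfold W
  rw [← substHom_apply hx]
  simp only [map_sub, map_add, map_div₀, map_one, map_ofNat, map_pow, substHom_X]
  simp only [← map_div₀, ← map_one C, ← map_ofNat C, ← map_pow, ← map_sub, substHom_C]

lemma subst_DW {x : RatFunc ℂ} (hx : Nonconst x) (m : ℂ) :
    subst x (DW m) = 1 / x + C (m ^ 2 - 1 / 4) / x ^ 2 := by
  unfold DW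
  rw [← substHom_apply hx]
  simp only [map_add, map_div₀, map_one, map_pow, substHom_X, substHom_C]

/-! ### The transformed potentials of the explicit covers -/

lemma lin_ne_zero {a : ℂ} (ha : a ≠ 0) (b : ℂ) : C a * X + C b ≠ 0 := by
  apply Nonconst.ne_zero
  apply nonconst_of_der_ne_zero
  simpa [der_add, der_C_mul] using ha

lemma X_add_C_ne_zero (b : ℂ) : X + C b ≠ 0 := by
  simpa using lin_ne_zero one_ne_zero b

lemma X_sub_C_ne_zero (b : ℂ) : X - C b ≠ 0 := by
  simpa [sub_eq_add_neg] using lin_ne_zero one_ne_zero (-b)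

/-- The transformed potential in terms of `x₁ = x'`, `G = x''/x'` and `G'`. -/
lemma pullback_of_der {x x₁ G G₁ : RatFunc ℂ} (h1 : der x = x₁) (h0 : x₁ ≠ 0)
    (hG : der x₁ = G * x₁) (hG1 : der G = G₁) (Q : RatFunc ℂ) :
    pullback x Q = subst x Q * x₁ ^ 2 - 1 / 2 * (G₁ - 1 / 2 * G ^ 2) := by
  unfold pullback
  have : dlog x₁ = G := by rw [dlog, hG]; field_simp
  rw [schwarzian_eq, h1, this, hG1]

lemma W_of_sq {m m' : ℂ} (k : ℂ) (h : m ^ 2 = m' ^ 2) : W k m = W k m' := by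
  unfold W; rw [h]

lemma DW_of_sq {m m' : ℂ} (h : m ^ 2 = m' ^ 2) : DW m = DW m' := by
  unfold DW; rw [h]

lemma pullback_W_of_der {x x₁ G G₁ : RatFunc ℂ} (h1 : der x = x₁) (h0 : x₁ ≠ 0)
    (hG : der x₁ = G * x₁) (hG1 : der G = G₁) (k m : ℂ) :
    pullback x (W k m) = (1 / 4 - C k / x + C (m ^ 2 - 1 / 4) / x ^ 2) * x₁ ^ 2 -
      1 / 2 * (G₁ - 1 / 2 * G ^ 2) := by
  rw [pullback_of_der h1 h0 hG hG1, subst_W (nonconst_of_der_ne_zero (h1 ▸ h0))]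

lemma pullback_DW_of_der {x x₁ G G₁ : RatFunc ℂ} (h1 : der x = x₁) (h0 : x₁ ≠ 0)
    (hG : der x₁ = G * x₁) (hG1 : der G = G₁) (m : ℂ) :
    pullback x (DW m) = (1 / x + C (m ^ 2 - 1 / 4) / x ^ 2) * x₁ ^ 2 -
      1 / 2 * (G₁ - 1 / 2 * G ^ 2) := by
  rw [pullback_of_der h1 h0 hG hG1, subst_DW (nonconst_of_der_ne_zero (h1 ▸ h0))]

lemma der_const_mul_pow (a : ℂ) {n : ℕ} (hn : n ≠ 0) :
    der (C a * X ^ n) = C a * (n : RatFunc ℂ) * X ^ n / X := by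
  have hX : (X : RatFunc ℂ) ≠ 0 := RatFunc.X_ne_zero
  cases n with
  | zero => exact absurd rfl hn
  | succ k =>
    rw [der_C_mul, der_pow, der_X, Nat.add_sub_cancel]; field_simp; ring

/-- The transformed potentials for the covers `x = a zⁿ`. -/
lemma pullback_W_pow {a : ℂ} (ha : a ≠ 0) {n : ℕ} (hn : n ≠ 0) (k m : ℂ) :
    pullback (C a * X ^ n) (W k m) =
      C (a ^ 2 * n ^ 2 / 4) * X ^ (2 * n) / X ^ 2 - C (k * a * n ^ 2) * X ^ n / X ^ 2 +
        C ((4 * m ^ 2 * n ^ 2 - 1) / 4) / X ^ 2 := by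
  have hX : (X : RatFunc ℂ) ≠ 0 := RatFunc.X_ne_zero
  have ha' : C a ≠ 0 := by simpa using ha
  have hn' : (n : RatFunc ℂ) ≠ 0 := by exact_mod_cast hn
  have e := der_const_mul_pow a hn
  rw [pullback_W_of_der (x₁ := C a * (n : RatFunc ℂ) * X ^ n / X) (G := ((n : RatFunc ℂ) - 1) / X)
    (G₁ := -((n : RatFunc ℂ) - 1) / X ^ 2) e (by simp_all)]
  · simp only [map_mul, map_pow, map_sub, map_div₀, map_one, map_ofNat, map_natCast]
    field_simp
    ring
  · have : der (C a * (n : RatFunc ℂ) * X ^ n) = C a * (n : RatFunc ℂ) * (n : RatFunc ℂ) * X ^ n / X := by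
      rw [mul_right_comm, der_mul, e, der_natCast]; ring
    rw [der_div _ _ hX, this, der_X]; field_simp
  · rw [der_div _ _ hX, der_sub, der_natCast, der_one, der_X]; field_simp; ring

lemma pullback_DW_pow {a : ℂ} (ha : a ≠ 0) {n : ℕ} (hn : n ≠ 0) (m : ℂ) :
    pullback (C a * X ^ n) (DW m) =
      C (a * n ^ 2) * X ^ n / X ^ 2 + C ((4 * m ^ 2 * n ^ 2 - 1) / 4) / X ^ 2 := by
  have hX : (X : RatFunc ℂ) ≠ 0 := RatFunc.X_ne_zero
  have ha' : C a ≠ 0 := by simpa using ha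
  have hn' : (n : RatFunc ℂ) ≠ 0 := by exact_mod_cast hn
  have e := der_const_mul_pow a hn
  rw [pullback_DW_of_der (x₁ := C a * (n : RatFunc ℂ) * X ^ n / X) (G := ((n : RatFunc ℂ) - 1) / X)
    (G₁ := -((n : RatFunc ℂ) - 1) / X ^ 2) e (by simp_all)]
  · simp only [map_mul, map_pow, map_sub, map_div₀, map_one, map_ofNat, map_natCast]
    field_simp
    ring
  · have : der (C a * (n : RatFunc ℂ) * X ^ n) = C a * (n : RatFunc ℂ) * (n : RatFunc ℂ) * X ^ n / X := by
      rw [mul_right_comm, der_mul, e, der_natCast]; ring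
    rw [der_div _ _ hX, this, der_X]; field_simp
  · rw [der_div _ _ hX, der_sub, der_natCast, der_one, der_X]; field_simp; ring

lemma pullback_coverP4sym (k m : ℂ) : pullback coverP4sym (W k m) = potP4sym k m := by
  have hX : (X : RatFunc ℂ) ≠ 0 := RatFunc.X_ne_zero
  rw [show coverP4sym = C (1 / 4) * X ^ 2 by
    simp only [coverP4sym, map_div₀, map_one, map_ofNat]; ring,
    pullback_W_pow (by norm_num) (by norm_num)]
  simp only [potP4sym, map_mul, map_pow, map_sub, map_div₀, map_one, map_ofNat, map_natCast]
  push_cast; field_simp; ring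

lemma pullback_coverWeber (k : ℂ) : pullback coverWeber (W k (1 / 4)) = potWeber k := by
  have hX : (X : RatFunc ℂ) ≠ 0 := RatFunc.X_ne_zero
  rw [show coverWeber = C (1 / 2) * X ^ 2 by
    simp only [coverWeber, map_div₀, map_one, map_ofNat]; ring,
    pullback_W_pow (by norm_num) (by norm_num)]
  simp only [potWeber, map_mul, map_pow, map_sub, map_div₀, map_one, map_ofNat, map_natCast]
  push_cast; field_simp; ring

lemma pullback_coverKummer (m : ℂ) : pullback coverKummer (DW m) = potKummer m := by
  have hX : (X : RatFunc ℂ) ≠ 0 := RatFunc.X_ne_zero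
  rw [show coverKummer = C (1 / 16) * X ^ 2 by
    simp only [coverKummer, map_div₀, map_one, map_ofNat]; ring,
    pullback_DW_pow (by norm_num) (by norm_num)]
  simp only [potKummer, map_mul, map_pow, map_sub, map_div₀, map_one, map_ofNat, map_natCast]
  push_cast; field_simp; ring

lemma potKummer_eq (m : ℂ) : potKummer m = W 0 (2 * m) := by
  simp only [potKummer, W, map_mul, map_pow, map_sub, map_div₀, map_one, map_ofNat, map_zero]
  ring

lemma pullback_coverP2sym (k : ℂ) : pullback coverP2sym (W k (1 / 3)) = potP2sym k := by
  have hX : (X : RatFunc ℂ) ≠ 0 := RatFunc.X_ne_zero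
  rw [show coverP2sym = C (2 / 3) * X ^ 3 by
    simp only [coverP2sym, map_div₀, map_ofNat]; ring,
    pullback_W_pow (by norm_num) (by norm_num)]
  simp only [potP2sym, map_mul, map_pow, map_sub, map_div₀, map_one, map_ofNat, map_natCast]
  push_cast; field_simp; ring

lemma pullback_coverP2sym' (k : ℂ) : pullback coverP2sym (W k (1 / 6)) = potP2sym' k := by
  have hX : (X : RatFunc ℂ) ≠ 0 := RatFunc.X_ne_zero
  rw [show coverP2sym = C (2 / 3) * X ^ 3 by
    simp only [coverP2sym, map_div₀, map_ofNat]; ring,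
    pullback_W_pow (by norm_num) (by norm_num)]
  simp only [potP2sym', map_mul, map_pow, map_sub, map_div₀, map_one, map_ofNat, map_natCast]
  push_cast; field_simp; ring

lemma pullback_coverP34sym (m : ℂ) : pullback coverP34sym (DW m) = potP34sym m := by
  have hX : (X : RatFunc ℂ) ≠ 0 := RatFunc.X_ne_zero
  rw [show coverP34sym = C (1 / 18) * X ^ 3 by
    simp only [coverP34sym, map_div₀, map_one, map_ofNat]; ring,
    pullback_DW_pow (by norm_num) (by norm_num)]
  simp only [potP34sym, map_mul, map_pow, map_sub, map_div₀, map_one, map_ofNat, map_natCast]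
  push_cast; field_simp; ring

lemma pullback_coverAiry : pullback coverAiry (DW (1 / 6)) = potAiry := by
  have hX : (X : RatFunc ℂ) ≠ 0 := RatFunc.X_ne_zero
  rw [show coverAiry = C (1 / 9) * X ^ 3 by
    simp only [coverAiry, map_div₀, map_one, map_ofNat]; ring,
    pullback_DW_pow (by norm_num) (by norm_num)]
  simp only [potAiry, map_mul, map_pow, map_sub, map_div₀, map_one, map_ofNat, map_natCast]
  push_cast; field_simp; ring

lemma pullback_coverP1sym : pullback coverP1sym (DW (1 / 5)) = potP1sym := by
  have hX : (X : RatFunc ℂ) ≠ 0 := RatFunc.X_ne_zero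
  rw [show coverP1sym = C (4 / 25) * X ^ 5 by
    simp only [coverP1sym, map_div₀, map_ofNat]; ring,
    pullback_DW_pow (by norm_num) (by norm_num)]
  simp only [potP1sym, map_mul, map_pow, map_sub, map_div₀, map_one, map_ofNat, map_natCast]
  push_cast; field_simp; ring

lemma pullback_coverP1sym' : pullback coverP1sym (DW (1 / 10)) = potP1sym' := by
  have hX : (X : RatFunc ℂ) ≠ 0 := RatFunc.X_ne_zero
  rw [show coverP1sym = C (4 / 25) * X ^ 5 by
    simp only [coverP1sym, map_div₀, map_ofNat]; ring,
    pullback_DW_pow (by norm_num) (by norm_num)]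
  simp only [potP1sym', map_mul, map_pow, map_sub, map_div₀, map_one, map_ofNat, map_natCast]
  push_cast; field_simp; ring

lemma der_X_add_C (a : ℂ) : der (X + C a) = 1 := by simp [der_add]
lemma der_X_sub_C (a : ℂ) : der (X - C a) = 1 := by simp [der_sub]
lemma der_X_sub_one : der (X - 1) = 1 := by simp [der_sub, der_one]
lemma der_X_add_one : der (X + 1) = 1 := by simp [der_add, der_one]

lemma der_one_div (f : RatFunc ℂ) : der (1 / f) = -der f / f ^ 2 := by
  rw [one_div, der_inv]

lemma der_num_div (n : ℕ) [n.AtLeastTwo] (f : RatFunc ℂ) :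
    der (ofNat(n) / f) = -ofNat(n) * der f / f ^ 2 := by
  rw [div_eq_mul_inv, der_mul, der_inv, der_ofNat]; ring

lemma der_div_num (n : ℕ) [n.AtLeastTwo] (f : RatFunc ℂ) :
    der (f / ofNat(n)) = der f / ofNat(n) := by
  rw [div_eq_mul_inv, der_mul, der_inv, der_ofNat]; ring

lemma pullback_coverD6alg {k t s : ℂ} (ht : s ^ 2 = t) :
    pullback (coverD6alg s) (W k (1 / 4)) = potD6alg k t s := by
  have hX : (X : RatFunc ℂ) ≠ 0 := RatFunc.X_ne_zero
  have h1 := X_sub_C_ne_zero s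
  have h2 := X_add_C_ne_zero s
  subst ht
  rw [pullback_W_of_der (x₁ := (X - C s) * (X + C s) / X ^ 2)
    (G := 1 / (X - C s) + 1 / (X + C s) - 2 / X)
    (G₁ := -1 / (X - C s) ^ 2 - 1 / (X + C s) ^ 2 + 2 / X ^ 2)]
  · unfold coverD6alg potD6alg
    simp only [map_mul, map_pow, map_sub, map_add, map_div₀, map_one, map_ofNat]
    field_simp; ring
  · unfold coverD6alg
    rw [der_div _ _ hX, der_pow, der_X_sub_C, der_X]; push_cast; field_simp; ring
  · simp_all
  · rw [der_div _ _ (by simp_all), der_mul, der_pow, der_X_sub_C, der_X_add_C, der_X]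
    push_cast; field_simp
  · simp only [der_sub, der_add, der_one_div, der_num_div, der_X, der_C]
    field_simp; ring

lemma pullback_coverP4Her (t : ℂ) :
    pullback (coverP4Her t) (W 0 (1 / 2)) = potP4Her t := by
  have h2 := X_add_C_ne_zero (2 * t)
  have hX : (X : RatFunc ℂ) ≠ 0 := RatFunc.X_ne_zero
  have h3 := X_add_C_ne_zero (4 * t)
  rw [pullback_W_of_der (x₁ := (X + C (2 * t)) / 2)
    (G := 1 / (X + C (2 * t))) (G₁ := -1 / (X + C (2 * t)) ^ 2)]
  · unfold coverP4Her potP4Her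
    simp only [map_mul, map_pow, map_sub, map_div₀, map_one, map_ofNat, map_zero] at *
    field_simp; ring
  · unfold coverP4Her
    rw [der_div_num, der_mul, der_X_add_C, der_X]
    simp only [map_mul, map_ofNat]; ring
  · simp_all
  · rw [der_div_num, der_X_add_C]; field_simp
  · rw [der_one_div, der_X_add_C]

lemma pullback_coverP5rat {m h t : ℂ} (hh : h ≠ 0) (ht : t ≠ 0) :
    pullback (coverP5rat h t) (DW m) = potP5rat m h t := by
  have hX : (X : RatFunc ℂ) ≠ 0 := RatFunc.X_ne_zero
  have h1 : X - 1 ≠ (0 : RatFunc ℂ) := by simpa using X_sub_C_ne_zero 1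
  have h2 : X + 1 ≠ (0 : RatFunc ℂ) := by simpa using X_add_C_ne_zero 1
  have h3 : C h ≠ 0 := by simpa using hh
  have h4 : C t ≠ 0 := by simpa using ht
  rw [pullback_DW_of_der (x₁ := -(C h * C t ^ 2) * (X + 1) / (4 * (X - 1) ^ 3))
    (G := 1 / (X + 1) - 3 / (X - 1))
    (G₁ := -1 / (X + 1) ^ 2 + 3 / (X - 1) ^ 2)]
  · unfold coverP5rat potP5rat
    simp only [map_mul, map_pow, map_sub, map_add, map_div₀, map_one, map_ofNat]
    field_simp; ring
  · unfold coverP5rat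
    rw [der_div _ _ (by simp_all), der_C_mul, der_mul, der_pow, der_X_sub_one, der_X, der_ofNat]
    simp only [map_mul, map_pow]
    push_cast; field_simp; ring
  · have : -(C h * C t ^ 2) ≠ 0 := by rw [neg_ne_zero]; simp_all
    simp_all
  · have e : der (-(C h * C t ^ 2)) = 0 := by
      rw [← map_pow, ← map_mul, ← map_neg, der_C]
    rw [der_div _ _ (by simp_all), der_mul, e, der_mul, der_pow, der_X_sub_one, der_X_add_one,
      der_ofNat]
    push_cast; field_simp; ring
  · rw [der_sub, der_one_div, der_num_div, der_X_add_one, der_X_sub_one]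
    field_simp; ring

lemma pullback_coverD8alg {h t s : ℂ} (hh : h ≠ 0) (ht : s ^ 2 = t) :
    pullback (coverD8alg h s) (DW (1 / 4)) = potD8alg h t s := by
  have hX : (X : RatFunc ℂ) ≠ 0 := RatFunc.X_ne_zero
  have h1 := X_sub_C_ne_zero s
  have h2 := X_add_C_ne_zero s
  have h3 : C h ≠ 0 := by simpa using hh
  subst ht
  rw [pullback_DW_of_der (x₁ := C h * ((X - C s) * (X + C s)) / X ^ 2)
    (G := 1 / (X - C s) + 1 / (X + C s) - 2 / X)
    (G₁ := -1 / (X - C s) ^ 2 - 1 / (X + C s) ^ 2 + 2 / X ^ 2)]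
  · unfold coverD8alg potD8alg
    simp only [map_mul, map_pow, map_sub, map_div₀, map_one, map_ofNat]
    field_simp; ring
  · unfold coverD8alg
    rw [der_div _ _ hX, der_C_mul, der_pow, der_X_sub_C, der_X]; push_cast; field_simp; ring
  · simp_all
  · rw [der_div _ _ (by simp_all), der_C_mul, der_mul, der_pow, der_X_sub_C, der_X_add_C, der_X]
    push_cast; field_simp
  · simp only [der_sub, der_add, der_one_div, der_num_div, der_X, der_C]
    field_simp; ring

lemma pullback_coverP34rat {t : ℂ} (ht : t ≠ 0) :
    pullback (coverP34rat t) (DW (1 / 4)) = potP34rat t := by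
  obtain ⟨b, rfl⟩ : ∃ b, t = 2 * b := ⟨t / 2, by ring⟩
  have hX : (X : RatFunc ℂ) ≠ 0 := RatFunc.X_ne_zero
  have h1 := X_sub_C_ne_zero (3 * b)
  have h2 := X_sub_C_ne_zero b
  have h4 : C b ≠ 0 := by simpa using ht
  have e1 : C (3 * (2 * b) / 2) = 3 * C b := by rw [← map_ofNat C, ← map_mul]; congr 1; ring
  have e2 : C (2 * b / 2) = C b := by congr 1; ring
  rw [map_mul, map_ofNat] at h1
  have h1' : X - C b * 3 ≠ 0 := by rwa [mul_comm]
  rw [pullback_DW_of_der (x₁ := (X - 3 * C b) * (X - C b) / 6)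
    (G := 1 / (X - 3 * C b) + 1 / (X - C b))
    (G₁ := -1 / (X - 3 * C b) ^ 2 - 1 / (X - C b) ^ 2)]
  · unfold coverP34rat potP34rat
    rw [e1, e2]
    simp only [map_mul, map_pow, map_sub, map_add, map_div₀, map_one, map_ofNat] at *
    field_simp; ring
  · unfold coverP34rat
    rw [e1, der_div_num, der_mul, der_pow, der_sub, der_mul, der_ofNat, der_C, der_X]
    push_cast; ring
  · simp_all
  · rw [der_div_num, der_mul, der_sub, der_sub, der_mul, der_ofNat, der_C, der_X]
    field_simp; ring
  · rw [der_add, der_one_div, der_one_div, der_sub, der_sub, der_mul, der_ofNat, der_C, der_X]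
    ring

lemma pullback_coverD7alg {t s : ℂ} (hs : s ≠ 0) (ht : s ^ 3 = t) :
    pullback (coverD7alg s) (DW (1 / 6)) = potD7alg t s := by
  have hX : (X : RatFunc ℂ) ≠ 0 := RatFunc.X_ne_zero
  have h1 := X_sub_C_ne_zero s
  have h2 := X_add_C_ne_zero (2 * s)
  have h3 : C s ≠ 0 := by simpa using hs
  subst ht
  rw [pullback_DW_of_der (x₁ := (X + C (2 * s)) ^ 2 * (X - C s) / (16 * X ^ 2))
    (G := 2 / (X + C (2 * s)) + 1 / (X - C s) - 2 / X)
    (G₁ := -2 / (X + C (2 * s)) ^ 2 - 1 / (X - C s) ^ 2 + 2 / X ^ 2)]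
  · unfold coverD7alg potD7alg
    simp only [map_mul, map_pow, map_sub, map_add, map_div₀, map_one, map_ofNat] at *
    field_simp; ring
  · unfold coverD7alg
    rw [der_div _ _ (by simp_all), der_pow, der_mul, der_X_add_C, der_X, der_ofNat]
    simp only [map_mul, map_ofNat] at *
    push_cast; field_simp; ring
  · simp_all
  · rw [der_div _ _ (by simp_all), der_mul, der_mul, der_pow, der_pow, der_X_sub_C, der_X_add_C,
      der_X, der_ofNat]
    push_cast; field_simp; ring
  · simp only [der_sub, der_add, der_one_div, der_num_div, der_X, der_C]
    field_simp; ring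

lemma pullback_coverP4rat (t : ℂ) :
    pullback (coverP4rat t) (DW (1 / 6)) = potP4rat t := by
  obtain ⟨b, rfl⟩ : ∃ b, t = 3 * b := ⟨t / 3, by ring⟩
  have hX : (X : RatFunc ℂ) ≠ 0 := RatFunc.X_ne_zero
  have h1 := X_add_C_ne_zero (8 * b)
  have h2 := X_add_C_ne_zero (2 * b)
  have e1 : C (8 * (3 * b) / 3) = 8 * C b := by rw [← map_ofNat C, ← map_mul]; congr 1; ring
  rw [map_mul, map_ofNat] at h1 h2
  have h1' : X + C b * 8 ≠ 0 := by rwa [mul_comm]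
  have h2' : X + C b * 2 ≠ 0 := by rwa [mul_comm]
  rw [pullback_DW_of_der (x₁ := (X + 8 * C b) ^ 2 * (X + 2 * C b) / 64)
    (G := 2 / (X + 8 * C b) + 1 / (X + 2 * C b))
    (G₁ := -2 / (X + 8 * C b) ^ 2 - 1 / (X + 2 * C b) ^ 2)]
  · unfold coverP4rat potP4rat
    have e2 : 3 * X + C (2 * (3 * b)) = 3 * (X + 2 * C b) := by
      simp only [map_mul, map_ofNat]; ring
    rw [e1, e2]
    simp only [map_mul, map_pow, map_sub, map_div₀, map_one, map_ofNat] at *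
    field_simp; ring
  · unfold coverP4rat
    rw [e1, der_div_num, der_mul, der_pow, der_add, der_mul, der_ofNat, der_C, der_X]
    push_cast; ring
  · simp_all
  · rw [der_div_num, der_mul, der_pow, der_add, der_add, der_mul, der_mul, der_ofNat, der_ofNat,
      der_C, der_X]
    push_cast; field_simp; ring
  · rw [der_add, der_one_div, der_num_div, der_add, der_add, der_mul, der_mul, der_ofNat,
      der_ofNat, der_C, der_X]
    ring

lemma pullback_coverP2rat (t : ℂ) :
    pullback (coverP2rat t) (DW (1 / 6)) = potP2rat t := by
  have hX : (X : RatFunc ℂ) ≠ 0 := RatFunc.X_ne_zero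
  have e : der (X ^ 2 + C t) = 2 * X := by
    rw [der_add, der_pow, der_C, der_X]; push_cast; ring
  have h1 : X ^ 2 + C t ≠ 0 := by
    apply Nonconst.ne_zero
    apply nonconst_of_der_ne_zero
    rw [e]; simp_all
  rw [pullback_DW_of_der (x₁ := X * (X ^ 2 + C t) ^ 2 / 6)
    (G := 1 / X + 4 * X / (X ^ 2 + C t))
    (G₁ := -1 / X ^ 2 + (4 * (X ^ 2 + C t) - 8 * X ^ 2) / (X ^ 2 + C t) ^ 2)]
  · unfold coverP2rat potP2rat
    simp only [map_pow, map_sub, map_div₀, map_one, map_ofNat] at *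
    field_simp; ring
  · unfold coverP2rat
    rw [der_div_num, der_pow, e]
    push_cast; ring
  · simp_all
  · rw [der_div_num, der_mul, der_pow, e, der_X]; push_cast; field_simp; ring
  · rw [der_add, der_one_div, der_div _ _ h1, der_mul, der_ofNat, der_X, e]
    ring

/-- The covers of degenerate Whittaker equations which factor through the quadratic
transformation `x = y²/16` of degenerate Whittaker to Whittaker equations. -/
lemma pullback_sq_div {y : RatFunc ℂ} (hy : Nonconst y) (m : ℂ) :
    pullback (y ^ 2 / 16) (DW m) = pullback y (W 0 (2 * m)) := by
  have hK : Nonconst coverKummer := by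
    apply nonconst_of_der_ne_zero
    have hX : (X : RatFunc ℂ) ≠ 0 := RatFunc.X_ne_zero
    rw [coverKummer, der_div_num, der_pow, der_X]; push_cast; simp_all
  have e : subst y coverKummer = y ^ 2 / 16 := by
    rw [coverKummer, ← substHom_apply hy]
    simp only [map_div₀, map_pow, substHom_X, map_ofNat]
  rw [← e, ← pullback_pullback hy hK, pullback_coverKummer, potKummer_eq]

/-! ### Values and orders of rational functions at points -/

/-- The rational function `f` is regular at `a` and has the value `v` there. -/
def HasVal (f : RatFunc ℂ) (a v : ℂ) : Prop :=
  ∃ p q : Polynomial ℂ, q.eval a ≠ 0 ∧ f = ofPoly p / ofPoly q ∧ p.eval a = v * q.eval a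

lemma ne_zero_of_eval {q : Polynomial ℂ} {a : ℂ} (h : q.eval a ≠ 0) : q ≠ 0 := by
  rintro rfl; simp at h

lemma HasVal.congr {f : RatFunc ℂ} {a v w : ℂ} (h : HasVal f a v) (e : v = w) : HasVal f a w :=
  e ▸ h

lemma hasVal_ofPoly (p : Polynomial ℂ) (a : ℂ) : HasVal (ofPoly p) a (p.eval a) :=
  ⟨p, 1, by simp, by simp, by simp⟩

lemma hasVal_C (c a : ℂ) : HasVal (C c) a c := by
  simpa using hasVal_ofPoly (Polynomial.C c) a

lemma hasVal_X (a : ℂ) : HasVal X a a := by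
  simpa using hasVal_ofPoly Polynomial.X a

lemma hasVal_zero (a : ℂ) : HasVal 0 a 0 := by simpa using hasVal_C 0 a
lemma hasVal_one (a : ℂ) : HasVal 1 a 1 := by simpa using hasVal_C 1 a
lemma hasVal_natCast (n : ℕ) (a : ℂ) : HasVal (n : RatFunc ℂ) a n := by
  simpa using hasVal_C (n : ℂ) a
lemma hasVal_ofNat (n : ℕ) [n.AtLeastTwo] (a : ℂ) : HasVal (ofNat(n) : RatFunc ℂ) a ofNat(n) :=
  hasVal_natCast n a

lemma HasVal.add {f g : RatFunc ℂ} {a v w : ℂ} (hf : HasVal f a v) (hg : HasVal g a w) :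
    HasVal (f + g) a (v + w) := by
  obtain ⟨p, q, hq, rfl, h⟩ := hf
  obtain ⟨r, s, hs, rfl, h'⟩ := hg
  refine ⟨p * s + q * r, q * s, by simp [hq, hs], ?_, ?_⟩
  · rw [div_add_div _ _ (ofPoly_ne_zero (ne_zero_of_eval hq))
      (ofPoly_ne_zero (ne_zero_of_eval hs))]
    simp only [map_add, map_mul]
  · simp only [Polynomial.eval_add, Polynomial.eval_mul, h, h']; ring

lemma HasVal.mul {f g : RatFunc ℂ} {a v w : ℂ} (hf : HasVal f a v) (hg : HasVal g a w) :
    HasVal (f * g) a (v * w) := by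
  obtain ⟨p, q, hq, rfl, h⟩ := hf
  obtain ⟨r, s, hs, rfl, h'⟩ := hg
  refine ⟨p * r, q * s, by simp [hq, hs], ?_, ?_⟩
  · rw [div_mul_div_comm]; simp only [map_mul]
  · simp only [Polynomial.eval_mul, h, h']; ring

lemma HasVal.neg {f : RatFunc ℂ} {a v : ℂ} (hf : HasVal f a v) : HasVal (-f) a (-v) := by
  simpa using (hasVal_C (-1) a).mul hf

lemma HasVal.sub {f g : RatFunc ℂ} {a v w : ℂ} (hf : HasVal f a v) (hg : HasVal g a w) :
    HasVal (f - g) a (v - w) := by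
  simpa [sub_eq_add_neg] using hf.add hg.neg

lemma HasVal.inv {f : RatFunc ℂ} {a v : ℂ} (hf : HasVal f a v) (hv : v ≠ 0) :
    HasVal f⁻¹ a v⁻¹ := by
  obtain ⟨p, q, hq, rfl, h⟩ := hf
  refine ⟨q, p, by rw [h]; exact mul_ne_zero hv hq, by rw [inv_div], ?_⟩
  rw [h]; field_simp

lemma HasVal.div {f g : RatFunc ℂ} {a v w : ℂ} (hf : HasVal f a v) (hg : HasVal g a w)
    (hw : w ≠ 0) : HasVal (f / g) a (v / w) := by
  simpa [div_eq_mul_inv] using hf.mul (hg.inv hw)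

lemma HasVal.pow {f : RatFunc ℂ} {a v : ℂ} (hf : HasVal f a v) (n : ℕ) :
    HasVal (f ^ n) a (v ^ n) := by
  induction n with
  | zero => simpa using hasVal_one a
  | succ n ih => simpa [pow_succ] using ih.mul hf

lemma HasVal.unique {f : RatFunc ℂ} {a v w : ℂ} (h : HasVal f a v) (h' : HasVal f a w) :
    v = w := by
  obtain ⟨p, q, hq, rfl, h⟩ := h
  obtain ⟨r, s, hs, e, h'⟩ := h'
  rw [div_eq_div_iff (ofPoly_ne_zero (ne_zero_of_eval hq))
    (ofPoly_ne_zero (ne_zero_of_eval hs)), ← map_mul, ← map_mul] at e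
  have e' := congrArg (Polynomial.eval a) (RatFunc.algebraMap_injective ℂ e)
  simp only [Polynomial.eval_mul, h, h'] at e'
  have : (v - w) * (q.eval a * s.eval a) = 0 := by linear_combination e'
  simpa [hq, hs, sub_eq_zero] using this

lemma HasVal.ne_zero {f : RatFunc ℂ} {a v : ℂ} (h : HasVal f a v) (hv : v ≠ 0) : f ≠ 0 := by
  rintro rfl; exact hv (h.unique (hasVal_zero a))

lemma HasVal.der {f : RatFunc ℂ} {a v : ℂ} (h : HasVal f a v) : ∃ w, HasVal (der f) a w := by
  obtain ⟨p, q, hq, rfl, h⟩ := h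
  rw [der_div_ofPoly _ _ (ne_zero_of_eval hq)]
  exact ⟨_, (hasVal_ofPoly _ a).div (hasVal_ofPoly _ a) (by simpa using hq)⟩

lemma hasVal_X_sub_C (a c : ℂ) : HasVal (X - C c) a (a - c) := (hasVal_X a).sub (hasVal_C c a)

/-- A function vanishing at `a` is divisible by the local parameter. -/
lemma HasVal.exists_factor {f : RatFunc ℂ} {a : ℂ} (h : HasVal f a 0) :
    ∃ g v, HasVal g a v ∧ f = (X - C a) * g := by
  obtain ⟨p, q, hq, rfl, h⟩ := h
  rw [zero_mul] at h
  obtain ⟨r, rfl⟩ := Polynomial.dvd_iff_isRoot.mpr h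
  refine ⟨_, _, (hasVal_ofPoly r a).div (hasVal_ofPoly q a) hq, ?_⟩
  rw [map_mul, map_sub, ofPoly_X, ofPoly_C]; ring

lemma HasVal.eval {f : RatFunc ℂ} {a v : ℂ} (h : HasVal f a v) :
    f.eval (RingHom.id ℂ) a = v := by
  obtain ⟨p, q, hq, hf, h⟩ := h
  have h1 := congrArg (Polynomial.eval a) (num_mul_eq_mul_denom (ne_zero_of_eval hq) hf)
  simp only [Polynomial.eval_mul, h] at h1
  have h2 : f.num.eval a = v * f.denom.eval a :=
    mul_right_cancel₀ hq (by rw [h1]; ring)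
  have h3 : f.denom.eval a ≠ 0 := by
    intro h0
    obtain ⟨u, w, e⟩ := f.isCoprime_num_denom
    have := congrArg (Polynomial.eval a) e
    simp [h2, h0] at this
  unfold RatFunc.eval
  rw [Polynomial.eval₂_id, Polynomial.eval₂_id, h2]; field_simp

/-- The order of `f` at a point of `ℙ¹`: positive at zeros, negative at poles. -/
def ord (f : RatFunc ℂ) (c : OnePoint ℂ) : ℤ :=
  c.elim (-f.intDegree) (fun a => (f.num.rootMultiplicity a : ℤ) - f.denom.rootMultiplicity a)

lemma ord_infty (f : RatFunc ℂ) : ord f OnePoint.infty = -f.intDegree := rfl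

lemma ord_coe (f : RatFunc ℂ) (a : ℂ) :
    ord f a = (f.num.rootMultiplicity a : ℤ) - f.denom.rootMultiplicity a := rfl

lemma ord_div_ofPoly {p q : Polynomial ℂ} (hp : p ≠ 0) (hq : q ≠ 0) (a : ℂ) :
    ord (ofPoly p / ofPoly q) a = (p.rootMultiplicity a : ℤ) - q.rootMultiplicity a := by
  obtain ⟨f, hf⟩ : ∃ f, f = ofPoly p / ofPoly q := ⟨_, rfl⟩
  have h := num_mul_eq_mul_denom hq hf
  have hf0 : f ≠ 0 := by
    rw [hf]; exact div_ne_zero (ofPoly_ne_zero hp) (ofPoly_ne_zero hq)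
  have hn : f.num ≠ 0 := by simpa using hf0
  have h1 := congrArg (Polynomial.rootMultiplicity a) h
  rw [Polynomial.rootMultiplicity_mul (mul_ne_zero hn hq),
    Polynomial.rootMultiplicity_mul (mul_ne_zero hp f.denom_ne_zero)] at h1
  rw [← hf, ord_coe]; omega

lemma ord_mul {f g : RatFunc ℂ} (hf : f ≠ 0) (hg : g ≠ 0) (c : OnePoint ℂ) :
    ord (f * g) c = ord f c + ord g c := by
  induction c using OnePoint.rec with
  | infty => rw [ord_infty, ord_infty, ord_infty, RatFunc.intDegree_mul hf hg]; ring
  | coe a =>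
    obtain ⟨p, q, hq, rfl⟩ := exists_div_ofPoly f
    obtain ⟨r, s, hs, rfl⟩ := exists_div_ofPoly g
    have hp : p ≠ 0 := by rintro rfl; simp at hf
    have hr : r ≠ 0 := by rintro rfl; simp at hg
    rw [div_mul_div_comm, ← map_mul, ← map_mul, ord_div_ofPoly (mul_ne_zero hp hr)
      (mul_ne_zero hq hs), ord_div_ofPoly hp hq, ord_div_ofPoly hr hs,
      Polynomial.rootMultiplicity_mul (mul_ne_zero hp hr),
      Polynomial.rootMultiplicity_mul (mul_ne_zero hq hs)]
    push_cast; ring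

@[simp] lemma ord_C (a : ℂ) (c : OnePoint ℂ) : ord (C a) c = 0 := by
  induction c using OnePoint.rec with
  | infty => simp [ord_infty]
  | coe b =>
    rw [ord_coe, RatFunc.num_C, RatFunc.denom_C]
    simp [Polynomial.rootMultiplicity_C]

@[simp] lemma ord_one (c : OnePoint ℂ) : ord 1 c = 0 := by simpa using ord_C 1 c
@[simp] lemma ord_zero (c : OnePoint ℂ) : ord 0 c = 0 := by simpa using ord_C 0 c

lemma ord_inv (f : RatFunc ℂ) (c : OnePoint ℂ) : ord f⁻¹ c = -ord f c := by
  by_cases hf : f = 0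
  · simp [hf]
  have := ord_mul hf (inv_ne_zero hf) c
  rw [mul_inv_cancel₀ hf, ord_one] at this
  omega

lemma ord_div {f g : RatFunc ℂ} (hf : f ≠ 0) (hg : g ≠ 0) (c : OnePoint ℂ) :
    ord (f / g) c = ord f c - ord g c := by
  rw [div_eq_mul_inv, ord_mul hf (inv_ne_zero hg), ord_inv]; ring

lemma ord_pow (f : RatFunc ℂ) (n : ℕ) (c : OnePoint ℂ) : ord (f ^ n) c = n * ord f c := by
  by_cases hf : f = 0
  · subst hf; rcases n with _ | n <;> simp
  induction n with
  | zero => simp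
  | succ n ih => rw [pow_succ, ord_mul (pow_ne_zero _ hf) hf, ih]; push_cast; ring

lemma ord_zpow (f : RatFunc ℂ) (n : ℤ) (c : OnePoint ℂ) : ord (f ^ n) c = n * ord f c := by
  obtain ⟨k, rfl | rfl⟩ := n.eq_nat_or_neg
  · simpa using ord_pow f k c
  · rw [zpow_neg, ord_inv, zpow_natCast, ord_pow]; ring

lemma ord_X_sub_C_coe (a b : ℂ) : ord (X - C a) (b : OnePoint ℂ) = if b = a then 1 else 0 := by
  have := ord_div_ofPoly (Polynomial.X_sub_C_ne_zero a) one_ne_zero b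
  rw [map_one, div_one, map_sub, ofPoly_X, ofPoly_C] at this
  rw [this, Polynomial.rootMultiplicity_X_sub_C,
    Polynomial.rootMultiplicity_eq_zero (p := 1) (by simp)]
  split_ifs <;> simp

lemma ord_X_sub_C_infty (a : ℂ) : ord (X - C a) OnePoint.infty = -1 := by
  rw [ord_infty, show X - C a = ofPoly (Polynomial.X - Polynomial.C a) by
    rw [map_sub, ofPoly_X, ofPoly_C], RatFunc.intDegree_polynomial]
  simp

lemma ord_eq_zero_of_hasVal {f : RatFunc ℂ} {a v : ℂ} (h : HasVal f a v) (hv : v ≠ 0) :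
    ord f a = 0 := by
  obtain ⟨p, q, hq, rfl, h⟩ := h
  have hp : p.eval a ≠ 0 := by rw [h]; exact mul_ne_zero hv hq
  rw [ord_div_ofPoly (ne_zero_of_eval hp) (ne_zero_of_eval hq),
    Polynomial.rootMultiplicity_eq_zero hp, Polynomial.rootMultiplicity_eq_zero hq]
  rfl

lemma ord_zpow_mul {u : RatFunc ℂ} {a v : ℂ} (h : HasVal u a v) (hv : v ≠ 0) (n : ℤ) :
    ord ((X - C a) ^ n * u) a = n := by
  rw [ord_mul (zpow_ne_zero _ (X_sub_C_ne_zero a)) (h.ne_zero hv), ord_zpow, ord_X_sub_C_coe,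
    ord_eq_zero_of_hasVal h hv]
  simp

/-- A nonzero rational function is a power of the local parameter times a unit. -/
lemma exists_unit_factor {f : RatFunc ℂ} (hf : f ≠ 0) (a : ℂ) :
    ∃ u v, v ≠ 0 ∧ HasVal u a v ∧ f = (X - C a) ^ ord f a * u := by
  obtain ⟨p, q, hq, rfl⟩ := exists_div_ofPoly f
  have hp : p ≠ 0 := by rintro rfl; simp at hf
  obtain ⟨p', hpe, hp'⟩ := Polynomial.exists_eq_pow_rootMultiplicity_mul_and_not_dvd p hp a
  obtain ⟨q', hqe, hq'⟩ := Polynomial.exists_eq_pow_rootMultiplicity_mul_and_not_dvd q hq a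
  rw [Polynomial.dvd_iff_isRoot, Polynomial.IsRoot] at hp' hq'
  refine ⟨ofPoly p' / ofPoly q', p'.eval a / q'.eval a, div_ne_zero hp' hq',
    (hasVal_ofPoly _ _).div (hasVal_ofPoly _ _) hq', ?_⟩
  rw [ord_div_ofPoly hp hq, zpow_sub₀ (X_sub_C_ne_zero a), zpow_natCast, zpow_natCast]
  conv_lhs => rw [hpe, hqe]
  simp only [map_mul, map_pow, map_sub, ofPoly_X, ofPoly_C]
  have h1 := X_sub_C_ne_zero a
  have h2 : ofPoly q' ≠ 0 := ofPoly_ne_zero (by rintro rfl; simp at hq')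
  field_simp

lemma hasVal_of_ord_nonneg {f : RatFunc ℂ} {a : ℂ} (h : 0 ≤ ord f a) : ∃ v, HasVal f a v := by
  by_cases hf : f = 0
  · exact ⟨0, hf ▸ hasVal_zero a⟩
  obtain ⟨u, v, -, hu, e⟩ := exists_unit_factor hf a
  rw [e]
  obtain ⟨n, hn⟩ := Int.eq_ofNat_of_zero_le h
  rw [hn, zpow_natCast]
  exact ⟨_, ((hasVal_X_sub_C a a).pow n).mul hu⟩

lemma hasVal_of_ord_zero {f : RatFunc ℂ} {a : ℂ} (hf : f ≠ 0) (h : ord f a = 0) :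
    ∃ v, v ≠ 0 ∧ HasVal f a v := by
  obtain ⟨u, v, hv, hu, e⟩ := exists_unit_factor hf a
  rw [h, zpow_zero, one_mul] at e
  exact ⟨v, hv, e ▸ hu⟩

/-- A rational function without zeros and poles in `ℂ` is constant. -/
lemma eq_C_of_ord_eq_zero {f : RatFunc ℂ} (hf : f ≠ 0) (h : ∀ a : ℂ, ord f a = 0) :
    ∃ κ : ℂ, κ ≠ 0 ∧ f = C κ := by
  have hcop := f.isCoprime_num_denom
  have hn : f.num ≠ 0 := by simpa using hf
  have key : ∀ p q : Polynomial ℂ, IsCoprime p q → p ≠ 0 → q ≠ 0 →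
      (∀ a, (p.rootMultiplicity a : ℤ) - q.rootMultiplicity a = 0) → p.natDegree = 0 := by
    intro p q hpq hp hq h
    by_contra h0
    obtain ⟨a, ha⟩ := IsAlgClosed.exists_root p (by
      intro h1; exact h0 (Polynomial.natDegree_eq_of_degree_eq_some h1))
    have h1 := (Polynomial.rootMultiplicity_pos hp).mpr ha
    have h2 := h a
    have h3 : q.IsRoot a := (Polynomial.rootMultiplicity_pos hq).mp (by omega)
    obtain ⟨u, w, e⟩ := hpq
    have := congrArg (Polynomial.eval a) e
    simp [ha.eq_zero, h3.eq_zero] at this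
  have hN := key _ _ hcop hn f.denom_ne_zero (fun a => h a)
  have hD := key _ _ hcop.symm f.denom_ne_zero hn (fun a => by
    have := h a; rw [ord_coe] at this; omega)
  have e : f = C (f.num.coeff 0 / f.denom.coeff 0) := by
    conv_lhs => rw [← RatFunc.num_div_denom f]
    rw [Polynomial.eq_C_of_natDegree_eq_zero hN, Polynomial.eq_C_of_natDegree_eq_zero hD]
    simp
  refine ⟨_, ?_, e⟩
  intro h0
  rw [h0, map_zero] at e
  exact hf e

/-- A rational function is determined by its divisor up to a constant factor. -/
lemma eq_C_mul_of_ord_eq {f g : RatFunc ℂ} (hf : f ≠ 0) (hg : g ≠ 0)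
    (h : ∀ a : ℂ, ord f a = ord g a) : ∃ κ : ℂ, κ ≠ 0 ∧ f = C κ * g := by
  obtain ⟨κ, hκ, e⟩ := eq_C_of_ord_eq_zero (div_ne_zero hf hg)
    (fun a => by rw [ord_div hf hg, h]; ring)
  exact ⟨κ, hκ, by rw [← e]; field_simp⟩

/-! ### Pole orders of potentials -/

lemma poleOrder_coe (V : RatFunc ℂ) (a : ℂ) : poleOrder V a = (-ord V a).toNat := by
  change V.denom.rootMultiplicity a = _
  rw [ord_coe]
  by_cases h : V.denom.rootMultiplicity a = 0
  · rw [h]; simp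
  · have h1 : V.denom.IsRoot a :=
      (Polynomial.rootMultiplicity_pos V.denom_ne_zero).mp (Nat.pos_of_ne_zero h)
    have h2 : V.num.rootMultiplicity a = 0 := by
      apply Polynomial.rootMultiplicity_eq_zero
      intro h2
      obtain ⟨u, w, e⟩ := V.isCoprime_num_denom
      have := congrArg (Polynomial.eval a) e
      simp [h1.eq_zero, h2.eq_zero] at this
    rw [h2]; simp

lemma poleOrder_infty {V : RatFunc ℂ} (hV : V ≠ 0) :
    poleOrder V OnePoint.infty = (4 - ord V OnePoint.infty).toNat := by
  unfold poleOrder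
  rw [OnePoint.elim_infty, if_neg hV, ord_infty]; congr 1; ring

lemma poleOrder_of_hasVal {V : RatFunc ℂ} {a v : ℂ} (n : ℕ) (h : HasVal ((X - C a) ^ n * V) a v)
    (hv : v ≠ 0) : poleOrder V a = n := by
  have h1 : V = (X - C a) ^ (-(n : ℤ)) * ((X - C a) ^ n * V) := by
    have := X_sub_C_ne_zero a
    rw [zpow_neg, zpow_natCast]; field_simp
  rw [poleOrder_coe, h1, ord_zpow_mul h hv]; simp

/-- The principal part of a potential with a pole of order at most `2`. -/
def LocalForm (V : RatFunc ℂ) (a l b : ℂ) : Prop :=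
  ∃ r v, HasVal r a v ∧ V = C l / (X - C a) ^ 2 + C b / (X - C a) + r

lemma HasVal.localForm {V : RatFunc ℂ} {a v : ℂ} (h : HasVal V a v) : LocalForm V a 0 0 :=
  ⟨V, v, h, by simp⟩

lemma LocalForm.of_sq {V : RatFunc ℂ} {a l : ℂ} (h : HasVal ((X - C a) ^ 2 * V) a l) :
    ∃ b, LocalForm V a l b := by
  have h0 := X_sub_C_ne_zero a
  obtain ⟨g, b, hg, e⟩ := HasVal.exists_factor ((h.sub (hasVal_C l a)).congr (sub_self l))
  obtain ⟨r, v, hr, e'⟩ := HasVal.exists_factor ((hg.sub (hasVal_C b a)).congr (sub_self b))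
  refine ⟨b, r, v, hr, ?_⟩
  field_simp
  linear_combination e + (X - C a) * e'

lemma LocalForm.unique {V : RatFunc ℂ} {a l b l' b' : ℂ} (h : LocalForm V a l b)
    (h' : LocalForm V a l' b') : l = l' ∧ b = b' := by
  have h0 := X_sub_C_ne_zero a
  obtain ⟨r, v, hr, e⟩ := h
  obtain ⟨r', v', hr', e'⟩ := h'
  have hz := hasVal_X_sub_C a a
  rw [sub_self] at hz
  have h1 : HasVal ((X - C a) ^ 2 * V) a l := by
    rw [e, show (X - C a) ^ 2 * (C l / (X - C a) ^ 2 + C b / (X - C a) + r) =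
      C l + (X - C a) * C b + (X - C a) ^ 2 * r by field_simp]
    exact (((hasVal_C l a).add (hz.mul (hasVal_C b a))).add ((hz.pow 2).mul hr)).congr (by ring)
  have h2 : HasVal ((X - C a) ^ 2 * V) a l' := by
    rw [e', show (X - C a) ^ 2 * (C l' / (X - C a) ^ 2 + C b' / (X - C a) + r') =
      C l' + (X - C a) * C b' + (X - C a) ^ 2 * r' by field_simp]
    exact (((hasVal_C l' a).add (hz.mul (hasVal_C b' a))).add ((hz.pow 2).mul hr')).congr (by ring)
  obtain rfl := h1.unique h2
  refine ⟨rfl, ?_⟩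
  have h3 : HasVal ((X - C a) * (V - C l / (X - C a) ^ 2)) a b := by
    rw [e, show (X - C a) * (C l / (X - C a) ^ 2 + C b / (X - C a) + r - C l / (X - C a) ^ 2) =
      C b + (X - C a) * r by field_simp; ring]
    exact ((hasVal_C b a).add (hz.mul hr)).congr (by ring)
  have h4 : HasVal ((X - C a) * (V - C l / (X - C a) ^ 2)) a b' := by
    rw [e', show (X - C a) * (C l / (X - C a) ^ 2 + C b' / (X - C a) + r' - C l / (X - C a) ^ 2) =
      C b' + (X - C a) * r' by field_simp; ring]
    exact ((hasVal_C b' a).add (hz.mul hr')).congr (by ring)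
  exact h3.unique h4

lemma poleOrder_of_regular {V : RatFunc ℂ} {a v : ℂ} (h : HasVal V a v) : poleOrder V a = 0 := by
  by_cases hv : v = 0
  · by_cases hV : V = 0
    · subst hV; rw [poleOrder_coe]; simp
    obtain ⟨u, w, hw, hu, e⟩ := exists_unit_factor hV a
    rw [poleOrder_coe]
    by_contra h0
    have h1 : ord V a < 0 := by omega
    have h2 : HasVal u a 0 := by
      have : u = (X - C a) ^ (-ord V a) * V := by
        rw [e, ord_zpow_mul hu hw, ← mul_assoc, ← zpow_add₀ (X_sub_C_ne_zero a)]; simp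
      rw [this]
      obtain ⟨n, hn⟩ := Int.eq_ofNat_of_zero_le (show 0 ≤ -ord V a by omega)
      rw [hn, zpow_natCast]
      exact (((hasVal_X_sub_C a a).pow n).mul h).congr (by simp [hv])
    exact hw (hu.unique h2)
  · exact poleOrder_of_hasVal 0 (by simpa using h) hv

lemma LocalForm.hasVal_sq {V : RatFunc ℂ} {a l b : ℂ} (h : LocalForm V a l b) :
    HasVal ((X - C a) ^ 2 * V) a l := by
  have h0 := X_sub_C_ne_zero a
  obtain ⟨r, v, hr, e⟩ := h
  have hz := hasVal_X_sub_C a a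
  rw [e, show (X - C a) ^ 2 * (C l / (X - C a) ^ 2 + C b / (X - C a) + r) =
    C l + (X - C a) * C b + (X - C a) ^ 2 * r by field_simp]
  exact (((hasVal_C l a).add (hz.mul (hasVal_C b a))).add ((hz.pow 2).mul hr)).congr (by ring)

lemma LocalForm.poleOrder_le {V : RatFunc ℂ} {a l b : ℂ} (h : LocalForm V a l b) :
    poleOrder V a ≤ 2 := by
  have h0 := X_sub_C_ne_zero a
  by_cases hV : V = 0
  · subst hV; rw [poleOrder_coe]; simp
  have h1 := h.hasVal_sq
  have h2 := poleOrder_of_regular h1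
  rw [poleOrder_coe, ord_mul (pow_ne_zero 2 h0) hV, ord_pow, ord_X_sub_C_coe] at h2
  rw [poleOrder_coe]
  simp at h2 ⊢; omega

/-! ### Möbius transformations -/

/-- The denominator of the Möbius transformation belonging to a matrix. -/
def mobDen (g : GL (Fin 2) ℂ) : RatFunc ℂ := C (g 1 0) * X + C (g 1 1)

/-- The Möbius transformation belonging to a matrix, as a rational function. -/
def mob (g : GL (Fin 2) ℂ) : RatFunc ℂ := (C (g 0 0) * X + C (g 0 1)) / mobDen g

lemma gl_det_ne_zero (g : GL (Fin 2) ℂ) : g 0 0 * g 1 1 - g 0 1 * g 1 0 ≠ 0 := by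
  have := g.det_ne_zero
  rwa [Matrix.det_fin_two] at this

lemma linear_ne_zero {u w : ℂ} (h : u ≠ 0 ∨ w ≠ 0) : C u * X + C w ≠ 0 := by
  by_cases hu : u = 0
  · subst hu; simpa using h
  · exact lin_ne_zero hu w

lemma gl_row_ne_zero (g : GL (Fin 2) ℂ) : g 1 0 ≠ 0 ∨ g 1 1 ≠ 0 := by
  by_contra! h
  exact gl_det_ne_zero g (by rw [h.1, h.2]; ring)

lemma mobDen_ne_zero (g : GL (Fin 2) ℂ) : mobDen g ≠ 0 := linear_ne_zero (gl_row_ne_zero g)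

lemma der_linear (u w : ℂ) : der (C u * X + C w) = C u := by
  rw [der_add, der_C_mul, der_X, der_C]; ring

lemma der_mob (g : GL (Fin 2) ℂ) :
    der (mob g) = C (g 0 0 * g 1 1 - g 0 1 * g 1 0) / mobDen g ^ 2 := by
  have h := mobDen_ne_zero g
  rw [mob, der_div _ _ h, der_linear]
  unfold mobDen at h ⊢
  rw [der_linear]
  congr 1
  simp only [map_sub, map_mul]; ring

lemma der_mob_ne_zero (g : GL (Fin 2) ℂ) : der (mob g) ≠ 0 := by
  rw [der_mob]
  exact div_ne_zero ((map_ne_zero C).mpr (gl_det_ne_zero g)) (pow_ne_zero 2 (mobDen_ne_zero g))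

lemma nonconst_mob (g : GL (Fin 2) ℂ) : Nonconst (mob g) :=
  nonconst_of_der_ne_zero (der_mob_ne_zero g)

lemma schwarzian_mob (g : GL (Fin 2) ℂ) : schwarzian (mob g) = 0 := by
  have h := mobDen_ne_zero g
  have hd : C (g 0 0 * g 1 1 - g 0 1 * g 1 0) ≠ 0 :=
    (map_ne_zero C).mpr (gl_det_ne_zero g)
  have e : dlog (der (mob g)) = C (-2 * g 1 0) / mobDen g := by
    rw [der_mob, dlog_div hd (pow_ne_zero 2 h), dlog_C, dlog_pow, dlog, mobDen, der_linear]
    simp only [map_mul, map_neg, map_ofNat]; push_cast; ring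
  rw [schwarzian_eq, e, der_div _ _ h, der_C]
  unfold mobDen at h ⊢
  rw [der_linear]
  simp only [map_mul, map_neg, map_ofNat]
  field_simp; ring

lemma pullback_mob (g : GL (Fin 2) ℂ) (V : RatFunc ℂ) :
    pullback (mob g) V =
      subst (mob g) V * (C (g 0 0 * g 1 1 - g 0 1 * g 1 0) / mobDen g ^ 2) ^ 2 := by
  rw [pullback, schwarzian_mob, der_mob]; ring

lemma subst_mob_mob (g h : GL (Fin 2) ℂ) : subst (mob h) (mob g) = mob (g * h) := by
  have h1 := mobDen_ne_zero h
  have h2 := mobDen_ne_zero (g * h)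
  have h3 : substHom (mob h) (nonconst_mob h) (mobDen g) ≠ 0 := by
    simpa using mobDen_ne_zero g
  rw [← substHom_apply (nonconst_mob h), show mob g = (C (g 0 0) * X + C (g 0 1)) / mobDen g from rfl,
    show mob (g * h) = (C ((g * h) 0 0) * X + C ((g * h) 0 1)) / mobDen (g * h) from rfl,
    map_div₀, div_eq_div_iff h3 h2]
  unfold mobDen at *
  have e : mob h * (C (h 1 0) * X + C (h 1 1)) = C (h 0 0) * X + C (h 0 1) := div_mul_cancel₀ _ h1
  simp only [map_add, map_mul, substHom_C, substHom_X]
  simp only [Units.val_mul, Matrix.mul_apply, Fin.sum_univ_two, map_add, map_mul]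
  linear_combination (C (g 0 0) * C (g 1 1) - C (g 0 1) * C (g 1 0)) * e

lemma mob_one : mob 1 = X := by
  simp [mob, mobDen]

lemma ord_linear_coe {u w : ℂ} (h : u ≠ 0 ∨ w ≠ 0) (b : ℂ) :
    ord (C u * X + C w) b = if u * b + w = 0 then 1 else 0 := by
  by_cases hu : u = 0
  · subst hu
    have hw : w ≠ 0 := by simpa using h
    simp [hw]
  · have e : C u * X + C w = C u * (X - C (-w / u)) := by
      rw [mul_sub, ← map_mul]
      rw [show u * (-w / u) = -w by field_simp, map_neg]; ring
    rw [e, ord_mul (by simpa using hu) (X_sub_C_ne_zero _), ord_C, ord_X_sub_C_coe, zero_add]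
    congr 1
    rw [eq_div_iff hu, eq_iff_iff]
    constructor <;> intro h' <;> linear_combination h'

lemma ord_linear_infty {u w : ℂ} (h : u ≠ 0 ∨ w ≠ 0) :
    ord (C u * X + C w) OnePoint.infty = if u = 0 then 0 else -1 := by
  by_cases hu : u = 0
  · subst hu; simp
  · have e : C u * X + C w = C u * (X - C (-w / u)) := by
      rw [mul_sub, ← map_mul]
      rw [show u * (-w / u) = -w by field_simp, map_neg]; ring
    rw [e, ord_mul (by simpa using hu) (X_sub_C_ne_zero _), ord_C, ord_X_sub_C_infty, if_neg hu]
    rfl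

/-- Möbius transformations transport divisors. -/
lemma ord_subst_mob (g : GL (Fin 2) ℂ) {f : RatFunc ℂ} (hf : f ≠ 0) (c : OnePoint ℂ) :
    ord (subst (mob g) f) c = ord f (g • c) := by
  have hg := nonconst_mob g
  have hd := gl_det_ne_zero g
  have hD := mobDen_ne_zero g
  have hlin : ∀ a, ord (substHom _ hg (X - C a)) c = ord (X - C a) (g • c) := by
    intro a
    have hN : g 0 0 - a * g 1 0 ≠ 0 ∨ g 0 1 - a * g 1 1 ≠ 0 := by
      by_contra! h
      exact hd (by linear_combination g 1 1 * h.1 - g 1 0 * h.2)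
    have e : substHom _ hg (X - C a) =
        (C (g 0 0 - a * g 1 0) * X + C (g 0 1 - a * g 1 1)) / mobDen g := by
      rw [map_sub, substHom_X, substHom_C, mob, eq_div_iff hD, sub_mul, div_mul_cancel₀ _ hD,
        mobDen]
      simp only [map_sub, map_mul]; ring
    rw [e, ord_div (linear_ne_zero hN) hD, mobDen]
    induction c using OnePoint.rec with
    | infty =>
      rw [ord_linear_infty hN, ord_linear_infty (gl_row_ne_zero g), OnePoint.smul_infty_eq_ite]
      by_cases h0 : g 1 0 = 0
      · have : g 0 0 ≠ 0 := by rintro h; apply hd; rw [h, h0]; ring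
        simp [h0, this, ord_X_sub_C_infty]
      · rw [if_neg h0, if_neg h0, ord_X_sub_C_coe]
        have : g 0 0 / g 1 0 = a ↔ g 0 0 - a * g 1 0 = 0 := by
          rw [div_eq_iff h0, sub_eq_zero]
        simp only [this]; split_ifs <;> simp
    | coe b =>
      rw [ord_linear_coe hN, ord_linear_coe (gl_row_ne_zero g), OnePoint.smul_some_eq_ite]
      by_cases h0 : g 1 0 * b + g 1 1 = 0
      · rw [if_pos h0, if_pos h0, ord_X_sub_C_infty, if_neg]
        · rfl
        · intro h
          have h1 : g 0 0 * b + g 0 1 = 0 := by linear_combination h + a * h0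
          rcases gl_row_ne_zero g with h2 | h2
          · apply mul_ne_zero hd h2; linear_combination (g 1 0 ^ 2) * -h1 + g 0 0 * g 1 0 * h0
          · apply mul_ne_zero hd h2
            linear_combination (-g 1 0 * g 1 1) * h1 + (g 0 0 * g 1 1) * h0
      · rw [if_neg h0, if_neg h0, ord_X_sub_C_coe]
        have : (g 0 0 * b + g 0 1) / (g 1 0 * b + g 1 1) = a ↔
            (g 0 0 - a * g 1 0) * b + (g 0 1 - a * g 1 1) = 0 := by
          rw [div_eq_iff h0]
          constructor <;> intro h' <;> linear_combination h'
        simp only [this]; split_ifs <;> simp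
  have hpoly : ∀ p : Polynomial ℂ, p ≠ 0 →
      ord (substHom _ hg (ofPoly p)) c = ord (ofPoly p) (g • c) := by
    intro p hp
    have e : ofPoly p = C p.leadingCoeff * (p.roots.map fun a => X - C a).prod := by
      conv_lhs => rw [(IsAlgClosed.splits p).eq_prod_roots]
      rw [map_mul, ofPoly_C, map_multiset_prod, Multiset.map_map]
      simp only [Function.comp_def, map_sub, ofPoly_X, ofPoly_C]
    have hprod : ∀ s : Multiset ℂ, (s.map fun a => X - C a).prod ≠ 0 ∧
        ord (substHom _ hg (s.map fun a => X - C a).prod) c =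
          ord (s.map fun a => X - C a).prod (g • c) := by
      intro s
      induction s using Multiset.induction_on with
      | empty => simp
      | cons a s ih =>
        rw [Multiset.map_cons, Multiset.prod_cons]
        refine ⟨mul_ne_zero (X_sub_C_ne_zero a) ih.1, ?_⟩
        have h1 : substHom _ hg (X - C a) ≠ 0 := (map_ne_zero _).mpr (X_sub_C_ne_zero a)
        have h2 : substHom _ hg (s.map fun a => X - C a).prod ≠ 0 := by simpa using ih.1
        rw [map_mul, ord_mul h1 h2, ord_mul (X_sub_C_ne_zero a) ih.1, ih.2, hlin]
    have hl : C p.leadingCoeff ≠ 0 := by simpa using hp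
    have hs := hprod p.roots
    have h2 : substHom _ hg (p.roots.map fun a => X - C a).prod ≠ 0 := by
      rw [map_ne_zero]; exact hs.1
    rw [e, map_mul, substHom_C, ord_mul hl h2, ord_mul hl hs.1, hs.2, ord_C, ord_C]
  obtain ⟨p, q, hq, rfl⟩ := exists_div_ofPoly f
  have hp : p ≠ 0 := by rintro rfl; simp at hf
  rw [← substHom_apply hg, map_div₀, ord_div (by rw [map_ne_zero]; exact ofPoly_ne_zero hp)
    (by rw [map_ne_zero]; exact ofPoly_ne_zero hq),
    ord_div (ofPoly_ne_zero hp) (ofPoly_ne_zero hq), hpoly p hp, hpoly q hq]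

/-! ### The divisor of a cover -/

/-- The inclusion of the affine line in `ℙ¹`. -/
def ptEmb : ℂ ↪ OnePoint ℂ := ⟨fun a => (a : OnePoint ℂ), OnePoint.coe_injective⟩

@[simp] lemma ptEmb_apply (a : ℂ) : ptEmb a = (a : OnePoint ℂ) := rfl

lemma rootType_eq {d : ℕ} {p : Polynomial ℂ} (hp : p ≠ 0)
    {N : OnePoint ℂ → ℕ} (hN : ∀ a : ℂ, N a = p.rootMultiplicity a)
    (hN' : N OnePoint.infty = d - p.natDegree) {S : Finset (OnePoint ℂ)}
    (hS : ∀ c, c ∈ S ↔ 0 < N c) : rootType d p = S.val.map N := by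
  classical
  have hS' : S = (p.roots.toFinset.map ptEmb) ∪
      (if p.natDegree < d then {OnePoint.infty} else ∅) := by
    ext c
    rw [hS]
    induction c using OnePoint.rec with
    | infty =>
      rw [hN']
      split_ifs with h <;> simp [h]
    | coe a =>
      rw [hN, Polynomial.rootMultiplicity_pos hp]
      split_ifs with h <;> simp [hp]
  have hdisj : Disjoint (p.roots.toFinset.map ptEmb)
      (if p.natDegree < d then {OnePoint.infty} else ∅) := by
    rw [Finset.disjoint_left]
    intro c hc
    obtain ⟨a, -, rfl⟩ := Finset.mem_map.mp hc
    split_ifs <;> simp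
  rw [hS', ← Finset.disjUnion_eq_union _ _ hdisj, Finset.disjUnion_val, Multiset.map_add,
    rootType]
  congr 1
  · rw [Finset.map_val, Multiset.map_map]
    convert rfl using 2
    simp [hN]
  · split_ifs <;> simp [hN']

lemma rootType_sum {d : ℕ} {p : Polynomial ℂ} (hd : p.natDegree ≤ d) :
    (rootType d p).sum = d := by
  have h1 : (p.roots.toFinset.val.map fun a => p.rootMultiplicity a).sum = p.natDegree := by
    have := Multiset.toFinset_sum_count_eq p.roots
    rw [(IsAlgClosed.splits p).natDegree_eq_card_roots, ← this]
    simp only [Polynomial.count_roots]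
    rfl
  unfold rootType
  rw [Multiset.sum_add]
  have h2 : (p.roots.toFinset.val.map fun a => p.rootMultiplicity a).sum +
      (if p.natDegree < d then ({d - p.natDegree} : Multiset ℕ) else 0).sum = d := by
    rw [h1]; split_ifs <;> simp <;> omega
  convert h2

lemma num_rootMultiplicity (x : RatFunc ℂ) (a : ℂ) :
    x.num.rootMultiplicity a = (ord x a).toNat := by
  have h := poleOrder_coe x a
  change x.denom.rootMultiplicity a = _ at h
  have h2 := ord_coe x a
  omega

lemma denom_rootMultiplicity (x : RatFunc ℂ) (a : ℂ) :
    x.denom.rootMultiplicity a = (-ord x a).toNat := poleOrder_coe x a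

lemma zeroType_eq {x : RatFunc ℂ} (hx : x ≠ 0) {S : Finset (OnePoint ℂ)}
    (hS : ∀ c, c ∈ S ↔ 0 < ord x c) : zeroType x = S.val.map fun c => (ord x c).toNat := by
  apply rootType_eq (by simpa using hx)
  · intro a; rw [num_rootMultiplicity]
  · rw [ord_infty, RatFunc.intDegree, coverDegree]; omega
  · intro c; rw [hS]; omega

lemma poleType_eq {x : RatFunc ℂ} {S : Finset (OnePoint ℂ)}
    (hS : ∀ c, c ∈ S ↔ ord x c < 0) : poleType x = S.val.map fun c => (-ord x c).toNat := by
  apply rootType_eq x.denom_ne_zero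
  · intro a; rw [denom_rootMultiplicity]
  · rw [ord_infty, RatFunc.intDegree, coverDegree]; omega
  · intro c; rw [hS]; omega

lemma zeroType_sum (x : RatFunc ℂ) : (zeroType x).sum = coverDegree x :=
  rootType_sum (le_max_left _ _)

lemma poleType_sum (x : RatFunc ℂ) : (poleType x).sum = coverDegree x :=
  rootType_sum (le_max_right _ _)

lemma exists_zeroSet {x : RatFunc ℂ} (hx : x ≠ 0) :
    ∃ S : Finset (OnePoint ℂ), ∀ c, c ∈ S ↔ 0 < ord x c := by
  classical
  refine ⟨(x.num.roots.toFinset.map ptEmb) ∪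
      (if 0 < ord x OnePoint.infty then {OnePoint.infty} else ∅), fun c => ?_⟩
  have hn : x.num ≠ 0 := by simpa using hx
  induction c using OnePoint.rec with
  | infty => split_ifs with h <;> simp [h]
  | coe a =>
    have h := Polynomial.rootMultiplicity_pos hn (x := a)
    rw [num_rootMultiplicity] at h
    have h2 : 0 < ord x a ↔ x.num.IsRoot a := by rw [← h]; omega
    rw [h2]
    split_ifs <;> simp [hn]

lemma exists_poleSet {x : RatFunc ℂ} (hx : x ≠ 0) :
    ∃ S : Finset (OnePoint ℂ), ∀ c, c ∈ S ↔ ord x c < 0 := by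
  obtain ⟨S, hS⟩ := exists_zeroSet (inv_ne_zero hx)
  exact ⟨S, fun c => by rw [hS, ord_inv]; omega⟩

lemma Nonconst.of_coverDegree {x : RatFunc ℂ} (h : 1 ≤ coverDegree x) : Nonconst x := by
  rintro c rfl
  simp [coverDegree] at h

section Invariance

variable (g : GL (Fin 2) ℂ)

lemma zeroType_subst_mob {x : RatFunc ℂ} (hx : x ≠ 0) :
    zeroType (subst (mob g) x) = zeroType x := by
  obtain ⟨S, hS⟩ := exists_zeroSet hx
  have hx' : subst (mob g) x ≠ 0 := by
    rw [← substHom_apply (nonconst_mob g), map_ne_zero]; exact hx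
  rw [zeroType_eq hx hS, zeroType_eq hx' (S := S.map (MulAction.toPerm g⁻¹).toEmbedding)]
  · rw [Finset.map_val, Multiset.map_map]
    congr 1; ext c
    simp [ord_subst_mob g hx]
  · intro c
    rw [Finset.mem_map, ord_subst_mob g hx]
    constructor
    · rintro ⟨e, he, rfl⟩; simpa using (hS e).mp he
    · intro h; exact ⟨g • c, (hS _).mpr h, by simp⟩

lemma poleType_subst_mob {x : RatFunc ℂ} (hx : x ≠ 0) :
    poleType (subst (mob g) x) = poleType x := by
  obtain ⟨S, hS⟩ := exists_poleSet hx
  rw [poleType_eq hS, poleType_eq (S := S.map (MulAction.toPerm g⁻¹).toEmbedding)]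
  · rw [Finset.map_val, Multiset.map_map]
    congr 1; ext c
    simp [ord_subst_mob g hx]
  · intro c
    rw [Finset.mem_map, ord_subst_mob g hx]
    constructor
    · rintro ⟨e, he, rfl⟩; simpa using (hS e).mp he
    · intro h; exact ⟨g • c, (hS _).mpr h, by simp⟩

lemma coverDegree_subst_mob {x : RatFunc ℂ} (hx : x ≠ 0) :
    coverDegree (subst (mob g) x) = coverDegree x := by
  rw [← zeroType_sum, zeroType_subst_mob g hx, zeroType_sum]

lemma isMobius_mob : IsMobius (mob g) := by
  have h : subst (mob g) X = mob g := by
    rw [← substHom_apply (nonconst_mob g), substHom_X]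
  unfold IsMobius
  rw [← h, coverDegree_subst_mob g RatFunc.X_ne_zero, coverDegree]
  simp

end Invariance

lemma IsMobius.exists_mob {φ : RatFunc ℂ} (h : IsMobius φ) : ∃ g, φ = mob g := by
  have hcop := φ.isCoprime_num_denom
  unfold IsMobius coverDegree at h
  have h1 : φ.num.natDegree ≤ 1 := by omega
  have h2 : φ.denom.natDegree ≤ 1 := by omega
  obtain ⟨b, a, e1⟩ : ∃ b a, φ.num = Polynomial.C a * Polynomial.X + Polynomial.C b :=
    ⟨_, _, Polynomial.eq_X_add_C_of_natDegree_le_one h1⟩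
  obtain ⟨d, c, e2⟩ : ∃ d c, φ.denom = Polynomial.C c * Polynomial.X + Polynomial.C d :=
    ⟨_, _, Polynomial.eq_X_add_C_of_natDegree_le_one h2⟩
  have hdet : a * d - b * c ≠ 0 := by
    intro h0
    obtain ⟨u, w, e⟩ := hcop
    by_cases hc : c = 0
    · subst hc
      have hd : d ≠ 0 := by
        rintro rfl; exact φ.denom_ne_zero (by rw [e2]; simp)
      have ha : a = 0 := by
        rw [mul_zero, sub_zero] at h0; exact (mul_eq_zero.mp h0).resolve_right hd
      subst ha
      rw [e1, e2] at h; simp at h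
    · have := congrArg (Polynomial.eval (-d / c)) e
      rw [e1, e2] at this
      simp only [Polynomial.eval_add, Polynomial.eval_mul, Polynomial.eval_C, Polynomial.eval_X,
        Polynomial.eval_one] at this
      rw [show c * (-d / c) + d = 0 by field_simp; ring,
        show a * (-d / c) + b = 0 by field_simp; linear_combination -h0] at this
      simp at this
  refine ⟨Matrix.GeneralLinearGroup.mkOfDetNeZero !![a, b; c, d]
    (by rw [Matrix.det_fin_two_of]; exact hdet), ?_⟩
  have h00 := RatFunc.num_div_denom φ
  rw [e1, e2] at h00
  rw [← h00]
  simp [mob, mobDen, Matrix.GeneralLinearGroup.mkOfDetNeZero]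

/-- The group of Möbius transformations moves any two points of `ℙ¹` to `∞` and `0`. -/
lemma exists_mob_smul {c₁ c₂ : OnePoint ℂ} (h : c₁ ≠ c₂) :
    ∃ g : GL (Fin 2) ℂ, g • OnePoint.infty = c₁ ∧ g • ((0 : ℂ) : OnePoint ℂ) = c₂ := by
  have key : ∀ a b c d : ℂ, a * d - b * c ≠ 0 → ∃ g : GL (Fin 2) ℂ,
      g 0 0 = a ∧ g 0 1 = b ∧ g 1 0 = c ∧ g 1 1 = d := by
    intro a b c d hdet
    refine ⟨Matrix.GeneralLinearGroup.mkOfDetNeZero !![a, b; c, d]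
      (by rw [Matrix.det_fin_two_of]; exact hdet), ?_⟩
    simp [Matrix.GeneralLinearGroup.mkOfDetNeZero]
  induction c₁ using OnePoint.rec with
  | infty =>
    induction c₂ using OnePoint.rec with
    | infty => exact absurd rfl h
    | coe b =>
      obtain ⟨g, h1, h2, h3, h4⟩ := key 1 b 0 1 (by simp)
      exact ⟨g, by rw [OnePoint.smul_infty_eq_ite]; simp [h3],
        by rw [OnePoint.smul_some_eq_ite]; simp [*]⟩
  | coe a =>
    induction c₂ using OnePoint.rec with
    | infty =>
      obtain ⟨g, h1, h2, h3, h4⟩ := key a 1 1 0 (by simp)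
      exact ⟨g, by rw [OnePoint.smul_infty_eq_ite]; simp [*],
        by rw [OnePoint.smul_some_eq_ite]; simp [*]⟩
    | coe b =>
      have hab : a ≠ b := fun e => h (by rw [e])
      obtain ⟨g, h1, h2, h3, h4⟩ := key a b 1 1 (by simpa [sub_eq_zero] using hab)
      exact ⟨g, by rw [OnePoint.smul_infty_eq_ite]; simp [*],
        by rw [OnePoint.smul_some_eq_ite]; simp [*]⟩

/-! ### Invariance of the singularity type under Möbius transformations -/

open scoped Classical in
lemma ord_mobDen (g : GL (Fin 2) ℂ) (c : OnePoint ℂ) :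
    ord (mobDen g) c + (if c = OnePoint.infty then 1 else 0) =
      if g • c = OnePoint.infty then 1 else 0 := by
  unfold mobDen
  induction c using OnePoint.rec with
  | infty =>
    rw [ord_linear_infty (gl_row_ne_zero g), OnePoint.smul_infty_eq_ite]
    split_ifs <;> simp_all
  | coe b =>
    rw [ord_linear_coe (gl_row_ne_zero g), OnePoint.smul_some_eq_ite]
    split_ifs <;> simp_all

open scoped Classical in
lemma poleOrder_eq {V : RatFunc ℂ} (hV : V ≠ 0) (c : OnePoint ℂ) :
    poleOrder V c = (4 * (if c = OnePoint.infty then 1 else 0) - ord V c).toNat := by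
  induction c using OnePoint.rec with
  | infty => rw [poleOrder_infty hV]; simp
  | coe a => rw [poleOrder_coe]; simp

lemma poleOrder_zero (c : OnePoint ℂ) : poleOrder 0 c = 0 := by
  induction c using OnePoint.rec with
  | infty => simp [poleOrder]
  | coe a => rw [poleOrder_coe]; simp

lemma poleOrder_pullback_mob (g : GL (Fin 2) ℂ) (V : RatFunc ℂ) (c : OnePoint ℂ) :
    poleOrder (pullback (mob g) V) c = poleOrder V (g • c) := by
  by_cases hV : V = 0
  · subst hV
    rw [pullback_mob, ← substHom_apply (nonconst_mob g), map_zero, zero_mul, poleOrder_zero,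
      poleOrder_zero]
  have hD := mobDen_ne_zero g
  have hd : C (g 0 0 * g 1 1 - g 0 1 * g 1 0) ≠ 0 := (map_ne_zero C).mpr (gl_det_ne_zero g)
  have h1 : subst (mob g) V ≠ 0 := by
    rw [← substHom_apply (nonconst_mob g), map_ne_zero]; exact hV
  have h2 := div_ne_zero hd (pow_ne_zero 2 hD)
  rw [pullback_mob, poleOrder_eq (mul_ne_zero h1 (pow_ne_zero 2 h2)), poleOrder_eq hV,
    ord_mul h1 (pow_ne_zero 2 h2), ord_pow, ord_div hd (pow_ne_zero 2 hD), ord_pow, ord_C,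
    ord_subst_mob g hV]
  have := ord_mobDen g c
  congr 1
  push_cast
  linarith

lemma HasVal.denom_ne_zero_and_num {f : RatFunc ℂ} {a v : ℂ} (h : HasVal f a v) :
    f.denom.eval a ≠ 0 ∧ f.num.eval a = v * f.denom.eval a := by
  obtain ⟨p, q, hq, hf, h⟩ := h
  have h1 := congrArg (Polynomial.eval a) (num_mul_eq_mul_denom (ne_zero_of_eval hq) hf)
  simp only [Polynomial.eval_mul, h] at h1
  have h2 : f.num.eval a = v * f.denom.eval a :=
    mul_right_cancel₀ hq (by rw [h1]; ring)
  refine ⟨?_, h2⟩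
  intro h0
  obtain ⟨u, w, e⟩ := f.isCoprime_num_denom
  have := congrArg (Polynomial.eval a) e
  simp [h2, h0] at this

lemma isApparentAt_iff {V : RatFunc ℂ} {c : ℂ} :
    IsApparentAt V c ↔ ∃ b, HasVal (V - 3 / 4 / (X - C c) ^ 2 - C b / (X - C c)) c (b ^ 2) := by
  constructor
  · rintro ⟨b, r, h1, h2, e⟩
    refine ⟨b, ?_⟩
    have hr : HasVal r c 0 := ⟨r.num, r.denom, h1, (RatFunc.num_div_denom r).symm, by simpa using h2⟩
    rw [e, show 3 / 4 / (X - C c) ^ 2 + C b / (X - C c) + C (b ^ 2) + r -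
      3 / 4 / (X - C c) ^ 2 - C b / (X - C c) = C (b ^ 2) + r by ring]
    exact ((hasVal_C _ c).add hr).congr (by ring)
  · rintro ⟨b, h⟩
    have h' := ((h.sub (hasVal_C (b ^ 2) c)).congr (sub_self _)).denom_ne_zero_and_num
    exact ⟨b, _, h'.1, by rw [h'.2]; ring, by ring⟩

lemma HasVal.subst {x f : RatFunc ℂ} {c a v : ℂ} (hx : Nonconst x) (h : HasVal f a v)
    (hxa : HasVal x c a) : HasVal (subst x f) c v := by
  have key : ∀ p : Polynomial ℂ, HasVal (p.eval₂ C x) c (p.eval a) := by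
    intro p
    induction p using Polynomial.induction_on' with
    | add p q hp hq =>
      rw [Polynomial.eval₂_add, Polynomial.eval_add]; exact hp.add hq
    | monomial n b =>
      rw [Polynomial.eval₂_monomial, Polynomial.eval_monomial]
      exact (hasVal_C b c).mul (hxa.pow n)
  obtain ⟨p, q, hq, rfl, h⟩ := h
  rw [subst_div_ofPoly hx _ _ (ne_zero_of_eval hq)]
  exact ((key p).div (key q) hq).congr (by rw [h]; field_simp)

/-- The absence of logarithms at an apparent singularity does not depend on the coordinate. -/
lemma IsApparentAt.pullback_mob {V : RatFunc ℂ} {c c₀ : ℂ} (h : IsApparentAt V c₀)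
    (g : GL (Fin 2) ℂ) (hg : g • (c : OnePoint ℂ) = c₀) : IsApparentAt (pullback (mob g) V) c := by
  rw [isApparentAt_iff] at h ⊢
  obtain ⟨b, h⟩ := h
  obtain ⟨r, hr⟩ : ∃ r, r = V - 3 / 4 / (X - C c₀) ^ 2 - C b / (X - C c₀) := ⟨_, rfl⟩
  rw [← hr] at h
  have hV : V = 3 / 4 / (X - C c₀) ^ 2 + C b / (X - C c₀) + r := by rw [hr]; ring
  set α := g 0 0
  set β := g 0 1
  set γ := g 1 0 with hγ
  set δ := g 1 1 with hδ
  have hD := mobDen_ne_zero g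
  have hdet : α * δ - β * γ ≠ 0 := gl_det_ne_zero g
  rw [OnePoint.smul_some_eq_ite] at hg
  have hl : γ * c + δ ≠ 0 := by
    intro h0; rw [if_pos h0] at hg; exact OnePoint.infty_ne_coe _ hg
  rw [if_neg hl, OnePoint.coe_eq_coe, div_eq_iff hl] at hg
  obtain ⟨l, hl'⟩ : ∃ l, l = γ * c + δ := ⟨_, rfl⟩
  rw [← hl'] at hl hg
  obtain ⟨D, hD'⟩ : ∃ D, D = α * δ - β * γ := ⟨_, rfl⟩
  rw [← hD'] at hdet
  have hw := X_sub_C_ne_zero c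
  obtain ⟨w, hw'⟩ : ∃ w, w = X - C c := ⟨_, rfl⟩
  have hden : mobDen g = C l + C γ * w := by
    rw [mobDen, hl', hw', map_add, map_mul]; ring
  have hL : C l ≠ 0 := (map_ne_zero C).mpr hl
  have hDd : C D ≠ 0 := (map_ne_zero C).mpr hdet
  have hmob : mob g - C c₀ = C D * w / (C l * mobDen g) := by
    rw [eq_div_iff (mul_ne_zero hL hD), mob, sub_mul, mul_comm (C l), ← mul_assoc,
      div_mul_cancel₀ _ hD, mobDen, hw']
    have e2 : C D = C α * C δ - C β * C γ := by rw [hD']; simp only [map_sub, map_mul]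
    have e3 : C l = C γ * C c + C δ := by rw [hl']; simp only [map_add, map_mul]
    have e4 : C α * C c + C β = C c₀ * C l := by
      rw [← map_mul, ← map_mul, ← map_add, hg]
    rw [← hγ, ← hδ]
    linear_combination (-(X - C c)) * e2 + (C α * X + C β) * e3 +
      (C γ * X + C δ) * e4
  have hval : HasVal (mob g) c c₀ := by
    have : HasVal (mobDen g) c l := by
      rw [hl']; exact ((hasVal_C _ c).mul (hasVal_X c)).add (hasVal_C _ c)
    exact ((((hasVal_C _ c).mul (hasVal_X c)).add (hasVal_C _ c)).div this hl).congr
      (by rw [div_eq_iff hl]; exact hg)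
  have hr' := h.subst (nonconst_mob g) hval
  have hsub : subst (mob g) V =
      3 / 4 / (mob g - C c₀) ^ 2 + C b / (mob g - C c₀) + subst (mob g) r := by
    rw [hV, ← substHom_apply (nonconst_mob g), ← substHom_apply (nonconst_mob g)]
    simp only [map_add, map_sub, map_div₀, map_pow, map_ofNat, substHom_X, substHom_C]
  refine ⟨b * D / l ^ 2 - 3 / 2 * γ / l, ?_⟩
  -- the first two coefficients of the expansion determine the new residue `b'`; what is left of
  -- the double pole contributes `(9/4) (γ/l)²` to the constant term, which makes it `b'²`
  have e : pullback (mob g) V - 3 / 4 / (X - C c) ^ 2 -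
      C (b * D / l ^ 2 - 3 / 2 * γ / l) / (X - C c) =
      3 / 4 * (3 * C γ ^ 2 + 2 * C γ ^ 3 / C l * w) / mobDen g ^ 2 -
        C (b * D * γ / l ^ 2) * (3 * C l ^ 2 + 3 * C l * C γ * w + C γ ^ 2 * w ^ 2) / mobDen g ^ 3 +
        subst (mob g) r * C D ^ 2 / mobDen g ^ 4 := by
    rw [FuchsCover.pullback_mob, hsub, hmob, ← hw', ← hD']
    rw [← hw'] at hw
    rw [hden] at hD ⊢
    have hD2 : C l + w * C γ ≠ 0 := by rwa [mul_comm w]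
    simp only [map_sub, map_mul, map_div₀, map_pow, map_ofNat]
    field_simp
    ring
  rw [e]
  have hwv : HasVal w c 0 := by rw [hw']; exact (hasVal_X_sub_C c c).congr (sub_self c)
  have hdv : HasVal (mobDen g) c l := by
    rw [hden]
    exact ((hasVal_C l c).add ((hasVal_C γ c).mul hwv)).congr (by ring)
  have n2 := hasVal_ofNat 2 c
  have n3 := hasVal_ofNat 3 c
  have n4 := hasVal_ofNat 4 c
  have cγ := hasVal_C γ c
  have cl := hasVal_C l c
  refine (((((n3.div n4 (by norm_num)).mul ((n3.mul (cγ.pow 2)).add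
    (((n2.mul (cγ.pow 3)).div cl hl).mul hwv))).div (hdv.pow 2) (pow_ne_zero 2 hl)).sub
    (((hasVal_C _ c).mul (((n3.mul (cl.pow 2)).add (((n3.mul cl).mul cγ).mul hwv)).add
      ((cγ.pow 2).mul (hwv.pow 2)))).div (hdv.pow 3) (pow_ne_zero 3 hl))).add
    ((hr'.mul ((hasVal_C D c).pow 2)).div
      (hdv.pow 4) (pow_ne_zero 4 hl))).congr ?_
  field_simp
  ring

/-- The matrix of the coordinate change `z = 1/w`. -/
def glInv : GL (Fin 2) ℂ :=
  Matrix.GeneralLinearGroup.mkOfDetNeZero !![0, 1; 1, 0] (by simp)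

lemma mob_glInv : mob glInv = 1 / X := by
  simp [mob, mobDen, glInv, Matrix.GeneralLinearGroup.mkOfDetNeZero]

lemma glInv_smul_zero : glInv • ((0 : ℂ) : OnePoint ℂ) = OnePoint.infty := by
  rw [OnePoint.smul_some_eq_ite]
  simp [glInv, Matrix.GeneralLinearGroup.mkOfDetNeZero]

lemma pullback_mob_mob (g h : GL (Fin 2) ℂ) (V : RatFunc ℂ) :
    pullback (mob h) (pullback (mob g) V) = pullback (mob (g * h)) V := by
  rw [pullback_pullback (nonconst_mob h) (nonconst_mob g), subst_mob_mob]

/-- Every point of `ℙ¹` is the image of a finite point under one of the coordinate changes used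
to define apparent singularities. -/
lemma isApparent_iff (V : RatFunc ℂ) (c : OnePoint ℂ) :
    ∃ (h : GL (Fin 2) ℂ) (a : ℂ), h • (a : OnePoint ℂ) = c ∧
      (IsApparent V c ↔ IsApparentAt (pullback (mob h) V) a) := by
  induction c using OnePoint.rec with
  | infty =>
    refine ⟨glInv, 0, glInv_smul_zero, ?_⟩
    rw [mob_glInv]; rfl
  | coe a =>
    refine ⟨1, a, by simp, ?_⟩
    rw [mob_one, pullback_X]; rfl

lemma IsApparent.of_pullback_mob {V : RatFunc ℂ} (g : GL (Fin 2) ℂ) {c : OnePoint ℂ}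
    (h : IsApparent (pullback (mob g) V) c) : IsApparent V (g • c) := by
  obtain ⟨h₁, a₁, e₁, i₁⟩ := isApparent_iff (pullback (mob g) V) c
  obtain ⟨h₂, a₂, e₂, i₂⟩ := isApparent_iff V (g • c)
  rw [i₂]
  have := (i₁.mp h).pullback_mob (c := a₂) (h₁⁻¹ * g⁻¹ * h₂) (by
    rw [mul_smul, mul_smul, e₂, inv_smul_smul, ← e₁, inv_smul_smul])
  rw [pullback_mob_mob, pullback_mob_mob] at this
  rwa [show g * (h₁ * (h₁⁻¹ * g⁻¹ * h₂)) = h₂ by group] at this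

lemma HasSingularityType.of_pullback_mob {V : RatFunc ℂ} {T : Multiset ℚ} (g : GL (Fin 2) ℂ)
    (h : HasSingularityType (pullback (mob g) V) T) : HasSingularityType V T := by
  obtain ⟨S, A, hd, hA, hap, hS, hT⟩ := h
  let e := (MulAction.toPerm g : Equiv.Perm (OnePoint ℂ)).toEmbedding
  refine ⟨S.map e, A.map e, (Finset.disjoint_map e).mpr hd, by simpa using hA, ?_, ?_, ?_⟩
  · intro c hc
    obtain ⟨c', hc', rfl⟩ := Finset.mem_map.mp hc
    exact (hap c' hc').of_pullback_mob g
  · intro c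
    have h1 := hS (g⁻¹ • c)
    rw [poleOrder_pullback_mob, smul_inv_smul] at h1
    rw [h1]
    have key : ∀ B : Finset (OnePoint ℂ), c ∈ B.map e ↔ g⁻¹ • c ∈ B := by
      intro B
      rw [Finset.mem_map]
      constructor
      · rintro ⟨c', hc', rfl⟩; simpa [e] using hc'
      · intro h; exact ⟨_, h, by simp [e]⟩
    rw [key, key]
  · rw [Finset.map_val, Multiset.map_map, ← hT]
    congr 1
    ext c
    simp [e, poincareRank, poleOrder_pullback_mob]

lemma Target.Holds.of_pullback_mob {V : RatFunc ℂ} {J : Target} (g : GL (Fin 2) ℂ)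
    (h : J.Holds (pullback (mob g) V)) : J.Holds V := by
  have key : ∀ φ, IsMobius φ → ∃ ψ, IsMobius ψ ∧ pullback φ (pullback (mob g) V) = pullback ψ V := by
    intro φ hφ
    obtain ⟨h, rfl⟩ := hφ.exists_mob
    exact ⟨_, isMobius_mob (g * h), pullback_mob_mob g h V⟩
  cases J with
  | painleve J =>
    obtain ⟨F, hF, φ, hφ, t, ht, h⟩ := h
    obtain ⟨ψ, hψ, e⟩ := key φ hφ
    rw [e] at h
    exact ⟨F, hF, ψ, hψ, t, ht, h⟩
  | confluent =>
    obtain ⟨φ, hφ, h⟩ := h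
    obtain ⟨ψ, hψ, e⟩ := key φ hφ
    rw [e] at h
    exact ⟨ψ, hψ, h⟩

/-! ### Local analysis of the transformed equation -/

lemma pullback_eq_dlog (x Q : RatFunc ℂ) :
    pullback x Q = subst x Q * der x ^ 2 -
      1 / 2 * (der (dlog (der x)) - 1 / 2 * dlog (der x) ^ 2) := by
  rw [pullback, schwarzian_eq]

lemma HasVal.exists_dlog {u : RatFunc ℂ} {a v : ℂ} (hu : HasVal u a v) (hv : v ≠ 0) :
    ∃ w, HasVal (dlog u) a w := by
  obtain ⟨w, hw⟩ := hu.der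
  exact ⟨_, hw.div hu hv⟩

lemma dlog_X_sub_C (a : ℂ) : dlog (X - C a) = 1 / (X - C a) := by
  rw [dlog, der_X_sub_C]

/-- The logarithmic derivative has a simple pole whose residue is the order. -/
lemma exists_dlog_eq {f : RatFunc ℂ} (hf : f ≠ 0) (a : ℂ) :
    ∃ h v, HasVal h a v ∧ dlog f = C (ord f a : ℂ) / (X - C a) + h := by
  obtain ⟨u, v, hv, hu, e⟩ := exists_unit_factor hf a
  obtain ⟨w, hw⟩ := hu.exists_dlog hv
  refine ⟨_, w, hw, ?_⟩
  conv_lhs => rw [e]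
  rw [dlog_mul (zpow_ne_zero _ (X_sub_C_ne_zero a)) (hu.ne_zero hv), dlog_zpow, dlog_X_sub_C,
    map_intCast]
  ring

/-- The order of the derivative at a zero or a pole. -/
lemma ord_der_coe {x : RatFunc ℂ} (hx : x ≠ 0) {a : ℂ} (h : ord x a ≠ 0) :
    ord (der x) a = ord x a - 1 := by
  obtain ⟨g, v, hg, e⟩ := exists_dlog_eq hx a
  have h0 := X_sub_C_ne_zero a
  have h1 : der x = x * ((X - C a)⁻¹ * (C (ord x a : ℂ) + (X - C a) * g)) := by
    have : der x = x * dlog x := by rw [dlog]; field_simp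
    rw [this, e]; field_simp
  have h2 : HasVal (C (ord x a : ℂ) + (X - C a) * g) a (ord x a : ℂ) :=
    ((hasVal_C _ a).add ((hasVal_X_sub_C a a).mul hg)).congr (by ring)
  have hn : (ord x a : ℂ) ≠ 0 := by exact_mod_cast h
  rw [h1, ord_mul hx (mul_ne_zero (inv_ne_zero h0) (h2.ne_zero hn)),
    ord_mul (inv_ne_zero h0) (h2.ne_zero hn), ord_inv, ord_X_sub_C_coe,
    ord_eq_zero_of_hasVal h2 hn]
  simp; ring

lemma ord_der_nonneg {x : RatFunc ℂ} {a : ℂ} (h : 0 ≤ ord x a) : 0 ≤ ord (der x) a := by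
  obtain ⟨v, hv⟩ := hasVal_of_ord_nonneg h
  obtain ⟨w, hw⟩ := hv.der
  have := poleOrder_of_regular hw
  rw [poleOrder_coe] at this; omega

lemma ord_der_infty {x : RatFunc ℂ} (hx : Nonconst x) (h : ord x OnePoint.infty ≠ 0) :
    ord (der x) OnePoint.infty = ord x OnePoint.infty + 1 := by
  have h1 : ord (subst (mob glInv) x) ((0 : ℂ) : OnePoint ℂ) = ord x OnePoint.infty := by
    rw [ord_subst_mob _ hx.ne_zero, glInv_smul_zero]
  have hx' : subst (mob glInv) x ≠ 0 := (subst_nonconst (nonconst_mob _) hx).ne_zero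
  have h2 := ord_der_coe hx' (by rw [h1]; exact h)
  have hdx := der_ne_zero hx
  have hdx' : subst (mob glInv) (der x) ≠ 0 := by
    rw [← substHom_apply (nonconst_mob _), map_ne_zero]; exact hdx
  have hd := (map_ne_zero (C : ℂ →+* RatFunc ℂ)).mpr (gl_det_ne_zero glInv)
  rw [der_subst (nonconst_mob _), ord_mul hdx' (der_mob_ne_zero _), ord_subst_mob _ hdx,
    glInv_smul_zero, der_mob, ord_div hd (pow_ne_zero 2 (mobDen_ne_zero _)), ord_C, ord_pow,
    h1] at h2
  have h3 := ord_mobDen glInv ((0 : ℂ) : OnePoint ℂ)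
  rw [glInv_smul_zero] at h3
  simp at h3
  rw [h3] at h2
  push_cast at h2
  linarith

/-- The contribution of the Schwarzian derivative. -/
lemma localForm_schwarzian {x : RatFunc ℂ} (hx : Nonconst x) (a : ℂ) :
    ∃ h v, HasVal h a v ∧ dlog (der x) = C (ord (der x) a : ℂ) / (X - C a) + h ∧
      LocalForm (-(1 / 2 * (der (dlog (der x)) - 1 / 2 * dlog (der x) ^ 2))) a
        ((ord (der x) a : ℂ) * (ord (der x) a + 2) / 4) (ord (der x) a / 2 * v) := by
  obtain ⟨h, v, hv, e⟩ := exists_dlog_eq (der_ne_zero hx) a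
  refine ⟨h, v, hv, e, ?_⟩
  have h0 := X_sub_C_ne_zero a
  obtain ⟨w, hw⟩ := hv.der
  set j : ℂ := (ord (der x) a : ℂ)
  obtain ⟨g, u, hg, eg⟩ := HasVal.exists_factor ((hv.sub (hasVal_C v a)).congr (sub_self v))
  refine ⟨C (j / 2) * g - 1 / 2 * der h + 1 / 4 * h ^ 2, _,
    (((hasVal_C _ a).mul hg).sub (((hasVal_one a).div (hasVal_ofNat 2 a) two_ne_zero).mul hw)).add
      (((hasVal_one a).div (hasVal_ofNat 4 a) (by norm_num)).mul (hv.pow 2)), ?_⟩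
  have eg' : g = (h - C v) / (X - C a) := by rw [eg]; field_simp
  rw [e, der_add, der_div _ _ h0, der_C, der_X_sub_C, eg']
  simp only [map_mul, map_add, map_div₀, map_ofNat]
  field_simp
  ring

lemma LocalForm.add {V V' : RatFunc ℂ} {a l b l' b' : ℂ} (h : LocalForm V a l b)
    (h' : LocalForm V' a l' b') : LocalForm (V + V') a (l + l') (b + b') := by
  obtain ⟨r, v, hr, e⟩ := h
  obtain ⟨r', v', hr', e'⟩ := h'
  refine ⟨r + r', _, hr.add hr', ?_⟩
  rw [e, e', map_add, map_add]; ring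

section Local

variable {x Q : RatFunc ℂ} {A B m : ℂ}

/-- At a point where `x` is neither zero nor infinite only the ramification matters. -/
lemma localForm_of_ord_eq_zero (hx : Nonconst x)
    (hQ : subst x Q = C A + C B / x + C (m ^ 2 - 1 / 4) / x ^ 2) {a : ℂ} (h : ord x a = 0) :
    ∃ b, LocalForm (pullback x Q) a ((ord (der x) a : ℂ) * (ord (der x) a + 2) / 4) b := by
  obtain ⟨v, hv, hxv⟩ := hasVal_of_ord_zero hx.ne_zero h
  obtain ⟨w, hw⟩ := hxv.der
  obtain ⟨_, v', -, -, hS⟩ := localForm_schwarzian hx a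
  have h1 := (((((hasVal_C A a).add ((hasVal_C B a).div hxv hv)).add
    ((hasVal_C (m ^ 2 - 1 / 4) a).div (hxv.pow 2) (pow_ne_zero 2 hv))).mul (hw.pow 2))).localForm
  rw [← hQ] at h1
  have h2 := h1.add hS
  rw [← sub_eq_add_neg, ← pullback_eq_dlog, zero_add, zero_add] at h2
  exact ⟨_, h2⟩

/-- At a zero of `x` of order `μ` the exponent difference `2m` is multiplied by `μ`. If the
exponent difference becomes `1` at a simple zero, the singularity does not disappear as long as
`Q` contains the term `1/x`. -/
lemma localForm_of_ord_pos (hx : Nonconst x)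
    (hQ : subst x Q = C A + C B / x + C (m ^ 2 - 1 / 4) / x ^ 2) {a : ℂ} (h : 0 < ord x a) :
    ∃ b, LocalForm (pullback x Q) a ((4 * m ^ 2 * (ord x a : ℂ) ^ 2 - 1) / 4) b ∧
      (ord x a = 1 → 4 * m ^ 2 = 1 → B ≠ 0 → b ≠ 0) := by
  obtain ⟨u, v, hv, hu, e⟩ := exists_unit_factor hx.ne_zero a
  obtain ⟨n, hn⟩ : ∃ n : ℕ, ord x a = n + 1 :=
    ⟨(ord x a - 1).toNat, by omega⟩
  have h0 := X_sub_C_ne_zero a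
  have hu0 := hu.ne_zero hv
  have ex : x = (X - C a) ^ (n + 1) * u := by
    conv_lhs => rw [e, hn]
    norm_cast
  obtain ⟨w₁, hw₁⟩ := hu.der
  obtain ⟨w₂, hw₂⟩ := hw₁.der
  have hz := (hasVal_X_sub_C a a).congr (sub_self a)
  -- `x' = (X - a)ⁿ w`
  obtain ⟨w, hwdef⟩ : ∃ w, w = (n + 1 : ℂ) • u + (X - C a) * der u := ⟨_, rfl⟩
  rw [RatFunc.smul_eq_C_mul] at hwdef
  have hn1 : (n + 1 : ℂ) ≠ 0 := by exact_mod_cast n.succ_ne_zero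
  have hw : HasVal w a ((n + 1) * v) := by
    rw [hwdef]; exact (((hasVal_C _ a).mul hu).add (hz.mul hw₁)).congr (by ring)
  have hw0 := hw.ne_zero (mul_ne_zero hn1 hv)
  have hdx : der x = (X - C a) ^ n * w := by
    rw [ex, der_mul, der_pow, der_X_sub_C, hwdef, Nat.add_sub_cancel, map_add, map_natCast,
      map_one]
    push_cast; ring
  have hdw : HasVal (der w) a ((n + 2) * w₁) := by
    rw [hwdef, der_add, der_C_mul, der_mul, der_X_sub_C]
    exact (((hasVal_C _ a).mul hw₁).add (((hasVal_one a).mul hw₁).add (hz.mul hw₂))).congr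
      (by ring)
  have hord : ord (der x) a = n := by rw [ord_der_coe hx.ne_zero (by omega), hn]; ring
  obtain ⟨h', v', hv', e', hS⟩ := localForm_schwarzian hx a
  have hh' : h' = dlog w := by
    rw [hord, hdx, dlog_mul (pow_ne_zero n h0) hw0, dlog_pow, dlog_X_sub_C] at e'
    have : C ((n : ℤ) : ℂ) = (n : RatFunc ℂ) := by rw [Int.cast_natCast, map_natCast]
    rw [this] at e'
    linear_combination -e'
  have hv'' : v' = (n + 2) * w₁ / ((n + 1) * v) := by
    rw [hh'] at hv'
    exact hv'.unique (hdw.div hw (mul_ne_zero hn1 hv))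
  rw [hord] at hS
  -- the term `(m² - 1/4) (x'/x)²`
  have hT : LocalForm (C (m ^ 2 - 1 / 4) * dlog x ^ 2) a ((m ^ 2 - 1 / 4) * (n + 1) ^ 2)
      (2 * (m ^ 2 - 1 / 4) * (n + 1) * (w₁ / v)) := by
    have hd : dlog x = C (n + 1 : ℂ) / (X - C a) + dlog u := by
      rw [ex, dlog_mul (pow_ne_zero _ h0) hu0, dlog_pow, dlog_X_sub_C]
      simp only [map_add, map_natCast, map_one]; push_cast; ring
    have hg0 : HasVal (dlog u) a (w₁ / v) := hw₁.div hu hv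
    obtain ⟨g, y, hg, eg⟩ := HasVal.exists_factor
      ((hg0.sub (hasVal_C (w₁ / v) a)).congr (sub_self _))
    refine ⟨C (m ^ 2 - 1 / 4) * (2 * C (n + 1 : ℂ) * g + dlog u ^ 2), _, (hasVal_C _ a).mul
      (((((hasVal_ofNat 2 a)).mul (hasVal_C _ a)).mul hg).add (hg0.pow 2)), ?_⟩
    have eg' : g = (dlog u - C (w₁ / v)) / (X - C a) := by rw [eg]; field_simp
    rw [hd, eg']
    simp only [map_mul, map_pow, map_ofNat]
    field_simp
    ring
  -- the other terms
  have hR : LocalForm ((C A + C B / x) * der x ^ 2) a 0 (if n = 0 then B * v else 0) := by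
    rw [hdx, ex]
    rcases n with _ | n
    · have hq := (hw.pow 2).div hu hv
      obtain ⟨g, y, hg, eg⟩ := HasVal.exists_factor ((hq.sub (hasVal_C v a)).congr
        (by field_simp; push_cast; ring))
      refine ⟨C A * w ^ 2 + C B * g, _, ((hasVal_C A a).mul (hw.pow 2)).add
        ((hasVal_C B a).mul hg), ?_⟩
      have eg' : g = (w ^ 2 / u - C v) / (X - C a) := by rw [eg]; field_simp
      rw [eg']
      simp only [map_zero, zero_div, zero_add, if_true, map_mul, pow_zero, one_mul, pow_one]
      field_simp
      ring
    · refine ⟨C A * ((X - C a) ^ (n + 1) * w) ^ 2 + C B * (X - C a) ^ n * w ^ 2 / u, _,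
        ((hasVal_C A a).mul (((hz.pow _).mul hw).pow 2)).add
          ((((hasVal_C B a).mul (hz.pow n)).mul (hw.pow 2)).div hu hv), ?_⟩
      simp only [map_zero, zero_div, zero_add, if_neg (Nat.succ_ne_zero n)]
      field_simp
      ring
  have hfin := (hR.add hT).add hS
  have eV : (C A + C B / x) * der x ^ 2 + C (m ^ 2 - 1 / 4) * dlog x ^ 2 +
      -(1 / 2 * (der (dlog (der x)) - 1 / 2 * dlog (der x) ^ 2)) = pullback x Q := by
    rw [pullback_eq_dlog, hQ]
    have hx0 := hx.ne_zero
    have : dlog x = der x / x := rfl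
    rw [this]; field_simp; ring
  rw [eV] at hfin
  have e1 : (0 : ℂ) + (m ^ 2 - 1 / 4) * (n + 1) ^ 2 + (((n : ℤ) : ℂ) * (((n : ℤ) : ℂ) + 2) / 4) =
      (4 * m ^ 2 * (ord x a : ℂ) ^ 2 - 1) / 4 := by
    rw [hn]; push_cast; ring
  rw [e1] at hfin
  refine ⟨_, hfin, fun h1 h2 h3 => ?_⟩
  have hn0 : n = 0 := by omega
  have hb : B * v ≠ 0 := mul_ne_zero h3 hv
  rw [if_pos hn0]
  subst hn0
  intro hc
  refine hb (Eq.trans ?_ hc)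
  push_cast
  linear_combination (-w₁ / v / 2) * h2

end Local

/-- The common form of the potentials of the Whittaker equation (`A = 1/4`, `B = -k`) and of the
degenerate Whittaker equation (`A = 0`, `B = 1`). -/
def genPot (A B m : ℂ) : RatFunc ℂ := C A + C B / X + C (m ^ 2 - 1 / 4) / X ^ 2

lemma subst_genPot {x : RatFunc ℂ} (hx : Nonconst x) (A B m : ℂ) :
    subst x (genPot A B m) = C A + C B / x + C (m ^ 2 - 1 / 4) / x ^ 2 := by
  rw [← substHom_apply hx, genPot]
  simp only [map_add, map_div₀, map_pow, substHom_C, substHom_X]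

lemma W_eq_genPot (k m : ℂ) : W k m = genPot (1 / 4) (-k) m := by
  rw [W, genPot, map_neg, map_div₀, map_one, map_ofNat]; ring

lemma DW_eq_genPot (m : ℂ) : DW m = genPot 0 1 m := by
  rw [DW, genPot, map_zero, map_one, zero_add]

section Pole

variable {x : RatFunc ℂ} {A B m : ℂ}

lemma poleOrder_of_ord_neg_coe (hx : Nonconst x) {a : ℂ} {n : ℕ} (hn : ord x a = -(n + 1)) :
    (A ≠ 0 → poleOrder (pullback x (genPot A B m)) a = 2 * (n + 1) + 2) ∧
    (A = 0 → B ≠ 0 → poleOrder (pullback x (genPot A B m)) a = n + 1 + 2) := by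
  obtain ⟨u, v, hv, hu, e⟩ := exists_unit_factor hx.ne_zero a
  have h0 := X_sub_C_ne_zero a
  have hu0 := hu.ne_zero hv
  have ex : x = u / (X - C a) ^ (n + 1) := by
    conv_lhs => rw [e, hn]
    rw [zpow_neg]; norm_cast; field_simp
  obtain ⟨w₁, hw₁⟩ := hu.der
  have hz := (hasVal_X_sub_C a a).congr (sub_self a)
  obtain ⟨w, hwdef⟩ : ∃ w, w = (X - C a) * der u - C (n + 1 : ℂ) * u := ⟨_, rfl⟩
  have hn1 : (n + 1 : ℂ) ≠ 0 := by exact_mod_cast n.succ_ne_zero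
  have hw : HasVal w a (-((n + 1) * v)) := by
    rw [hwdef]; exact ((hz.mul hw₁).sub ((hasVal_C _ a).mul hu)).congr (by ring)
  have hw0 : -((n + 1) * v) ≠ 0 := neg_ne_zero.mpr (mul_ne_zero hn1 hv)
  have hdx : der x = w / (X - C a) ^ (n + 2) := by
    rw [ex, der_div _ _ (pow_ne_zero _ h0), der_pow, der_X_sub_C, hwdef, Nat.add_sub_cancel,
      map_add, map_natCast, map_one]
    push_cast
    field_simp
    ring
  obtain ⟨_, _, -, -, hS⟩ := localForm_schwarzian hx a
  have hS2 := hS.hasVal_sq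
  obtain ⟨σ, hσ⟩ : ∃ σ, σ = -(1 / 2 * (der (dlog (der x)) - 1 / 2 * dlog (der x) ^ 2)) :=
    ⟨_, rfl⟩
  rw [← hσ] at hS2
  have hV : pullback x (genPot A B m) =
      (C A + C B / x + C (m ^ 2 - 1 / 4) / x ^ 2) * der x ^ 2 + σ := by
    rw [pullback_eq_dlog, subst_genPot hx, hσ]; ring
  -- the contributions of `1/x²` and of the Schwarzian derivative have poles of order at most two
  have hc := (((hasVal_C (m ^ 2 - 1 / 4) a).mul ((hw.div hu hv).pow 2)).add hS2)
  rw [hV, hdx, ex]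
  constructor
  · intro hA
    refine poleOrder_of_hasVal (v := A * (-((n + 1) * v)) ^ 2) _ ?_
      (mul_ne_zero hA (pow_ne_zero 2 hw0))
    have h1 := (((hasVal_C A a).mul (hw.pow 2)).add
      (((hasVal_C B a).mul (hz.pow (n + 1))).mul ((hw.pow 2).div hu hv))).add
        ((hz.pow (2 * (n + 1))).mul hc)
    convert h1 using 1
    · have e2 : (X - C a) ^ (2 * (n + 1) + 2) = ((X - C a) ^ n) ^ 2 * (X - C a) ^ 4 := by ring
      have e3 : (X - C a) ^ (n + 1) = (X - C a) ^ n * (X - C a) := by ring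
      have e4 : (X - C a) ^ (n + 2) = (X - C a) ^ n * (X - C a) ^ 2 := by ring
      have e5 : (X - C a) ^ (2 * (n + 1)) = ((X - C a) ^ n) ^ 2 * (X - C a) ^ 2 := by ring
      rw [e2, e3, e4, e5]
      have h5 : (X - C a) ^ n ≠ 0 := pow_ne_zero n h0
      clear * - h0 h5 hu0
      generalize (X - C a) ^ n = y at *
      generalize X - C a = z at *
      field_simp
      ring
    · simp
  · rintro rfl hB
    refine poleOrder_of_hasVal (v := B * ((-((n + 1) * v)) ^ 2 / v)) _ ?_
      (mul_ne_zero hB (div_ne_zero (pow_ne_zero 2 hw0) hv))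
    have h1 := ((hasVal_C B a).mul ((hw.pow 2).div hu hv)).add ((hz.pow (n + 1)).mul hc)
    convert h1 using 1
    · have e2 : (X - C a) ^ (n + 1 + 2) = (X - C a) ^ n * (X - C a) ^ 3 := by ring
      have e3 : (X - C a) ^ (n + 1) = (X - C a) ^ n * (X - C a) := by ring
      have e4 : (X - C a) ^ (n + 2) = (X - C a) ^ n * (X - C a) ^ 2 := by ring
      rw [e2, e3, e4, map_zero, zero_add]
      have h5 : (X - C a) ^ n ≠ 0 := pow_ne_zero n h0
      clear * - h0 h5 hu0
      generalize (X - C a) ^ n = y at *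
      generalize X - C a = z at *
      field_simp
      ring
    · simp

lemma exists_mob_smul_zero (c : OnePoint ℂ) :
    ∃ g : GL (Fin 2) ℂ, g • ((0 : ℂ) : OnePoint ℂ) = c := by
  obtain ⟨c', hc'⟩ : ∃ c' : OnePoint ℂ, c' ≠ c := exists_ne c
  obtain ⟨g, -, h⟩ := exists_mob_smul hc'
  exact ⟨g, h⟩

lemma poleOrder_of_ord_neg (hx : Nonconst x) {c : OnePoint ℂ} (h : ord x c < 0) :
    (A ≠ 0 → poleOrder (pullback x (genPot A B m)) c = 2 * (-ord x c).toNat + 2) ∧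
    (A = 0 → B ≠ 0 → poleOrder (pullback x (genPot A B m)) c = (-ord x c).toNat + 2) := by
  obtain ⟨g, rfl⟩ := exists_mob_smul_zero c
  have hg := nonconst_mob g
  rw [← poleOrder_pullback_mob, pullback_pullback hg hx]
  rw [← ord_subst_mob g hx.ne_zero] at h ⊢
  obtain ⟨n, hn⟩ : ∃ n : ℕ, ord (subst (mob g) x) ((0 : ℂ) : OnePoint ℂ) = -(n + 1) :=
    ⟨(-ord (subst (mob g) x) ((0 : ℂ) : OnePoint ℂ) - 1).toNat, by omega⟩
  have := poleOrder_of_ord_neg_coe (A := A) (B := B) (m := m) (subst_nonconst hg hx) hn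
  have e : (-ord (subst (mob g) x) ((0 : ℂ) : OnePoint ℂ)).toNat = n + 1 := by omega
  rw [e]; exact this

lemma poleOrder_le_two_of_ord_nonneg (hx : Nonconst x) {c : OnePoint ℂ} (h : 0 ≤ ord x c) :
    poleOrder (pullback x (genPot A B m)) c ≤ 2 := by
  obtain ⟨g, rfl⟩ := exists_mob_smul_zero c
  have hg := nonconst_mob g
  rw [← poleOrder_pullback_mob, pullback_pullback hg hx]
  rw [← ord_subst_mob g hx.ne_zero] at h
  have hx' := subst_nonconst hg hx
  rcases h.eq_or_lt with h | h
  · obtain ⟨b, hb⟩ := localForm_of_ord_eq_zero hx' (subst_genPot hx' A B m) h.symm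
    exact hb.poleOrder_le
  · obtain ⟨b, hb, -⟩ := localForm_of_ord_pos hx' (subst_genPot hx' A B m) h
    exact hb.poleOrder_le

/-- The irregular singular points of the transformed equation are the poles of `x`, and their
Poincaré ranks are determined by the multiplicities. -/
lemma poleType_map (hx : Nonconst x) {f : ℕ → ℕ}
    (hf : (A ≠ 0 ∧ f = fun n => 2 * n + 2) ∨ (A = 0 ∧ B ≠ 0 ∧ f = fun n => n + 2))
    {I : Finset (OnePoint ℂ)}
    (hI : ∀ c, c ∈ I ↔ 2 < poleOrder (pullback x (genPot A B m)) c) :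
    (∀ c, c ∈ I ↔ ord x c < 0) ∧
    (poleType x).map f = I.val.map (poleOrder (pullback x (genPot A B m))) := by
  have key : ∀ c, ord x c < 0 →
      poleOrder (pullback x (genPot A B m)) c = f (-ord x c).toNat := by
    intro c hc
    rcases hf with ⟨h1, rfl⟩ | ⟨h1, h2, rfl⟩
    · exact (poleOrder_of_ord_neg hx hc).1 h1
    · exact (poleOrder_of_ord_neg hx hc).2 h1 h2
  have hf' : ∀ n, 0 < n → 2 < f n := by
    intro n hn
    rcases hf with ⟨h1, rfl⟩ | ⟨h1, h2, rfl⟩ <;> simp only <;> omega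
  have hI' : ∀ c, c ∈ I ↔ ord x c < 0 := by
    intro c
    rw [hI]
    constructor
    · intro h
      by_contra hc
      exact absurd (poleOrder_le_two_of_ord_nonneg (A := A) (B := B) (m := m) hx (not_lt.mp hc))
        (by omega)
    · intro h
      rw [key c h]
      exact hf' _ (by omega)
  refine ⟨hI', ?_⟩
  rw [poleType_eq hI', Multiset.map_map]
  refine Multiset.map_congr rfl fun c hc => ?_
  exact (key c ((hI' c).mp hc)).symm

end Pole

/-! ### The Riemann–Hurwitz formula -/

lemma sum_rootMultiplicity {p : Polynomial ℂ} {D : Finset ℂ}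
    (hD : ∀ a, p.rootMultiplicity a ≠ 0 → a ∈ D) :
    ∑ a ∈ D, p.rootMultiplicity a = p.natDegree := by
  rw [IsAlgClosed.card_roots_eq_natDegree.symm, ← Multiset.sum_count_eq_card (s := D)]
  · simp only [Polynomial.count_roots]
  · intro a ha
    exact hD a (by rw [← Polynomial.count_roots]; exact (Multiset.count_pos.mpr ha).ne')

lemma sum_ord {f : RatFunc ℂ} {D : Finset ℂ} (hD : ∀ a : ℂ, ord f a ≠ 0 → a ∈ D) :
    ∑ a ∈ D, ord f a = -ord f OnePoint.infty := by
  have h1 : ∀ a, f.num.rootMultiplicity a ≠ 0 → a ∈ D := by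
    intro a ha
    rw [num_rootMultiplicity] at ha
    exact hD a (by omega)
  have h2 : ∀ a, f.denom.rootMultiplicity a ≠ 0 → a ∈ D := by
    intro a ha
    rw [denom_rootMultiplicity] at ha
    exact hD a (by omega)
  simp only [ord_coe, Finset.sum_sub_distrib]
  rw [ord_infty, neg_neg, RatFunc.intDegree, ← sum_rootMultiplicity h1,
    ← sum_rootMultiplicity h2]
  push_cast; rfl

/-- A finite set of points of `ℂ` outside of which `f` has order zero. -/
lemma exists_support (f : RatFunc ℂ) : ∃ D : Finset ℂ, ∀ a : ℂ, ord f a ≠ 0 → a ∈ D := by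
  classical
  refine ⟨f.num.roots.toFinset ∪ f.denom.roots.toFinset, fun a ha => ?_⟩
  rw [ord_coe, ← Polynomial.count_roots, ← Polynomial.count_roots] at ha
  simp only [Finset.mem_union, Multiset.mem_toFinset]
  by_contra! h
  rw [Multiset.count_eq_zero_of_notMem h.1, Multiset.count_eq_zero_of_notMem h.2] at ha
  exact ha rfl

/-- The Riemann–Hurwitz formula for a cover with a pole at `∞`: the ramification outside the
fibres over `0` and `∞` is determined by the number of points in these fibres. -/
lemma riemann_hurwitz {x : RatFunc ℂ} (hx : Nonconst x) (hinf : ord x OnePoint.infty < 0) :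
    ∃ O : Finset ℂ, (∀ a, a ∈ O ↔ ord x a = 0 ∧ 0 < ord (der x) a) ∧
      ∑ a ∈ O, ord (der x) a = (zeroType x).card + (poleType x).card - 2 := by
  classical
  obtain ⟨D₁, hD₁⟩ := exists_support x
  obtain ⟨D₂, hD₂⟩ := exists_support (der x)
  obtain ⟨S, hS⟩ := exists_zeroSet hx.ne_zero
  obtain ⟨T, hT⟩ := exists_poleSet hx.ne_zero
  have hcZ : (zeroType x).card = S.card := by rw [zeroType_eq hx.ne_zero hS, Multiset.card_map]; rfl
  have hcP : (poleType x).card = T.card := by rw [poleType_eq hT, Multiset.card_map]; rfl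
  set D := D₁ ∪ D₂
  have s1 := sum_ord (D := D) fun a ha => Finset.mem_union_left _ (hD₁ a ha)
  have s2 := sum_ord (D := D) fun a ha => Finset.mem_union_right _ (hD₂ a ha)
  rw [ord_der_infty hx hinf.ne] at s2
  -- the finite points of the fibres
  have cZ : (D.filter fun a : ℂ => 0 < ord x a).card = S.card := by
    have : (D.filter fun a : ℂ => 0 < ord x a).map ptEmb = S := by
      ext c
      simp only [Finset.mem_map, Finset.mem_filter, hS]
      constructor
      · rintro ⟨a, ⟨-, ha⟩, rfl⟩; exact ha
      · intro hc
        induction c using OnePoint.rec with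
        | infty => exact absurd hc (by omega)
        | coe a => exact ⟨a, ⟨Finset.mem_union_left _ (hD₁ a hc.ne'), hc⟩, rfl⟩
    rw [← this, Finset.card_map]
  have cP : (D.filter fun a : ℂ => ord x a < 0).card + 1 = T.card := by
    have : insert OnePoint.infty ((D.filter fun a : ℂ => ord x a < 0).map ptEmb) = T := by
      ext c
      simp only [Finset.mem_insert, Finset.mem_map, Finset.mem_filter, hT]
      constructor
      · rintro (rfl | ⟨a, ⟨-, ha⟩, rfl⟩)
        · exact hinf
        · exact ha
      · intro hc
        induction c using OnePoint.rec with
        | infty => exact Or.inl rfl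
        | coe a => exact Or.inr ⟨a, ⟨Finset.mem_union_left _ (hD₁ a hc.ne), hc⟩, rfl⟩
    rw [← this, Finset.card_insert_of_notMem, Finset.card_map]
    simp [ptEmb]
  refine ⟨D.filter fun a : ℂ => ord x a = 0 ∧ 0 < ord (der x) a, fun a => ?_, ?_⟩
  · rw [Finset.mem_filter, and_iff_right_iff_imp]
    exact fun h => Finset.mem_union_right _ (hD₂ a h.2.ne')
  · have h3 : ∀ a : ℂ, ord (der x) a = ord x a - (if 0 < ord x a then 1 else 0)
        - (if ord x a < 0 then 1 else 0) +
        (if ord x a = 0 ∧ 0 < ord (der x) a then ord (der x) a else 0) := by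
      intro a
      rcases lt_trichotomy (ord x a) 0 with h | h | h
      · rw [ord_der_coe hx.ne_zero h.ne, if_neg h.le.not_gt, if_pos h, if_neg (by omega)]; ring
      · have h0 := ord_der_nonneg h.ge
        rw [h]
        simp only [lt_irrefl, if_false, true_and]
        split_ifs with h4 <;> omega
      · rw [ord_der_coe hx.ne_zero h.ne', if_pos h, if_neg h.le.not_gt, if_neg (by omega)]; ring
    rw [Finset.sum_filter]
    rw [Finset.sum_congr rfl fun a _ => h3 a, Finset.sum_add_distrib, Finset.sum_sub_distrib,
      Finset.sum_sub_distrib, s1, ← Finset.sum_filter (s := D), ← Finset.sum_filter (s := D),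
      Finset.sum_const, Finset.sum_const, cZ] at s2
    rw [hcZ, hcP]
    simp only [nsmul_eq_mul, mul_one] at s2
    push_cast [← cP] at *
    linarith

/-! ### Ramification forced by a target with few singular points -/

section Ramification

variable {x : RatFunc ℂ} {A B m : ℂ}

/-- The exponents at a zero of `x`, with the order as a natural number. -/
lemma localForm_zero (hx : Nonconst x) {a : ℂ} (h : 0 < ord x a) :
    ∃ b, LocalForm (pullback x (genPot A B m)) a
      ((4 * m ^ 2 * ((ord x a).toNat : ℂ) ^ 2 - 1) / 4) b ∧
      ((ord x a).toNat = 1 → 4 * m ^ 2 = 1 → B ≠ 0 → b ≠ 0) := by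
  obtain ⟨b, hb, hb'⟩ := localForm_of_ord_pos hx (subst_genPot hx A B m) h
  have e : (ord x a : ℂ) = ((ord x a).toNat : ℂ) := by
    rw [← Int.cast_natCast, Int.toNat_of_nonneg h.le]
  rw [e] at hb
  exact ⟨b, hb, fun h1 => hb' (by omega)⟩

lemma zero_ne_infty (hinf : ord x OnePoint.infty < 0) {c : OnePoint ℂ} (hc : 0 < ord x c) :
    ∃ a : ℂ, c = a := by
  induction c using OnePoint.rec with
  | infty => omega
  | coe a => exact ⟨a, rfl⟩

/-- If outside the irregular singular points there is at most one singular point, and it has the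
exponents of an apparent singularity or those of a regular point up to a logarithm, then there are
at most three points in the fibres over `0` and `∞`. -/
lemma ramification_of_apparent (hx : Nonconst x) (hinf : ord x OnePoint.infty < 0) {q : ℂ}
    (hV : ∀ a : ℂ, poleOrder (pullback x (genPot A B m)) a ≤ 2 → ∃ l b,
      LocalForm (pullback x (genPot A B m)) a l b ∧ (l = 0 ∨ l = 3 / 4) ∧ (a ≠ q → l = 0)) :
    (zeroType x).card + (poleType x).card ≤ 3 ∧
    ((zeroType x).card + (poleType x).card = 3 → ∀ μ ∈ zeroType x, 4 * m ^ 2 * (μ : ℂ) ^ 2 = 1) ∧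
    (∀ μ ∈ zeroType x, 4 * m ^ 2 * (μ : ℂ) ^ 2 = 1 ∨ 4 * m ^ 2 * (μ : ℂ) ^ 2 = 4) := by
  obtain ⟨O, hO, hsum⟩ := riemann_hurwitz hx hinf
  -- a ramified point outside of the two fibres has to be `q`, and it is a simple branch point
  have hOq : ∀ a ∈ O, a = q ∧ ord (der x) a = 1 := by
    intro a ha
    obtain ⟨h0, hj⟩ := (hO a).mp ha
    obtain ⟨b, hb⟩ := localForm_of_ord_eq_zero hx (subst_genPot hx A B m) h0
    obtain ⟨l, b', hl, hl1, hl2⟩ := hV a hb.poleOrder_le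
    have e := (hb.unique hl).1
    obtain ⟨j, hj'⟩ : ∃ j : ℕ, ord (der x) a = j + 1 := ⟨(ord (der x) a - 1).toNat, by omega⟩
    rw [hj'] at e
    push_cast at e
    have hl0 : l ≠ 0 := by
      rw [← e]
      have : (((j + 1) * (j + 3) : ℕ) : ℂ) ≠ 0 := by norm_cast
      intro h
      apply this
      push_cast
      linear_combination 4 * h
    refine ⟨not_not.mp fun h => hl0 (hl2 h), ?_⟩
    rw [hl1.resolve_left hl0] at e
    have e3 : (((j + 1) * (j + 3) : ℕ) : ℂ) = ((3 : ℕ) : ℂ) := by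
      push_cast; linear_combination 4 * e
    have e4 : (j + 1) * (j + 3) = 3 := by exact_mod_cast e3
    have : j = 0 := by nlinarith
    omega
  have hOsub : O ⊆ {q} := fun a ha => Finset.mem_singleton.mpr (hOq a ha).1
  have hOcard : ∑ a ∈ O, ord (der x) a = O.card := by
    rw [Finset.sum_congr rfl fun a ha => (hOq a ha).2]; simp
  have hO1 : O.card ≤ 1 := by simpa using Finset.card_le_card hOsub
  have hzero : ∀ μ ∈ zeroType x, ∃ (a : ℂ) (l : ℂ), 0 < ord x a ∧
      (4 * m ^ 2 * (μ : ℂ) ^ 2 - 1) / 4 = l ∧ (l = 0 ∨ l = 3 / 4) ∧ (a ≠ q → l = 0) := by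
    obtain ⟨S, hS⟩ := exists_zeroSet hx.ne_zero
    intro μ hμ
    rw [zeroType_eq hx.ne_zero hS, Multiset.mem_map] at hμ
    obtain ⟨c, hc, rfl⟩ := hμ
    have hc' := (hS c).mp hc
    obtain ⟨a, rfl⟩ := zero_ne_infty hinf hc'
    obtain ⟨b, hb, -⟩ := localForm_zero (A := A) (B := B) (m := m) hx hc'
    obtain ⟨l, b', hl, hl1, hl2⟩ := hV a hb.poleOrder_le
    exact ⟨a, l, hc', (hb.unique hl).1, hl1, hl2⟩
  refine ⟨by omega, fun h3 μ hμ => ?_, fun μ hμ => ?_⟩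
  · obtain ⟨a, l, ha, e, -, hl⟩ := hzero μ hμ
    have hO1' : 0 < O.card := by omega
    obtain ⟨o, ho⟩ := Finset.card_pos.mp hO1'
    have haq : a ≠ q := by
      rintro rfl
      have := ((hO o).mp ho).1
      rw [(hOq o ho).1] at this
      omega
    rw [hl haq] at e
    linear_combination 4 * e
  · obtain ⟨a, l, -, e, hl, -⟩ := hzero μ hμ
    rcases hl with rfl | rfl
    · left; linear_combination 4 * e
    · right; linear_combination 4 * e

/-- If outside the irregular singular points there are at most two singular points, then one of
them is used up by the ramification as soon as there are three points in the fibres over `0` and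
`∞`, so that all zeros of `x` but one become regular points. -/
lemma ramification_of_two_singular (hx : Nonconst x) (hinf : ord x OnePoint.infty < 0) {q q' : ℂ}
    (hV : ∀ a : ℂ, a ≠ q → a ≠ q' → poleOrder (pullback x (genPot A B m)) a ≤ 2 →
      LocalForm (pullback x (genPot A B m)) a 0 0)
    (h3 : 3 ≤ (zeroType x).card + (poleType x).card) :
    ∃ μ₀ rest, zeroType x = μ₀ ::ₘ rest ∧
      ∀ μ ∈ rest, 4 * m ^ 2 * (μ : ℂ) ^ 2 = 1 ∧ (μ = 1 → B = 0) := by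
  classical
  obtain ⟨O, hO, hsum⟩ := riemann_hurwitz hx hinf
  have hne : O.Nonempty := by
    by_contra h
    rw [Finset.not_nonempty_iff_eq_empty.mp h, Finset.sum_empty] at hsum
    omega
  obtain ⟨o, ho⟩ := hne
  obtain ⟨ho0, hoj⟩ := (hO o).mp ho
  -- a point with ramification outside of the two fibres is singular
  have hoq : o = q ∨ o = q' := by
    by_contra! h
    obtain ⟨b, hb⟩ := localForm_of_ord_eq_zero hx (subst_genPot hx A B m) ho0
    have e := (hb.unique (hV o h.1 h.2 hb.poleOrder_le)).1
    obtain ⟨j, hj'⟩ : ∃ j : ℕ, ord (der x) o = j + 1 := ⟨(ord (der x) o - 1).toNat, by omega⟩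
    rw [hj'] at e
    push_cast at e
    have : (((j + 1) * (j + 3) : ℕ) : ℂ) ≠ 0 := by norm_cast
    apply this
    push_cast
    linear_combination 4 * e
  obtain ⟨c, hc⟩ : ∃ c : ℂ, ∀ a, a ≠ c → 0 < ord x a → a ≠ q ∧ a ≠ q' := by
    rcases hoq with rfl | rfl
    · exact ⟨q', fun a h1 h2 => ⟨by rintro rfl; omega, h1⟩⟩
    · exact ⟨q, fun a h1 h2 => ⟨h1, by rintro rfl; omega⟩⟩
  obtain ⟨S, hS⟩ := exists_zeroSet hx.ne_zero
  have hreg : ∀ p ∈ S, p ≠ (c : OnePoint ℂ) →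
      4 * m ^ 2 * ((ord x p).toNat : ℂ) ^ 2 = 1 ∧ ((ord x p).toNat = 1 → B = 0) := by
    intro p hp hpc
    have hp' := (hS p).mp hp
    obtain ⟨a, rfl⟩ := zero_ne_infty hinf hp'
    obtain ⟨b, hb, hb'⟩ := localForm_zero (A := A) (B := B) (m := m) hx hp'
    have hac := hc a (fun h => hpc (by rw [h])) hp'
    obtain ⟨e1, e2⟩ := hb.unique (hV a hac.1 hac.2 hb.poleOrder_le)
    have e3 : 4 * m ^ 2 * ((ord x a).toNat : ℂ) ^ 2 = 1 := by linear_combination 4 * e1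
    refine ⟨e3, fun h1 => ?_⟩
    by_contra hB
    refine hb' h1 ?_ hB e2
    rw [h1] at e3
    simpa using e3
  have hS0 : S.Nonempty := by
    by_contra h
    have h0 := zeroType_eq hx.ne_zero hS
    rw [Finset.not_nonempty_iff_eq_empty.mp h] at h0
    have h1 := zeroType_sum x
    rw [← poleType_sum, h0] at h1
    obtain ⟨T, hT⟩ := exists_poleSet hx.ne_zero
    rw [poleType_eq hT] at h1
    have h2 := Finset.sum_pos' (s := T) (f := fun c => (-ord x c).toNat) (fun _ _ => Nat.zero_le _)
      ⟨OnePoint.infty, (hT _).mpr hinf, by omega⟩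
    change _ = T.sum _ at h1
    simp at h1
    omega
  rw [zeroType_eq hx.ne_zero hS]
  obtain ⟨p₀, hp₀, hp₁⟩ : ∃ p₀ ∈ S, ∀ p ∈ S, p ≠ p₀ → p ≠ (c : OnePoint ℂ) := by
    by_cases h : (c : OnePoint ℂ) ∈ S
    · exact ⟨c, h, fun _ _ h => h⟩
    · obtain ⟨p, hp⟩ := hS0
      exact ⟨p, hp, fun p' hp' _ hc' => h (hc' ▸ hp')⟩
  refine ⟨(ord x p₀).toNat, (S.erase p₀).val.map fun c => (ord x c).toNat, ?_, ?_⟩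
  · rw [← Multiset.map_cons (fun c => (ord x c).toNat)]
    congr 1
    rw [Finset.erase_val, Multiset.cons_erase hp₀]
  · intro μ hμ
    obtain ⟨p, hp, rfl⟩ := Multiset.mem_map.mp hμ
    have hp' := Finset.mem_erase.mp hp
    exact hreg p hp'.2 (hp₁ p hp'.2 hp'.1)

end Ramification

/-! ### Values at infinity -/

/-- `f` is regular at `∞` and takes the value `v` there. -/
def HasValInf (f : RatFunc ℂ) (v : ℂ) : Prop := HasVal (subst (mob glInv) f) 0 v

section HasValInf

variable {f g : RatFunc ℂ} {v w : ℂ}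

lemma HasValInf.add (hf : HasValInf f v) (hg : HasValInf g w) : HasValInf (f + g) (v + w) := by
  rw [HasValInf, ← substHom_apply (nonconst_mob _), map_add]; exact HasVal.add hf hg

lemma HasValInf.sub (hf : HasValInf f v) (hg : HasValInf g w) : HasValInf (f - g) (v - w) := by
  rw [HasValInf, ← substHom_apply (nonconst_mob _), map_sub]; exact HasVal.sub hf hg

lemma HasValInf.mul (hf : HasValInf f v) (hg : HasValInf g w) : HasValInf (f * g) (v * w) := by
  rw [HasValInf, ← substHom_apply (nonconst_mob _), map_mul]; exact HasVal.mul hf hg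

lemma HasValInf.pow (hf : HasValInf f v) (n : ℕ) : HasValInf (f ^ n) (v ^ n) := by
  rw [HasValInf, ← substHom_apply (nonconst_mob _), map_pow]; exact HasVal.pow hf n

lemma hasValInf_C (c : ℂ) : HasValInf (C c) c := by
  rw [HasValInf, ← substHom_apply (nonconst_mob _), substHom_C]; exact hasVal_C c 0

lemma hasValInf_inv_X_sub_C (q : ℂ) : HasValInf (X - C q)⁻¹ 0 := by
  rw [HasValInf, ← substHom_apply (nonconst_mob _), map_inv₀, map_sub, substHom_C, substHom_X,
    mob_glInv]
  have h : HasVal (X / (1 - C q * X)) 0 (0 / (1 - q * 0)) :=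
    (hasVal_X 0).div ((hasVal_one 0).sub ((hasVal_C q 0).mul (hasVal_X 0))) (by simp)
  convert h using 1
  · have hX : (X : RatFunc ℂ) ≠ 0 := X_ne_zero
    have : (1 : RatFunc ℂ) / X - C q = (1 - C q * X) / X := by field_simp
    rw [this, inv_div]
  · simp

lemma hasValInf_inv_X : HasValInf (X : RatFunc ℂ)⁻¹ 0 := by
  simpa using hasValInf_inv_X_sub_C 0

lemma hasValInf_X_div (q : ℂ) : HasValInf (X / (X - C q)) 1 := by
  have h := (hasValInf_C 1).add ((hasValInf_C q).mul (hasValInf_inv_X_sub_C q))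
  have h0 := X_sub_C_ne_zero q
  convert h using 1
  · rw [map_one]; field_simp; ring
  · simp

lemma ord_infty_of_hasValInf (h : HasValInf f v) (hv : v ≠ 0) : ord f OnePoint.infty = 0 := by
  have h1 := ord_eq_zero_of_hasVal h hv
  have hf : f ≠ 0 := by
    rintro rfl
    rw [HasValInf, ← substHom_apply (nonconst_mob _), map_zero] at h
    exact hv (h.unique (hasVal_zero 0))
  rwa [ord_subst_mob _ hf, glInv_smul_zero] at h1

lemma ord_X_infty : ord X OnePoint.infty = -1 := by simpa using ord_X_sub_C_infty 0

lemma poleOrder_infty_of_hasValInf {V : RatFunc ℂ} (n : ℕ) (h : HasValInf (V / X ^ n) v)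
    (hv : v ≠ 0) : poleOrder V OnePoint.infty = n + 4 := by
  have h1 := ord_infty_of_hasValInf h hv
  have hX : (X : RatFunc ℂ) ^ n ≠ 0 := pow_ne_zero _ X_ne_zero
  have hV : V ≠ 0 := by
    rintro rfl
    rw [zero_div, HasValInf, ← substHom_apply (nonconst_mob _), map_zero] at h
    exact hv (h.unique (hasVal_zero 0))
  rw [ord_div hV hX, ord_pow, ord_X_infty] at h1
  rw [poleOrder_infty hV]
  omega

lemma poleOrder_infty_of_hasValInf_mul_X {V : RatFunc ℂ} (h : HasValInf (V * X) v)
    (hv : v ≠ 0) : poleOrder V OnePoint.infty = 3 := by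
  have h1 := ord_infty_of_hasValInf h hv
  have hV : V ≠ 0 := by
    rintro rfl
    rw [zero_mul, HasValInf, ← substHom_apply (nonconst_mob _), map_zero] at h
    exact hv (h.unique (hasVal_zero 0))
  rw [ord_mul hV X_ne_zero, ord_X_infty] at h1
  rw [poleOrder_infty hV]
  omega

lemma poleOrder_infty_le_two {V : RatFunc ℂ} (h : HasValInf (V * X ^ 2) v) :
    poleOrder V OnePoint.infty ≤ 2 := by
  by_cases hV : V = 0
  · rw [hV, poleOrder_zero]; omega
  have hX : (X : RatFunc ℂ) ^ 2 ≠ 0 := pow_ne_zero _ X_ne_zero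
  have hf : V * X ^ 2 ≠ 0 := mul_ne_zero hV hX
  have h1 := (poleOrder_coe _ 0).symm.trans (poleOrder_of_regular h)
  rw [ord_subst_mob _ hf, glInv_smul_zero, ord_mul hV hX, ord_pow, ord_X_infty] at h1
  rw [poleOrder_infty hV]
  omega

end HasValInf

/-! ### Singularities of the target equations -/

/-- Irregular of pole order `M` at `∞`; in `ℂ` at most one singular point, which has the leading
coefficient `3/4` of an apparent singularity. -/
def IrrInftyApparent (V : RatFunc ℂ) (M : ℕ) : Prop :=
  poleOrder V OnePoint.infty = M ∧ ∃ q : ℂ, ∀ a : ℂ, ∃ l b, LocalForm V a l b ∧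
    (l = 0 ∨ l = 3 / 4) ∧ (a ≠ q → l = 0)

/-- Irregular of pole order `M` at `∞`; in `ℂ` at most two singular points, which are regular
singularities. -/
def IrrInftyTwo (V : RatFunc ℂ) (M : ℕ) : Prop :=
  poleOrder V OnePoint.infty = M ∧ (∀ a : ℂ, poleOrder V a ≤ 2) ∧
    ∃ q q' : ℂ, ∀ a, a ≠ q → a ≠ q' → LocalForm V a 0 0

/-- Irregular of pole orders `M`, `N` at `∞`, `0`; elsewhere at most one singular point, which has
the leading coefficient `3/4` of an apparent singularity. -/
def IrrInftyZero (V : RatFunc ℂ) (M N : ℕ) : Prop :=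
  poleOrder V OnePoint.infty = M ∧ poleOrder V ((0 : ℂ) : OnePoint ℂ) = N ∧
    ∃ q : ℂ, ∀ a : ℂ, a ≠ 0 → ∃ l b, LocalForm V a l b ∧ (l = 0 ∨ l = 3 / 4) ∧ (a ≠ q → l = 0)

/-- Irregular only at the point `1`, of pole order `M`. -/
def IrrOne (V : RatFunc ℂ) (M : ℕ) : Prop :=
  poleOrder V ((1 : ℂ) : OnePoint ℂ) = M ∧ ∀ c, c ≠ ((1 : ℂ) : OnePoint ℂ) → poleOrder V c ≤ 2

/-- A potential with the principal part of an apparent singularity at `q` split off; the terms of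
the apparent singularity are absent if `ε = e = 0`. -/
def withTail (R : RatFunc ℂ) (q ε e : ℂ) : RatFunc ℂ :=
  R + C (ε * (3 / 4)) / (X - C q) ^ 2 + C e / (X - C q)

section Tail

variable {R : RatFunc ℂ} {a q ε e v : ℂ}

lemma withTail_zero (R : RatFunc ℂ) (q : ℂ) : withTail R q 0 0 = R := by simp [withTail]

lemma hasVal_withTail (h : HasVal R a v) (haq : a ≠ q) : ∃ w, HasVal (withTail R q ε e) a w := by
  have h1 := sub_ne_zero.mpr haq
  exact ⟨_, (h.add ((hasVal_C _ a).div ((hasVal_X_sub_C a q).pow 2) (pow_ne_zero 2 h1))).add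
    ((hasVal_C _ a).div (hasVal_X_sub_C a q) h1)⟩

lemma localForm_withTail (h : HasVal R a v) (hε : ε = 0 ∨ ε = 1) :
    ∃ l b, LocalForm (withTail R q ε e) a l b ∧ (l = 0 ∨ l = 3 / 4) ∧ (a ≠ q → l = 0) := by
  by_cases haq : a = q
  · subst haq
    refine ⟨ε * (3 / 4), e, ⟨R, v, h, by rw [withTail]; ring⟩, ?_, fun h => absurd rfl h⟩
    rcases hε with rfl | rfl <;> simp
  · obtain ⟨w, hw⟩ := hasVal_withTail (ε := ε) (e := e) h haq
    exact ⟨0, 0, hw.localForm, Or.inl rfl, fun _ => rfl⟩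

lemma poleOrder_withTail_le (h : HasVal R a v) : poleOrder (withTail R q ε e) a ≤ 2 := by
  by_cases haq : a = q
  · subst haq
    exact LocalForm.poleOrder_le (l := ε * (3 / 4)) (b := e) ⟨R, v, h, by rw [withTail]; ring⟩
  · obtain ⟨w, hw⟩ := hasVal_withTail (ε := ε) (e := e) h haq
    exact hw.localForm.poleOrder_le

lemma poleOrder_withTail_zero_le (h : HasVal (X ^ 2 * R) 0 v) (hq : q ≠ 0) :
    poleOrder (withTail R q ε e) ((0 : ℂ) : OnePoint ℂ) ≤ 2 := by
  have h1 : (0 : ℂ) - q ≠ 0 := sub_ne_zero.mpr hq.symm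
  have h2 : HasVal ((X - C 0) ^ 2 * withTail R q ε e) 0 _ :=
    ((h.add (((hasVal_X 0).pow 2).mul ((hasVal_C (ε * (3 / 4)) 0).div ((hasVal_X_sub_C 0 q).pow 2)
      (pow_ne_zero 2 h1)))).add (((hasVal_X 0).pow 2).mul
        ((hasVal_C e 0).div (hasVal_X_sub_C 0 q) h1))).congr rfl |> fun h => by
      rw [map_zero, sub_zero, withTail, mul_add, mul_add]; exact h
  obtain ⟨b, hb⟩ := LocalForm.of_sq h2
  exact hb.poleOrder_le

lemma poleOrder_withTail_zero (n : ℕ) (hn : n ≠ 0) (h : HasVal (X ^ n * R) 0 v) (hv : v ≠ 0)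
    (hq : q ≠ 0) : poleOrder (withTail R q ε e) ((0 : ℂ) : OnePoint ℂ) = n := by
  have h1 : (0 : ℂ) - q ≠ 0 := sub_ne_zero.mpr hq.symm
  have h2 := (h.add (((hasVal_X 0).pow n).mul ((hasVal_C (ε * (3 / 4)) 0).div
    ((hasVal_X_sub_C 0 q).pow 2) (pow_ne_zero 2 h1)))).add (((hasVal_X 0).pow n).mul
        ((hasVal_C e 0).div (hasVal_X_sub_C 0 q) h1))
  refine poleOrder_of_hasVal n (v := v) ?_ hv
  rw [map_zero, sub_zero, withTail, mul_add, mul_add]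
  exact h2.congr (by rw [zero_pow hn]; ring)

lemma poleOrder_withTail_infty (n : ℕ) (h : HasValInf (R / X ^ n) v) (hv : v ≠ 0) :
    poleOrder (withTail R q ε e) OnePoint.infty = n + 4 := by
  refine poleOrder_infty_of_hasValInf n (v := v) ?_ hv
  have h1 := hasValInf_inv_X_sub_C q
  have h2 := (h.add (((hasValInf_inv_X.pow n).mul (hasValInf_C (ε * (3 / 4)))).mul (h1.pow 2))).add
    (((hasValInf_inv_X.pow n).mul (hasValInf_C e)).mul h1)
  convert h2 using 1
  · rw [withTail]; generalize X - C q = z; ring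
  · simp

lemma poleOrder_withTail_infty' (h : HasValInf (R * X) v) (hv : v + e ≠ 0) :
    poleOrder (withTail R q ε e) OnePoint.infty = 3 := by
  refine poleOrder_infty_of_hasValInf_mul_X (v := v + e) ?_ hv
  have h1 := hasValInf_inv_X_sub_C q
  have h2 := (h.add (((hasValInf_C (ε * (3 / 4))).mul h1).mul (hasValInf_X_div q))).add
    ((hasValInf_C e).mul (hasValInf_X_div q))
  convert h2 using 1
  · rw [withTail]; generalize X - C q = z; ring
  · simp

lemma split_tail (q p : ℂ) :
    C (p * q) / (X * (X - C q)) = -(C p / X) - C (-p) / (X - C q) := by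
  have h0 := X_sub_C_ne_zero q
  have h1 : (X : RatFunc ℂ) ≠ 0 := X_ne_zero
  rw [map_mul, map_neg]
  field_simp
  ring

lemma three_quarters (q : ℂ) : (3 : RatFunc ℂ) / (4 * (X - C q) ^ 2) =
    C (1 * (3 / 4)) / (X - C q) ^ 2 := by
  have h0 := X_sub_C_ne_zero q
  rw [one_mul, map_div₀, map_ofNat, map_ofNat]
  field_simp

end Tail

section Families

lemma familyP1_isPoly {R : RatFunc ℂ} {t c : ℂ} (hR : R = 4 * X ^ 3 + C (2 * t) * X + C c)
    (q ε e : ℂ) (hε : ε = 0 ∨ ε = 1) : IrrInftyApparent (withTail R q ε e) 7 := by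
  subst hR
  refine ⟨poleOrder_withTail_infty 3 (v := 4) ?_ (by norm_num), q, fun a =>
    localForm_withTail ((((hasVal_ofNat 4 a).mul ((hasVal_X a).pow 3)).add
      ((hasVal_C _ a).mul (hasVal_X a))).add (hasVal_C c a)) hε⟩
  have h := ((hasValInf_C 4).add ((hasValInf_C (2 * t)).mul (hasValInf_inv_X.pow 2))).add
    ((hasValInf_C c).mul (hasValInf_inv_X.pow 3))
  have h1 : (X : RatFunc ℂ) ≠ 0 := X_ne_zero
  convert h using 1
  · rw [map_ofNat]; field_simp
  · simp

lemma familyP2_isPoly {R : RatFunc ℂ} {t α c : ℂ}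
    (hR : R = X ^ 4 + C t * X ^ 2 + C (2 * α) * X + C c)
    (q ε e : ℂ) (hε : ε = 0 ∨ ε = 1) : IrrInftyApparent (withTail R q ε e) 8 := by
  subst hR
  refine ⟨poleOrder_withTail_infty 4 (v := 1) ?_ one_ne_zero, q, fun a =>
    localForm_withTail (((((hasVal_X a).pow 4).add ((hasVal_C _ a).mul ((hasVal_X a).pow 2))).add
      ((hasVal_C _ a).mul (hasVal_X a))).add (hasVal_C c a)) hε⟩
  have h := (((hasValInf_C 1).add ((hasValInf_C t).mul (hasValInf_inv_X.pow 2))).add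
    ((hasValInf_C (2 * α)).mul (hasValInf_inv_X.pow 3))).add
    ((hasValInf_C c).mul (hasValInf_inv_X.pow 4))
  have h1 : (X : RatFunc ℂ) ≠ 0 := X_ne_zero
  convert h using 1
  · rw [map_one]; field_simp
  · simp

lemma irrInftyTwo_withTail {R : RatFunc ℂ} {q ε e l : ℂ} (n : ℕ)
    (hR : ∀ a : ℂ, a ≠ 0 → ∃ v, HasVal R a v) (h0 : HasVal (X ^ 2 * R) 0 l) (hq : q ≠ 0)
    (hM : poleOrder (withTail R q ε e) OnePoint.infty = n) :
    IrrInftyTwo (withTail R q ε e) n := by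
  refine ⟨hM, fun a => ?_, 0, q, fun a ha haq => ?_⟩
  · by_cases ha : a = 0
    · subst ha; exact poleOrder_withTail_zero_le h0 hq
    · obtain ⟨v, hv⟩ := hR a ha
      exact poleOrder_withTail_le hv
  · obtain ⟨v, hv⟩ := hR a ha
    obtain ⟨w, hw⟩ := hasVal_withTail (ε := ε) (e := e) hv haq
    exact hw.localForm

lemma laurent_regular (l b : ℂ) {P : RatFunc ℂ} (hP : ∀ a, ∃ v, HasVal P a v) :
    (∀ a : ℂ, a ≠ 0 → ∃ v, HasVal (P + C b / X + C l / X ^ 2) a v) ∧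
      HasVal (X ^ 2 * (P + C b / X + C l / X ^ 2)) 0 l := by
  constructor
  · intro a ha
    obtain ⟨v, hv⟩ := hP a
    exact ⟨_, (hv.add ((hasVal_C b a).div (hasVal_X a) ha)).add
      ((hasVal_C l a).div ((hasVal_X a).pow 2) (pow_ne_zero 2 ha))⟩
  · obtain ⟨v, hv⟩ := hP 0
    have h := ((((hasVal_X 0).pow 2).mul hv).add ((hasVal_X 0).mul (hasVal_C b 0))).add
      (hasVal_C l 0)
    have h1 : (X : RatFunc ℂ) ≠ 0 := X_ne_zero
    convert h using 1
    · field_simp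
    · simp

lemma familyP34_laurent (t b l : ℂ) {q ε e : ℂ} (hq : q ≠ 0) :
    IrrInftyTwo (withTail (X / 2 - C (t / 2) + C b / X + C l / X ^ 2) q ε e) 5 := by
  have hP : ∀ a, ∃ v, HasVal (X / 2 - C (t / 2)) a v := fun a =>
    ⟨_, ((hasVal_X a).div (hasVal_ofNat 2 a) two_ne_zero).sub (hasVal_C _ a)⟩
  obtain ⟨h1, h2⟩ := laurent_regular l b hP
  refine irrInftyTwo_withTail 5 h1 h2 hq (poleOrder_withTail_infty 1 (v := 1 / 2) ?_ (by norm_num))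
  have h := (((hasValInf_C (1 / 2)).sub ((hasValInf_C (t / 2)).mul hasValInf_inv_X)).add
    ((hasValInf_C b).mul (hasValInf_inv_X.pow 2))).add ((hasValInf_C l).mul (hasValInf_inv_X.pow 3))
  have h1 : (X : RatFunc ℂ) ≠ 0 := X_ne_zero
  convert h using 1
  · rw [map_div₀, map_div₀, map_ofNat, map_one]; field_simp
  · simp

lemma familyP4_laurent (t a₁ b l : ℂ) {q ε e : ℂ} (hq : q ≠ 0) :
    IrrInftyTwo (withTail (C a₁ + ((X + C (2 * t)) / 4) ^ 2 + C b / X + C l / X ^ 2) q ε e) 6 := by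
  have hP : ∀ a, ∃ v, HasVal (C a₁ + ((X + C (2 * t)) / 4) ^ 2) a v := fun a =>
    ⟨_, (hasVal_C _ a).add ((((hasVal_X a).add (hasVal_C _ a)).div (hasVal_ofNat 4 a)
      (by norm_num)).pow 2)⟩
  obtain ⟨h1, h2⟩ := laurent_regular l b hP
  refine irrInftyTwo_withTail 6 h1 h2 hq (poleOrder_withTail_infty 2 (v := 1 / 16) ?_ (by norm_num))
  have h := ((((hasValInf_C (1 / 4)).add ((hasValInf_C (2 * t / 4)).mul hasValInf_inv_X)).pow 2).add
    ((hasValInf_C a₁).mul (hasValInf_inv_X.pow 2))).add (((hasValInf_C b).mul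
      (hasValInf_inv_X.pow 3)).add ((hasValInf_C l).mul (hasValInf_inv_X.pow 4)))
  have h1 : (X : RatFunc ℂ) ≠ 0 := X_ne_zero
  convert h using 1
  · rw [map_div₀, map_div₀, map_ofNat, map_one]; field_simp; ring
  · norm_num

lemma W_irrInftyTwo (k m : ℂ) : IrrInftyTwo (W k m) 4 := by
  have hP : ∀ a, ∃ v, HasVal (C (1 / 4)) a v := fun a => ⟨_, hasVal_C _ a⟩
  obtain ⟨h1, h2⟩ := laurent_regular (m ^ 2 - 1 / 4) (-k) hP
  rw [W_eq_genPot, ← withTail_zero (genPot _ _ _) 1]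
  refine irrInftyTwo_withTail 4 h1 h2 one_ne_zero
    (poleOrder_withTail_infty 0 (v := 1 / 4) ?_ (by norm_num))
  have h := ((hasValInf_C (1 / 4)).add ((hasValInf_C (-k)).mul hasValInf_inv_X)).add
    ((hasValInf_C (m ^ 2 - 1 / 4)).mul (hasValInf_inv_X.pow 2))
  convert h using 1
  · rw [genPot]; ring
  · simp

lemma DW_irrInftyTwo (m : ℂ) : IrrInftyTwo (DW m) 3 := by
  have hP : ∀ a, ∃ v, HasVal (C 0) a v := fun a => ⟨_, hasVal_C _ a⟩
  obtain ⟨h1, h2⟩ := laurent_regular (m ^ 2 - 1 / 4) 1 hP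
  rw [DW_eq_genPot, ← withTail_zero (genPot _ _ _) 1]
  refine irrInftyTwo_withTail 3 h1 h2 one_ne_zero
    (poleOrder_withTail_infty' (v := 1) ?_ (by norm_num))
  have h := (hasValInf_C 1).add ((hasValInf_C (m ^ 2 - 1 / 4)).mul hasValInf_inv_X)
  have h1 : (X : RatFunc ℂ) ≠ 0 := X_ne_zero
  convert h using 1
  · rw [genPot, map_zero]; field_simp; ring
  · simp

lemma weber_irrInftyTwo (c : ℂ) : IrrInftyTwo (X ^ 2 / 4 + C c) 6 := by
  have h0 : ∀ a, HasVal (X ^ 2 / 4 + C c) a (a ^ 2 / 4 + c) := fun a =>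
    (((hasVal_X a).pow 2).div (hasVal_ofNat 4 a) (by norm_num)).add (hasVal_C c a)
  refine ⟨poleOrder_infty_of_hasValInf 2 (v := 1 / 4) ?_ (by norm_num),
    fun a => (h0 a).localForm.poleOrder_le, 0, 0, fun a _ _ => (h0 a).localForm⟩
  have h := (hasValInf_C (1 / 4)).add ((hasValInf_C c).mul (hasValInf_inv_X.pow 2))
  have h1 : (X : RatFunc ℂ) ≠ 0 := X_ne_zero
  convert h using 1
  · rw [map_div₀, map_one, map_ofNat]; field_simp
  · simp

lemma airy_irrInftyTwo : IrrInftyTwo X 5 := by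
  refine ⟨poleOrder_infty_of_hasValInf 1 (v := 1) ?_ one_ne_zero,
    fun a => (hasVal_X a).localForm.poleOrder_le, 0, 0, fun a _ _ => (hasVal_X a).localForm⟩
  have h := hasValInf_C 1
  convert h using 1
  rw [pow_one, map_one, div_self X_ne_zero]

lemma familyP3_laurent (a₀ b₀ c b₁ a₁ : ℂ) {q ε e : ℂ} (hq : q ≠ 0) (hε : ε = 0 ∨ ε = 1)
    (h0 : a₀ ≠ 0 ∨ (a₀ = 0 ∧ b₀ ≠ 0)) (h1 : a₁ ≠ 0 ∨ (a₁ = 0 ∧ b₁ + e ≠ 0)) :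
    IrrInftyZero (withTail (C a₀ / X ^ 4 + C b₀ / X ^ 3 + C c / X ^ 2 + C b₁ / X + C a₁) q ε e)
      (if a₁ = 0 then 3 else 4) (if a₀ = 0 then 3 else 4) := by
  have hX : (X : RatFunc ℂ) ≠ 0 := X_ne_zero
  have hi := hasValInf_inv_X
  refine ⟨?_, ?_, q, fun a ha => localForm_withTail (((((hasVal_C a₀ a).div ((hasVal_X a).pow 4)
    (pow_ne_zero _ ha)).add ((hasVal_C b₀ a).div ((hasVal_X a).pow 3) (pow_ne_zero _ ha))).add
    ((hasVal_C c a).div ((hasVal_X a).pow 2) (pow_ne_zero _ ha))).add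
    ((hasVal_C b₁ a).div (hasVal_X a) ha) |>.add (hasVal_C a₁ a)) hε⟩
  · rcases h1 with h1 | ⟨rfl, h1⟩
    · rw [if_neg h1]
      refine poleOrder_withTail_infty 0 (v := a₁) ?_ h1
      have h := ((((hasValInf_C a₀).mul (hi.pow 4)).add ((hasValInf_C b₀).mul (hi.pow 3))).add
        ((hasValInf_C c).mul (hi.pow 2))).add ((hasValInf_C b₁).mul hi) |>.add (hasValInf_C a₁)
      convert h using 1
      · ring
      · simp
    · rw [if_pos rfl]
      refine poleOrder_withTail_infty' (v := b₁) ?_ h1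
      have h := ((((hasValInf_C a₀).mul (hi.pow 3)).add ((hasValInf_C b₀).mul (hi.pow 2))).add
        ((hasValInf_C c).mul hi)).add (hasValInf_C b₁)
      convert h using 1
      · rw [map_zero]; field_simp; ring
      · simp
  · rcases h0 with h0 | ⟨rfl, h0⟩
    · rw [if_neg h0]
      refine poleOrder_withTail_zero 4 (by norm_num) (v := a₀) ?_ h0 hq
      have h := ((((hasVal_C a₀ 0)).add ((hasVal_C b₀ 0).mul (hasVal_X 0))).add
        ((hasVal_C c 0).mul ((hasVal_X 0).pow 2))).add ((hasVal_C b₁ 0).mul ((hasVal_X 0).pow 3))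
        |>.add ((hasVal_C a₁ 0).mul ((hasVal_X 0).pow 4))
      convert h using 1
      · field_simp
      · simp
    · rw [if_pos rfl]
      refine poleOrder_withTail_zero 3 (by norm_num) (v := b₀) ?_ h0 hq
      have h := (((hasVal_C b₀ 0).add
        ((hasVal_C c 0).mul (hasVal_X 0))).add ((hasVal_C b₁ 0).mul ((hasVal_X 0).pow 2)))
        |>.add ((hasVal_C a₁ 0).mul ((hasVal_X 0).pow 3))
      convert h using 1
      · rw [map_zero]; field_simp; ring
      · simp

end Families

section P5

/-- The common form of the linear equations of P5, with or without apparent singularity. -/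
def potP5Form (A B D b a₀ G E q : ℂ) : RatFunc ℂ :=
  C A / (X - 1) ^ 4 + C B / (X - 1) ^ 3 + C D / ((X - 1) ^ 2 * X) + C b / (X - 1) ^ 2 +
    C a₀ / X ^ 2 + C G / (X * (X - 1) * (X - C q)) + C E / (X - C q) ^ 2

lemma hasVal_X_sub_one (a : ℂ) : HasVal (X - 1) a (a - 1) := (hasVal_X a).sub (hasVal_one a)

lemma HasValInf.congr_left {f g : RatFunc ℂ} {v : ℂ} (h : HasValInf f v) (e : f = g) :
    HasValInf g v := e ▸ h

lemma HasVal.congr_left {f g : RatFunc ℂ} {a v : ℂ} (h : HasVal f a v) (e : f = g) :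
    HasVal g a v := e ▸ h

lemma poleOrder_potP5Form_le {A B D b a₀ G E q : ℂ} (hq0 : q ≠ 0) (hq1 : q ≠ 1) {c : OnePoint ℂ}
    (hc : c ≠ ((1 : ℂ) : OnePoint ℂ)) : poleOrder (potP5Form A B D b a₀ G E q) c ≤ 2 := by
  have hX : (X : RatFunc ℂ) ≠ 0 := X_ne_zero
  have hX1 : (X : RatFunc ℂ) - 1 ≠ 0 := by simpa using X_sub_C_ne_zero 1
  have hXq := X_sub_C_ne_zero q
  induction c using OnePoint.rec with
  | infty =>
    have h1 : HasValInf (X - 1)⁻¹ 0 := by simpa using hasValInf_inv_X_sub_C 1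
    have h1' : HasValInf (X / (X - 1)) 1 := by simpa using hasValInf_X_div 1
    have hi := hasValInf_inv_X_sub_C q
    have h := (((((((hasValInf_C A).mul (h1.pow 2)).mul (h1'.pow 2)).add
      (((hasValInf_C B).mul h1).mul (h1'.pow 2))).add (((hasValInf_C D).mul h1).mul h1')).add
      ((hasValInf_C b).mul (h1'.pow 2))).add (hasValInf_C a₀)).add
        (((hasValInf_C G).mul h1').mul hi) |>.add ((hasValInf_C E).mul ((hasValInf_X_div q).pow 2))
    have e := poleOrder_infty_le_two (h.congr_left (g := potP5Form A B D b a₀ G E q * X ^ 2) ?_)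
    · exact e
    rw [potP5Form]
    field_simp
  | coe a =>
    have ha1 : a - 1 ≠ 0 := sub_ne_zero.mpr fun h => hc (by rw [h])
    have h1 := hasVal_X_sub_one a
    have hB := (((hasVal_C A a).div (h1.pow 4) (pow_ne_zero _ ha1)).add
      ((hasVal_C B a).div (h1.pow 3) (pow_ne_zero _ ha1))).add
      ((hasVal_C b a).div (h1.pow 2) (pow_ne_zero _ ha1))
    by_cases ha0 : a = 0
    · subst ha0
      have hq : (0 : ℂ) - q ≠ 0 := sub_ne_zero.mpr hq0.symm
      have hx := hasVal_X 0
      have h := ((((((hx.pow 2).mul hB).add ((hasVal_C D 0).mul (hx.div (h1.pow 2)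
        (pow_ne_zero _ ha1)))).add (hasVal_C a₀ 0)).add ((hasVal_C G 0).mul
        (hx.div (h1.mul (hasVal_X_sub_C 0 q)) (mul_ne_zero ha1 hq)))).add
        (((hx.pow 2).mul (hasVal_C E 0)).div ((hasVal_X_sub_C 0 q).pow 2) (pow_ne_zero _ hq)))
      obtain ⟨b', hb'⟩ := LocalForm.of_sq (V := potP5Form A B D b a₀ G E q) (a := 0) (l := _) (by
        convert h using 1
        rw [potP5Form, map_zero, sub_zero]
        field_simp
        ring)
      exact hb'.poleOrder_le
    · have hx := hasVal_X a
      have hB' := (hB.add ((hasVal_C D a).div ((h1.pow 2).mul hx)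
        (mul_ne_zero (pow_ne_zero _ ha1) ha0))).add ((hasVal_C a₀ a).div (hx.pow 2)
          (pow_ne_zero _ ha0))
      by_cases haq : a = q
      · subst haq
        have hz := hasVal_X_sub_C a a
        have h := (((hz.pow 2).mul hB').add ((hasVal_C G a).mul (hz.div (hx.mul h1)
          (mul_ne_zero ha0 ha1)))).add (hasVal_C E a)
        obtain ⟨b', hb'⟩ := LocalForm.of_sq (V := potP5Form A B D b a₀ G E a) (a := a) (l := _) (by
          convert h using 1
          rw [potP5Form]
          field_simp
          ring)
        exact hb'.poleOrder_le
      · have hq : a - q ≠ 0 := sub_ne_zero.mpr haq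
        have h := (hB'.add ((hasVal_C G a).div ((hx.mul h1).mul (hasVal_X_sub_C a q))
          (mul_ne_zero (mul_ne_zero ha0 ha1) hq))).add
          ((hasVal_C E a).div ((hasVal_X_sub_C a q).pow 2) (pow_ne_zero _ hq))
        exact (h.congr_left (g := potP5Form A B D b a₀ G E q)
          (by rw [potP5Form]; ring)).localForm.poleOrder_le

lemma irrOne_potP5Form {A B D b a₀ G E q : ℂ} (hq0 : q ≠ 0) (hq1 : q ≠ 1)
    (h : A ≠ 0 ∨ (A = 0 ∧ B ≠ 0)) :
    IrrOne (potP5Form A B D b a₀ G E q) (if A = 0 then 3 else 4) := by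
  refine ⟨?_, fun c hc => poleOrder_potP5Form_le hq0 hq1 hc⟩
  have hX : (X : RatFunc ℂ) ≠ 0 := X_ne_zero
  have hX1 : (X : RatFunc ℂ) - 1 ≠ 0 := by simpa using X_sub_C_ne_zero 1
  have hXq := X_sub_C_ne_zero q
  have hq : (1 : ℂ) - q ≠ 0 := sub_ne_zero.mpr hq1.symm
  have hz := (hasVal_X_sub_one 1).congr (sub_self 1)
  have hx := hasVal_X 1
  have hR := (((hasVal_C D 1).div hx one_ne_zero).add (hasVal_C b 1)).add
    (((hz.pow 2).mul (hasVal_C a₀ 1)).div (hx.pow 2) (by norm_num)) |>.add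
    ((hz.mul (hasVal_C G 1)).div (hx.mul (hasVal_X_sub_C 1 q)) (by simpa using hq)) |>.add
    (((hz.pow 2).mul (hasVal_C E 1)).div ((hasVal_X_sub_C 1 q).pow 2) (pow_ne_zero _ hq))
  rcases h with h | ⟨rfl, h⟩
  · rw [if_neg h]
    refine poleOrder_of_hasVal 4 (v := A) ?_ h
    have h := ((hasVal_C A 1).add ((hasVal_C B 1).mul hz)).add ((hz.pow 2).mul hR)
    convert h using 1
    · rw [potP5Form, map_one]
      field_simp
      ring
    · simp
  · rw [if_pos rfl]
    refine poleOrder_of_hasVal 3 (v := B) ?_ h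
    have h := (hasVal_C B 1).add (hz.mul hR)
    convert h using 1
    · rw [potP5Form, map_one, map_zero]
      field_simp
      ring
    · simp

end P5

/-- The singularities of a target equation in the coordinate in which its potential is given. -/
lemma Target.Holds.exists_shape {V : RatFunc ℂ} {J : Target} (hJ : J.Holds V) :
    ∃ g, IrrInftyApparent (pullback (mob g) V) 7 ∨ IrrInftyApparent (pullback (mob g) V) 8 ∨
      (∃ M ∈ Finset.Icc 3 6, IrrInftyTwo (pullback (mob g) V) M) ∨
      (∃ M ∈ Finset.Icc 3 4, ∃ N ∈ Finset.Icc 3 4, IrrInftyZero (pullback (mob g) V) M N) ∨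
      (∃ M ∈ Finset.Icc 3 4, IrrOne (pullback (mob g) V) M) := by
  have h34 : ∀ c : ℂ, (if c = 0 then 3 else 4) ∈ Finset.Icc 3 4 := by
    intro c; split_ifs <;> simp
  have hP3 : ∀ α β γ δ t : ℂ, t ≠ 0 → (γ ≠ 0 ∨ (γ = 0 ∧ α ≠ 0)) → (δ ≠ 0 ∨ (δ = 0 ∧ β ≠ 0)) →
      ∀ U : RatFunc ℂ, ((∃ q p : ℂ, q ∉ (familyP3 α β γ δ).fixed ∧
          U = (familyP3 α β γ δ).potential t q p) ∨
        (∃ c : ℂ, U = (familyP3 α β γ δ).degenerate t c)) →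
      ∃ M ∈ Finset.Icc 3 4, ∃ N ∈ Finset.Icc 3 4, IrrInftyZero U M N := by
    intro α β γ δ t ht hγ hδ U hU
    have e0 : -δ / 16 * t ^ 2 ≠ 0 ∨ (-δ / 16 * t ^ 2 = 0 ∧ -β / 8 * t ≠ 0) := by
      rcases hδ with h | ⟨rfl, h⟩
      · exact Or.inl (mul_ne_zero (div_ne_zero (neg_ne_zero.mpr h) (by norm_num)) (pow_ne_zero 2 ht))
      · exact Or.inr ⟨by simp, mul_ne_zero (div_ne_zero (neg_ne_zero.mpr h) (by norm_num)) ht⟩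
    have e1 : γ / 16 ≠ 0 ∨ (γ / 16 = 0 ∧ α / 8 ≠ 0) := by
      rcases hγ with h | ⟨rfl, h⟩
      · exact Or.inl (div_ne_zero h (by norm_num))
      · exact Or.inr ⟨by simp, div_ne_zero h (by norm_num)⟩
    rcases hU with ⟨q, p, hq, rfl⟩ | ⟨c, rfl⟩
    · refine ⟨_, h34 (γ / 16), _, h34 (-δ / 16 * t ^ 2), ?_⟩
      have hq' : q ≠ 0 := hq
      have h := familyP3_laurent (-δ / 16 * t ^ 2) (-β / 8 * t) (q ^ 2 * p ^ 2 - q * p -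
        -δ / 16 * t ^ 2 / q ^ 2 - -β / 8 * t / q - α / 8 * q - γ / 16 * q ^ 2) (α / 8 + p) (γ / 16)
        (e := -p) hq' (Or.inr rfl) e0 (by simpa using e1)
      convert h using 1
      simp only [familyP3, withTail]
      rw [split_tail, three_quarters, map_add]
      ring
    · refine ⟨_, h34 (γ / 16), _, h34 (-δ / 16 * t ^ 2), ?_⟩
      have h := familyP3_laurent (-δ / 16 * t ^ 2) (-β / 8 * t) c (α / 8) (γ / 16)
        (e := 0) one_ne_zero (Or.inl rfl) e0 (by simpa using e1)
      rw [withTail_zero] at h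
      exact h
  have hP5 : ∀ α β γ δ t : ℂ, t ≠ 0 → (δ ≠ 0 ∨ (δ = 0 ∧ γ ≠ 0)) →
      ∀ U : RatFunc ℂ, ((∃ q p : ℂ, q ∉ (familyP5 α β γ δ).fixed ∧
          U = (familyP5 α β γ δ).potential t q p) ∨
        (∃ c : ℂ, U = (familyP5 α β γ δ).degenerate t c)) →
      ∃ M ∈ Finset.Icc 3 4, IrrOne U M := by
    intro α β γ δ t ht hδ U hU
    have e0 : -δ / 2 * t ^ 2 ≠ 0 ∨ (-δ / 2 * t ^ 2 = 0 ∧ -γ / 2 * t ≠ 0) := by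
      rcases hδ with h | ⟨rfl, h⟩
      · exact Or.inl (mul_ne_zero (div_ne_zero (neg_ne_zero.mpr h) (by norm_num)) (pow_ne_zero 2 ht))
      · exact Or.inr ⟨by simp, mul_ne_zero (div_ne_zero (neg_ne_zero.mpr h) (by norm_num)) ht⟩
    rcases hU with ⟨q, p, hq, rfl⟩ | ⟨c, rfl⟩
    · obtain ⟨hq0, hq1⟩ : q ≠ 0 ∧ q ≠ 1 := by simpa [familyP5] using hq
      refine ⟨_, h34 (-δ / 2 * t ^ 2), ?_⟩
      have h := irrOne_potP5Form (D := q * (q - 1) ^ 2 * (-(-δ / 2) * t ^ 2 / (q - 1) ^ 4 -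
        -γ / 2 * t / (q - 1) ^ 3 + p ^ 2 - (1 / q + 1 / (q - 1)) * p -
        ((α + β) / 2 - 3 / 4) / (q - 1) ^ 2 - (-β / 2 - 1 / 4) / q ^ 2)) (b := (α + β) / 2 - 3 / 4)
        (a₀ := -β / 2 - 1 / 4) (G := -(p * (q - 1) * q)) (E := 1 * (3 / 4)) hq0 hq1 e0
      convert h using 1
      simp only [familyP5, potP5Form]
      rw [three_quarters, map_neg C (p * (q - 1) * q)]
      ring
    · refine ⟨_, h34 (-δ / 2 * t ^ 2), ?_⟩
      have h := irrOne_potP5Form (D := c) (b := (α + β) / 2 - 3 / 4)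
        (a₀ := -β / 2 - 1 / 4) (G := 0) (E := 0) (q := 2) two_ne_zero (by norm_num) e0
      convert h using 1
      simp only [familyP5, potP5Form, map_zero, zero_div, add_zero]
      ring
  rcases J with J | _
  · obtain ⟨F, hF, φ, hφ, t, ht, hV⟩ := hJ
    obtain ⟨g, rfl⟩ := hφ.exists_mob
    refine ⟨g, ?_⟩
    generalize pullback (mob g) V = U at *
    cases J with
    | P1 =>
      left
      obtain rfl : F = familyP1 := hF
      rcases hV with ⟨q, p, -, rfl⟩ | ⟨c, rfl⟩
      · have h := familyP1_isPoly (t := t) (c := 2 * (p ^ 2 / 2 - 2 * q ^ 3 - t * q)) rfl q 1 (-p)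
          (Or.inr rfl)
        convert h using 1
        simp only [familyP1, withTail]
        rw [three_quarters, map_neg C p]; ring
      · have h := familyP1_isPoly (t := t) (c := c) rfl 0 0 0 (Or.inl rfl)
        rwa [withTail_zero] at h
    | P2 =>
      right; left
      obtain ⟨α, rfl⟩ := hF
      rcases hV with ⟨q, p, -, rfl⟩ | ⟨c, rfl⟩
      · have h := familyP2_isPoly (t := t) (α := α)
          (c := 2 * (p ^ 2 / 2 - q ^ 4 / 2 - t * q ^ 2 / 2 - α * q)) rfl q 1 (-p) (Or.inr rfl)
        convert h using 1
        simp only [familyP2, withTail]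
        rw [three_quarters, map_neg C p]; ring
      · have h := familyP2_isPoly (t := t) (α := α) (c := c) rfl 0 0 0 (Or.inl rfl)
        rwa [withTail_zero] at h
    | P34 =>
      right; right; left
      obtain ⟨α, rfl⟩ := hF
      refine ⟨5, by simp, ?_⟩
      rcases hV with ⟨q, p, hq, rfl⟩ | ⟨c, rfl⟩
      · have h := familyP34_laurent t (p - (-q * p ^ 2 + p + q ^ 2 / 2 - t * q / 2 +
          (α - 1) / (4 * q))) ((α - 1) / 4) (q := q) (ε := 1) (e := -p) hq
        convert h using 1
        simp only [familyP34, withTail]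
        rw [split_tail, three_quarters, map_sub C p]; ring
      · have h := familyP34_laurent t c ((α - 1) / 4) (q := 1) (ε := 0) (e := 0) one_ne_zero
        rw [withTail_zero] at h
        convert h using 1
        simp only [familyP34]; ring
    | P4 =>
      right; right; left
      obtain ⟨α, β, rfl⟩ := hF
      refine ⟨6, by simp, ?_⟩
      rcases hV with ⟨q, p, hq, rfl⟩ | ⟨c, rfl⟩
      · have h := familyP4_laurent t (-α / 4) (p + (2 * q * p ^ 2 - 2 * p -
          2 * (-β / 8 - 1 / 4) / q - 2 * (-α / 4) * q - 2 * q * ((q + 2 * t) / 4) ^ 2) / 2)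
          (-β / 8 - 1 / 4) (q := q) (ε := 1) (e := -p) hq
        convert h using 1
        simp only [familyP4, withTail]
        rw [split_tail, three_quarters, map_add C p, map_div₀ C _ 2, map_ofNat]
        have hX : (X : RatFunc ℂ) ≠ 0 := X_ne_zero
        ring
      · have h := familyP4_laurent t (-α / 4) c (-β / 8 - 1 / 4) (q := 1) (ε := 0) (e := 0)
          one_ne_zero
        rw [withTail_zero] at h
        convert h using 1
        simp only [familyP4]; ring
    | P3D6 =>
      right; right; right; left
      obtain ⟨α, β, γ, δ, hγ, hδ, rfl⟩ := hF
      exact hP3 α β γ δ t ht (Or.inl hγ) (Or.inl hδ) U hV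
    | P3D7 =>
      right; right; right; left
      obtain ⟨α, β, γ, δ, h, rfl⟩ := hF
      rcases h with ⟨h1, h2, h3⟩ | ⟨h1, h2, h3⟩
      · exact hP3 α β γ δ t ht (Or.inl h3) (Or.inr ⟨h1, h2⟩) U hV
      · exact hP3 α β γ δ t ht (Or.inr ⟨h1, h2⟩) (Or.inl h3) U hV
    | P3D8 =>
      right; right; right; left
      obtain ⟨α, β, hα, hβ, rfl⟩ := hF
      exact hP3 α β 0 0 t ht (Or.inr ⟨rfl, hα⟩) (Or.inr ⟨rfl, hβ⟩) U hV
    | P5 =>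
      right; right; right; right
      obtain ⟨α, β, γ, δ, hδ, rfl⟩ := hF
      exact hP5 α β γ δ t ht (Or.inl hδ) U hV
    | degP5 =>
      right; right; right; right
      obtain ⟨α, β, γ, hγ, rfl⟩ := hF
      exact hP5 α β γ 0 t ht (Or.inr ⟨rfl, hγ⟩) U hV
  · obtain ⟨φ, hφ, h⟩ := hJ
    obtain ⟨g, rfl⟩ := hφ.exists_mob
    refine ⟨g, Or.inr (Or.inr (Or.inl ?_))⟩
    rcases h with ⟨k, m, h⟩ | ⟨m, h⟩ | ⟨c, h⟩ | h <;> rw [h]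
    · exact ⟨4, by simp, W_irrInftyTwo k m⟩
    · exact ⟨3, by simp, DW_irrInftyTwo m⟩
    · exact ⟨6, by simp, weber_irrInftyTwo c⟩
    · exact ⟨5, by simp, airy_irrInftyTwo⟩

/-! ### The possible branching types -/

lemma zeroType_pos {x : RatFunc ℂ} (hx : x ≠ 0) {μ : ℕ} (h : μ ∈ zeroType x) : 0 < μ := by
  obtain ⟨S, hS⟩ := exists_zeroSet hx
  rw [zeroType_eq hx hS, Multiset.mem_map] at h
  obtain ⟨c, hc, rfl⟩ := h
  have := (hS c).mp hc
  omega

section Shape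

variable {x : RatFunc ℂ} {A B m : ℂ} {f : ℕ → ℕ}

/-- `f` gives the pole order of the transformed equation at a pole of `x`. -/
def IsPoleRule (A B : ℂ) (f : ℕ → ℕ) : Prop :=
  (A ≠ 0 ∧ f = fun n => 2 * n + 2) ∨ (A = 0 ∧ B ≠ 0 ∧ f = fun n => n + 2)

lemma poleType_of_irr_singleton (hx : Nonconst x) (hf : IsPoleRule A B f) {c₀ : OnePoint ℂ}
    {M : ℕ} (hM : 2 < M) (h0 : poleOrder (pullback x (genPot A B m)) c₀ = M)
    (h : ∀ c, c ≠ c₀ → poleOrder (pullback x (genPot A B m)) c ≤ 2) :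
    ord x c₀ < 0 ∧ ∃ ν, poleType x = {ν} ∧ f ν = M := by
  obtain ⟨h1, h2⟩ := poleType_map (m := m) hx hf (I := {c₀}) (by
    intro c
    rw [Finset.mem_singleton]
    constructor
    · rintro rfl; omega
    · intro h'; by_contra hc; exact absurd (h c hc) (by omega))
  refine ⟨(h1 c₀).mp (Finset.mem_singleton_self _), ?_⟩
  rw [Finset.singleton_val, Multiset.map_singleton, h0, Multiset.map_eq_singleton] at h2
  exact h2

lemma IrrInftyApparent.types (hx : Nonconst x) (hf : IsPoleRule A B f) {M : ℕ} (hM : 2 < M)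
    (h : IrrInftyApparent (pullback x (genPot A B m)) M) :
    (∃ ν, poleType x = {ν} ∧ f ν = M) ∧ (zeroType x).card ≤ 2 ∧
      ((zeroType x).card = 2 → ∀ μ ∈ zeroType x, 4 * m ^ 2 * (μ : ℂ) ^ 2 = 1) ∧
      (∀ μ ∈ zeroType x, 4 * m ^ 2 * (μ : ℂ) ^ 2 = 1 ∨ 4 * m ^ 2 * (μ : ℂ) ^ 2 = 4) := by
  obtain ⟨h0, q, hq⟩ := h
  obtain ⟨hinf, ν, hν, hfν⟩ := poleType_of_irr_singleton hx hf hM h0 (by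
    intro c hc
    induction c using OnePoint.rec with
    | infty => exact absurd rfl hc
    | coe a => obtain ⟨l, b, hl, -⟩ := hq a; exact hl.poleOrder_le)
  obtain ⟨h1, h2, h3⟩ := ramification_of_apparent hx hinf (q := q) fun a _ => hq a
  rw [hν, Multiset.card_singleton] at h1 h2
  exact ⟨⟨ν, hν, hfν⟩, by omega, fun h => h2 (by omega), h3⟩

lemma IrrInftyTwo.types (hx : Nonconst x) (hf : IsPoleRule A B f) {M : ℕ} (hM : 2 < M)
    (h : IrrInftyTwo (pullback x (genPot A B m)) M) :
    (∃ ν, poleType x = {ν} ∧ f ν = M) ∧ ∃ μ₀ rest, zeroType x = μ₀ ::ₘ rest ∧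
      ∀ μ ∈ rest, 4 * m ^ 2 * (μ : ℂ) ^ 2 = 1 ∧ (μ = 1 → B = 0) := by
  obtain ⟨h0, hle, q, q', hq⟩ := h
  obtain ⟨hinf, ν, hν, hfν⟩ := poleType_of_irr_singleton hx hf hM h0 (by
    intro c hc
    induction c using OnePoint.rec with
    | infty => exact absurd rfl hc
    | coe a => exact hle a)
  refine ⟨⟨ν, hν, hfν⟩, ?_⟩
  by_cases h3 : 3 ≤ (zeroType x).card + (poleType x).card
  · exact ramification_of_two_singular hx hinf (fun a h1 h2 _ => hq a h1 h2) h3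
  · rw [hν, Multiset.card_singleton] at h3
    have hs : (zeroType x).sum = ν := by rw [zeroType_sum, ← poleType_sum, hν]; simp
    have hc : (zeroType x).card = 1 := by
      rcases Nat.eq_zero_or_pos (zeroType x).card with h | h
      · rw [Multiset.card_eq_zero.mp h, Multiset.sum_zero] at hs
        rcases hf with ⟨_, rfl⟩ | ⟨_, _, rfl⟩
        · simp only at hfν
          obtain ⟨T, hT⟩ := exists_poleSet hx.ne_zero
          have : ν ∈ poleType x := by rw [hν]; simp
          rw [poleType_eq hT, Multiset.mem_map] at this
          obtain ⟨c, hc, e⟩ := this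
          have := (hT c).mp hc
          omega
        · simp only at hfν; omega
      · omega
    obtain ⟨a, ha⟩ := Multiset.card_eq_one.mp hc
    exact ⟨a, 0, ha, by simp⟩

lemma IrrInftyZero.types (hx : Nonconst x) (hf : IsPoleRule A B f) {M N : ℕ} (hM : 2 < M)
    (hN : 2 < N) (h : IrrInftyZero (pullback x (genPot A B m)) M N) :
    (∃ ν₁ ν₂, poleType x = {ν₁, ν₂} ∧ f ν₁ = M ∧ f ν₂ = N) ∧ (zeroType x).card ≤ 1 ∧
      (∀ μ ∈ zeroType x, 4 * m ^ 2 * (μ : ℂ) ^ 2 = 1) := by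
  classical
  obtain ⟨h0, h0', q, hq⟩ := h
  have hne : OnePoint.infty ≠ ((0 : ℂ) : OnePoint ℂ) := OnePoint.infty_ne_coe 0
  obtain ⟨h1, h2⟩ := poleType_map (m := m) hx hf (I := {(OnePoint.infty : OnePoint ℂ), ((0 : ℂ) : OnePoint ℂ)}) (by
    intro c
    rw [Finset.mem_insert, Finset.mem_singleton]
    constructor
    · rintro (rfl | rfl) <;> omega
    · intro h'
      by_contra! hc
      induction c using OnePoint.rec with
      | infty => exact absurd rfl hc.1
      | coe a =>
        obtain ⟨l, b, hl, -⟩ := hq a fun ha => hc.2 (by rw [ha])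
        exact absurd hl.poleOrder_le (by omega))
  have hinf : ord x OnePoint.infty < 0 := (h1 _).mp (by simp)
  have h00 : poleOrder (pullback x (genPot A B m)) ((0 : ℂ) : OnePoint ℂ) > 2 := by omega
  have hval : ({(OnePoint.infty : OnePoint ℂ), ((0 : ℂ) : OnePoint ℂ)} : Finset (OnePoint ℂ)).val =
      OnePoint.infty ::ₘ {((0 : ℂ) : OnePoint ℂ)} := by
    rw [Finset.insert_val_of_notMem (by simp), Finset.singleton_val]
  rw [hval, Multiset.map_cons, Multiset.map_singleton, h0, h0'] at h2
  obtain ⟨ν₁, hν₁, e₁, e₂⟩ := (Multiset.map_eq_cons (f := f) _ _ _).mpr h2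
  obtain ⟨ν₂, e₃, e₄⟩ := Multiset.map_eq_singleton.mp e₂
  have hP : poleType x = {ν₁, ν₂} := by
    rw [← Multiset.cons_erase hν₁, e₃]; rfl
  obtain ⟨h3, h4, -⟩ := ramification_of_apparent hx hinf (A := A) (B := B) (m := m) (q := q)
    fun a ha => hq a fun h => by rw [h] at ha; omega
  have hc : (poleType x).card = 2 := by rw [hP]; rfl
  rw [hc] at h3 h4
  refine ⟨⟨ν₁, ν₂, hP, e₁, e₄⟩, by omega, fun μ hμ => h4 ?_ μ hμ⟩
  have : 0 < (zeroType x).card := Multiset.card_pos_iff_exists_mem.mpr ⟨μ, hμ⟩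
  omega

lemma IrrOne.types (hx : Nonconst x) (hf : IsPoleRule A B f) {M : ℕ} (hM : 2 < M)
    (h : IrrOne (pullback x (genPot A B m)) M) : ∃ ν, poleType x = {ν} ∧ f ν = M :=
  (poleType_of_irr_singleton hx hf hM h.1 h.2).2

end Shape

lemma eq_zero_of_sum_eq_zero {s : Multiset ℕ} (h : ∀ μ ∈ s, 0 < μ) (hs : s.sum = 0) : s = 0 := by
  by_contra hne
  obtain ⟨a, ha⟩ := Multiset.exists_mem_of_ne_zero hne
  have := Multiset.sum_eq_zero_iff.mp hs a ha
  have := h a ha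
  omega

lemma eq_of_sum_eq_one {s : Multiset ℕ} (h : ∀ μ ∈ s, 0 < μ) (hs : s.sum = 1) : s = {1} := by
  obtain ⟨a, ha⟩ := Multiset.exists_mem_of_ne_zero (s := s) (by rintro rfl; simp at hs)
  obtain ⟨r, rfl⟩ := Multiset.exists_cons_of_mem ha
  rw [Multiset.sum_cons] at hs
  have := h a ha
  rw [eq_zero_of_sum_eq_zero (s := r) (fun μ hμ => h μ (Multiset.mem_cons_of_mem hμ)) (by omega),
    show a = 1 by omega]
  rfl

lemma eq_of_sum_eq_two {s : Multiset ℕ} (h : ∀ μ ∈ s, 0 < μ) (hs : s.sum = 2) :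
    s = {2} ∨ s = {1, 1} := by
  obtain ⟨a, ha⟩ := Multiset.exists_mem_of_ne_zero (s := s) (by rintro rfl; simp at hs)
  obtain ⟨r, rfl⟩ := Multiset.exists_cons_of_mem ha
  rw [Multiset.sum_cons] at hs
  have h1 := h a ha
  have hr : ∀ μ ∈ r, 0 < μ := fun μ hμ => h μ (Multiset.mem_cons_of_mem hμ)
  obtain rfl | rfl : a = 1 ∨ a = 2 := by omega
  · right; rw [eq_of_sum_eq_one hr (by omega)]; rfl
  · left; rw [eq_zero_of_sum_eq_zero hr (by omega)]; rfl

lemma eq_of_sum_le_three {s : Multiset ℕ} (h : ∀ μ ∈ s, 2 ≤ μ) (hs : s.sum ≤ 3) :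
    s = 0 ∨ s = {2} ∨ s = {3} := by
  by_cases h0 : s = 0
  · exact Or.inl h0
  obtain ⟨a, ha⟩ := Multiset.exists_mem_of_ne_zero h0
  obtain ⟨r, rfl⟩ := Multiset.exists_cons_of_mem ha
  rw [Multiset.sum_cons] at hs
  have h1 := h a ha
  have hr : r = 0 := by
    by_contra hne
    obtain ⟨b, hb⟩ := Multiset.exists_mem_of_ne_zero hne
    have := h b (Multiset.mem_cons_of_mem hb)
    have := Multiset.single_le_sum (fun _ _ => Nat.zero_le _) b hb
    omega
  subst hr
  right
  rw [Multiset.sum_zero] at hs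
  obtain rfl | rfl : a = 2 ∨ a = 3 := by omega
  · exact Or.inl rfl
  · exact Or.inr rfl

/-- Only one multiplicity `μ` satisfies `4 m² μ² = 1`. -/
lemma natCast_sq_inj {c : ℂ} {a b : ℕ} (ha : c * (a : ℂ) ^ 2 = 1) (hb : c * (b : ℂ) ^ 2 = 1) :
    a = b := by
  have h : (a : ℂ) ^ 2 = (b : ℂ) ^ 2 := by linear_combination (a : ℂ) ^ 2 * (-hb) + (b : ℂ) ^ 2 * ha
  have h2 : a ^ 2 = b ^ 2 := by exact_mod_cast h
  exact Nat.pow_left_injective two_ne_zero h2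

/-- A transform of a Whittaker equation of the Painlevé type or confluent hypergeometric occurs
in the table. -/
lemma tableW_of_isPainleveOrConfluent {x : RatFunc ℂ} (hd : 2 ≤ coverDegree x) {k m : ℂ}
    (h : IsPainleveOrConfluent (pullback x (W k m))) :
    ∃ T J, TableW k m (zeroType x) (poleType x) T J := by
  have hx : Nonconst x := Nonconst.of_coverDegree (by omega)
  obtain ⟨J, hJ⟩ := h
  obtain ⟨g, hg⟩ := hJ.exists_shape
  have hx' := subst_nonconst (nonconst_mob g) hx
  simp only [pullback_pullback (nonconst_mob g) hx, W_eq_genPot] at hg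
  have hpos : ∀ μ ∈ zeroType x, 0 < μ := fun μ => zeroType_pos hx.ne_zero
  have hsum := zeroType_sum x
  have hsum' := poleType_sum x
  rw [← zeroType_subst_mob (g := g) hx.ne_zero] at hpos hsum ⊢
  rw [← poleType_subst_mob (g := g) hx.ne_zero] at hsum' ⊢
  rw [← hsum'] at hd hsum
  clear hsum'
  generalize subst (mob g) x = y at *
  have hf : IsPoleRule (1 / 4) (-k) fun n => 2 * n + 2 := Or.inl ⟨by norm_num, rfl⟩
  rcases hg with h | h | ⟨M, hM, h⟩ | ⟨M, hM, N, hN, h⟩ | ⟨M, hM, h⟩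
  -- target P1: its pole order `7` is odd, while those of the transform are `2 ν + 2`
  · obtain ⟨⟨ν, hν, e⟩, -⟩ := h.types hx' hf (by norm_num)
    omega
  -- target P2, pole order `8 = 2 · 3 + 2`
  · obtain ⟨⟨ν, hν, e⟩, h1, h2, h3⟩ := h.types hx' hf (by norm_num)
    obtain rfl : ν = 3 := by omega
    rw [hν] at hsum hd ⊢
    rw [Multiset.sum_singleton] at hsum
    obtain h4 | h4 | h4 : (zeroType y).card = 0 ∨ (zeroType y).card = 1 ∨ (zeroType y).card = 2 := by
      omega
    · rw [Multiset.card_eq_zero.mp h4] at hsum; simp at hsum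
    · obtain ⟨a, ha⟩ := Multiset.card_eq_one.mp h4
      rw [ha, Multiset.sum_singleton] at hsum
      subst hsum
      rw [ha] at h3 ⊢
      have h5 := h3 3 (by simp)
      push_cast at h5
      rcases h5 with h5 | h5
      · exact ⟨_, _, .P2sym' k m (by linear_combination h5 / 36)⟩
      · exact ⟨_, _, .P2sym k m (by linear_combination h5 / 36)⟩
    · have h5 := h2 h4
      obtain ⟨a, b, hab⟩ := Multiset.card_eq_two.mp h4
      rw [hab] at h5 hsum
      have := natCast_sq_inj (h5 a (by simp)) (h5 b (by simp))
      simp at hsum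
      omega
  -- targets P34, P4 and the confluent hypergeometric equations
  · rw [Finset.mem_Icc] at hM
    obtain ⟨⟨ν, hν, e⟩, μ₀, rest, hZ, hrest⟩ := h.types hx' hf (by omega)
    rw [hν, Multiset.sum_singleton] at hd hsum
    obtain rfl : ν = 2 := by omega
    rw [hν]
    rcases eq_of_sum_eq_two hpos hsum with h2 | h2
    · rw [h2]
      by_cases hm : m ^ 2 = (1 / 4) ^ 2
      · exact ⟨_, _, .Weber k m hm⟩
      · exact ⟨_, _, .P4sym k m hm⟩
    · have hr : rest = {1} := by
        rw [h2] at hZ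
        have h3 : μ₀ ∈ ({1, 1} : Multiset ℕ) := by rw [hZ]; simp
        obtain rfl : μ₀ = 1 := by simpa using h3
        exact ((Multiset.cons_inj_right 1).mp hZ).symm
      obtain ⟨h4, h5⟩ := hrest 1 (by rw [hr]; simp)
      have hk : k = 0 := by simpa using h5 rfl
      rw [h2, hk]
      exact ⟨_, _, .P4Her m (by push_cast at h4; linear_combination h4 / 4)⟩
  -- targets P3: both pole orders have to be `4`
  · rw [Finset.mem_Icc] at hM hN
    obtain ⟨⟨ν₁, ν₂, hν, e₁, e₂⟩, h1, h2⟩ := h.types hx' hf (by omega) (by omega)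
    obtain rfl : ν₁ = 1 := by omega
    obtain rfl : ν₂ = 1 := by omega
    rw [hν] at hsum ⊢
    rcases eq_of_sum_eq_two hpos hsum with h3 | h3
    · rw [h3] at h2 ⊢
      have h4 := h2 2 (by simp)
      exact ⟨_, _, .D6alg k m (by push_cast at h4; linear_combination h4 / 16)⟩
    · rw [h3] at h1; simp at h1
  -- targets P5: the pole order is at most `4`, so that `ν = 1` is the degree
  · rw [Finset.mem_Icc] at hM
    obtain ⟨ν, hν, e⟩ := h.types hx' hf (by omega)
    rw [hν, Multiset.sum_singleton] at hd
    omega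

/-! ### Covers with even branching over zero and infinity -/

/-- A rational function all of whose orders are even is a square, here written as
`y² / 16`. -/
lemma exists_sq_div {x : RatFunc ℂ} (hx : x ≠ 0) (hZ : ∀ μ ∈ zeroType x, Even μ)
    (hP : ∀ μ ∈ poleType x, Even μ) :
    ∃ y : RatFunc ℂ, x = y ^ 2 / 16 ∧ zeroType x = (zeroType y).map (2 * ·) ∧
      poleType x = (poleType y).map (2 * ·) := by
  obtain ⟨S, hS⟩ := exists_zeroSet hx
  obtain ⟨T, hT⟩ := exists_poleSet hx
  have hev : ∀ c, Even (ord x c) := by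
    intro c
    rcases lt_trichotomy (ord x c) 0 with h | h | h
    · have := hP _ (by rw [poleType_eq hT]; exact Multiset.mem_map_of_mem _ ((hT c).mpr h))
      rw [← Int.even_coe_nat, Int.toNat_of_nonneg (by omega)] at this
      simpa using this
    · rw [h]; exact Even.zero
    · have := hZ _ (by rw [zeroType_eq hx hS]; exact Multiset.mem_map_of_mem _ ((hS c).mpr h))
      rwa [← Int.even_coe_nat, Int.toNat_of_nonneg (by omega)] at this
  obtain ⟨D, hD⟩ := exists_support x
  have hprod : ∀ E : Finset ℂ, (∏ a ∈ E, (X - C a) ^ (ord x a / 2) : RatFunc ℂ) ≠ 0 ∧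
      ∀ b : ℂ, ord (∏ a ∈ E, (X - C a) ^ (ord x a / 2)) b = if b ∈ E then ord x b / 2 else 0 := by
    classical
    intro E
    induction E using Finset.induction_on with
    | empty => exact ⟨by simp, fun b => by simp [ord_one]⟩
    | insert a E ha ih =>
      have h1 := zpow_ne_zero (ord x a / 2) (X_sub_C_ne_zero a)
      rw [Finset.prod_insert ha]
      refine ⟨mul_ne_zero h1 ih.1, fun b => ?_⟩
      rw [ord_mul h1 ih.1, ih.2, ord_zpow, ord_X_sub_C_coe]
      by_cases hb : b = a
      · subst hb; simp [ha]
      · simp [hb]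
  obtain ⟨hy0, hord⟩ := hprod D
  generalize (∏ a ∈ D, (X - C a) ^ (ord x a / 2) : RatFunc ℂ) = y₀ at hy0 hord
  obtain ⟨κ, hκ, e⟩ := eq_C_mul_of_ord_eq hx (pow_ne_zero 2 hy0) (by
    intro a
    rw [ord_pow, hord]
    obtain ⟨r, hr⟩ := hev a
    by_cases ha : a ∈ D
    · rw [if_pos ha, hr]; push_cast; omega
    · rw [if_neg ha]
      by_contra h
      exact ha (hD a (by simpa using h)))
  obtain ⟨σ, hσ⟩ := IsAlgClosed.exists_pow_nat_eq κ (n := 2) two_pos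
  have hσ0 : σ ≠ 0 := by rintro rfl; exact hκ (by simpa using hσ.symm)
  have hy : C (4 * σ) * y₀ ≠ 0 := mul_ne_zero
    ((map_ne_zero C).mpr (mul_ne_zero (by norm_num) hσ0)) hy0
  have hxy : x = (C (4 * σ) * y₀) ^ 2 / 16 := by
    rw [e, ← hσ, map_mul, map_pow, map_ofNat]; ring
  generalize C (4 * σ) * y₀ = y at hy hxy
  have h2 : ∀ c, ord x c = 2 * ord y c := by
    intro c
    have h16 : (16 : RatFunc ℂ) = C 16 := (map_ofNat C 16).symm
    rw [hxy, h16, ord_div (pow_ne_zero 2 hy) ((map_ne_zero C).mpr (by norm_num)), ord_pow, ord_C]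
    push_cast; ring
  refine ⟨y, hxy, ?_, ?_⟩
  · rw [zeroType_eq hx hS, zeroType_eq hy (S := S) (fun c => by rw [hS, h2]; omega),
      Multiset.map_map]
    exact Multiset.map_congr rfl fun c _ => by
      rw [h2, Function.comp_apply]; omega
  · rw [poleType_eq hT, poleType_eq (S := T) (fun c => by rw [hT, h2]; omega),
      Multiset.map_map]
    exact Multiset.map_congr rfl fun c _ => by
      rw [h2, Function.comp_apply]; omega

lemma exists_sq_div_of_types {x : RatFunc ℂ} (hx : x ≠ 0) {Z P : Multiset ℕ}
    (hZ : zeroType x = Z.map (2 * ·)) (hP : poleType x = P.map (2 * ·)) :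
    ∃ y : RatFunc ℂ, x = y ^ 2 / 16 ∧ zeroType y = Z ∧ poleType y = P := by
  have hev : ∀ s : Multiset ℕ, ∀ μ ∈ s.map (2 * ·), Even μ := by
    intro s μ hμ
    obtain ⟨a, -, rfl⟩ := Multiset.mem_map.mp hμ
    exact even_two_mul a
  obtain ⟨y, hy, h1, h2⟩ := exists_sq_div hx (hZ ▸ hev Z) (hP ▸ hev P)
  have hinj : Function.Injective (Multiset.map (2 * · : ℕ → ℕ)) :=
    Multiset.map_injective fun a b h => by simpa using h
  exact ⟨y, hy, hinj (h1.symm.trans hZ), hinj (h2.symm.trans hP)⟩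

/-- A transform of a degenerate Whittaker equation of the Painlevé type or confluent
hypergeometric occurs in the table, or it is a transform of a Whittaker equation that does. -/
lemma tableDW_of_isPainleveOrConfluent {x : RatFunc ℂ} (hd : 2 ≤ coverDegree x) {m : ℂ}
    (h : IsPainleveOrConfluent (pullback x (DW m))) :
    (∃ T J, TableDW m (zeroType x) (poleType x) T J) ∨
      ∃ y : RatFunc ℂ, x = y ^ 2 / 16 ∧ ∃ T J, TableW 0 (2 * m) (zeroType y) (poleType y) T J := by
  have hx : Nonconst x := Nonconst.of_coverDegree (by omega)
  obtain ⟨J, hJ⟩ := h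
  obtain ⟨g, hg⟩ := hJ.exists_shape
  have hx' := subst_nonconst (nonconst_mob g) hx
  simp only [pullback_pullback (nonconst_mob g) hx, DW_eq_genPot] at hg
  have hpos : ∀ μ ∈ zeroType x, 0 < μ := fun μ => zeroType_pos hx.ne_zero
  have hsum : (zeroType x).sum = (poleType x).sum := (zeroType_sum x).trans (poleType_sum x).symm
  rw [← poleType_sum x] at hd
  have hsq : ∀ Z P : Multiset ℕ, zeroType x = Z.map (2 * ·) → poleType x = P.map (2 * ·) →
      (∃ T J, TableW 0 (2 * m) Z P T J) →
      ∃ y : RatFunc ℂ, x = y ^ 2 / 16 ∧ ∃ T J, TableW 0 (2 * m) (zeroType y) (poleType y) T J := by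
    intro Z P hZ hP hT
    obtain ⟨y, hy, rfl, rfl⟩ := exists_sq_div_of_types hx.ne_zero hZ hP
    exact ⟨y, hy, hT⟩
  have key := fun M hM => IrrInftyApparent.types (M := M) hx' (A := 0) (B := 1) (m := m)
    (Or.inr ⟨rfl, one_ne_zero, rfl⟩) hM
  have key2 := fun M hM => IrrInftyTwo.types (M := M) hx' (A := 0) (B := 1) (m := m)
    (Or.inr ⟨rfl, one_ne_zero, rfl⟩) hM
  have key3 := fun M N hM hN => IrrInftyZero.types (M := M) (N := N) hx' (A := 0) (B := 1) (m := m)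
    (Or.inr ⟨rfl, one_ne_zero, rfl⟩) hM hN
  have key4 := fun M hM => IrrOne.types (M := M) hx' (A := 0) (B := 1) (m := m)
    (Or.inr ⟨rfl, one_ne_zero, rfl⟩) hM
  simp only [zeroType_subst_mob (g := g) hx.ne_zero,
    poleType_subst_mob (g := g) hx.ne_zero] at key key2 key3 key4
  generalize zeroType x = Z at *
  generalize poleType x = P at *
  have htwo : P = {2} → ∃ T J, TableDW m Z P T J := by
    rintro rfl
    rcases eq_of_sum_eq_two hpos hsum with rfl | rfl
    · by_cases hm : m ^ 2 = (1 / 4) ^ 2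
      · exact ⟨_, _, .Kummer' m hm⟩
      · exact ⟨_, _, .Kummer m hm⟩
    · exact ⟨_, _, .P5rat m⟩
  have hcard : Z.card ≠ 0 := by
    intro h
    rw [Multiset.card_eq_zero.mp h, Multiset.sum_zero] at hsum
    omega
  rcases hg with h | h | ⟨M, hM, h⟩ | ⟨M, hM, N, hN, h⟩ | ⟨M, hM, h⟩
  -- target P1, pole order `7 = 5 + 2`
  · left
    obtain ⟨⟨ν, rfl, e⟩, h1, h2, h3⟩ := key _ (by norm_num) h
    obtain rfl : ν = 5 := by omega
    rw [Multiset.sum_singleton] at hsum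
    obtain h4 | h4 : Z.card = 1 ∨ Z.card = 2 := by omega
    · obtain ⟨a, rfl⟩ := Multiset.card_eq_one.mp h4
      rw [Multiset.sum_singleton] at hsum
      subst hsum
      have h5 := h3 5 (by simp)
      push_cast at h5
      rcases h5 with h5 | h5
      · exact ⟨_, _, .P1sym' m (by linear_combination h5 / 100)⟩
      · exact ⟨_, _, .P1sym m (by linear_combination h5 / 100)⟩
    · have h5 := h2 h4
      obtain ⟨a, b, rfl⟩ := Multiset.card_eq_two.mp h4
      have := natCast_sq_inj (h5 a (by simp)) (h5 b (by simp))
      simp at hsum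
      omega
  -- target P2, pole order `8 = 6 + 2`; a single sixfold zero is the square of a triple one
  · obtain ⟨⟨ν, rfl, e⟩, h1, h2, h3⟩ := key _ (by norm_num) h
    obtain rfl : ν = 6 := by omega
    rw [Multiset.sum_singleton] at hsum
    obtain h4 | h4 : Z.card = 1 ∨ Z.card = 2 := by omega
    · right
      obtain ⟨a, rfl⟩ := Multiset.card_eq_one.mp h4
      rw [Multiset.sum_singleton] at hsum
      subst hsum
      have h5 := h3 6 (by simp)
      push_cast at h5
      refine hsq {3} {3} rfl rfl ?_
      rcases h5 with h5 | h5
      · exact ⟨_, _, .P2sym' 0 _ (by linear_combination h5 / 36)⟩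
      · exact ⟨_, _, .P2sym 0 _ (by linear_combination h5 / 36)⟩
    · left
      have h5 := h2 h4
      obtain ⟨a, b, rfl⟩ := Multiset.card_eq_two.mp h4
      have h6 := natCast_sq_inj (h5 a (by simp)) (h5 b (by simp))
      subst h6
      obtain rfl : a = 3 := by simp at hsum; omega
      have h7 := h5 3 (by simp)
      exact ⟨_, _, .P2rat m (by push_cast at h7; linear_combination h7 / 36)⟩
  -- targets P34, P4 and the confluent hypergeometric equations; a simple zero of `x` is always
  -- a singular point of the transform of `DW`, so that the regular zeros are multiple
  · rw [Finset.mem_Icc] at hM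
    obtain ⟨⟨ν, rfl, e⟩, μ₀, rest, rfl, hrest⟩ := key2 _ (by omega) h
    rw [Multiset.sum_singleton] at hd hsum
    have hμ₀ := hpos μ₀ (Multiset.mem_cons_self _ _)
    have hge : ∀ μ ∈ rest, 2 ≤ μ := by
      intro μ hμ
      have h1 := hpos μ (Multiset.mem_cons_of_mem hμ)
      have h2 : μ ≠ 1 := fun h => one_ne_zero ((hrest μ hμ).2 h)
      omega
    rw [Multiset.sum_cons] at hsum
    obtain rfl | rfl | rfl : ν = 2 ∨ ν = 3 ∨ ν = 4 := by omega
    · exact Or.inl (htwo rfl)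
    · left
      rcases eq_of_sum_le_three hge (by omega) with rfl | rfl | rfl
      · rw [Multiset.sum_zero] at hsum
        obtain rfl : μ₀ = 3 := by omega
        by_cases hm : m ^ 2 = (1 / 6) ^ 2
        · exact ⟨_, _, .Airy m hm⟩
        · exact ⟨_, _, .P34sym m hm⟩
      · rw [Multiset.sum_singleton] at hsum
        obtain rfl : μ₀ = 1 := by omega
        have h1 := (hrest 2 (by simp)).1
        have e : (1 ::ₘ {2} : Multiset ℕ) = {2, 1} := Multiset.pair_comm 1 2
        rw [e]
        exact ⟨_, _, .P34rat m (by push_cast at h1; linear_combination h1 / 16)⟩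
      · rw [Multiset.sum_singleton] at hsum
        omega
    · rcases eq_of_sum_le_three hge (by omega) with rfl | rfl | rfl
      · right
        rw [Multiset.sum_zero] at hsum
        obtain rfl : μ₀ = 4 := by omega
        refine hsq {2} {2} rfl rfl ?_
        by_cases hm : (2 * m) ^ 2 = (1 / 4) ^ 2
        · exact ⟨_, _, .Weber 0 _ hm⟩
        · exact ⟨_, _, .P4sym 0 _ hm⟩
      · right
        rw [Multiset.sum_singleton] at hsum
        obtain rfl : μ₀ = 2 := by omega
        have h1 := (hrest 2 (by simp)).1
        refine hsq {1, 1} {2} rfl rfl ?_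
        exact ⟨_, _, .P4Her _ (by push_cast at h1; linear_combination h1 / 4)⟩
      · left
        rw [Multiset.sum_singleton] at hsum
        obtain rfl : μ₀ = 1 := by omega
        have h1 := (hrest 3 (by simp)).1
        have e : (1 ::ₘ {3} : Multiset ℕ) = {3, 1} := Multiset.pair_comm 1 3
        rw [e]
        exact ⟨_, _, .P4rat m (by push_cast at h1; linear_combination h1 / 36)⟩
  -- targets P3
  · rw [Finset.mem_Icc] at hM hN
    obtain ⟨⟨ν₁, ν₂, rfl, e₁, e₂⟩, h1, h2⟩ := key3 _ _ (by omega) (by omega) h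
    obtain ⟨a, rfl⟩ := Multiset.card_eq_one.mp (show Z.card = 1 by omega)
    have h3 := h2 a (by simp)
    simp only [Multiset.sum_singleton, Multiset.insert_eq_cons, Multiset.sum_cons] at hsum
    obtain rfl | rfl : ν₁ = 1 ∨ ν₁ = 2 := by omega
    · obtain rfl | rfl : ν₂ = 1 ∨ ν₂ = 2 := by omega
      · left
        subst hsum
        exact ⟨_, _, .D8alg m (by push_cast at h3; linear_combination h3 / 16)⟩
      · left
        subst hsum
        have e : ({1, 2} : Multiset ℕ) = {2, 1} := Multiset.pair_comm 1 2
        rw [e]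
        exact ⟨_, _, .D7alg m (by push_cast at h3; linear_combination h3 / 36)⟩
    · obtain rfl | rfl : ν₂ = 1 ∨ ν₂ = 2 := by omega
      · left
        subst hsum
        exact ⟨_, _, .D7alg m (by push_cast at h3; linear_combination h3 / 36)⟩
      · right
        subst hsum
        refine hsq {2} {1, 1} rfl rfl ?_
        exact ⟨_, _, .D6alg 0 _ (by push_cast at h3; linear_combination h3 / 16)⟩
  · rw [Finset.mem_Icc] at hM
    obtain ⟨ν, rfl, e⟩ := key4 _ (by omega) h
    rw [Multiset.sum_singleton] at hd
    exact Or.inl (htwo (by rw [show ν = 2 by omega]))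

/-! ### The explicit potentials as linear equations of solutions -/

lemma potD6alg_eq {k t s : ℂ} (hs : s ≠ 0) (ht : s ^ 2 = t) :
    potD6alg k t s = (familyP3 (-8 * k) (8 * k) 4 (-4)).potential t (-s) (-3 / (4 * s)) := by
  subst ht
  have e1 : (-s) ^ 2 * (-3 / (4 * s)) ^ 2 - -s * (-3 / (4 * s)) - -(-4) / 16 * (s ^ 2) ^ 2 / (-s) ^ 2
      - -(8 * k) / 8 * s ^ 2 / -s - -8 * k / 8 * -s - 4 / 16 * (-s) ^ 2 =
      -((8 * s ^ 2 + 32 * k * s + 3) / 16) := by field_simp; ring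
  have e2 : -3 / (4 * s) * -s = 3 / 4 := by field_simp
  have e3 : -(-4) / 16 * (s ^ 2) ^ 2 = (s ^ 2) ^ 2 / 4 := by ring
  have e4 : -(8 * k) / 8 * s ^ 2 = -(k * s ^ 2) := by ring
  have e5 : -8 * k / 8 = -k := by ring
  have e6 : (4 : ℂ) / 16 = 1 / 4 := by norm_num
  have h0 := X_add_C_ne_zero s
  have hX : (X : RatFunc ℂ) ≠ 0 := X_ne_zero
  simp only [familyP3, potD6alg]
  rw [e1, e2, e3, e4, e5, e6, map_neg C s, sub_neg_eq_add]
  simp only [map_neg, map_div₀, map_ofNat, map_one]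
  field_simp
  ring

lemma potD8alg_eq {h t s : ℂ} (hs : s ≠ 0) (ht : s ^ 2 = t) :
    potD8alg h t s = (familyP3 (8 * h) (-8 * h) 0 0).potential t (-s) (-3 / (4 * s)) := by
  subst ht
  have e1 : (-s) ^ 2 * (-3 / (4 * s)) ^ 2 - -s * (-3 / (4 * s)) - -0 / 16 * (s ^ 2) ^ 2 / (-s) ^ 2
      - -(-8 * h) / 8 * s ^ 2 / -s - 8 * h / 8 * -s - 0 / 16 * (-s) ^ 2 =
      (32 * h * s - 3) / 16 := by field_simp; ring
  have e2 : -3 / (4 * s) * -s = 3 / 4 := by field_simp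
  have e3 : (-0 : ℂ) / 16 * (s ^ 2) ^ 2 = 0 := by ring
  have e4 : -(-8 * h) / 8 * s ^ 2 = h * s ^ 2 := by ring
  have e5 : 8 * h / 8 = h := by ring
  have e6 : (0 : ℂ) / 16 = 0 := by norm_num
  have h0 := X_add_C_ne_zero s
  have hX : (X : RatFunc ℂ) ≠ 0 := X_ne_zero
  simp only [familyP3, potD8alg]
  rw [e1, e2, e3, e4, e5, e6, map_neg C s, sub_neg_eq_add]
  simp only [map_div₀, map_ofNat, map_zero]
  field_simp
  ring

lemma potD7alg_eq {t s : ℂ} (hs : s ≠ 0) (ht : s ^ 3 = t) :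
    potD7alg t s = (familyP3 0 (-2) 2 0).potential t s (2 / (3 * s)) := by
  subst ht
  have e1 : s ^ 2 * (2 / (3 * s)) ^ 2 - s * (2 / (3 * s)) - -0 / 16 * (s ^ 3) ^ 2 / s ^ 2
      - -(-2) / 8 * s ^ 3 / s - 0 / 8 * s - 2 / 16 * s ^ 2 =
      -((16 + 27 * s ^ 2) / 72) := by field_simp; ring
  have e2 : 2 / (3 * s) * s = 2 / 3 := by field_simp
  have e3 : (-0 : ℂ) / 16 * (s ^ 3) ^ 2 = 0 := by ring
  have e4 : -(-2) / 8 * s ^ 3 = s ^ 3 / 4 := by ring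
  have e5 : (0 : ℂ) / 8 = 0 := by ring
  have e6 : (2 : ℂ) / 16 = 1 / 8 := by norm_num
  have h0 := X_sub_C_ne_zero s
  have hX : (X : RatFunc ℂ) ≠ 0 := X_ne_zero
  have hC : C s ≠ 0 := (map_ne_zero C).mpr hs
  simp only [familyP3, potD7alg]
  rw [e1, e2, e3, e4, e5, e6]
  simp only [map_neg, map_mul, map_div₀, map_ofNat, map_zero, map_one]
  field_simp
  ring

lemma potP4Her_eq (t : ℂ) : potP4Her t = (familyP4 0 (-2)).potential t (-2 * t) 0 := by
  have e1 : 2 * (-2 * t) * 0 ^ 2 - 2 * 0 - 2 * (-(-2) / 8 - 1 / 4) / (-2 * t)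
      - 2 * (-0 / 4) * (-2 * t) - 2 * (-2 * t) * ((-2 * t + 2 * t) / 4) ^ 2 = 0 := by
    norm_num
  have e2 : (-(-2) / 8 - 1 / 4 : ℂ) = 0 := by norm_num
  simp only [familyP4, potP4Her]
  rw [e1, e2]
  simp

lemma potP4rat_eq {t : ℂ} (ht : t ≠ 0) :
    potP4rat t = (familyP4 0 (-2 / 9)).potential t (-2 * t / 3) (-1 / (2 * t)) := by
  have e1 : 2 * (-2 * t / 3) * (-1 / (2 * t)) ^ 2 - 2 * (-1 / (2 * t))
      - 2 * (-(-2 / 9) / 8 - 1 / 4) / (-2 * t / 3)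
      - 2 * (-0 / 4) * (-2 * t / 3) - 2 * (-2 * t / 3) * ((-2 * t / 3 + 2 * t) / 4) ^ 2 =
      2 * (2 * t ^ 3 / 27) := by
    field_simp; ring
  have e2 : (-(-2 / 9) / 8 - 1 / 4 : ℂ) = -2 / 9 := by norm_num
  have e3 : -1 / (2 * t) * (-2 * t / 3) = 1 / 3 := by field_simp
  have h0 : (3 : RatFunc ℂ) * X + C (2 * t) ≠ 0 := by
    have := lin_ne_zero (three_ne_zero (α := ℂ) ) (2 * t)
    rwa [map_ofNat] at this
  have h1 : X - C (-2 * t / 3) = (3 * X + C (2 * t)) / 3 := by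
    rw [show -2 * t / 3 = -(2 * t / 3) by ring, map_neg, map_div₀, map_ofNat]; ring
  have hX : (X : RatFunc ℂ) ≠ 0 := X_ne_zero
  simp only [familyP4, potP4rat]
  rw [e1, e2, e3, h1, map_mul C 2 (2 * t ^ 3 / 27), map_div₀ C (-2) 9, map_div₀ C 1 3]
  simp only [map_neg, map_ofNat, map_zero, map_one, neg_zero, zero_div, add_zero]
  generalize C (2 * t) = c at *
  field_simp
  ring

lemma potP34rat_eq {t : ℂ} (ht : t ≠ 0) :
    potP34rat t = (familyP34 (1 / 4)).potential t (t / 2) (1 / (2 * t)) := by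
  have e1 : -(t / 2) * (1 / (2 * t)) ^ 2 + 1 / (2 * t) + (t / 2) ^ 2 / 2 - t * (t / 2) / 2 +
      (1 / 4 - 1) / (4 * (t / 2)) = -((t ^ 3 / 4 + 1) / (2 * t)) + 1 / (2 * t) := by
    field_simp; ring
  have e2 : ((1 / 4 - 1) / 4 : ℂ) = -(3 / 16) := by norm_num
  have h0 := X_sub_C_ne_zero (t / 2)
  have hX : (X : RatFunc ℂ) ≠ 0 := X_ne_zero
  simp only [familyP34, potP34rat]
  rw [split_tail, e1, e2]
  simp only [map_neg, map_add, map_div₀ C (3 : ℂ), map_ofNat]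
  field_simp
  ring

lemma potP5rat_eq {m h t : ℂ} :
    potP5rat m h t =
      (familyP5 (2 * m ^ 2) (-2 * m ^ 2) 0 (-2 * h)).potential t (-1) (-3 / 4) := by
  have e1 : (-1 : ℂ) * (-1 - 1) ^ 2 * (-(-(-2 * h) / 2) * t ^ 2 / (-1 - 1) ^ 4 -
      -0 / 2 * t / (-1 - 1) ^ 3 + (-3 / 4) ^ 2 - (1 / -1 + 1 / (-1 - 1)) * (-3 / 4) -
      ((2 * m ^ 2 + -2 * m ^ 2) / 2 - 3 / 4) / (-1 - 1) ^ 2 - (-(-2 * m ^ 2) / 2 - 1 / 4) / (-1) ^ 2)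
      = (16 * m ^ 2 + h * t ^ 2) / 4 + 1 / 2 := by
    norm_num; ring
  have e2 : (-(-2 * m ^ 2) / 2 - 1 / 4 : ℂ) = (4 * m ^ 2 - 1) / 4 := by ring
  have e3 : (-3 / 4 : ℂ) * (-1 - 1) * -1 = -3 / 2 := by norm_num
  have e4 : (2 * m ^ 2 + -2 * m ^ 2) / 2 - 3 / 4 = -3 / 4 := by ring
  have e5 : -(-2 * h) / 2 * t ^ 2 = h * t ^ 2 := by ring
  have e6 : (-0 : ℂ) / 2 * t = 0 := by ring
  have h0 : (X : RatFunc ℂ) - 1 ≠ 0 := by simpa using X_sub_C_ne_zero 1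
  have h1 : (X : RatFunc ℂ) + 1 ≠ 0 := by simpa using X_add_C_ne_zero 1
  have hX : (X : RatFunc ℂ) ≠ 0 := X_ne_zero
  simp only [familyP5, potP5rat]
  rw [e1, e2, e3, e4, e5, e6]
  simp only [map_neg, map_add, map_sub, map_div₀, map_ofNat, map_one, map_zero, sub_neg_eq_add]
  field_simp
  ring

lemma potP2rat_eq (t : ℂ) : potP2rat t = (familyP2 0).potential t 0 0 := by
  simp only [familyP2, potP2rat]
  simp
  ring

/-! ### Families with the apparent singularity split off -/

lemma familyP1_potential (t q p : ℂ) : familyP1.potential t q p =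
    withTail (4 * X ^ 3 + C (2 * t) * X + C (2 * (p ^ 2 / 2 - 2 * q ^ 3 - t * q))) q 1 (-p) := by
  simp only [familyP1, withTail]
  rw [three_quarters, map_neg C p]; ring

lemma familyP2_potential (α t q p : ℂ) : (familyP2 α).potential t q p =
    withTail (X ^ 4 + C t * X ^ 2 + C (2 * α) * X +
      C (2 * (p ^ 2 / 2 - q ^ 4 / 2 - t * q ^ 2 / 2 - α * q))) q 1 (-p) := by
  simp only [familyP2, withTail]
  rw [three_quarters, map_neg C p]; ring

lemma familyP34_potential (α t q p : ℂ) : (familyP34 α).potential t q p =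
    withTail (X / 2 - C (t / 2) + C (p - (familyP34 α).hamiltonian t q p) / X +
      C ((α - 1) / 4) / X ^ 2) q 1 (-p) := by
  simp only [familyP34, withTail]
  rw [split_tail, three_quarters, map_sub C p, map_neg C p]; ring

lemma familyP34_degenerate (α t c q : ℂ) : (familyP34 α).degenerate t c =
    withTail (X / 2 - C (t / 2) + C c / X + C ((α - 1) / 4) / X ^ 2) q 0 0 := by
  rw [withTail_zero]
  simp only [familyP34]; ring

lemma familyP4_potential (α β t q p : ℂ) : (familyP4 α β).potential t q p =
    withTail (C (-α / 4) + ((X + C (2 * t)) / 4) ^ 2 +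
      C (p + (familyP4 α β).hamiltonian t q p / 2) / X + C (-β / 8 - 1 / 4) / X ^ 2) q 1 (-p) := by
  simp only [familyP4, withTail]
  rw [split_tail, three_quarters, map_add C p, map_div₀ C _ 2, map_ofNat, map_neg C p]
  ring

lemma familyP4_degenerate (α β t c q : ℂ) : (familyP4 α β).degenerate t c =
    withTail (C (-α / 4) + ((X + C (2 * t)) / 4) ^ 2 + C c / X + C (-β / 8 - 1 / 4) / X ^ 2)
      q 0 0 := by
  rw [withTail_zero]
  simp only [familyP4]; ring

lemma familyP3_potential (α β γ δ t q p : ℂ) : (familyP3 α β γ δ).potential t q p =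
    withTail (C (-δ / 16 * t ^ 2) / X ^ 4 + C (-β / 8 * t) / X ^ 3 +
      C (q ^ 2 * p ^ 2 - q * p - -δ / 16 * t ^ 2 / q ^ 2 - -β / 8 * t / q - α / 8 * q -
        γ / 16 * q ^ 2) / X ^ 2 + C (α / 8 + p) / X + C (γ / 16)) q 1 (-p) := by
  simp only [familyP3, withTail]
  rw [split_tail, three_quarters, map_add C (α / 8), map_neg C p]
  ring

/-! ### Normal forms of the covers -/

lemma exists_mob_affine {l : ℂ} (hl : l ≠ 0) (b : ℂ) :
    ∃ g : GL (Fin 2) ℂ, mob g = C l * X + C b := by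
  refine ⟨Matrix.GeneralLinearGroup.mkOfDetNeZero !![l, b; 0, 1] (by simpa using hl), ?_⟩
  simp [mob, mobDen, Matrix.GeneralLinearGroup.mkOfDetNeZero]

lemma map_eq_singleton_iff_exists {S : Finset (OnePoint ℂ)} {N : OnePoint ℂ → ℕ} {n : ℕ}
    (h : S.val.map N = {n}) : ∃ c, N c = n ∧ ∀ c', c' ∈ S ↔ c' = c := by
  obtain ⟨c, hc, e⟩ := Multiset.map_eq_singleton.mp h
  refine ⟨c, e, fun c' => ?_⟩
  rw [← Finset.mem_val, hc, Multiset.mem_singleton]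

lemma exists_of_map_eq_pair {S : Finset (OnePoint ℂ)} {N : OnePoint ℂ → ℕ} {n₁ n₂ : ℕ}
    (h : S.val.map N = {n₁, n₂}) :
    ∃ c₁ c₂, c₁ ≠ c₂ ∧ N c₁ = n₁ ∧ N c₂ = n₂ ∧ ∀ c', c' ∈ S ↔ c' = c₁ ∨ c' = c₂ := by
  classical
  obtain ⟨c₁, h₁, e₁, h'⟩ := (Multiset.map_eq_cons (f := N) _ _ _).mpr h
  obtain ⟨c₂, h₂, e₂⟩ := Multiset.map_eq_singleton.mp h'
  have hS : S.val = {c₁, c₂} := by rw [← Multiset.cons_erase h₁, h₂]; rfl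
  have hnd := S.nodup
  rw [hS] at hnd
  refine ⟨c₁, c₂, by simpa using hnd, e₁, e₂, fun c' => ?_⟩
  rw [← Finset.mem_val, hS]
  simp

section Fibres

variable {x : RatFunc ℂ} {n n₁ n₂ : ℕ}

lemma zeroType_singleton (hx : x ≠ 0) (h : zeroType x = {n}) :
    ∃ c, 0 < ord x c ∧ ord x c = n ∧ ∀ c', c' ≠ c → ord x c' ≤ 0 := by
  obtain ⟨S, hS⟩ := exists_zeroSet hx
  rw [zeroType_eq hx hS] at h
  obtain ⟨c, e, hc⟩ := map_eq_singleton_iff_exists h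
  have h1 := (hS c).mp ((hc c).mpr rfl)
  exact ⟨c, h1, by omega, fun c' h' => not_lt.mp fun h2 => h' ((hc c').mp ((hS c').mpr h2))⟩

lemma poleType_singleton (hx : x ≠ 0) (h : poleType x = {n}) :
    ∃ c, ord x c < 0 ∧ ord x c = -n ∧ ∀ c', c' ≠ c → 0 ≤ ord x c' := by
  obtain ⟨S, hS⟩ := exists_poleSet hx
  rw [poleType_eq hS] at h
  obtain ⟨c, e, hc⟩ := map_eq_singleton_iff_exists h
  have h1 := (hS c).mp ((hc c).mpr rfl)
  exact ⟨c, h1, by omega, fun c' h' => not_lt.mp fun h2 => h' ((hc c').mp ((hS c').mpr h2))⟩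

lemma zeroType_pair (hx : x ≠ 0) (h : zeroType x = {n₁, n₂}) :
    ∃ c₁ c₂, c₁ ≠ c₂ ∧ (0 < ord x c₁ ∧ ord x c₁ = n₁) ∧ (0 < ord x c₂ ∧ ord x c₂ = n₂) ∧
      ∀ c', c' ≠ c₁ → c' ≠ c₂ → ord x c' ≤ 0 := by
  obtain ⟨S, hS⟩ := exists_zeroSet hx
  rw [zeroType_eq hx hS] at h
  obtain ⟨c₁, c₂, hne, e₁, e₂, hc⟩ := exists_of_map_eq_pair h
  have h1 := (hS c₁).mp ((hc c₁).mpr (Or.inl rfl))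
  have h2 := (hS c₂).mp ((hc c₂).mpr (Or.inr rfl))
  refine ⟨c₁, c₂, hne, ⟨h1, by omega⟩, ⟨h2, by omega⟩, fun c' h' h'' => not_lt.mp fun h3 => ?_⟩
  rcases (hc c').mp ((hS c').mpr h3) with h4 | h4
  · exact h' h4
  · exact h'' h4

lemma poleType_pair (hx : x ≠ 0) (h : poleType x = {n₁, n₂}) :
    ∃ c₁ c₂, c₁ ≠ c₂ ∧ (ord x c₁ < 0 ∧ ord x c₁ = -n₁) ∧ (ord x c₂ < 0 ∧ ord x c₂ = -n₂) ∧
      ∀ c', c' ≠ c₁ → c' ≠ c₂ → 0 ≤ ord x c' := by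
  obtain ⟨S, hS⟩ := exists_poleSet hx
  rw [poleType_eq hS] at h
  obtain ⟨c₁, c₂, hne, e₁, e₂, hc⟩ := exists_of_map_eq_pair h
  have h1 := (hS c₁).mp ((hc c₁).mpr (Or.inl rfl))
  have h2 := (hS c₂).mp ((hc c₂).mpr (Or.inr rfl))
  refine ⟨c₁, c₂, hne, ⟨h1, by omega⟩, ⟨h2, by omega⟩, fun c' h' h'' => not_lt.mp fun h3 => ?_⟩
  rcases (hc c').mp ((hS c').mpr h3) with h4 | h4
  · exact h' h4
  · exact h'' h4

end Fibres

/-- If `g` takes `a` to `c`, then `g` takes no other point to `c`. -/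
lemma smul_eq_iff_of_eq {g : GL (Fin 2) ℂ} {a c : OnePoint ℂ} (h : g • a = c) (b : OnePoint ℂ) :
    g • b = c ↔ b = a := by
  rw [← h]; exact smul_left_cancel_iff g

lemma exists_coe_smul {g : GL (Fin 2) ℂ} {c c₁ : OnePoint ℂ} (h : g • OnePoint.infty = c₁)
    (hc : c ≠ c₁) : ∃ b : ℂ, g • (b : OnePoint ℂ) = c := by
  have e : g • (g⁻¹ • c) = c := smul_inv_smul g c
  generalize g⁻¹ • c = p at e
  induction p using OnePoint.rec with
  | infty => exact absurd (e.symm.trans h) hc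
  | coe b => exact ⟨b, e⟩

lemma ord_X_coe (a : ℂ) : ord X (a : OnePoint ℂ) = if a = 0 then 1 else 0 := by
  simpa using ord_X_sub_C_coe 0 a

section Normal

variable {x : RatFunc ℂ} {n n₁ n₂ : ℕ}

lemma subst_affine {l b : ℂ} {g : GL (Fin 2) ℂ} (hl : l ≠ 0)
    {y : RatFunc ℂ} (hy : subst (mob g) x = y) :
    ∃ (h : GL (Fin 2) ℂ) (hn : Nonconst (C l * X + C b)), subst (mob h) x =
      substHom (C l * X + C b) hn y := by
  obtain ⟨h, hh⟩ := exists_mob_affine hl b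
  have hn : Nonconst (C l * X + C b) := hh ▸ nonconst_mob h
  refine ⟨g * h, hn, ?_⟩
  rw [← subst_mob_mob, ← subst_subst (nonconst_mob h) (nonconst_mob g), hy, hh, substHom_apply]

/-- One zero and one pole: the cover is a power of the coordinate. -/
lemma exists_normal_pow (hx : Nonconst x) (hZ : zeroType x = {n}) (hP : poleType x = {n})
    {κ₀ : ℂ} (hκ₀ : κ₀ ≠ 0) : ∃ g, subst (mob g) x = C κ₀ * X ^ n := by
  obtain ⟨c₂, hz, hz', hz0⟩ := zeroType_singleton hx.ne_zero hZ
  obtain ⟨c₁, hp, hp', hp0⟩ := poleType_singleton hx.ne_zero hP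
  have hne : c₁ ≠ c₂ := by rintro rfl; omega
  obtain ⟨g, hg1, hg2⟩ := exists_mob_smul hne
  have hn : n ≠ 0 := by omega
  have hx' := (subst_nonconst (nonconst_mob g) hx).ne_zero
  obtain ⟨κ, hκ, e⟩ := eq_C_mul_of_ord_eq hx' (pow_ne_zero n X_ne_zero) (by
    intro a
    rw [ord_subst_mob g hx.ne_zero, ord_pow, ord_X_coe]
    by_cases ha : a = 0
    · subst ha; rw [hg2, hz', if_pos rfl, mul_one]
    · rw [if_neg ha, mul_zero]
      have h1 := hp0 (g • (a : OnePoint ℂ)) (by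
        rw [Ne, smul_eq_iff_of_eq hg1]; exact OnePoint.coe_ne_infty a)
      have h2 := hz0 (g • (a : OnePoint ℂ)) (by
        rw [Ne, smul_eq_iff_of_eq hg2]; exact fun h => ha (OnePoint.coe_injective h))
      omega)
  obtain ⟨l, hl⟩ := IsAlgClosed.exists_pow_nat_eq (κ₀ / κ) (Nat.pos_of_ne_zero hn)
  have hl0 : l ≠ 0 := by
    rintro rfl
    rw [zero_pow hn] at hl
    exact div_ne_zero hκ₀ hκ hl.symm
  obtain ⟨h, hn', e'⟩ := subst_affine (b := 0) hl0 e
  refine ⟨h, ?_⟩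
  rw [e', map_mul, map_pow, substHom_C, substHom_X, map_zero, add_zero, mul_pow, ← map_pow, hl,
    ← mul_assoc, ← map_mul]
  congr 2
  field_simp

/-- Two zeros and one pole. -/
lemma exists_normal_two_zeros (hx : Nonconst x) (hZ : zeroType x = {n₁, n₂})
    (hP : poleType x = {n}) {κ₀ : ℂ} (hκ₀ : κ₀ ≠ 0) :
    ∃ g b, b ≠ 0 ∧ subst (mob g) x = C κ₀ * X ^ n₂ * (X - C b) ^ n₁ := by
  obtain ⟨c₃, c₂, h32, ⟨hy, hy'⟩, ⟨hz, hz'⟩, hz0⟩ := zeroType_pair hx.ne_zero hZ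
  obtain ⟨c₁, hp, hp', hp0⟩ := poleType_singleton hx.ne_zero hP
  have hne : c₁ ≠ c₂ := by rintro rfl; omega
  have hne' : c₃ ≠ c₁ := by rintro rfl; omega
  obtain ⟨g, hg1, hg2⟩ := exists_mob_smul hne
  obtain ⟨b, hb⟩ := exists_coe_smul hg1 hne'
  have hb0 : b ≠ 0 := by rintro rfl; exact h32 (hb.symm.trans hg2)
  have hx' := (subst_nonconst (nonconst_mob g) hx).ne_zero
  have h1 := pow_ne_zero n₁ (X_sub_C_ne_zero b)
  have h2 := pow_ne_zero n₂ (X_ne_zero (K := ℂ))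
  obtain ⟨κ, hκ, e⟩ := eq_C_mul_of_ord_eq hx' (mul_ne_zero h2 h1) (by
    intro a
    rw [ord_subst_mob g hx.ne_zero, ord_mul h2 h1, ord_pow, ord_pow, ord_X_coe, ord_X_sub_C_coe]
    by_cases ha : a = 0
    · subst ha; rw [hg2, hz', if_pos rfl, if_neg hb0.symm, mul_one, mul_zero, add_zero]
    · rw [if_neg ha, mul_zero, zero_add]
      by_cases hab : a = b
      · subst hab; rw [hb, hy', if_pos rfl, mul_one]
      rw [if_neg hab, mul_zero]
      have h1 := hp0 (g • (a : OnePoint ℂ)) (by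
        rw [Ne, smul_eq_iff_of_eq hg1]; exact OnePoint.coe_ne_infty a)
      have h2 := hz0 (g • (a : OnePoint ℂ)) (by
        rw [Ne, smul_eq_iff_of_eq hb]; exact fun h => hab (OnePoint.coe_injective h)) (by
        rw [Ne, smul_eq_iff_of_eq hg2]; exact fun h => ha (OnePoint.coe_injective h))
      omega)
  have hn : 0 < n₁ + n₂ := by omega
  obtain ⟨l, hl⟩ := IsAlgClosed.exists_pow_nat_eq (κ₀ / κ) hn
  have hl0 : l ≠ 0 := by
    rintro rfl
    rw [zero_pow hn.ne'] at hl
    exact div_ne_zero hκ₀ hκ hl.symm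
  obtain ⟨h, hn', e'⟩ := subst_affine (b := 0) hl0 e
  refine ⟨h, b / l, div_ne_zero hb0 hl0, ?_⟩
  have hκ₀' : κ₀ = κ * l ^ n₂ * l ^ n₁ := by
    rw [mul_assoc, ← pow_add, add_comm n₂, hl]; field_simp
  have hCl := (map_ne_zero (C : ℂ →+* RatFunc ℂ)).mpr hl0
  have hlin : C l * X - C b = C l * (X - C (b / l)) := by
    rw [map_div₀]; field_simp
  rw [e', map_mul, map_mul, map_pow, map_pow, map_sub, substHom_C, substHom_C, substHom_X,
    map_zero, add_zero, hlin, mul_pow, mul_pow, hκ₀', map_mul, map_mul, map_pow, map_pow]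
  ring

/-- One zero and two poles. -/
lemma exists_normal_two_poles (hx : Nonconst x) (hZ : zeroType x = {n})
    (hP : poleType x = {n₁, n₂}) {κ₀ : ℂ} (hκ₀ : κ₀ ≠ 0) :
    ∃ g a, a ≠ 0 ∧ subst (mob g) x = C κ₀ * (X - C a) ^ n / X ^ n₂ := by
  obtain ⟨c₁, c₂, hne, ⟨hp, hp'⟩, ⟨hz, hz'⟩, hp0⟩ := poleType_pair hx.ne_zero hP
  obtain ⟨c₃, hy, hy', hz0⟩ := zeroType_singleton hx.ne_zero hZ
  have hne' : c₃ ≠ c₁ := by rintro rfl; omega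
  have h32 : c₃ ≠ c₂ := by rintro rfl; omega
  have hn : n = n₁ + n₂ := by
    have := (zeroType_sum x).trans (poleType_sum x).symm
    rw [hZ, hP] at this
    simpa using this
  obtain ⟨g, hg1, hg2⟩ := exists_mob_smul hne
  obtain ⟨b, hb⟩ := exists_coe_smul hg1 hne'
  have hb0 : b ≠ 0 := by rintro rfl; exact h32 (hb.symm.trans hg2)
  have hx' := (subst_nonconst (nonconst_mob g) hx).ne_zero
  have h1 := pow_ne_zero n (X_sub_C_ne_zero b)
  have h2 := pow_ne_zero n₂ (X_ne_zero (K := ℂ))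
  obtain ⟨κ, hκ, e⟩ := eq_C_mul_of_ord_eq hx' (div_ne_zero h1 h2) (by
    intro a
    rw [ord_subst_mob g hx.ne_zero, ord_div h1 h2, ord_pow, ord_pow, ord_X_coe, ord_X_sub_C_coe]
    by_cases ha : a = 0
    · subst ha; rw [hg2, hz', if_pos rfl, if_neg hb0.symm, mul_one, mul_zero, zero_sub]
    · rw [if_neg ha, mul_zero, sub_zero]
      by_cases hab : a = b
      · subst hab; rw [hb, hy', if_pos rfl, mul_one]
      rw [if_neg hab, mul_zero]
      have h1 := hp0 (g • (a : OnePoint ℂ)) (by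
        rw [Ne, smul_eq_iff_of_eq hg1]; exact OnePoint.coe_ne_infty a) (by
        rw [Ne, smul_eq_iff_of_eq hg2]; exact fun h => ha (OnePoint.coe_injective h))
      have h2 := hz0 (g • (a : OnePoint ℂ)) (by
        rw [Ne, smul_eq_iff_of_eq hb]; exact fun h => hab (OnePoint.coe_injective h))
      omega)
  have hn₁ : 0 < n₁ := by omega
  obtain ⟨l, hl⟩ := IsAlgClosed.exists_pow_nat_eq (κ₀ / κ) hn₁
  have hl0 : l ≠ 0 := by
    rintro rfl
    rw [zero_pow hn₁.ne'] at hl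
    exact div_ne_zero hκ₀ hκ hl.symm
  obtain ⟨h, hn', e'⟩ := subst_affine (b := 0) hl0 e
  refine ⟨h, b / l, div_ne_zero hb0 hl0, ?_⟩
  have hκ₀' : κ₀ = κ * l ^ n₁ := by rw [hl]; field_simp
  have hCl := (map_ne_zero (C : ℂ →+* RatFunc ℂ)).mpr hl0
  have hlin : C l * X - C b = C l * (X - C (b / l)) := by
    rw [map_div₀]; field_simp
  rw [e', map_mul, map_div₀, map_pow, map_pow, map_sub, substHom_C, substHom_C, substHom_X,
    map_zero, add_zero, hlin, mul_pow, mul_pow, hκ₀', map_mul, map_pow, hn, pow_add]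
  field_simp

/-- Two simple zeros and one double pole, which are put at `0`, `∞` and `1`. -/
lemma exists_normal_P5 (hx : Nonconst x) (hZ : zeroType x = {1, 1}) (hP : poleType x = {2}) :
    ∃ g h, h ≠ 0 ∧ subst (mob g) x = coverP5rat h 1 := by
  obtain ⟨c₁, c₂, hne, ⟨hy, hy'⟩, ⟨hz, hz'⟩, hz0⟩ := zeroType_pair hx.ne_zero hZ
  obtain ⟨c₃, hp, hp', hp0⟩ := poleType_singleton hx.ne_zero hP
  have hne' : c₃ ≠ c₁ := by rintro rfl; omega
  have h32 : c₃ ≠ c₂ := by rintro rfl; omega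
  obtain ⟨g, hg1, hg2⟩ := exists_mob_smul hne
  obtain ⟨b, hb⟩ := exists_coe_smul hg1 hne'
  have hb0 : b ≠ 0 := by rintro rfl; exact h32 (hb.symm.trans hg2)
  have hx' := (subst_nonconst (nonconst_mob g) hx).ne_zero
  have h1 := pow_ne_zero 2 (X_sub_C_ne_zero b)
  have h2 := X_ne_zero (K := ℂ)
  obtain ⟨κ, hκ, e⟩ := eq_C_mul_of_ord_eq hx' (div_ne_zero h2 h1) (by
    intro a
    rw [ord_subst_mob g hx.ne_zero, ord_div h2 h1, ord_pow, ord_X_coe, ord_X_sub_C_coe]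
    by_cases ha : a = 0
    · subst ha; rw [hg2, hz', if_pos rfl, if_neg hb0.symm]; norm_num
    · rw [if_neg ha]
      by_cases hab : a = b
      · subst hab; rw [hb, hp', if_pos rfl]; norm_num
      rw [if_neg hab, mul_zero]
      have h1 := hz0 (g • (a : OnePoint ℂ)) (by
        rw [Ne, smul_eq_iff_of_eq hg1]; exact OnePoint.coe_ne_infty a) (by
        rw [Ne, smul_eq_iff_of_eq hg2]; exact fun h => ha (OnePoint.coe_injective h))
      have h2 := hp0 (g • (a : OnePoint ℂ)) (by
        rw [Ne, smul_eq_iff_of_eq hb]; exact fun h => hab (OnePoint.coe_injective h))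
      omega)
  obtain ⟨h, hn', e'⟩ := subst_affine (b := 0) hb0 e
  refine ⟨h, 4 * (κ / b), mul_ne_zero (by norm_num) (div_ne_zero hκ hb0), ?_⟩
  have hCl := (map_ne_zero (C : ℂ →+* RatFunc ℂ)).mpr hb0
  have hlin : C b * X - C b = C b * (X - 1) := by ring
  have h3 : (X : RatFunc ℂ) - 1 ≠ 0 := by simpa using X_sub_C_ne_zero 1
  rw [e', map_mul, map_div₀, map_pow, map_sub, substHom_C, substHom_C, substHom_X,
    map_zero, add_zero, hlin, coverP5rat, one_pow, mul_one, map_mul C 4, map_ofNat, map_div₀]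
  field_simp

end Normal

/-! ### Singularity types -/

/-- The Poincaré rank of a singular point at which the potential has a pole of order `n`. -/
def rankOfOrder (n : ℕ) : ℚ := if 2 < n then (n : ℚ) / 2 - 1 else 0

lemma poincareRank_eq (V : RatFunc ℂ) (c : OnePoint ℂ) :
    poincareRank V c = rankOfOrder (poleOrder V c) := rfl

lemma IsApparentAt.poleOrder {V : RatFunc ℂ} {c : ℂ} (h : IsApparentAt V c) :
    poleOrder V c = 2 := by
  obtain ⟨b, hb⟩ := isApparentAt_iff.mp h
  have hz := (hasVal_X_sub_C c c).congr (sub_self c)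
  have h0 := X_sub_C_ne_zero c
  have h1 := (((hz.pow 2).mul hb).add (hasVal_C (3 / 4) c)).add ((hasVal_C b c).mul hz)
  refine poleOrder_of_hasVal 2 (v := 3 / 4) ?_ (by norm_num)
  convert h1 using 1
  · rw [map_div₀, map_ofNat, map_ofNat]; field_simp; ring
  · simp

section SingType

variable {V : RatFunc ℂ}

/-- Singularity type of an equation with one irregular singular point and without regular
singularities. -/
lemma hasSingularityType_one {c₀ : OnePoint ℂ} {M : ℕ} (hM : 0 < M) (h0 : poleOrder V c₀ = M)
    {A : Finset (OnePoint ℂ)} (hA : A.card ≤ 1) (hA0 : c₀ ∉ A)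
    (hA1 : ∀ c ∈ A, IsApparent V c ∧ 0 < poleOrder V c)
    (h : ∀ c, c ≠ c₀ → c ∉ A → poleOrder V c = 0) : HasSingularityType V {rankOfOrder M} := by
  refine ⟨{c₀}, A, Finset.disjoint_singleton_left.mpr hA0, hA, fun c hc => (hA1 c hc).1,
    fun c => ?_, ?_⟩
  · rw [Finset.mem_singleton]
    constructor
    · intro hc
      by_contra! h'
      exact absurd (h c h'.1 h'.2) hc.ne'
    · rintro (rfl | hc)
      · omega
      · exact (hA1 c hc).2
  · rw [Finset.singleton_val, Multiset.map_singleton, poincareRank_eq, h0]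

lemma hasSingularityType_two {c₀ c₁ : OnePoint ℂ} (hne : c₀ ≠ c₁) {M N : ℕ} (hM : 0 < M)
    (hN : 0 < N) (h0 : poleOrder V c₀ = M) (h1 : poleOrder V c₁ = N)
    {A : Finset (OnePoint ℂ)} (hA : A.card ≤ 1) (hA0 : c₀ ∉ A) (hA0' : c₁ ∉ A)
    (hA1 : ∀ c ∈ A, IsApparent V c ∧ 0 < poleOrder V c)
    (h : ∀ c, c ≠ c₀ → c ≠ c₁ → c ∉ A → poleOrder V c = 0) :
    HasSingularityType V {rankOfOrder M, rankOfOrder N} := by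
  classical
  refine ⟨{c₀, c₁}, A, ?_, hA, fun c hc => (hA1 c hc).1, fun c => ?_, ?_⟩
  · rw [Finset.disjoint_left]
    intro c hc
    rcases Finset.mem_insert.mp hc with rfl | hc
    · exact hA0
    · rw [Finset.mem_singleton] at hc; subst hc; exact hA0'
  · rw [Finset.mem_insert, Finset.mem_singleton]
    constructor
    · intro hc
      by_contra! h'
      exact absurd (h c h'.1.1 h'.1.2 h'.2) hc.ne'
    · rintro ((rfl | rfl) | hc)
      · omega
      · omega
      · exact (hA1 c hc).2
  · rw [Finset.insert_val_of_notMem (by simpa using hne), Finset.singleton_val, Multiset.map_cons,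
      Multiset.map_singleton, poincareRank_eq, poincareRank_eq, h0, h1]
    rfl

/-- The conditions for `q` to be an apparent singularity of `withTail R q ε e`, or to be
absent. -/
def TailOK (R : RatFunc ℂ) (q ε e : ℂ) : Prop :=
  (ε = 0 ∧ e = 0) ∨ (ε = 1 ∧ HasVal R q (e ^ 2))

variable {R : RatFunc ℂ} {q ε e : ℂ}

lemma TailOK.exists_apparent (h : TailOK R q ε e) :
    ∃ A : Finset (OnePoint ℂ), A.card ≤ 1 ∧ A ⊆ {(q : OnePoint ℂ)} ∧
      (∀ c ∈ A, IsApparent (withTail R q ε e) c ∧ 0 < poleOrder (withTail R q ε e) c) ∧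
      ∀ (a : ℂ) v, HasVal R a v → (a : OnePoint ℂ) ∉ A → poleOrder (withTail R q ε e) a = 0 := by
  rcases h with ⟨rfl, rfl⟩ | ⟨rfl, h⟩
  · refine ⟨∅, by simp, by simp, by simp, fun a v hv _ => ?_⟩
    rw [withTail_zero]
    exact poleOrder_of_regular hv
  · have hap : IsApparentAt (withTail R q 1 e) q := by
      rw [isApparentAt_iff]
      refine ⟨e, h.congr_left ?_⟩
      rw [withTail, one_mul, map_div₀, map_ofNat, map_ofNat]; ring
    refine ⟨{(q : OnePoint ℂ)}, by simp, subset_rfl, fun c hc => ?_, fun a v hv ha => ?_⟩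
    · rw [Finset.mem_singleton] at hc
      subst hc
      exact ⟨hap, by rw [hap.poleOrder]; norm_num⟩
    · obtain ⟨w, hw⟩ := hasVal_withTail (q := q) (ε := 1) (e := e) hv (fun h' => ha (by rw [h']; simp))
      exact poleOrder_of_regular hw

lemma hasSingularityType_withTail_one (h : TailOK R q ε e) (hR : ∀ a, ∃ v, HasVal R a v) {M : ℕ}
    (hM : 0 < M) (h0 : poleOrder (withTail R q ε e) OnePoint.infty = M) :
    HasSingularityType (withTail R q ε e) {rankOfOrder M} := by
  obtain ⟨A, hA, hA0, hA1, hA2⟩ := h.exists_apparent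
  refine hasSingularityType_one hM h0 hA (fun h' => ?_) hA1 fun c hc hcA => ?_
  · simpa using hA0 h'
  · induction c using OnePoint.rec with
    | infty => exact absurd rfl hc
    | coe a => obtain ⟨v, hv⟩ := hR a; exact hA2 a v hv hcA

lemma hasSingularityType_withTail_two (h : TailOK R q ε e) (hq : q ≠ 0)
    (hR : ∀ a : ℂ, a ≠ 0 → ∃ v, HasVal R a v) {M N : ℕ}
    (hM : 0 < M) (hN : 0 < N) (h0 : poleOrder (withTail R q ε e) OnePoint.infty = M)
    (h1 : poleOrder (withTail R q ε e) ((0 : ℂ) : OnePoint ℂ) = N) :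
    HasSingularityType (withTail R q ε e) {rankOfOrder N, rankOfOrder M} := by
  obtain ⟨A, hA, hA0, hA1, hA2⟩ := h.exists_apparent
  refine hasSingularityType_two (OnePoint.coe_ne_infty 0) hN hM h1 h0 hA (fun h' => ?_)
    (fun h' => ?_) hA1 fun c hc hc' hcA => ?_
  · have := Finset.mem_singleton.mp (hA0 h')
    exact hq (OnePoint.coe_injective this).symm
  · simpa using hA0 h'
  · induction c using OnePoint.rec with
    | infty => exact absurd rfl hc'
    | coe a =>
      obtain ⟨v, hv⟩ := hR a (fun h' => hc (by rw [h']))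
      exact hA2 a v hv hcA

end SingType

section FamilyTypes

lemma familyP2_singularityType {t α c q ε e : ℂ}
    (h : TailOK (X ^ 4 + C t * X ^ 2 + C (2 * α) * X + C c) q ε e) :
    HasSingularityType (withTail (X ^ 4 + C t * X ^ 2 + C (2 * α) * X + C c) q ε e) {3} := by
  have hε : ε = 0 ∨ ε = 1 := h.imp (·.1) (·.1)
  have e : rankOfOrder 8 = 3 := by norm_num [rankOfOrder]
  rw [← e]
  exact hasSingularityType_withTail_one h (fun a => ⟨_, ((((hasVal_X a).pow 4).add
    ((hasVal_C _ a).mul ((hasVal_X a).pow 2))).add ((hasVal_C _ a).mul (hasVal_X a))).add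
    (hasVal_C c a)⟩) (by norm_num) (familyP2_isPoly rfl q ε _ hε).1

lemma familyP1_singularityType {t c q ε e : ℂ}
    (h : TailOK (4 * X ^ 3 + C (2 * t) * X + C c) q ε e) :
    HasSingularityType (withTail (4 * X ^ 3 + C (2 * t) * X + C c) q ε e) {5 / 2} := by
  have hε : ε = 0 ∨ ε = 1 := h.imp (·.1) (·.1)
  have e : rankOfOrder 7 = 5 / 2 := by norm_num [rankOfOrder]
  rw [← e]
  exact hasSingularityType_withTail_one h (fun a => ⟨_, ((((hasVal_ofNat 4 a).mul
    ((hasVal_X a).pow 3)).add ((hasVal_C _ a).mul (hasVal_X a))).add (hasVal_C c a))⟩)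
    (by norm_num) (familyP1_isPoly rfl q ε _ hε).1

lemma familyP34_singularityType {t b l q ε e : ℂ} (hq : q ≠ 0) (hl : l ≠ 0)
    (h : TailOK (X / 2 - C (t / 2) + C b / X + C l / X ^ 2) q ε e) :
    HasSingularityType (withTail (X / 2 - C (t / 2) + C b / X + C l / X ^ 2) q ε e)
      {0, 3 / 2} := by
  have e1 : rankOfOrder 5 = 3 / 2 := by norm_num [rankOfOrder]
  have e2 : rankOfOrder 2 = 0 := by norm_num [rankOfOrder]
  rw [← e1, ← e2]
  obtain ⟨h1, h2⟩ := laurent_regular l b (P := X / 2 - C (t / 2)) fun a =>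
    ⟨_, ((hasVal_X a).div (hasVal_ofNat 2 a) two_ne_zero).sub (hasVal_C _ a)⟩
  exact hasSingularityType_withTail_two h hq h1 (by norm_num) (by norm_num)
    (familyP34_laurent t b l hq).1 (poleOrder_withTail_zero 2 two_ne_zero h2 hl hq)

lemma familyP4_singularityType {a₁ t b l q ε e : ℂ} (hq : q ≠ 0) (hl : l ≠ 0)
    (h : TailOK (C a₁ + ((X + C (2 * t)) / 4) ^ 2 + C b / X + C l / X ^ 2) q ε e) :
    HasSingularityType (withTail (C a₁ + ((X + C (2 * t)) / 4) ^ 2 + C b / X + C l / X ^ 2) q ε e)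
      {0, 2} := by
  have e1 : rankOfOrder 6 = 2 := by norm_num [rankOfOrder]
  have e2 : rankOfOrder 2 = 0 := by norm_num [rankOfOrder]
  rw [← e1, ← e2]
  obtain ⟨h1, h2⟩ := laurent_regular l b (P := C a₁ + ((X + C (2 * t)) / 4) ^ 2) fun a =>
    ⟨_, (hasVal_C _ a).add ((((hasVal_X a).add (hasVal_C _ a)).div (hasVal_ofNat 4 a)
      (by norm_num)).pow 2)⟩
  exact hasSingularityType_withTail_two h hq h1 (by norm_num) (by norm_num)
    (familyP4_laurent t a₁ b l hq).1 (poleOrder_withTail_zero 2 two_ne_zero h2 hl hq)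

lemma familyP3_singularityType {a₀ b₀ c b₁ a₁ q ε e : ℂ} (hq : q ≠ 0)
    (h0 : a₀ ≠ 0 ∨ (a₀ = 0 ∧ b₀ ≠ 0)) (h1 : a₁ ≠ 0 ∨ (a₁ = 0 ∧ b₁ + e ≠ 0))
    (h : TailOK (C a₀ / X ^ 4 + C b₀ / X ^ 3 + C c / X ^ 2 + C b₁ / X + C a₁) q ε e) :
    HasSingularityType
      (withTail (C a₀ / X ^ 4 + C b₀ / X ^ 3 + C c / X ^ 2 + C b₁ / X + C a₁) q ε e)
      {rankOfOrder (if a₀ = 0 then 3 else 4), rankOfOrder (if a₁ = 0 then 3 else 4)} := by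
  have hε : ε = 0 ∨ ε = 1 := h.imp (·.1) (·.1)
  obtain ⟨hM, hN, -⟩ := familyP3_laurent a₀ b₀ c b₁ a₁ hq hε h0 h1
  refine hasSingularityType_withTail_two h hq (fun a ha => ⟨_, ((((hasVal_C a₀ a).div
    ((hasVal_X a).pow 4) (pow_ne_zero _ ha)).add ((hasVal_C b₀ a).div ((hasVal_X a).pow 3)
    (pow_ne_zero _ ha))).add ((hasVal_C c a).div ((hasVal_X a).pow 2) (pow_ne_zero _ ha))).add
    ((hasVal_C b₁ a).div (hasVal_X a) ha) |>.add (hasVal_C a₁ a)⟩) ?_ ?_ hM hN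
  · split_ifs <;> norm_num
  · split_ifs <;> norm_num

/-- By the form of the Hamiltonian `z = q` is an apparent singularity. -/
lemma tailOK_P3 {α β γ δ t q p : ℂ} (hq : q ≠ 0) :
    TailOK (C (-δ / 16 * t ^ 2) / X ^ 4 + C (-β / 8 * t) / X ^ 3 +
      C (q ^ 2 * p ^ 2 - q * p - -δ / 16 * t ^ 2 / q ^ 2 - -β / 8 * t / q - α / 8 * q -
        γ / 16 * q ^ 2) / X ^ 2 + C (α / 8 + p) / X + C (γ / 16)) q 1 (-p) := by
  refine Or.inr ⟨rfl, HasVal.congr (((((hasVal_C _ q).div ((hasVal_X q).pow 4)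
    (pow_ne_zero _ hq)).add ((hasVal_C _ q).div ((hasVal_X q).pow 3)
    (pow_ne_zero _ hq))).add ((hasVal_C _ q).div ((hasVal_X q).pow 2) (pow_ne_zero _ hq))).add
    ((hasVal_C _ q).div (hasVal_X q) hq) |>.add (hasVal_C _ q)) ?_⟩
  field_simp
  ring

lemma tailOK_P34 {α t q p : ℂ} (hq : q ≠ 0) :
    TailOK (X / 2 - C (t / 2) + C (p - (familyP34 α).hamiltonian t q p) / X +
      C ((α - 1) / 4) / X ^ 2) q 1 (-p) := by
  refine Or.inr ⟨rfl, HasVal.congr (((((hasVal_X q).div (hasVal_ofNat 2 q) two_ne_zero).sub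
    (hasVal_C _ q)).add ((hasVal_C _ q).div (hasVal_X q) hq)).add
      ((hasVal_C _ q).div ((hasVal_X q).pow 2) (pow_ne_zero _ hq))) ?_⟩
  simp only [familyP34]
  field_simp
  ring

lemma tailOK_P4 {α β t q p : ℂ} (hq : q ≠ 0) :
    TailOK (C (-α / 4) + ((X + C (2 * t)) / 4) ^ 2 +
      C (p + (familyP4 α β).hamiltonian t q p / 2) / X + C (-β / 8 - 1 / 4) / X ^ 2) q 1 (-p) := by
  refine Or.inr ⟨rfl, HasVal.congr ((((hasVal_C _ q).add ((((hasVal_X q).add (hasVal_C _ q)).div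
    (hasVal_ofNat 4 q) (by norm_num)).pow 2)).add ((hasVal_C _ q).div (hasVal_X q) hq)).add
      ((hasVal_C _ q).div ((hasVal_X q).pow 2) (pow_ne_zero _ hq))) ?_⟩
  simp only [familyP4]
  field_simp
  ring

end FamilyTypes

/-! ### The rows of the tables -/

/-- The claim on a transformed equation `u'' = V u` in a row of the tables. -/
def RowHolds (V : RatFunc ℂ) (T : Multiset ℚ) (J : Target) : Prop :=
  HasSingularityType V T ∧ J.Holds V

lemma RowHolds.of_subst_mob {x y Q : RatFunc ℂ} {T : Multiset ℚ} {J : Target} (hx : Nonconst x)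
    {g : GL (Fin 2) ℂ} (e : subst (mob g) x = y) (h : RowHolds (pullback y Q) T J) :
    RowHolds (pullback x Q) T J := by
  rw [← e, ← pullback_pullback (nonconst_mob g) hx] at h
  exact ⟨h.1.of_pullback_mob g, h.2.of_pullback_mob g⟩

lemma isMobius_X : IsMobius X := by
  have := isMobius_mob (g := 1)
  rwa [mob_one] at this

lemma holds_potential {J : PainleveKind} {F : PainleveFamily} (hF : F ∈ J.families) {t q p : ℂ}
    (ht : t ∈ F.times) (hq : q ∉ F.fixed) : (Target.painleve J).Holds (F.potential t q p) :=
  ⟨F, hF, X, isMobius_X, t, ht, Or.inl ⟨q, p, hq, pullback_X _⟩⟩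

lemma holds_degenerate {J : PainleveKind} {F : PainleveFamily} (hF : F ∈ J.families) {t c : ℂ}
    (ht : t ∈ F.times) : (Target.painleve J).Holds (F.degenerate t c) :=
  ⟨F, hF, X, isMobius_X, t, ht, Or.inr ⟨c, pullback_X _⟩⟩

lemma rankOfOrder_two : rankOfOrder 2 = 0 := by norm_num [rankOfOrder]
lemma rankOfOrder_three : rankOfOrder 3 = 1 / 2 := by norm_num [rankOfOrder]
lemma rankOfOrder_four : rankOfOrder 4 = 1 := by norm_num [rankOfOrder]
lemma rankOfOrder_five : rankOfOrder 5 = 3 / 2 := by norm_num [rankOfOrder]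
lemma rankOfOrder_six : rankOfOrder 6 = 2 := by norm_num [rankOfOrder]

lemma hasSingularityType_of_regular {V : RatFunc ℂ} {M : ℕ} (hM : 0 < M)
    (h0 : poleOrder V OnePoint.infty = M) (h : ∀ a, ∃ v, HasVal V a v) :
    HasSingularityType V {rankOfOrder M} := by
  refine hasSingularityType_one hM h0 (A := ∅) (by simp) (by simp) (by simp) fun c hc _ => ?_
  induction c using OnePoint.rec with
  | infty => exact absurd rfl hc
  | coe a => obtain ⟨v, hv⟩ := h a; exact poleOrder_of_regular hv

section Rows

variable {x : RatFunc ℂ}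

lemma potP4sym_eq (k m : ℂ) :
    potP4sym k m = (familyP4 (4 * k) (-32 * m ^ 2)).degenerate 0 0 := by
  have e1 : -(-32 * m ^ 2) / 8 - 1 / 4 = (16 * m ^ 2 - 1) / 4 := by ring
  have e2 : -(4 * k) / 4 = -k := by ring
  simp only [familyP4, potP4sym, e1, e2]
  simp only [map_div₀, map_ofNat, mul_zero, map_zero, add_zero, zero_div, map_neg]
  field_simp
  ring

lemma row_P4sym {k m : ℂ} (hm : m ^ 2 ≠ (1 / 4) ^ 2) :
    RowHolds (potP4sym k m) {0, 2} (.painleve .P4) := by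
  constructor
  · rw [potP4sym_eq, familyP4_degenerate _ _ _ _ 1]
    refine familyP4_singularityType one_ne_zero ?_ (Or.inl ⟨rfl, rfl⟩)
    intro h
    exact hm (by linear_combination h / 4)
  · rw [potP4sym_eq]
    exact holds_degenerate (J := .P4) ⟨_, _, rfl⟩ (Set.mem_univ _)

lemma row_Weber {k : ℂ} : RowHolds (potWeber k) {2} .confluent := by
  have e : potWeber k = X ^ 2 / 4 + C (-(2 * k)) := by rw [potWeber, map_neg]; ring
  rw [e]
  constructor
  · rw [← rankOfOrder_six]
    exact hasSingularityType_of_regular (by norm_num) (weber_irrInftyTwo _).1 fun a =>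
      ⟨_, (((hasVal_X a).pow 2).div (hasVal_ofNat 4 a) (by norm_num)).add (hasVal_C _ a)⟩
  · exact ⟨X, isMobius_X, Or.inr (Or.inr (Or.inl ⟨_, pullback_X _⟩))⟩

lemma row_D6alg {k t s : ℂ} (hs : s ≠ 0) (ht : s ^ 2 = t) :
    RowHolds (potD6alg k t s) {1, 1} (.painleve .P3D6) := by
  have ht0 : t ≠ 0 := ht ▸ pow_ne_zero 2 hs
  rw [potD6alg_eq hs ht]
  constructor
  · rw [familyP3_potential]
    have h0 : -(-4) / 16 * t ^ 2 ≠ 0 := mul_ne_zero (by norm_num) (pow_ne_zero 2 ht0)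
    have h1 : (4 : ℂ) / 16 ≠ 0 := by norm_num
    have h := familyP3_singularityType (neg_ne_zero.mpr hs) (Or.inl h0) (Or.inl h1)
      (tailOK_P3 (α := -8 * k) (β := 8 * k) (γ := 4) (δ := -4) (t := t) (q := -s)
        (p := -3 / (4 * s)) (neg_ne_zero.mpr hs))
    rwa [if_neg h0, if_neg h1, rankOfOrder_four] at h
  · exact holds_potential (J := .P3D6) ⟨_, _, _, _, by norm_num, by norm_num, rfl⟩ ht0
      (neg_ne_zero.mpr hs)

lemma row_D8alg {h t s : ℂ} (hh : h ≠ 0) (hs : s ≠ 0) (ht : s ^ 2 = t) :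
    RowHolds (potD8alg h t s) {1 / 2, 1 / 2} (.painleve .P3D8) := by
  have ht0 : t ≠ 0 := ht ▸ pow_ne_zero 2 hs
  rw [potD8alg_eq hs ht]
  constructor
  · rw [familyP3_potential]
    have h0 : (-0 : ℂ) / 16 * t ^ 2 = 0 := by ring
    have h0' : -(-8 * h) / 8 * t ≠ 0 := mul_ne_zero (by simpa using hh) ht0
    have h1 : (0 : ℂ) / 16 = 0 := by norm_num
    have h1' : 8 * h / 8 + -3 / (4 * s) + -(-3 / (4 * s)) ≠ 0 := by simpa using hh
    have h := familyP3_singularityType (neg_ne_zero.mpr hs) (Or.inr ⟨h0, h0'⟩) (Or.inr ⟨h1, h1'⟩)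
      (tailOK_P3 (α := 8 * h) (β := -8 * h) (γ := 0) (δ := 0) (t := t) (q := -s)
        (p := -3 / (4 * s)) (neg_ne_zero.mpr hs))
    rwa [if_pos h0, if_pos h1, rankOfOrder_three] at h
  · exact holds_potential (J := .P3D8)
      ⟨_, _, mul_ne_zero (by norm_num) hh, mul_ne_zero (by norm_num) hh, rfl⟩ ht0
      (neg_ne_zero.mpr hs)

lemma row_D7alg {t s : ℂ} (hs : s ≠ 0) (ht : s ^ 3 = t) :
    RowHolds (potD7alg t s) {1, 1 / 2} (.painleve .P3D7) := by
  have ht0 : t ≠ 0 := ht ▸ pow_ne_zero 3 hs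
  rw [potD7alg_eq hs ht]
  constructor
  · rw [familyP3_potential]
    have h0 : (-0 : ℂ) / 16 * t ^ 2 = 0 := by ring
    have h0' : -(-2) / 8 * t ≠ 0 := mul_ne_zero (by norm_num) ht0
    have h1 : (2 : ℂ) / 16 ≠ 0 := by norm_num
    have h := familyP3_singularityType hs (Or.inr ⟨h0, h0'⟩) (Or.inl h1)
      (tailOK_P3 (α := 0) (β := -2) (γ := 2) (δ := 0) (t := t) (q := s) (p := 2 / (3 * s)) hs)
    rw [if_pos h0, if_neg h1, rankOfOrder_three, rankOfOrder_four] at h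
    exact (Multiset.pair_comm (1 : ℚ) (1 / 2)) ▸ h
  · exact holds_potential (J := .P3D7)
      ⟨_, _, _, _, Or.inl ⟨rfl, by norm_num, two_ne_zero⟩, rfl⟩ ht0 hs

lemma row_P4Her {t : ℂ} (ht : t ≠ 0) : RowHolds (potP4Her t) {0, 2} (.painleve .P4) := by
  constructor
  · have hX := X_add_C_ne_zero (2 * t)
    have hR : ∀ a, HasVal (((X + C (2 * t)) / 4) ^ 2) a (((a + 2 * t) / 4) ^ 2) := fun a =>
      (((hasVal_X a).add (hasVal_C _ a)).div (hasVal_ofNat 4 a) (by norm_num)).pow 2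
    have hinf : poleOrder (potP4Her t) OnePoint.infty = 6 := by
      rw [potP4Her_eq, familyP4_potential]
      exact (familyP4_laurent t _ _ _ (mul_ne_zero (by norm_num) ht)).1
    have h2 : poleOrder (potP4Her t) ((-(2 * t) : ℂ) : OnePoint ℂ) = 2 := by
      refine poleOrder_of_hasVal 2 (v := 3 / 4) ?_ (by norm_num)
      have hz := (hasVal_X_sub_C (-(2 * t)) (-(2 * t))).congr (sub_self _)
      have h := ((hz.pow 2).mul (hR (-(2 * t)))).add (hasVal_C (3 / 4) _)
      convert h using 1
      · rw [map_neg, sub_neg_eq_add, potP4Her, map_div₀, map_ofNat, map_ofNat]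
        field_simp
      · simp
    rw [← rankOfOrder_two, ← rankOfOrder_six]
    refine hasSingularityType_two (OnePoint.coe_ne_infty _) (by norm_num) (by norm_num) h2 hinf
      (A := ∅) (by simp) (by simp) (by simp) (by simp) fun c hc hc' _ => ?_
    induction c using OnePoint.rec with
    | infty => exact absurd rfl hc'
    | coe a =>
      have ha : a + 2 * t ≠ 0 := fun h => hc (by rw [eq_neg_of_add_eq_zero_left h])
      exact poleOrder_of_regular ((hR a).add ((hasVal_ofNat 3 a).div ((hasVal_ofNat 4 a).mul
        (((hasVal_X a).add (hasVal_C _ a)).pow 2)) (mul_ne_zero (by norm_num) (pow_ne_zero 2 ha))))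
  · rw [potP4Her_eq]
    exact holds_potential (J := .P4) ⟨_, _, rfl⟩ (Set.mem_univ _) (mul_ne_zero (by norm_num) ht)

lemma potP2sym_eq (k : ℂ) : potP2sym k = (familyP2 (-3 * k)).potential 0 0 0 := by
  have e : 2 * (-3 * k) = -(6 * k) := by ring
  simp only [familyP2, potP2sym, e]
  simp
  ring

lemma potP2sym'_eq (k : ℂ) : potP2sym' k = (familyP2 (-3 * k)).degenerate 0 0 := by
  have e : 2 * (-3 * k) = -(6 * k) := by ring
  simp only [familyP2, potP2sym', e]
  simp
  ring

lemma row_P2_zero {α t : ℂ} :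
    RowHolds ((familyP2 α).potential t 0 0) {3} (.painleve .P2) := by
  constructor
  · rw [familyP2_potential]
    refine familyP2_singularityType (Or.inr ⟨rfl, HasVal.congr (((((hasVal_X 0).pow 4).add
      ((hasVal_C _ 0).mul ((hasVal_X 0).pow 2))).add ((hasVal_C _ 0).mul (hasVal_X 0))).add
      (hasVal_C _ 0)) ?_⟩)
    simp
  · exact holds_potential (J := .P2) ⟨_, rfl⟩ (Set.mem_univ _) (Set.notMem_empty _)

lemma row_P2_degenerate {α t c : ℂ} :
    RowHolds ((familyP2 α).degenerate t c) {3} (.painleve .P2) := by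
  constructor
  · have h := familyP2_singularityType (t := t) (α := α) (c := c) (q := 0) (Or.inl ⟨rfl, rfl⟩)
    rwa [withTail_zero] at h
  · exact holds_degenerate (J := .P2) ⟨_, rfl⟩ (Set.mem_univ _)

lemma potP1sym_eq : potP1sym = familyP1.potential 0 0 0 := by
  simp only [familyP1, potP1sym]
  simp
  ring

lemma potP1sym'_eq : potP1sym' = familyP1.degenerate 0 0 := by
  simp only [familyP1, potP1sym']
  simp

lemma row_P1sym : RowHolds potP1sym {5 / 2} (.painleve .P1) := by
  rw [potP1sym_eq]
  constructor
  · rw [familyP1_potential]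
    refine familyP1_singularityType (Or.inr ⟨rfl, HasVal.congr ((((hasVal_ofNat 4 0).mul
      ((hasVal_X 0).pow 3)).add ((hasVal_C _ 0).mul (hasVal_X 0))).add (hasVal_C _ 0)) ?_⟩)
    simp
  · exact holds_potential (J := .P1) rfl (Set.mem_univ _) (Set.notMem_empty _)

lemma row_P1sym' : RowHolds potP1sym' {5 / 2} (.painleve .P1) := by
  rw [potP1sym'_eq]
  constructor
  · have h := familyP1_singularityType (t := 0) (c := 0) (q := 0) (Or.inl ⟨rfl, rfl⟩)
    rwa [withTail_zero] at h
  · exact holds_degenerate (J := .P1) rfl (Set.mem_univ _)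

lemma potKummer_eq_genPot (m : ℂ) :
    potKummer m = withTail (C (1 / 4) + C 0 / X + C ((16 * m ^ 2 - 1) / 4) / X ^ 2) 1 0 0 := by
  rw [withTail_zero, potKummer, map_div₀, map_div₀, map_one, map_ofNat, map_zero]
  field_simp
  ring

lemma poleOrder_potKummer_infty (m : ℂ) : poleOrder (potKummer m) OnePoint.infty = 4 := by
  rw [potKummer_eq]; exact (W_irrInftyTwo _ _).1

lemma row_Kummer {m : ℂ} (hm : m ^ 2 ≠ (1 / 4) ^ 2) :
    RowHolds (potKummer m) {0, 1} .confluent := by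
  constructor
  · have hinf := poleOrder_potKummer_infty m
    have hl : (16 * m ^ 2 - 1) / 4 ≠ 0 := fun h => hm (by linear_combination h / 4)
    obtain ⟨h1, h2⟩ := laurent_regular ((16 * m ^ 2 - 1) / 4) 0 (P := C (1 / 4)) fun a =>
      ⟨_, hasVal_C _ a⟩
    rw [potKummer_eq_genPot] at hinf ⊢
    rw [← rankOfOrder_two, ← rankOfOrder_four]
    exact hasSingularityType_withTail_two (Or.inl ⟨rfl, rfl⟩) one_ne_zero h1 (by norm_num)
      (by norm_num) hinf (poleOrder_withTail_zero 2 two_ne_zero h2 hl one_ne_zero)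
  · rw [potKummer_eq]
    exact ⟨X, isMobius_X, Or.inl ⟨_, _, pullback_X _⟩⟩

lemma row_Kummer' {m : ℂ} (hm : m ^ 2 = (1 / 4) ^ 2) : RowHolds (potKummer m) {1} .confluent := by
  constructor
  · rw [← rankOfOrder_four]
    refine hasSingularityType_of_regular (by norm_num) (poleOrder_potKummer_infty m) fun a =>
      ⟨1 / 4, ?_⟩
    have e : 16 * m ^ 2 - 1 = 0 := by linear_combination 16 * hm
    refine (hasVal_C (1 / 4) a).congr_left ?_
    rw [potKummer, e, map_div₀, map_one, map_ofNat, map_zero, zero_div, add_zero]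
  · rw [potKummer_eq]
    exact ⟨X, isMobius_X, Or.inl ⟨_, _, pullback_X _⟩⟩

lemma potP34sym_eq (m : ℂ) : potP34sym m = (familyP34 (36 * m ^ 2)).degenerate 0 0 := by
  simp only [familyP34, potP34sym]
  simp only [map_div₀, map_ofNat, map_zero, zero_div]
  have hX : (X : RatFunc ℂ) ≠ 0 := X_ne_zero
  field_simp
  ring

lemma row_P34sym {m : ℂ} (hm : m ^ 2 ≠ (1 / 6) ^ 2) :
    RowHolds (potP34sym m) {0, 3 / 2} (.painleve .P34) := by
  rw [potP34sym_eq]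
  constructor
  · rw [familyP34_degenerate _ _ _ 1]
    refine familyP34_singularityType one_ne_zero (fun h => hm ?_) (Or.inl ⟨rfl, rfl⟩)
    linear_combination h / 9
  · exact holds_degenerate (J := .P34) ⟨_, rfl⟩ (Set.mem_univ _)

lemma row_Airy : RowHolds potAiry {3 / 2} .confluent := by
  constructor
  · rw [← rankOfOrder_five]
    exact hasSingularityType_of_regular (by norm_num) airy_irrInftyTwo.1 fun a => ⟨_, hasVal_X a⟩
  · exact ⟨X, isMobius_X, Or.inr (Or.inr (Or.inr (pullback_X _)))⟩

lemma row_P34rat {t : ℂ} (ht : t ≠ 0) :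
    RowHolds (potP34rat t) {0, 3 / 2} (.painleve .P34) := by
  have hq : t / 2 ≠ 0 := div_ne_zero ht two_ne_zero
  rw [potP34rat_eq ht]
  constructor
  · rw [familyP34_potential]
    exact familyP34_singularityType hq (by norm_num) (tailOK_P34 hq)
  · exact holds_potential (J := .P34) ⟨_, rfl⟩ (Set.mem_univ _) hq

lemma row_P4rat {t : ℂ} (ht : t ≠ 0) : RowHolds (potP4rat t) {0, 2} (.painleve .P4) := by
  have hq : -2 * t / 3 ≠ 0 := div_ne_zero (mul_ne_zero (by norm_num) ht) (by norm_num)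
  rw [potP4rat_eq ht]
  constructor
  · rw [familyP4_potential]
    exact familyP4_singularityType hq (by norm_num) (tailOK_P4 hq)
  · exact holds_potential (J := .P4) ⟨_, _, rfl⟩ (Set.mem_univ _) hq

end Rows

/-! ### The row P5-rat -/

lemma poleOrder_pos_of_ord_eq_one {x : RatFunc ℂ} {A B m : ℂ} (hx : Nonconst x) (hB : B ≠ 0)
    {c : OnePoint ℂ} (h : ord x c = 1) : 0 < poleOrder (pullback x (genPot A B m)) c := by
  obtain ⟨g, rfl⟩ := exists_mob_smul_zero c
  have hg := nonconst_mob g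
  rw [← poleOrder_pullback_mob, pullback_pullback hg hx]
  rw [← ord_subst_mob g hx.ne_zero] at h
  have hx' := subst_nonconst hg hx
  obtain ⟨b, hb, hb'⟩ := localForm_of_ord_pos hx' (subst_genPot hx' A B m)
    (show 0 < ord _ _ by rw [h]; exact one_pos)
  rw [h, Int.cast_one, one_pow, mul_one] at hb
  by_cases hl : (4 * m ^ 2 - 1) / 4 = 0
  · have hb0 := hb' h (by linear_combination 4 * hl) hB
    rw [hl] at hb
    obtain ⟨r, v, hr, e⟩ := hb
    have hz := (hasVal_X_sub_C (0 : ℂ) 0).congr (sub_self _)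
    have h1 : HasVal ((X - C 0) ^ 1 * pullback (subst (mob g) x) (genPot A B m)) 0 b := by
      have h2 := (hasVal_C b 0).add (hz.mul hr)
      have h0 := X_sub_C_ne_zero 0
      refine (h2.congr (by ring)).congr_left ?_
      have h3 : C (0 : ℂ) / (X - C 0) ^ 2 = 0 := by rw [map_zero, zero_div]
      rw [e, h3, zero_add]
      field_simp
    rw [poleOrder_of_hasVal 1 h1 hb0]
    exact one_pos
  · rw [poleOrder_of_hasVal 2 hb.hasVal_sq hl]
    exact two_pos

lemma row_P5rat {m h : ℂ} (hh : h ≠ 0) :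
    RowHolds (potP5rat m h 1) {0, 0, 1} (.painleve .P5) := by
  classical
  constructor
  · have hX := X_ne_zero (K := ℂ)
    have h1 := X_sub_C_ne_zero 1
    have hc : (C (h / 4) : RatFunc ℂ) ≠ 0 :=
      (map_ne_zero C).mpr (div_ne_zero hh (by norm_num))
    have hcov : coverP5rat h 1 = C (h / 4) * (X / (X - C 1) ^ 2) := by
      rw [coverP5rat, one_pow, mul_one, map_one, map_div₀, map_ofNat]
      rw [map_one] at h1
      field_simp
    have hord : ∀ c, ord (coverP5rat h 1) c = ord X c - 2 * ord (X - C 1) c := by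
      intro c
      rw [hcov, ord_mul hc (div_ne_zero hX (pow_ne_zero 2 h1)), ord_C,
        ord_div hX (pow_ne_zero 2 h1), ord_pow]
      push_cast; ring
    have o0 : ord (coverP5rat h 1) ((0 : ℂ) : OnePoint ℂ) = 1 := by
      rw [hord, ord_X_coe, ord_X_sub_C_coe]; norm_num
    have o1 : ord (coverP5rat h 1) ((1 : ℂ) : OnePoint ℂ) = -2 := by
      rw [hord, ord_X_coe, ord_X_sub_C_coe]; norm_num
    have oi : ord (coverP5rat h 1) OnePoint.infty = 1 := by
      rw [hord, ord_X_infty, ord_X_sub_C_infty]; norm_num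
    have hx : Nonconst (coverP5rat h 1) := by
      intro c hc
      rw [hc, ord_C] at o0
      exact absurd o0 (by norm_num)
    have e : pullback (coverP5rat h 1) (genPot 0 1 m) = potP5rat m h 1 := by
      rw [← DW_eq_genPot]; exact pullback_coverP5rat hh one_ne_zero
    have p0 := poleOrder_pos_of_ord_eq_one (A := 0) (m := m) hx one_ne_zero o0
    have pi := poleOrder_pos_of_ord_eq_one (A := 0) (m := m) hx one_ne_zero oi
    have p0' := poleOrder_le_two_of_ord_nonneg (A := 0) (B := 1) (m := m) hx (o0.symm ▸ zero_le_one)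
    have pi' := poleOrder_le_two_of_ord_nonneg (A := 0) (B := 1) (m := m) hx (oi.symm ▸ zero_le_one)
    have p1 := (poleOrder_of_ord_neg (A := 0) (B := 1) (m := m) hx
      (show ord _ _ < 0 by rw [o1]; norm_num)).2 rfl one_ne_zero
    rw [o1] at p1
    rw [e] at p0 pi p0' pi' p1
    have hX1 : (X : RatFunc ℂ) - 1 ≠ 0 := by rwa [map_one] at h1
    have hX2 : (X : RatFunc ℂ) + 1 ≠ 0 := by simpa using X_add_C_ne_zero 1
    have hap : IsApparentAt (potP5rat m h 1) (-1) := by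
      rw [isApparentAt_iff]
      have hv := hasVal_X (-1)
      have hv1 := hv.sub (hasVal_one (-1))
      refine ⟨3 / 4, HasVal.congr (HasVal.congr_left ((((hasVal_C (h * 1 ^ 2) _).div (hv1.pow 4)
        (by norm_num)).add ((hasVal_C (16 * m ^ 2 - 1 + h * 1 ^ 2) _).div (((hasVal_ofNat 4 _).mul
        hv).mul (hv1.pow 2)) (by norm_num))).sub ((hasVal_ofNat 3 _).div ((hasVal_ofNat 4 _).mul hv)
        (by norm_num)) |>.add ((hasVal_C (4 * m ^ 2 - 1) _).div ((hasVal_ofNat 4 _).mul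
        (hv.pow 2)) (by norm_num))) ?_) ?_⟩
      · rw [potP5rat, map_neg, map_one, sub_neg_eq_add, map_div₀ C 3, map_ofNat, map_ofNat]
        field_simp
        ring
      · norm_num; ring
    refine ⟨{((0 : ℂ) : OnePoint ℂ), OnePoint.infty, ((1 : ℂ) : OnePoint ℂ)},
      {((-1 : ℂ) : OnePoint ℂ)}, ?_, by simp, ?_, fun c => ?_, ?_⟩
    · rw [Finset.disjoint_singleton_right]
      simp only [Finset.mem_insert, Finset.mem_singleton, OnePoint.coe_eq_coe, OnePoint.coe_ne_infty,
        not_or]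
      norm_num
    · intro c hc
      rw [Finset.mem_singleton] at hc
      subst hc
      exact hap
    · simp only [Finset.mem_insert, Finset.mem_singleton]
      constructor
      · intro hpos
        by_contra! hc
        obtain ⟨⟨h0, hi, h1⟩, h2⟩ := hc
        induction c using OnePoint.rec with
        | infty => exact hi rfl
        | coe a =>
          have ha0 : a ≠ 0 := fun h' => h0 (by rw [h'])
          have ha1 : a - 1 ≠ 0 := sub_ne_zero.mpr fun h' => h1 (by rw [h'])
          have ha2 : a + 1 ≠ 0 := fun h' => h2 (by rw [eq_neg_of_add_eq_zero_left h'])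
          have hv := hasVal_X a
          have hv1 := hv.sub (hasVal_one a)
          have h4 : (4 : ℂ) ≠ 0 := by norm_num
          have := poleOrder_of_regular (V := potP5rat m h 1) ((((((hasVal_C _ a).div (hv1.pow 4)
            (pow_ne_zero 4 ha1)).add ((hasVal_C _ a).div (((hasVal_ofNat 4 a).mul
            hv).mul (hv1.pow 2)) (mul_ne_zero (mul_ne_zero h4 ha0) (pow_ne_zero 2 ha1)))).sub
            ((hasVal_ofNat 3 a).div ((hasVal_ofNat 4 a).mul hv) (mul_ne_zero h4 ha0))).add
            ((hasVal_C _ a).div ((hasVal_ofNat 4 a).mul (hv.pow 2))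
              (mul_ne_zero h4 (pow_ne_zero 2 ha0)))).add
            (((hasVal_ofNat 3 a).mul (hv.add (hasVal_ofNat 2 a))).div ((hasVal_ofNat 4 a).mul
              ((hv.add (hasVal_one a)).pow 2)) (mul_ne_zero h4 (pow_ne_zero 2 ha2))))
          omega
      · rintro ((rfl | rfl | rfl) | rfl)
        · exact p0
        · exact pi
        · omega
        · rw [hap.poleOrder]; norm_num
    · have hr : ∀ n, n ≤ 2 → rankOfOrder n = 0 := fun n hn => by
        rw [rankOfOrder, if_neg (by omega)]
      rw [Finset.insert_val_of_notMem (by simp), Finset.insert_val_of_notMem (by simp),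
        Finset.singleton_val, Multiset.map_cons, Multiset.map_cons, Multiset.map_singleton,
        poincareRank_eq, poincareRank_eq, poincareRank_eq, hr _ p0', hr _ pi', p1,
        show (-(-2 : ℤ)).toNat + 2 = 4 from rfl, rankOfOrder_four]
      rfl
  · rw [potP5rat_eq]
    exact holds_potential (J := .P5) ⟨_, _, _, _, mul_ne_zero (by norm_num) hh, rfl⟩
      (by simp [familyP5]) (by norm_num [familyP5])

lemma coverDegree_of_table {x : RatFunc ℂ} {n : ℕ} (h : (poleType x).sum = n) (hn : 1 ≤ n) :
    Nonconst x := Nonconst.of_coverDegree (by rw [← poleType_sum, h]; exact hn)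

/-- In each row of the table for the Whittaker equations the cover can be brought to the explicit
form. -/
lemma TableW.rowHolds {x : RatFunc ℂ} {k m : ℂ} {T : Multiset ℚ} {J : Target}
    (h : TableW k m (zeroType x) (poleType x) T J) : RowHolds (pullback x (W k m)) T J := by
  generalize hZ : zeroType x = Z at h
  generalize hP : poleType x = P at h
  have hx : 1 ≤ P.sum → Nonconst x := fun h => coverDegree_of_table (hP ▸ rfl) h
  cases h with
  | P4sym _ _ hm =>
    replace hx := hx (by simp)
    obtain ⟨g, e⟩ := exists_normal_pow (κ₀ := 1 / 4) hx hZ hP (by norm_num)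
    have hc : C (1 / 4) * X ^ 2 = coverP4sym := by
      rw [coverP4sym, map_div₀, map_one, map_ofNat]; ring
    refine RowHolds.of_subst_mob hx (e.trans hc) ?_
    rw [pullback_coverP4sym]
    exact row_P4sym hm
  | Weber _ _ hm =>
    replace hx := hx (by simp)
    obtain ⟨g, e⟩ := exists_normal_pow (κ₀ := 1 / 2) hx hZ hP (by norm_num)
    have hc : C (1 / 2) * X ^ 2 = coverWeber := by
      rw [coverWeber, map_div₀, map_one, map_ofNat]; ring
    refine RowHolds.of_subst_mob hx (e.trans hc) ?_
    rw [W_of_sq k hm, pullback_coverWeber]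
    exact row_Weber
  | D6alg _ _ hm =>
    replace hx := hx (by simp)
    obtain ⟨g, s, hs, e⟩ := exists_normal_two_poles (κ₀ := 1) hx hZ hP one_ne_zero
    have hc : C 1 * (X - C s) ^ 2 / X ^ 1 = coverD6alg s := by
      rw [coverD6alg, map_one, one_mul, pow_one]
    refine RowHolds.of_subst_mob hx (e.trans hc) ?_
    rw [W_of_sq k hm, pullback_coverD6alg rfl]
    exact row_D6alg hs rfl
  | P4Her _ hm =>
    replace hx := hx (by simp)
    obtain ⟨g, b, hb, e⟩ := exists_normal_two_zeros (κ₀ := 1 / 4) hx hZ hP (by norm_num)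
    have hc : C (1 / 4) * X ^ 1 * (X - C b) ^ 1 = coverP4Her (-b / 4) := by
      rw [coverP4Her, show 4 * (-b / 4) = -b by ring, map_neg, map_div₀, map_one, map_ofNat]; ring
    refine RowHolds.of_subst_mob hx (e.trans hc) ?_
    rw [W_of_sq 0 hm, pullback_coverP4Her]
    exact row_P4Her (div_ne_zero (neg_ne_zero.mpr hb) (by norm_num))
  | P2sym _ _ hm =>
    replace hx := hx (by simp)
    obtain ⟨g, e⟩ := exists_normal_pow (κ₀ := 2 / 3) hx hZ hP (by norm_num)
    have hc : C (2 / 3) * X ^ 3 = coverP2sym := by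
      rw [coverP2sym, map_div₀, map_ofNat, map_ofNat]; ring
    refine RowHolds.of_subst_mob hx (e.trans hc) ?_
    rw [W_of_sq k hm, pullback_coverP2sym, potP2sym_eq]
    exact row_P2_zero
  | P2sym' _ _ hm =>
    replace hx := hx (by simp)
    obtain ⟨g, e⟩ := exists_normal_pow (κ₀ := 2 / 3) hx hZ hP (by norm_num)
    have hc : C (2 / 3) * X ^ 3 = coverP2sym := by
      rw [coverP2sym, map_div₀, map_ofNat, map_ofNat]; ring
    refine RowHolds.of_subst_mob hx (e.trans hc) ?_
    rw [W_of_sq k hm, pullback_coverP2sym', potP2sym'_eq]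
    exact row_P2_degenerate

/-- In each row of the table for the degenerate Whittaker equations the cover can be brought to the
explicit form. -/
lemma TableDW.rowHolds {x : RatFunc ℂ} {m : ℂ} {T : Multiset ℚ} {J : Target}
    (h : TableDW m (zeroType x) (poleType x) T J) : RowHolds (pullback x (DW m)) T J := by
  generalize hZ : zeroType x = Z at h
  generalize hP : poleType x = P at h
  have hx : 1 ≤ P.sum → Nonconst x := fun h => coverDegree_of_table (hP ▸ rfl) h
  cases h with
  | Kummer hm =>
    replace hx := hx (by simp)
    obtain ⟨g, e⟩ := exists_normal_pow (κ₀ := 1 / 16) hx hZ hP (by norm_num)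
    have hc : C (1 / 16) * X ^ 2 = coverKummer := by
      rw [coverKummer, map_div₀, map_one, map_ofNat]; ring
    refine RowHolds.of_subst_mob hx (e.trans hc) ?_
    rw [pullback_coverKummer]
    exact row_Kummer hm
  | Kummer' hm =>
    replace hx := hx (by simp)
    obtain ⟨g, e⟩ := exists_normal_pow (κ₀ := 1 / 16) hx hZ hP (by norm_num)
    have hc : C (1 / 16) * X ^ 2 = coverKummer := by
      rw [coverKummer, map_div₀, map_one, map_ofNat]; ring
    refine RowHolds.of_subst_mob hx (e.trans hc) ?_
    rw [pullback_coverKummer]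
    exact row_Kummer' hm
  | P5rat =>
    replace hx := hx (by simp)
    obtain ⟨g, h, hh, e⟩ := exists_normal_P5 hx hZ hP
    refine RowHolds.of_subst_mob hx e ?_
    rw [pullback_coverP5rat hh one_ne_zero]
    exact row_P5rat hh
  | D8alg hm =>
    replace hx := hx (by simp)
    obtain ⟨g, s, hs, e⟩ := exists_normal_two_poles (κ₀ := 1) hx hZ hP one_ne_zero
    have hc : C 1 * (X - C s) ^ 2 / X ^ 1 = coverD8alg 1 s := by
      rw [coverD8alg, pow_one]
    refine RowHolds.of_subst_mob hx (e.trans hc) ?_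
    rw [DW_of_sq hm, pullback_coverD8alg one_ne_zero rfl]
    exact row_D8alg one_ne_zero hs rfl
  | P34sym hm =>
    replace hx := hx (by simp)
    obtain ⟨g, e⟩ := exists_normal_pow (κ₀ := 1 / 18) hx hZ hP (by norm_num)
    have hc : C (1 / 18) * X ^ 3 = coverP34sym := by
      rw [coverP34sym, map_div₀, map_one, map_ofNat]; ring
    refine RowHolds.of_subst_mob hx (e.trans hc) ?_
    rw [pullback_coverP34sym]
    exact row_P34sym hm
  | Airy hm =>
    replace hx := hx (by simp)
    obtain ⟨g, e⟩ := exists_normal_pow (κ₀ := 1 / 9) hx hZ hP (by norm_num)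
    have hc : C (1 / 9) * X ^ 3 = coverAiry := by
      rw [coverAiry, map_div₀, map_one, map_ofNat]; ring
    refine RowHolds.of_subst_mob hx (e.trans hc) ?_
    rw [DW_of_sq hm, pullback_coverAiry]
    exact row_Airy
  | P34rat hm =>
    replace hx := hx (by simp)
    obtain ⟨g, b, hb, e⟩ := exists_normal_two_zeros (κ₀ := 1 / 18) hx hZ hP (by norm_num)
    have hc : C (1 / 18) * X ^ 1 * (X - C b) ^ 2 = coverP34rat (2 * b / 3) := by
      rw [coverP34rat, show 3 * (2 * b / 3) / 2 = b by ring, map_div₀, map_one, map_ofNat]; ring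
    have ht : 2 * b / 3 ≠ 0 := div_ne_zero (mul_ne_zero two_ne_zero hb) three_ne_zero
    refine RowHolds.of_subst_mob hx (e.trans hc) ?_
    rw [DW_of_sq hm, pullback_coverP34rat ht]
    exact row_P34rat ht
  | D7alg hm =>
    replace hx := hx (by simp)
    obtain ⟨g, a, ha, e⟩ := exists_normal_two_poles (κ₀ := 1 / 32) hx hZ hP (by norm_num)
    have hc : C (1 / 32) * (X - C a) ^ 3 / X ^ 1 = coverD7alg (-a / 2) := by
      rw [coverD7alg, show 2 * (-a / 2) = -a by ring, map_neg, map_div₀, map_one, map_ofNat]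
      field_simp
      ring
    have hs : -a / 2 ≠ 0 := div_ne_zero (neg_ne_zero.mpr ha) two_ne_zero
    refine RowHolds.of_subst_mob hx (e.trans hc) ?_
    rw [DW_of_sq hm, pullback_coverD7alg hs rfl]
    exact row_D7alg hs rfl
  | P4rat hm =>
    replace hx := hx (by simp)
    obtain ⟨g, b, hb, e⟩ := exists_normal_two_zeros (κ₀ := 1 / 256) hx hZ hP (by norm_num)
    have hc : C (1 / 256) * X ^ 1 * (X - C b) ^ 3 = coverP4rat (-3 * b / 8) := by
      rw [coverP4rat, show 8 * (-3 * b / 8) / 3 = -b by ring, map_neg, map_div₀, map_one,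
        map_ofNat]
      ring
    have ht : -3 * b / 8 ≠ 0 := div_ne_zero (mul_ne_zero (by norm_num) hb) (by norm_num)
    refine RowHolds.of_subst_mob hx (e.trans hc) ?_
    rw [DW_of_sq hm, pullback_coverP4rat]
    exact row_P4rat ht
  | P1sym hm =>
    replace hx := hx (by simp)
    obtain ⟨g, e⟩ := exists_normal_pow (κ₀ := 4 / 25) hx hZ hP (by norm_num)
    have hc : C (4 / 25) * X ^ 5 = coverP1sym := by
      rw [coverP1sym, map_div₀, map_ofNat, map_ofNat]; ring
    refine RowHolds.of_subst_mob hx (e.trans hc) ?_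
    rw [DW_of_sq hm, pullback_coverP1sym]
    exact row_P1sym
  | P1sym' hm =>
    replace hx := hx (by simp)
    obtain ⟨g, e⟩ := exists_normal_pow (κ₀ := 4 / 25) hx hZ hP (by norm_num)
    have hc : C (4 / 25) * X ^ 5 = coverP1sym := by
      rw [coverP1sym, map_div₀, map_ofNat, map_ofNat]; ring
    refine RowHolds.of_subst_mob hx (e.trans hc) ?_
    rw [DW_of_sq hm, pullback_coverP1sym']
    exact row_P1sym'
  | P2rat hm =>
    replace hx := hx (by simp)
    obtain ⟨g, b, hb, e⟩ := exists_normal_two_zeros (κ₀ := 1 / 36) hx hZ hP (by norm_num)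
    -- move the midpoint of the two zeros to the origin
    obtain ⟨h, hn, e'⟩ := subst_affine (b := b / 2) one_ne_zero e
    have hc : substHom (C 1 * X + C (b / 2)) hn (C (1 / 36) * X ^ 3 * (X - C b) ^ 3) =
        coverP2rat (-b ^ 2 / 4) := by
      simp only [map_mul, map_pow, map_sub, substHom_C, substHom_X, coverP2rat]
      simp only [map_div₀, map_neg, map_pow, map_one, map_ofNat]
      ring
    refine RowHolds.of_subst_mob hx (e'.trans hc) ?_
    rw [DW_of_sq hm, pullback_coverP2rat, potP2rat_eq]
    exact row_P2_zero

theorem isPainleveOrConfluent_W_iff {x : RatFunc ℂ} (hd : 2 ≤ coverDegree x) (k m : ℂ) :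
    IsPainleveOrConfluent (pullback x (W k m)) ↔
      ∃ T J, TableW k m (zeroType x) (poleType x) T J :=
  ⟨tableW_of_isPainleveOrConfluent hd, fun ⟨_, J, h⟩ => ⟨J, h.rowHolds.2⟩⟩

theorem isPainleveOrConfluent_DW_iff {x : RatFunc ℂ} (hd : 2 ≤ coverDegree x) (m : ℂ) :
    IsPainleveOrConfluent (pullback x (DW m)) ↔
      (∃ T J, TableDW m (zeroType x) (poleType x) T J) ∨
        ∃ y : RatFunc ℂ, x = y ^ 2 / 16 ∧
          ∃ T J, TableW 0 (2 * m) (zeroType y) (poleType y) T J := by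
  refine ⟨tableDW_of_isPainleveOrConfluent hd, ?_⟩
  rintro (⟨_, J, h⟩ | ⟨y, rfl, _, J, h⟩)
  · exact ⟨J, h.rowHolds.2⟩
  · have hy : Nonconst y := by
      intro c hc
      have hx : Nonconst (y ^ 2 / 16) := Nonconst.of_coverDegree (by omega)
      refine hx (c ^ 2 / 16) ?_
      rw [hc, map_div₀, map_pow, map_ofNat]
    rw [pullback_sq_div hy]
    exact ⟨J, h.rowHolds.2⟩

/-! ### Hamiltonian systems and Painlevé equations -/

lemma deriv_deriv_eq {U : Set ℂ} (hU : IsOpen U) {q q' : ℂ → ℂ} {q'' t : ℂ} (ht : t ∈ U)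
    (hq : ∀ τ ∈ U, HasDerivAt q (q' τ) τ) (hq' : HasDerivAt q' q'' t) :
    deriv (deriv q) t = q'' := by
  have : deriv q =ᶠ[𝓝 t] q' :=
    Filter.eventually_of_mem (hU.mem_nhds ht) fun τ hτ => (hq τ hτ).deriv
  rw [this.deriv_eq, hq'.deriv]

/-- A solution of the Hamiltonian system on an open set is a solution in the sense of
`PainleveFamily.IsSolutionAt` if the derivative of `∂K/∂p` along it is the right hand side of the
Painlevé equation. -/
lemma isSolutionAt_of_hasDerivAt {F : PainleveFamily} {U : Set ℂ} (hU : IsOpen U)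
    {q p q' : ℂ → ℂ} {p' q'' t : ℂ} (ht : t ∈ U) (htimes : t ∈ F.times) (hfix : q t ∉ F.fixed)
    (hq : ∀ τ ∈ U, HasDerivAt q (q' τ) τ) (hp : HasDerivAt p p' t) (hq' : HasDerivAt q' q'' t)
    (hH : HasDerivAt (fun b => F.hamiltonian t (q t) b) (q' t) (p t))
    (hH' : HasDerivAt (fun a => F.hamiltonian t a (p t)) (-p') (q t))
    (hr : q'' = F.rhs t (q t) (q' t)) : F.IsSolutionAt q p t := by
  have hd : DifferentiableOn ℂ q U := fun τ hτ => (hq τ hτ).differentiableAt.differentiableWithinAt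
  refine ⟨htimes, hfix, hd.analyticAt (hU.mem_nhds ht), ?_, ?_, ?_⟩
  · rw [hH.deriv]; exact hq t ht
  · rw [hH'.deriv, neg_neg]; exact hp
  · rw [deriv_deriv_eq hU ht hq hq', (hq t ht).deriv, hr]

section Systems

variable {U : Set ℂ} {q p : ℂ → ℂ} {t : ℂ}

lemma familyP1_isSolutionAt (hU : IsOpen U) (hq : ∀ τ ∈ U, HasDerivAt q (p τ) τ)
    (hp : ∀ τ ∈ U, HasDerivAt p (6 * q τ ^ 2 + τ) τ) (ht : t ∈ U) :
    familyP1.IsSolutionAt q p t := by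
  refine isSolutionAt_of_hasDerivAt hU ht (Set.mem_univ _) (Set.notMem_empty _) hq (hp t ht)
    (hp t ht) ?_ ?_ rfl
  · have h := ((((hasDerivAt_id (p t)).pow 2).div_const 2).sub_const (2 * q t ^ 3)).sub_const
      (t * q t)
    refine HasDerivAt.congr_deriv h ?_
    simp
  · have h := ((((hasDerivAt_id (q t)).pow 3).const_mul 2).const_sub (p t ^ 2 / 2)).sub
      ((hasDerivAt_id (q t)).const_mul t)
    refine HasDerivAt.congr_deriv h ?_
    simp; ring

lemma familyP2_isSolutionAt {α : ℂ} (hU : IsOpen U) (hq : ∀ τ ∈ U, HasDerivAt q (p τ) τ)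
    (hp : ∀ τ ∈ U, HasDerivAt p (2 * q τ ^ 3 + τ * q τ + α) τ) (ht : t ∈ U) :
    (familyP2 α).IsSolutionAt q p t := by
  refine isSolutionAt_of_hasDerivAt hU ht (Set.mem_univ _) (Set.notMem_empty _) hq (hp t ht)
    (hp t ht) ?_ ?_ rfl
  · have h := (((((hasDerivAt_id (p t)).pow 2).div_const 2).sub_const (q t ^ 4 / 2)).sub_const
      (t * q t ^ 2 / 2)).sub_const (α * q t)
    refine HasDerivAt.congr_deriv h ?_
    simp
  · have h := (((((hasDerivAt_id (q t)).pow 4).div_const 2).const_sub (p t ^ 2 / 2)).sub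
      ((((hasDerivAt_id (q t)).pow 2).const_mul t).div_const 2)).sub
      ((hasDerivAt_id (q t)).const_mul α)
    refine HasDerivAt.congr_deriv h ?_
    simp; ring

lemma familyP34_isSolutionAt {α : ℂ} (hU : IsOpen U) (h0 : ∀ τ ∈ U, q τ ≠ 0)
    (hq : ∀ τ ∈ U, HasDerivAt q (-2 * q τ * p τ + 1) τ)
    (hp : ∀ τ ∈ U, HasDerivAt p (p τ ^ 2 - q τ + τ / 2 + (α - 1) / (4 * q τ ^ 2)) τ)
    (ht : t ∈ U) : (familyP34 α).IsSolutionAt q p t := by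
  have hqt := h0 t ht
  refine isSolutionAt_of_hasDerivAt hU ht (Set.mem_univ _) hqt hq (hp t ht)
    ((((hq t ht).const_mul (-2)).mul (hp t ht)).add_const 1) ?_ ?_ ?_
  · have h := (((((((hasDerivAt_id (p t)).pow 2).const_mul (-q t)).add
      (hasDerivAt_id (p t))).add_const (q t ^ 2 / 2)).sub_const
      (t * q t / 2)).add_const ((α - 1) / (4 * q t)))
    refine HasDerivAt.congr_deriv h ?_
    simp; ring
  · have h := ((((((hasDerivAt_id (q t)).neg.mul_const (p t ^ 2)).add_const (p t)).add
      (((hasDerivAt_id (q t)).pow 2).div_const 2)).sub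
      (((hasDerivAt_id (q t)).const_mul t).div_const 2)).add
      ((((hasDerivAt_id (q t)).const_mul 4).fun_inv (mul_ne_zero (by norm_num) hqt)).const_mul
        (α - 1)))
    refine HasDerivAt.congr_deriv h ?_
    simp only [id_eq]
    field_simp
    ring
  · simp only [familyP34]
    field_simp
    ring

lemma familyP4_isSolutionAt {α β : ℂ} (hU : IsOpen U) (h0 : ∀ τ ∈ U, q τ ≠ 0)
    (hq : ∀ τ ∈ U, HasDerivAt q (4 * q τ * p τ - 2) τ)
    (hp : ∀ τ ∈ U, HasDerivAt p (-(2 * p τ ^ 2) + (2 * (β / 8 + 1 / 4)) / q τ ^ 2 - α / 2 +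
      (q τ + 2 * τ) ^ 2 / 8 + q τ * (q τ + 2 * τ) / 4) τ)
    (ht : t ∈ U) : (familyP4 α β).IsSolutionAt q p t := by
  have hqt := h0 t ht
  refine isSolutionAt_of_hasDerivAt hU ht (Set.mem_univ _) hqt hq (hp t ht)
    ((((hq t ht).const_mul 4).mul (hp t ht)).sub_const 2) ?_ ?_ ?_
  · have h := (((((((hasDerivAt_id (p t)).pow 2).const_mul (2 * q t)).sub
      ((hasDerivAt_id (p t)).const_mul 2)).sub_const (2 * (-β / 8 - 1 / 4) / q t)).sub_const
      (2 * (-α / 4) * q t)).sub_const (2 * q t * ((q t + 2 * t) / 4) ^ 2))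
    refine HasDerivAt.congr_deriv h ?_
    simp; ring
  · have h := (((((((hasDerivAt_id (q t)).const_mul 2).mul_const (p t ^ 2)).sub_const
      (2 * p t)).sub
      (((hasDerivAt_id (q t)).fun_inv hqt).const_mul (2 * (-β / 8 - 1 / 4)))).sub
      ((hasDerivAt_id (q t)).const_mul (2 * (-α / 4)))).sub
      (((hasDerivAt_id (q t)).const_mul 2).mul
        ((((hasDerivAt_id (q t)).add_const (2 * t)).div_const 4).pow 2)))
    refine HasDerivAt.congr_deriv h ?_
    simp only [Pi.pow_apply, id_eq]
    field_simp
    ring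
  · simp only [familyP4]
    field_simp
    ring

lemma familyP3_isSolutionAt {α β γ δ : ℂ} (hU : IsOpen U) (h0 : ∀ τ ∈ U, q τ ≠ 0 ∧ τ ≠ 0)
    (hq : ∀ τ ∈ U, HasDerivAt q ((2 * q τ ^ 2 * p τ - q τ) / τ) τ)
    (hp : ∀ τ ∈ U, HasDerivAt p (-(2 * q τ * p τ ^ 2 - p τ - δ * τ ^ 2 / (8 * q τ ^ 3) -
      β * τ / (8 * q τ ^ 2) - α / 8 - γ * q τ / 8) / τ) τ)
    (ht : t ∈ U) : (familyP3 α β γ δ).IsSolutionAt q p t := by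
  obtain ⟨hqt, ht0⟩ := h0 t ht
  refine isSolutionAt_of_hasDerivAt hU ht ht0 hqt hq (hp t ht)
    ((((((hq t ht).pow 2).const_mul 2).mul (hp t ht)).sub (hq t ht)).div (hasDerivAt_id t) ht0)
    ?_ ?_ ?_
  · have h := (((((((hasDerivAt_id (p t)).pow 2).const_mul (q t ^ 2)).sub
      ((hasDerivAt_id (p t)).const_mul (q t))).sub_const (-δ / 16 * t ^ 2 / q t ^ 2)).sub_const
      (-β / 8 * t / q t)).sub_const (α / 8 * q t)).sub_const (γ / 16 * q t ^ 2) |>.div_const t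
    refine HasDerivAt.congr_deriv h ?_
    simp; ring
  · have h := ((((((((hasDerivAt_id (q t)).pow 2).mul_const (p t ^ 2)).sub
      ((hasDerivAt_id (q t)).mul_const (p t))).sub
      ((((hasDerivAt_id (q t)).pow 2).fun_inv (pow_ne_zero 2 hqt)).const_mul
        (-δ / 16 * t ^ 2))).sub
      (((hasDerivAt_id (q t)).fun_inv hqt).const_mul (-β / 8 * t))).sub
      ((hasDerivAt_id (q t)).const_mul (α / 8))).sub
      (((hasDerivAt_id (q t)).pow 2).const_mul (γ / 16))).div_const t
    refine HasDerivAt.congr_deriv h ?_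
    simp only [Pi.pow_apply, id_eq]
    field_simp
    ring
  · simp only [familyP3, Pi.pow_apply, Pi.sub_apply, Pi.mul_apply]
    field_simp
    ring

end Systems

/-! ### Algebraic and rational solutions -/

/-- A differentiable branch of `t ^ (1 / (n + 1))` has the expected derivative. -/
lemma hasDerivAt_root {n : ℕ} {U : Set ℂ} {s : ℂ → ℂ} (hU : IsOpen U)
    (hs : DifferentiableOn ℂ s U) (h : ∀ τ ∈ U, τ ≠ 0 ∧ s τ ^ (n + 1) = τ) {t : ℂ} (ht : t ∈ U) :
    HasDerivAt s (1 / ((n + 1) * s t ^ n)) t := by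
  have hd := (hs.differentiableAt (hU.mem_nhds ht)).hasDerivAt
  have h1 := hd.pow (n + 1)
  have h2 : HasDerivAt (s ^ (n + 1)) 1 t :=
    (hasDerivAt_id t).congr_of_eventuallyEq
      (Filter.eventually_of_mem (hU.mem_nhds ht) fun τ hτ => (h τ hτ).2)
  have e := h1.unique h2
  have hs0 : s t ≠ 0 := by
    intro h0
    have := (h t ht).2
    rw [h0, zero_pow n.succ_ne_zero] at this
    exact (h t ht).1 this.symm
  have hn : (n : ℂ) + 1 ≠ 0 := Nat.cast_add_one_ne_zero n
  have : 1 / ((n + 1) * s t ^ n) = deriv s t := by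
    have e' : ((n : ℂ) + 1) * s t ^ n * deriv s t = 1 := by simpa using e
    rw [div_eq_iff (mul_ne_zero hn (pow_ne_zero n hs0))]
    linear_combination -e'
  rw [this]
  exact hd

lemma root_ne_zero {t s : ℂ} {n : ℕ} (hn : n ≠ 0) (h : t ≠ 0 ∧ s ^ n = t) : s ≠ 0 := by
  rintro rfl
  rw [zero_pow hn] at h
  exact h.1 h.2.symm

/-- The symmetry `q ↦ t / q` of P3 fixes the parameters with `β = -α`, `δ = -γ`, and `q = -√t` is a
solution fixed by it. -/
lemma isSolutionAt_neg_sqrt {α γ : ℂ} {U : Set ℂ} {s : ℂ → ℂ}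
    {δ β : ℂ} (hβ : β = -α) (hδ : δ = -γ) (hU : IsOpen U)
    (hs : DifferentiableOn ℂ s U) (h : ∀ t ∈ U, t ≠ 0 ∧ s t ^ 2 = t) {t : ℂ} (ht : t ∈ U) :
    (familyP3 α β γ δ).IsSolutionAt (fun t => -s t) (fun t => -3 / (4 * s t)) t := by
  subst hβ hδ
  have hne : ∀ τ ∈ U, s τ ≠ 0 := fun τ hτ => root_ne_zero two_ne_zero (h τ hτ)
  have hder : ∀ τ ∈ U, HasDerivAt s (1 / (2 * s τ)) τ := fun τ hτ => by
    have := hasDerivAt_root (n := 1) hU hs h hτ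
    simpa [one_add_one_eq_two] using this
  refine familyP3_isSolutionAt hU (fun τ hτ => ⟨neg_ne_zero.2 (hne τ hτ), (h τ hτ).1⟩)
    (fun τ hτ => (hder τ hτ).neg.congr_deriv ?_)
    (fun τ hτ => ((((hder τ hτ).const_mul 4).fun_inv
      (mul_ne_zero (by norm_num) (hne τ hτ))).const_mul (-3)).congr_deriv ?_) ht
  · have h0 := hne τ hτ
    have h1 := (h τ hτ).2
    generalize s τ = r at *
    subst h1
    field_simp
    ring
  · have h0 := hne τ hτ
    have h1 := (h τ hτ).2
    generalize s τ = r at *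
    subst h1
    field_simp
    ring

lemma realizedOn_D6alg (k : ℂ) (U : Set ℂ) (s : ℂ → ℂ) (hU : IsOpen U)
    (hs : DifferentiableOn ℂ s U) (h : ∀ t ∈ U, t ≠ 0 ∧ s t ^ 2 = t) :
    (familyP3 (-8 * k) (8 * k) 4 (-4)).RealizedOn U (fun t => -s t) (W k (1 / 4))
      (fun t => coverD6alg (s t)) (fun t => potD6alg k t (s t)) :=
  ⟨fun t => -3 / (4 * s t), fun t ht =>
    have hne := root_ne_zero two_ne_zero (h t ht)
    ⟨isSolutionAt_neg_sqrt (by ring) rfl hU hs h ht, pullback_coverD6alg (h t ht).2,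
      potD6alg_eq hne (h t ht).2⟩⟩

lemma realizedOn_D8alg (c : ℂ) (U : Set ℂ) (s : ℂ → ℂ) (hc : c ≠ 0) (hU : IsOpen U)
    (hs : DifferentiableOn ℂ s U) (h : ∀ t ∈ U, t ≠ 0 ∧ s t ^ 2 = t) :
    (familyP3 (8 * c) (-8 * c) 0 0).RealizedOn U (fun t => -s t) (DW (1 / 4))
      (fun t => coverD8alg c (s t)) (fun t => potD8alg c t (s t)) :=
  ⟨fun t => -3 / (4 * s t), fun t ht =>
    have hne := root_ne_zero two_ne_zero (h t ht)
    ⟨isSolutionAt_neg_sqrt (by ring) (by ring) hU hs h ht,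
      pullback_coverD8alg hc (h t ht).2, potD8alg_eq hne (h t ht).2⟩⟩

lemma realizedOn_D7alg (U : Set ℂ) (s : ℂ → ℂ) (hU : IsOpen U)
    (hs : DifferentiableOn ℂ s U) (h : ∀ t ∈ U, t ≠ 0 ∧ s t ^ 3 = t) :
    (familyP3 0 (-2) 2 0).RealizedOn U s (DW (1 / 6))
      (fun t => coverD7alg (s t)) (fun t => potD7alg t (s t)) := by
  have hne : ∀ τ ∈ U, s τ ≠ 0 := fun τ hτ => root_ne_zero three_ne_zero (h τ hτ)
  have hder : ∀ τ ∈ U, HasDerivAt s (1 / (3 * s τ ^ 2)) τ := fun τ hτ => by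
    have := hasDerivAt_root (n := 2) hU hs h hτ
    norm_num at this
    simpa using this
  refine ⟨fun t => 2 / (3 * s t), fun t ht => ⟨familyP3_isSolutionAt hU
    (fun τ hτ => ⟨hne τ hτ, (h τ hτ).1⟩) (fun τ hτ => (hder τ hτ).congr_deriv ?_)
    (fun τ hτ => ((((hder τ hτ).const_mul 3).fun_inv
      (mul_ne_zero (by norm_num) (hne τ hτ))).const_mul 2).congr_deriv ?_) ht,
    pullback_coverD7alg (hne t ht) (h t ht).2, potD7alg_eq (hne t ht) (h t ht).2⟩⟩
  · have h0 := hne τ hτ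
    have h1 := (h τ hτ).2
    generalize s τ = r at *
    subst h1
    field_simp
    ring
  · have h0 := hne τ hτ
    have h1 := (h τ hτ).2
    generalize s τ = r at *
    subst h1
    field_simp
    ring

lemma realizedOn_P4Her :
    (familyP4 0 (-2)).RealizedOn {0}ᶜ (fun t => -2 * t) (W 0 (1 / 2)) coverP4Her potP4Her := by
  refine ⟨fun _ => 0, fun t ht => ⟨familyP4_isSolutionAt isOpen_compl_singleton
    (fun τ hτ => mul_ne_zero (by norm_num) hτ)
    (fun τ _ => ((hasDerivAt_id τ).const_mul (-2)).congr_deriv (by ring))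
    (fun τ _ => (hasDerivAt_const τ 0).congr_deriv ?_) ht,
    pullback_coverP4Her t, potP4Her_eq t⟩⟩
  norm_num

lemma realizedOn_P4rat :
    (familyP4 0 (-2 / 9)).RealizedOn {0}ᶜ (fun t => -2 * t / 3) (DW (1 / 6))
      coverP4rat potP4rat := by
  refine ⟨fun t => -1 / (2 * t), fun t ht => ⟨familyP4_isSolutionAt isOpen_compl_singleton
    (fun τ hτ => div_ne_zero (mul_ne_zero (by norm_num) hτ) (by norm_num))
    (fun τ hτ => (((hasDerivAt_id τ).const_mul (-2)).div_const 3).congr_deriv ?_)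
    (fun τ hτ => ((((hasDerivAt_id τ).const_mul 2).fun_inv
      (mul_ne_zero (by norm_num) hτ)).const_mul (-1)).congr_deriv ?_) ht,
    pullback_coverP4rat t, potP4rat_eq ht⟩⟩
  · have h0 : τ ≠ 0 := hτ
    field_simp
    ring
  · have h0 : τ ≠ 0 := hτ
    simp only [id_eq]
    field_simp
    ring

lemma realizedOn_P34rat :
    (familyP34 (1 / 4)).RealizedOn {0}ᶜ (fun t => t / 2) (DW (1 / 4)) coverP34rat potP34rat := by
  refine ⟨fun t => 1 / (2 * t), fun t ht => ⟨familyP34_isSolutionAt isOpen_compl_singleton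
    (fun τ hτ => div_ne_zero hτ (by norm_num))
    (fun τ hτ => ((hasDerivAt_id τ).div_const 2).congr_deriv ?_)
    (fun τ hτ => ((((hasDerivAt_id τ).const_mul 2).fun_inv
      (mul_ne_zero (by norm_num) hτ)).const_mul 1).congr_deriv ?_) ht,
    pullback_coverP34rat ht, potP34rat_eq ht⟩⟩
  · have h0 : τ ≠ 0 := hτ
    field_simp
    ring
  · have h0 : τ ≠ 0 := hτ
    simp only [id_eq]
    field_simp
    ring

lemma realizedOn_P2rat :
    (familyP2 0).RealizedOn Set.univ (fun _ => 0) (DW (1 / 6)) coverP2rat potP2rat :=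
  ⟨fun _ => 0, fun t ht => ⟨familyP2_isSolutionAt isOpen_univ
    (fun τ _ => hasDerivAt_const τ 0)
    (fun τ _ => (hasDerivAt_const τ 0).congr_deriv (by simp)) ht,
    pullback_coverP2rat t, potP2rat_eq t⟩⟩

lemma realizedOn_P5rat (m h : ℂ) (hh : h ≠ 0) :
    (familyP5 (2 * m ^ 2) (-2 * m ^ 2) 0 (-2 * h)).RealizedOn {0}ᶜ (fun _ => -1) (DW m)
      (coverP5rat h) (potP5rat m h) := by
  refine ⟨fun _ => -3 / 4, fun t ht => ⟨isSolutionAt_of_hasDerivAt isOpen_compl_singleton ht ht ?_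
    (fun τ _ => hasDerivAt_const τ _) (p' := 0) (hasDerivAt_const t _) (hasDerivAt_const t 0)
    ?_ ?_ ?_, pullback_coverP5rat hh ht, potP5rat_eq⟩⟩
  · simp only [familyP5, Set.mem_insert_iff, Set.mem_singleton_iff]
    norm_num
  · have h0 : t ≠ 0 := ht
    have h := (((((hasDerivAt_id (-3 / 4 : ℂ)).pow 2).sub
      ((hasDerivAt_id (-3 / 4 : ℂ)).const_mul (-3 / 2))).add_const
      (-(h * t ^ 2) / 16 + 1 / 4 * (3 / 4) - (m ^ 2 - 1 / 4))).const_mul (-4)).div_const t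
    refine (HasDerivAt.congr_deriv h ?_).congr_of_eventuallyEq (.of_forall fun b => ?_)
    · norm_num
    · simp only [familyP5, Pi.pow_apply, id_eq, Pi.sub_apply]
      field_simp
      ring
  · have h0 : t ≠ 0 := ht
    -- Off the fixed singular points the Hamiltonian with `p = -3/4` is `G`, and `G'(-1) = 0`.
    set G : ℂ → ℂ := fun a => (-(h * t ^ 2) * (a * ((a - 1) ^ 2)⁻¹) + a * (a - 1) ^ 2 * (9 / 16)
      + (a - 1) ^ 2 * (3 / 4) + a * (a - 1) * (3 / 4) + 3 / 4 * a
      - (m ^ 2 - 1 / 4) * ((a - 1) ^ 2 * a⁻¹)) / t with hG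
    have h1 := ((hasDerivAt_id (-1 : ℂ)).sub_const 1)
    have hG' : HasDerivAt G (-0) (-1) := by
      have h := (((((((((hasDerivAt_id (-1 : ℂ)).mul ((h1.pow 2).fun_inv (by norm_num))).const_mul
        (-(h * t ^ 2))).add (((hasDerivAt_id (-1 : ℂ)).mul (h1.pow 2)).mul_const (9 / 16))).add
        ((h1.pow 2).mul_const (3 / 4))).add (((hasDerivAt_id (-1 : ℂ)).mul h1).mul_const (3 / 4))).add
        ((hasDerivAt_id (-1 : ℂ)).const_mul (3 / 4))).sub
        (((h1.pow 2).mul ((hasDerivAt_id (-1 : ℂ)).fun_inv (by norm_num))).const_mul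
          (m ^ 2 - 1 / 4))).div_const t)
      refine HasDerivAt.congr_deriv h ?_
      simp only [Pi.pow_apply, id_eq]
      norm_num
    refine hG'.congr_of_eventuallyEq ?_
    have e0 : ∀ᶠ a : ℂ in 𝓝 (-1), a ≠ 0 := isOpen_ne.mem_nhds (by norm_num)
    have e1 : ∀ᶠ a : ℂ in 𝓝 (-1), a ≠ 1 := isOpen_ne.mem_nhds (by norm_num)
    filter_upwards [e0, e1] with a ha0 ha1
    have ha1 := sub_ne_zero.2 ha1
    simp only [familyP5, hG]
    field_simp
    ring
  · simp only [familyP5]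
    field_simp
    ring

/-! ### Power series solutions of quadratic systems -/

section Series

variable {c d : ℕ → ℂ} {A B M : ℝ} {t : ℂ}

lemma norm_term_le (hM : 0 ≤ M) (hc : ∀ n, ‖c n‖ ≤ A * M ^ n) (ht : 2 * M * ‖t‖ ≤ 1) (n : ℕ) :
    ‖c n * t ^ n‖ ≤ A * (1 / 2) ^ n := by
  have hA : 0 ≤ A := by simpa using (norm_nonneg _).trans (hc 0)
  rw [norm_mul, norm_pow]
  calc ‖c n‖ * ‖t‖ ^ n ≤ A * M ^ n * ‖t‖ ^ n := by gcongr; exact hc n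
    _ = A * (M * ‖t‖) ^ n := by rw [mul_pow, mul_assoc]
    _ ≤ A * (1 / 2) ^ n := by
      have : M * ‖t‖ ≤ 1 / 2 := by linarith
      gcongr

lemma summable_half (A : ℝ) : Summable fun n : ℕ => A * (1 / 2 : ℝ) ^ n :=
  summable_geometric_two.mul_left A

lemma summable_norm_term (hM : 0 ≤ M) (hc : ∀ n, ‖c n‖ ≤ A * M ^ n) (ht : 2 * M * ‖t‖ ≤ 1) :
    Summable fun n => ‖c n * t ^ n‖ :=
  (summable_half A).of_nonneg_of_le (fun _ => norm_nonneg _) (norm_term_le hM hc ht)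

lemma hasSum_term (hM : 0 ≤ M) (hc : ∀ n, ‖c n‖ ≤ A * M ^ n) (ht : 2 * M * ‖t‖ ≤ 1) :
    HasSum (fun n => c n * t ^ n) (∑' n, c n * t ^ n) :=
  (summable_norm_term hM hc ht).of_norm.hasSum

/-- Termwise differentiation of a power series whose coefficients grow at most geometrically. -/
lemma hasDerivAt_tsum_pow (hM : 0 < M) (hc : ∀ n, ‖c n‖ ≤ A * M ^ n) (ht : 2 * M * ‖t‖ < 1) :
    HasSum (fun n : ℕ => ((n + 1 : ℂ) * c (n + 1)) * t ^ n)
      (deriv (fun w => ∑' n, c n * w ^ n) t) ∧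
    HasDerivAt (fun w => ∑' n, c n * w ^ n) (deriv (fun w => ∑' n, c n * w ^ n) t) t := by
  have hU : IsOpen {w : ℂ | 2 * M * ‖w‖ < 1} :=
    isOpen_lt (continuous_const.mul continuous_norm) continuous_const
  have hd : ∀ n : ℕ, Differentiable ℂ fun w : ℂ => c n * w ^ n := fun n =>
    (differentiable_id.pow n).const_mul (c n)
  have hle : ∀ (n : ℕ) (w : ℂ), w ∈ {w : ℂ | 2 * M * ‖w‖ < 1} → ‖c n * w ^ n‖ ≤ A * (1 / 2) ^ n :=
    fun n w hw => norm_term_le hM.le hc (le_of_lt hw) n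
  have h1 := Complex.hasSum_deriv_of_summable_norm (summable_half A)
    (fun n => (hd n).differentiableOn) hU hle ht
  have h2 := Complex.differentiableOn_tsum_of_summable_norm (summable_half A)
    (fun n => (hd n).differentiableOn) hU hle
  refine ⟨?_, (h2.differentiableAt (hU.mem_nhds ht)).hasDerivAt⟩
  have e : ∀ n : ℕ, deriv (fun w : ℂ => c n * w ^ n) t = c n * (n * t ^ (n - 1)) := fun n =>
    ((hasDerivAt_pow n t).const_mul (c n)).deriv
  simp only [e] at h1
  rw [← hasSum_nat_add_iff' 1] at h1
  simp only [Finset.range_one, Finset.sum_singleton, Nat.cast_zero, zero_mul, mul_zero,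
    sub_zero, Nat.add_sub_cancel, Nat.cast_add, Nat.cast_one] at h1
  refine h1.congr_fun ?_ 
  intro n
  ring

lemma norm_deriv_coeff_le (hc : ∀ n, ‖c n‖ ≤ A * M ^ n) (n : ℕ) :
    ‖((n + 1 : ℂ) * c (n + 1))‖ ≤ A * M * (2 * M) ^ n := by
  have hA : 0 ≤ A := by simpa using (norm_nonneg _).trans (hc 0)
  have h1 : ‖(n + 1 : ℂ)‖ = n + 1 := by
    have := Complex.norm_natCast (n + 1)
    push_cast at this
    exact this
  have h2 : ((n : ℝ) + 1) ≤ 2 ^ n := by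
    have : n + 1 ≤ 2 ^ n := Nat.lt_two_pow_self
    exact_mod_cast this
  rw [norm_mul, h1]
  calc ((n : ℝ) + 1) * ‖c (n + 1)‖ ≤ 2 ^ n * (A * M ^ (n + 1)) := by
        gcongr
        exact hc _
    _ = A * M * (2 * M) ^ n := by rw [mul_pow]; ring

lemma hasSum_mul_term (hM : 0 ≤ M) (hc : ∀ n, ‖c n‖ ≤ A * M ^ n) (hd : ∀ n, ‖d n‖ ≤ B * M ^ n)
    (ht : 2 * M * ‖t‖ ≤ 1) :
    HasSum (fun n => (∑ ij ∈ Finset.HasAntidiagonal.antidiagonal n, c ij.1 * d ij.2) * t ^ n)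
      ((∑' n, c n * t ^ n) * ∑' n, d n * t ^ n) := by
  have h1 := summable_norm_term hM hc ht
  have h2 := summable_norm_term hM hd ht
  have h3 := tsum_mul_tsum_eq_tsum_sum_antidiagonal_of_summable_norm h1 h2
  have h4 := (summable_norm_sum_mul_antidiagonal_of_summable_norm h1 h2).of_norm.hasSum
  rw [← h3] at h4
  refine h4.congr_fun fun n => ?_
  rw [Finset.sum_mul]
  refine Finset.sum_congr rfl fun ij hij => ?_
  rw [← Finset.HasAntidiagonal.mem_antidiagonal.1 hij, pow_add]
  ring

lemma norm_antidiagonal_le (hA : 0 ≤ A) (n : ℕ) (hc : ∀ i ≤ n, ‖c i‖ ≤ A * M ^ i)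
    (hd : ∀ i ≤ n, ‖d i‖ ≤ A * M ^ i) (hM : 0 ≤ M) :
    ‖∑ ij ∈ Finset.HasAntidiagonal.antidiagonal n, c ij.1 * d ij.2‖ ≤ (n + 1) * (A ^ 2 * M ^ n) := by
  refine (norm_sum_le _ _).trans ?_
  calc ∑ ij ∈ Finset.HasAntidiagonal.antidiagonal n, ‖c ij.1 * d ij.2‖
      ≤ ∑ ij ∈ Finset.HasAntidiagonal.antidiagonal n, A ^ 2 * M ^ n := by
        refine Finset.sum_le_sum fun ij hij => ?_
        have h := Finset.HasAntidiagonal.mem_antidiagonal.1 hij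
        rw [norm_mul, ← h, pow_add]
        calc ‖c ij.1‖ * ‖d ij.2‖ ≤ (A * M ^ ij.1) * (A * M ^ ij.2) := by
              gcongr
              · exact hc _ (by omega)
              · exact hd _ (by omega)
          _ = _ := by ring
    _ = (n + 1) * (A ^ 2 * M ^ n) := by
        rw [Finset.sum_const, Finset.Nat.card_antidiagonal, nsmul_eq_mul]
        push_cast
        ring

end Series

section Quadratic

variable {ι : Type*} [Fintype ι] (b : ι → ι → ι → ℂ) (y₀ : ι → ℂ)

/-- The Taylor coefficients at `0` of the solution of the quadratic system
`yᵢ' = ∑ⱼₖ bᵢⱼₖ yⱼ yₖ` with initial value `y₀`. -/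
def quadCoeff : ℕ → ι → ℂ
  | 0, i => y₀ i
  | n + 1, i => 1 / (n + 1 : ℂ) * ∑ j, ∑ k, b i j k *
      ∑ l : Fin (n + 1), quadCoeff l j * quadCoeff (n - l) k

lemma quadCoeff_succ (n : ℕ) (i : ι) :
    quadCoeff b y₀ (n + 1) i = 1 / (n + 1 : ℂ) * ∑ j, ∑ k, b i j k *
      ∑ lm ∈ Finset.HasAntidiagonal.antidiagonal n, quadCoeff b y₀ lm.1 j * quadCoeff b y₀ lm.2 k := by
  rw [quadCoeff]
  simp only [Finset.Nat.sum_antidiagonal_eq_sum_range_succ_mk, Finset.sum_range]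

/-- The coefficients of a quadratic system grow at most geometrically: the convolution of two
sequences bounded by `A M ^ n` has the bound `(n + 1) A² M ^ n`, and the integration of the
system divides by `n + 1`. -/
lemma exists_quadCoeff_bound :
    ∃ A M : ℝ, 0 < M ∧ ∀ n i, ‖quadCoeff b y₀ n i‖ ≤ A * M ^ n := by
  set A : ℝ := ∑ i, ‖y₀ i‖ with hA
  set S : ℝ := ∑ i, ∑ j, ∑ k, ‖b i j k‖ with hS
  have hA0 : 0 ≤ A := Finset.sum_nonneg fun i _ => norm_nonneg _
  have hS0 : 0 ≤ S := Finset.sum_nonneg fun i _ => Finset.sum_nonneg fun j _ =>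
    Finset.sum_nonneg fun k _ => norm_nonneg _
  refine ⟨A, S * A + 1, by positivity, fun n => ?_⟩
  induction n using Nat.strong_induction_on with
  | _ n ih =>
    intro i
    cases n with
    | zero =>
      rw [pow_zero, mul_one, quadCoeff]
      exact Finset.single_le_sum (f := fun i => ‖y₀ i‖) (fun i _ => norm_nonneg _)
        (Finset.mem_univ i)
    | succ n =>
      set M : ℝ := S * A + 1 with hM
      have hM0 : 0 ≤ M := by positivity
      have hn : ‖(1 / (n + 1 : ℂ))‖ = 1 / (n + 1) := by
        have := Complex.norm_natCast (n + 1)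
        push_cast at this
        rw [norm_div, norm_one, this]
      have hn0 : (0 : ℝ) < n + 1 := by positivity
      rw [quadCoeff_succ, norm_mul, hn]
      calc 1 / ((n : ℝ) + 1) * ‖∑ j, ∑ k, b i j k *
            ∑ lm ∈ Finset.HasAntidiagonal.antidiagonal n, quadCoeff b y₀ lm.1 j * quadCoeff b y₀ lm.2 k‖
          ≤ 1 / ((n : ℝ) + 1) * ∑ j, ∑ k, ‖b i j k‖ * ((n + 1) * (A ^ 2 * M ^ n)) := by
            gcongr
            refine (norm_sum_le _ _).trans (Finset.sum_le_sum fun j _ => ?_)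
            refine (norm_sum_le _ _).trans (Finset.sum_le_sum fun k _ => ?_)
            rw [norm_mul]
            gcongr
            exact norm_antidiagonal_le hA0 n (fun l hl => ih l (by omega) j)
              (fun l hl => ih l (by omega) k) hM0
        _ = (∑ j, ∑ k, ‖b i j k‖) * (A ^ 2 * M ^ n) := by
            simp only [← Finset.sum_mul]
            field_simp
        _ ≤ S * (A ^ 2 * M ^ n) := by
            gcongr
            exact Finset.single_le_sum (f := fun i => ∑ j, ∑ k, ‖b i j k‖)
              (fun i _ => Finset.sum_nonneg fun j _ => Finset.sum_nonneg fun k _ => norm_nonneg _)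
              (Finset.mem_univ i)
        _ = A * M ^ n * (S * A) := by ring
        _ ≤ A * M ^ n * M := by
            gcongr
            linarith
        _ = A * M ^ (n + 1) := by ring

/-- The sum of the power series with the coefficients `quadCoeff`. -/
def quadSol (i : ι) (t : ℂ) : ℂ := ∑' n, quadCoeff b y₀ n i * t ^ n

lemma quadSol_zero (i : ι) : quadSol b y₀ i 0 = y₀ i := by
  rw [quadSol, tsum_eq_single 0 fun n hn => by rw [zero_pow hn, mul_zero], pow_zero, mul_one,
    quadCoeff]

lemma exists_hasDerivAt_quadSol : ∃ U : Set ℂ, IsOpen U ∧ 0 ∈ U ∧ ∀ t ∈ U, ∀ i,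
    HasDerivAt (quadSol b y₀ i) (∑ j, ∑ k, b i j k * (quadSol b y₀ j t * quadSol b y₀ k t)) t := by
  obtain ⟨A, M, hM, h⟩ := exists_quadCoeff_bound b y₀
  refine ⟨{w : ℂ | 2 * M * ‖w‖ < 1},
    isOpen_lt (continuous_const.mul continuous_norm) continuous_const, by simp, fun t ht i => ?_⟩
  have ht' : 2 * M * ‖t‖ < 1 := ht
  obtain ⟨h1, h2⟩ := hasDerivAt_tsum_pow hM (fun n => h n i) ht'
  have h3 : HasSum (fun n => ∑ j, ∑ k, b i j k * ((∑ lm ∈ Finset.HasAntidiagonal.antidiagonal n,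
      quadCoeff b y₀ lm.1 j * quadCoeff b y₀ lm.2 k) * t ^ n))
      (∑ j, ∑ k, b i j k * (quadSol b y₀ j t * quadSol b y₀ k t)) :=
    hasSum_sum fun j _ => hasSum_sum fun k _ =>
      (hasSum_mul_term hM.le (fun n => h n j) (fun n => h n k) ht'.le).mul_left _
  have e : ∀ n : ℕ, ((n + 1 : ℂ) * quadCoeff b y₀ (n + 1) i) * t ^ n =
      ∑ j, ∑ k, b i j k * ((∑ lm ∈ Finset.HasAntidiagonal.antidiagonal n,
      quadCoeff b y₀ lm.1 j * quadCoeff b y₀ lm.2 k) * t ^ n) := fun n => by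
    have hn : (n + 1 : ℂ) ≠ 0 := Nat.cast_add_one_ne_zero n
    rw [quadCoeff_succ, ← mul_assoc, mul_one_div_cancel hn, one_mul, Finset.sum_mul]
    refine Finset.sum_congr rfl fun j _ => ?_
    rw [Finset.sum_mul]
    exact Finset.sum_congr rfl fun k _ => by ring
  simp only [e] at h1
  rw [h1.unique h3] at h2
  exact h2

/-- A diagonal symmetry of the system and of the initial value is a symmetry of the solution. -/
lemma quadSol_symm {ω : ℂ} {g : ι → ℂ} (h0 : ∀ i, g i * y₀ i = y₀ i)
    (hb : ∀ i j k, b i j k ≠ 0 → ω * (g j * g k) = g i) (i : ι) (t : ℂ) :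
    quadSol b y₀ i (ω * t) = g i * quadSol b y₀ i t := by
  have key : ∀ n i, quadCoeff b y₀ n i * ω ^ n = g i * quadCoeff b y₀ n i := by
    intro n
    induction n using Nat.strong_induction_on with
    | _ n ih =>
      intro i
      cases n with
      | zero => rw [pow_zero, mul_one, quadCoeff, h0]
      | succ n =>
        rw [quadCoeff_succ, mul_left_comm (g i), mul_assoc, Finset.sum_mul, Finset.mul_sum _ _ (g i)]
        congr 1
        refine Finset.sum_congr rfl fun j _ => ?_
        rw [Finset.sum_mul, Finset.mul_sum _ _ (g i)]
        refine Finset.sum_congr rfl fun k _ => ?_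
        by_cases hz : b i j k = 0
        · simp [hz]
        rw [mul_assoc, mul_left_comm (g i), Finset.sum_mul, Finset.mul_sum _ _ (g i)]
        congr 1
        refine Finset.sum_congr rfl fun lm hlm => ?_
        have e := Finset.HasAntidiagonal.mem_antidiagonal.1 hlm
        have e1 := ih lm.1 (by omega) j
        have e2 := ih lm.2 (by omega) k
        rw [← hb i j k hz, ← e, pow_succ, pow_add]
        linear_combination (ω * (quadCoeff b y₀ lm.2 k * ω ^ lm.2)) * e1 +
          (ω * (g j * quadCoeff b y₀ lm.1 j)) * e2
  rw [quadSol, quadSol, ← tsum_mul_left]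
  refine tsum_congr fun n => ?_
  rw [mul_pow, ← mul_assoc, key, mul_assoc]

end Quadratic

/-- The quadratic form with the matrix `M` in `1, t, q, p`. -/
def planarForm (M : Matrix (Fin 4) (Fin 4) ℂ) (t q p : ℂ) : ℂ :=
  ∑ j, ∑ k, M j k * (![1, t, q, p] j * ![1, t, q, p] k)

/-- A planar system whose right hand sides are polynomials of degree at most `2` in `t, q, p`
has a solution vanishing at `0`, with all the diagonal symmetries of the system. It is made
quadratic and autonomous by adding `1` and `t` to the unknowns. -/
lemma exists_planar_solution (M N : Matrix (Fin 4) (Fin 4) ℂ) :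
    ∃ (U : Set ℂ) (q p : ℂ → ℂ), IsOpen U ∧ 0 ∈ U ∧ q 0 = 0 ∧ p 0 = 0 ∧
      (∀ t ∈ U, HasDerivAt q (planarForm M t (q t) (p t)) t) ∧
      (∀ t ∈ U, HasDerivAt p (planarForm N t (q t) (p t)) t) ∧
      ∀ ω g h : ℂ, (∀ j k, ω * (![1, ω, g, h] j * ![1, ω, g, h] k) * M j k = g * M j k) →
        (∀ j k, ω * (![1, ω, g, h] j * ![1, ω, g, h] k) * N j k = h * N j k) →
        ∀ t, q (ω * t) = g * q t ∧ p (ω * t) = h * p t := by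
  set b : Fin 4 → Fin 4 → Fin 4 → ℂ :=
    ![0, fun j k => if j = 0 ∧ k = 0 then 1 else 0, M, N] with hb
  set y₀ : Fin 4 → ℂ := ![1, 0, 0, 0] with hy
  have c0 : ∀ n, quadCoeff b y₀ n 0 = if n = 0 then 1 else 0 := by
    intro n
    cases n with
    | zero => simp [quadCoeff, hy]
    | succ n => rw [quadCoeff_succ]; simp [hb]
  have c1 : ∀ n, quadCoeff b y₀ n 1 = if n = 1 then 1 else 0 := by
    intro n
    cases n with
    | zero => simp [quadCoeff, hy]
    | succ n =>
      rw [quadCoeff_succ, Fin.sum_univ_four]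
      simp only [Fin.sum_univ_four, c0]
      cases n with
      | zero => simp [hb]
      | succ n =>
        rw [Finset.sum_eq_zero fun lm hlm => ?_]
        · simp [hb]
        · have := Finset.HasAntidiagonal.mem_antidiagonal.1 hlm
          split_ifs <;> first | omega | simp
  have y0 : ∀ t, quadSol b y₀ 0 t = 1 := fun t => by
    rw [quadSol, tsum_eq_single 0 fun n hn => by rw [c0, if_neg hn, zero_mul]]
    simp [c0]
  have y1 : ∀ t, quadSol b y₀ 1 t = t := fun t => by
    rw [quadSol, tsum_eq_single 1 fun n hn => by rw [c1, if_neg hn, zero_mul]]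
    simp [c1]
  obtain ⟨U, hU, h0, hd⟩ := exists_hasDerivAt_quadSol b y₀
  have hv : ∀ t, (fun j => quadSol b y₀ j t) = ![1, t, quadSol b y₀ 2 t, quadSol b y₀ 3 t] := by
    intro t
    ext j
    fin_cases j
    · exact y0 t
    · exact y1 t
    · rfl
    · rfl
  refine ⟨U, quadSol b y₀ 2, quadSol b y₀ 3, hU, h0, quadSol_zero b y₀ 2, quadSol_zero b y₀ 3,
    fun t ht => ?_, fun t ht => ?_, fun ω g h hM hN t => ?_⟩
  · rw [planarForm, ← hv t]
    exact hd t ht 2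
  · rw [planarForm, ← hv t]
    exact hd t ht 3
  · have hs := quadSol_symm b y₀ (ω := ω) (g := ![1, ω, g, h]) (fun i => by
      fin_cases i <;> simp [hy]) (fun i j k hne => ?_)
    · exact ⟨hs 2 t, hs 3 t⟩
    · fin_cases i
      · exact absurd rfl hne
      · have : j = 0 ∧ k = 0 := by
          by_contra hc
          exact hne (if_neg hc)
        rw [this.1, this.2]
        simp
      · exact mul_right_cancel₀ hne (hM j k)
      · exact mul_right_cancel₀ hne (hN j k)

/-! ### Symmetric solutions -/

section Charts

lemma analyticAt_of_hasDerivAt {U : Set ℂ} (hU : IsOpen U) {q q' : ℂ → ℂ}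
    (hq : ∀ t ∈ U, HasDerivAt q (q' t) t) {t : ℂ} (ht : t ∈ U) : AnalyticAt ℂ q t :=
  DifferentiableOn.analyticAt (fun τ hτ => (hq τ hτ).differentiableAt.differentiableWithinAt)
    (hU.mem_nhds ht)

/-- With `p + c / q` in place of `p` this is the Hamiltonian system of P4 with
`a₀ = c (c - 1)`, `a₁ = -k`; it stays regular where `q = 0`. -/
lemma exists_P4_chart (c k : ℂ) : ∃ (U : Set ℂ) (q p : ℂ → ℂ), IsOpen U ∧ 0 ∈ U ∧ q 0 = 0 ∧
    p 0 = 0 ∧ (∀ t ∈ U, HasDerivAt q (4 * q t * p t + 4 * c - 2) t) ∧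
    (∀ t ∈ U, HasDerivAt p (-(2 * p t ^ 2) - 2 * k + (q t + 2 * t) ^ 2 / 8 +
      q t * (q t + 2 * t) / 4) t) ∧
    ∀ ω : ℂ, ω ^ 2 = 1 → ∀ t, q (ω * t) = ω ^ 1 * q t := by
  obtain ⟨U, q, p, hU, h0, hq0, hp0, hq, hp, hs⟩ := exists_planar_solution
    !![4 * c - 2, 0, 0, 0; 0, 0, 0, 0; 0, 0, 0, 4; 0, 0, 0, 0]
    !![-2 * k, 0, 0, 0; 0, 1 / 2, 1, 0; 0, 0, 3 / 8, 0; 0, 0, 0, -2]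
  refine ⟨U, q, p, hU, h0, hq0, hp0, fun t ht => (hq t ht).congr_deriv ?_,
    fun t ht => (hp t ht).congr_deriv ?_, fun ω hω t => (hs ω (ω ^ 1) ω ?_ ?_ t).1⟩
  · simp [planarForm, Fin.sum_univ_four]
    ring
  · simp [planarForm, Fin.sum_univ_four]
    ring
  · have e : ω * (ω * ω) = ω := by linear_combination ω * hω
    simp [Fin.forall_fin_succ, e]
  · have e : ω * (ω * ω) = ω := by linear_combination ω * hω
    simp [Fin.forall_fin_succ, e]

/-- With `p + c / q` in place of `p` this is the Hamiltonian system of P34(`(1 - 2 c)²`); it stays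
regular where `q = 0`. -/
lemma exists_P34_chart (c : ℂ) : ∃ (U : Set ℂ) (q p : ℂ → ℂ), IsOpen U ∧ 0 ∈ U ∧ q 0 = 0 ∧
    p 0 = 0 ∧ (∀ t ∈ U, HasDerivAt q (-2 * q t * p t + 1 - 2 * c) t) ∧
    (∀ t ∈ U, HasDerivAt p (p t ^ 2 - q t + t / 2) t) ∧
    ∀ ω : ℂ, ω ^ 3 = 1 → ∀ t, q (ω * t) = ω ^ 1 * q t := by
  obtain ⟨U, q, p, hU, h0, hq0, hp0, hq, hp, hs⟩ := exists_planar_solution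
    !![1 - 2 * c, 0, 0, 0; 0, 0, 0, 0; 0, 0, 0, -2; 0, 0, 0, 0]
    !![0, 1 / 2, -1, 0; 0, 0, 0, 0; 0, 0, 0, 0; 0, 0, 0, 1]
  refine ⟨U, q, p, hU, h0, hq0, hp0, fun t ht => (hq t ht).congr_deriv ?_,
    fun t ht => (hp t ht).congr_deriv ?_, fun ω hω t => (hs ω (ω ^ 1) (ω ^ 2) ?_ ?_ t).1⟩
  · simp [planarForm, Fin.sum_univ_four]
    ring
  · simp [planarForm, Fin.sum_univ_four]
    ring
  · have e : ω * (ω * ω ^ 2) = ω := by linear_combination ω * hω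
    simp [Fin.forall_fin_succ, e]
  · have e : ω * (ω ^ 2 * ω ^ 2) = ω ^ 2 := by linear_combination ω ^ 2 * hω
    simp [Fin.forall_fin_succ, e, (sq ω).symm]

lemma exists_P1_chart : ∃ (U : Set ℂ) (q p : ℂ → ℂ), IsOpen U ∧ 0 ∈ U ∧ q 0 = 0 ∧
    p 0 = 0 ∧ (∀ t ∈ U, HasDerivAt q (p t) t) ∧
    (∀ t ∈ U, HasDerivAt p (6 * q t ^ 2 + t) t) ∧
    ∀ ω : ℂ, ω ^ 5 = 1 → ∀ t, q (ω * t) = ω ^ 3 * q t := by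
  obtain ⟨U, q, p, hU, h0, hq0, hp0, hq, hp, hs⟩ := exists_planar_solution
    !![0, 0, 0, 1; 0, 0, 0, 0; 0, 0, 0, 0; 0, 0, 0, 0]
    !![0, 1, 0, 0; 0, 0, 0, 0; 0, 0, 6, 0; 0, 0, 0, 0]
  refine ⟨U, q, p, hU, h0, hq0, hp0, fun t ht => (hq t ht).congr_deriv ?_,
    fun t ht => (hp t ht).congr_deriv ?_, fun ω hω t => (hs ω (ω ^ 3) (ω ^ 2) ?_ ?_ t).1⟩
  · simp [planarForm, Fin.sum_univ_four]
  · simp [planarForm, Fin.sum_univ_four]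
    ring
  · have e : ω * ω ^ 2 = ω ^ 3 := by ring
    simp [Fin.forall_fin_succ, e]
  · have e : ω * (ω ^ 3 * ω ^ 3) = ω ^ 2 := by linear_combination ω ^ 2 * hω
    simp [Fin.forall_fin_succ, e, (sq ω).symm]

/-- With `f = a r` this is the Hamiltonian system of P2(`a - 1/2`) in the coordinates `q` and
`f = q' + q² + t/2`, and its Bäcklund transform `q + 1/r` solves P2(`-a - 1/2`). -/
lemma exists_P2_chart (a : ℂ) : ∃ (U : Set ℂ) (q r : ℂ → ℂ), IsOpen U ∧ 0 ∈ U ∧ q 0 = 0 ∧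
    r 0 = 0 ∧ (∀ t ∈ U, HasDerivAt q (a * r t - q t ^ 2 - t / 2) t) ∧
    (∀ t ∈ U, HasDerivAt r (2 * q t * r t + 1) t) ∧
    ∀ ω : ℂ, ω ^ 3 = 1 → ∀ t, q (ω * t) = ω ^ 2 * q t ∧ r (ω * t) = ω * r t := by
  obtain ⟨U, q, p, hU, h0, hq0, hp0, hq, hp, hs⟩ := exists_planar_solution
    !![0, -1 / 2, 0, a; 0, 0, 0, 0; 0, 0, -1, 0; 0, 0, 0, 0]
    !![1, 0, 0, 0; 0, 0, 0, 0; 0, 0, 0, 2; 0, 0, 0, 0]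
  refine ⟨U, q, p, hU, h0, hq0, hp0, fun t ht => (hq t ht).congr_deriv ?_,
    fun t ht => (hp t ht).congr_deriv ?_, fun ω hω t => hs ω (ω ^ 2) ω ?_ ?_ t⟩
  · simp [planarForm, Fin.sum_univ_four]
    ring
  · simp [planarForm, Fin.sum_univ_four]
    ring
  · have e : ω * (ω ^ 2 * ω ^ 2) = ω ^ 2 := by linear_combination ω ^ 2 * hω
    simp [Fin.forall_fin_succ, e, (sq ω).symm]
  · have e : ω * (ω ^ 2 * ω) = ω := by linear_combination ω * hω
    simp [Fin.forall_fin_succ, e]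

end Charts

section Values

variable {t q p z : ℂ}

lemma hasVal_apparent (hq : q ≠ z) : HasVal (3 / (4 * (X - C q) ^ 2)) z (3 / (4 * (z - q) ^ 2)) :=
  (hasVal_ofNat 3 z).div ((hasVal_ofNat 4 z).mul ((hasVal_X_sub_C z q).pow 2))
    (mul_ne_zero (by norm_num) (pow_ne_zero 2 (sub_ne_zero.2 hq.symm)))

lemma hasVal_familyP1 (hq : q ≠ z) : HasVal (familyP1.potential t q p) z
    (4 * z ^ 3 + 2 * t * z + 2 * familyP1.hamiltonian t q p + 3 / (4 * (z - q) ^ 2)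
      - p / (z - q)) :=
  ((((((hasVal_ofNat 4 z).mul ((hasVal_X z).pow 3)).add ((hasVal_C _ z).mul (hasVal_X z))).add
    (hasVal_C _ z)).add (hasVal_apparent hq)).sub
    ((hasVal_C _ z).div (hasVal_X_sub_C z q) (sub_ne_zero.2 hq.symm)))

lemma hasVal_familyP2 {α : ℂ} (hq : q ≠ z) : HasVal ((familyP2 α).potential t q p) z
    (z ^ 4 + t * z ^ 2 + 2 * α * z + 2 * (familyP2 α).hamiltonian t q p + 3 / (4 * (z - q) ^ 2)
      - p / (z - q)) :=
  (((((((hasVal_X z).pow 4).add ((hasVal_C _ z).mul ((hasVal_X z).pow 2))).add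
    ((hasVal_C _ z).mul (hasVal_X z))).add
    (hasVal_C _ z)).add (hasVal_apparent hq)).sub
    ((hasVal_C _ z).div (hasVal_X_sub_C z q) (sub_ne_zero.2 hq.symm)))

lemma hasVal_familyP34 {α : ℂ} (hz : z ≠ 0) (hq : q ≠ z) :
    HasVal ((familyP34 α).potential t q p) z
      (z / 2 - t / 2 + (α - 1) / 4 / z ^ 2 - (familyP34 α).hamiltonian t q p / z
        + 3 / (4 * (z - q) ^ 2) - p * q / (z * (z - q))) :=
  (((((((hasVal_X z).div (hasVal_ofNat 2 z) two_ne_zero).sub (hasVal_C _ z)).add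
    ((hasVal_C _ z).div ((hasVal_X z).pow 2) (pow_ne_zero 2 hz))).sub
    ((hasVal_C _ z).div (hasVal_X z) hz)).add (hasVal_apparent hq)).sub
    ((hasVal_C _ z).div ((hasVal_X z).mul (hasVal_X_sub_C z q))
      (mul_ne_zero hz (sub_ne_zero.2 hq.symm))))

lemma hasVal_familyP4 {α β : ℂ} (hz : z ≠ 0) (hq : q ≠ z) :
    HasVal ((familyP4 α β).potential t q p) z
      ((-β / 8 - 1 / 4) / z ^ 2 + (familyP4 α β).hamiltonian t q p / (2 * z) + -α / 4
        + ((z + 2 * t) / 4) ^ 2 + 3 / (4 * (z - q) ^ 2) - p * q / (z * (z - q))) :=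
  (((((((hasVal_C _ z).div ((hasVal_X z).pow 2) (pow_ne_zero 2 hz)).add
    ((hasVal_C _ z).div ((hasVal_ofNat 2 z).mul (hasVal_X z)) (mul_ne_zero two_ne_zero hz))).add
    (hasVal_C _ z)).add
    ((((hasVal_X z).add (hasVal_C _ z)).div (hasVal_ofNat 4 z) (by norm_num)).pow 2)).add
    (hasVal_apparent hq)).sub
    ((hasVal_C _ z).div ((hasVal_X z).mul (hasVal_X_sub_C z q))
      (mul_ne_zero hz (sub_ne_zero.2 hq.symm))))

lemma hasVal_potP4sym (k m : ℂ) (hz : z ≠ 0) :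
    HasVal (potP4sym k m) z (-k + (16 * m ^ 2 - 1) / (4 * z ^ 2) + z ^ 2 / 16) :=
  (((hasVal_C k z).neg.add ((hasVal_C _ z).div ((hasVal_ofNat 4 z).mul ((hasVal_X z).pow 2))
    (mul_ne_zero (by norm_num) (pow_ne_zero 2 hz)))).add
    (((hasVal_X z).pow 2).div (hasVal_ofNat 16 z) (by norm_num)))

lemma hasVal_potP34sym (m : ℂ) (hz : z ≠ 0) :
    HasVal (potP34sym m) z (z / 2 + (36 * m ^ 2 - 1) / (4 * z ^ 2)) :=
  ((hasVal_X z).div (hasVal_ofNat 2 z) two_ne_zero).add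
    ((hasVal_C _ z).div ((hasVal_ofNat 4 z).mul ((hasVal_X z).pow 2))
      (mul_ne_zero (by norm_num) (pow_ne_zero 2 hz)))

lemma hasVal_potP2sym (k : ℂ) (hz : z ≠ 0) :
    HasVal (potP2sym k) z (z ^ 4 - 6 * k * z + 3 / (4 * z ^ 2)) :=
  (((hasVal_X z).pow 4).sub ((hasVal_C _ z).mul (hasVal_X z))).add
    ((hasVal_ofNat 3 z).div ((hasVal_ofNat 4 z).mul ((hasVal_X z).pow 2))
      (mul_ne_zero (by norm_num) (pow_ne_zero 2 hz)))

lemma hasVal_potP2sym' (k z : ℂ) : HasVal (potP2sym' k) z (z ^ 4 - 6 * k * z) :=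
  ((hasVal_X z).pow 4).sub ((hasVal_C _ z).mul (hasVal_X z))

lemma hasVal_potP1sym (hz : z ≠ 0) : HasVal potP1sym z (3 / (4 * z ^ 2) + 4 * z ^ 3) :=
  ((hasVal_ofNat 3 z).div ((hasVal_ofNat 4 z).mul ((hasVal_X z).pow 2))
      (mul_ne_zero (by norm_num) (pow_ne_zero 2 hz))).add
    ((hasVal_ofNat 4 z).mul ((hasVal_X z).pow 3))

lemma hasVal_potP1sym' (z : ℂ) : HasVal potP1sym' z (4 * z ^ 3) :=
  (hasVal_ofNat 4 z).mul ((hasVal_X z).pow 3)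

lemma tendsto_of_continuousAt {w : ℂ → ℂ} {v₀ : ℂ} (h : ContinuousAt w 0) (e : w 0 = v₀) :
    Tendsto w (𝓝[≠] 0) (𝓝 v₀) :=
  e ▸ h.tendsto.mono_left nhdsWithin_le_nhds

lemma eventually_ne_of_zero {q : ℂ → ℂ} (hq : ContinuousAt q 0) (h0 : q 0 = 0) (hz : z ≠ 0) :
    ∀ᶠ t in 𝓝[≠] 0, q t ≠ z :=
  nhdsWithin_le_nhds (hq.eventually_ne (by rw [h0]; exact hz.symm))

lemma tendsto_eval {V : ℂ → RatFunc ℂ} {V₀ : RatFunc ℂ} {v w : ℂ → ℂ} {v₀ : ℂ}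
    (h : ∀ᶠ t in 𝓝[≠] 0, HasVal (V t) z (v t)) (h₀ : HasVal V₀ z v₀)
    (e : ∀ᶠ t in 𝓝[≠] 0, v t = w t) (hw : Tendsto w (𝓝[≠] 0) (𝓝 v₀)) :
    Tendsto (fun t => (V t).eval (RingHom.id ℂ) z) (𝓝[≠] 0) (𝓝 (V₀.eval (RingHom.id ℂ) z)) := by
  rw [h₀.eval]
  refine hw.congr' ?_
  filter_upwards [h, e] with t ht et
  rw [ht.eval, et]

end Values

/-- In the chart `p = p̃ + c / q`, `c = 2 m + 1`, the Hamiltonian is regular at `q = 0`, and the term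
`p q / (z (z - q))` contributes `-c / z²` to the limit. -/
lemma isSymmetricWithLimit_P4 {k m : ℂ} (h : 4 * m + 1 ≠ 0) :
    ∃ q : ℂ → ℂ, AnalyticAt ℂ q 0 ∧ q 0 = 0 ∧ deriv q 0 = 2 * (4 * m + 1) ∧
      (familyP4 (4 * k) (-2 * (4 * m + 1) ^ 2)).IsSymmetricWithLimit 2 1 q (potP4sym k m) := by
  obtain ⟨U, q, p, hU, h0, hq0, hp0, hq, hp, hs⟩ := exists_P4_chart (2 * m + 1) k
  have hqa := analyticAt_of_hasDerivAt hU hq h0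
  have hpa := analyticAt_of_hasDerivAt hU hp h0
  have hq' : HasDerivAt q (2 * (4 * m + 1)) 0 :=
    (hq 0 h0).congr_deriv (by rw [hq0]; ring)
  have hne : ∀ᶠ t in 𝓝[≠] 0, q t ≠ 0 := hq'.eventually_ne (mul_ne_zero two_ne_zero h)
  have hmem : ∀ᶠ t in 𝓝[≠] (0 : ℂ), t ∈ U := nhdsWithin_le_nhds (hU.mem_nhds h0)
  have hqc : ContinuousOn q U := fun t ht => (hq t ht).continuousAt.continuousWithinAt
  have hU' : IsOpen (U ∩ q ⁻¹' {0}ᶜ) := hqc.isOpen_inter_preimage hU isOpen_compl_singleton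
  refine ⟨q, hqa, hq0, hq'.deriv, hqa.meromorphicAt,
    fun ω hω => .of_forall (hs ω hω), fun t => p t + (2 * m + 1) / q t,
    hpa.meromorphicAt.add ((MeromorphicAt.const _ _).div hqa.meromorphicAt), ?_, fun z hz => ?_⟩
  · filter_upwards [hmem, hne] with t ht hqt
    refine familyP4_isSolutionAt hU' (fun τ hτ => hτ.2) (fun τ hτ => ?_) (fun τ hτ => ?_) ⟨ht, hqt⟩
    · have hτ0 : q τ ≠ 0 := hτ.2
      refine (hq τ hτ.1).congr_deriv ?_
      field_simp
    · have hτ0 : q τ ≠ 0 := hτ.2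
      refine ((hp τ hτ.1).add
        (((hq τ hτ.1).fun_inv hτ0).const_mul (2 * m + 1))).congr_deriv ?_
      field_simp
      ring
  · have hqz : ∀ᶠ t in 𝓝[≠] 0, q t ≠ z := eventually_ne_of_zero hqa.continuousAt hq0 hz
    refine tendsto_eval (hqz.mono fun t ht => hasVal_familyP4 hz ht) (hasVal_potP4sym k m hz)
      (w := fun t => (2 * (4 * m + 1) ^ 2 / 8 - 1 / 4) / z ^ 2 + (2 * q t * p t ^ 2
        + (8 * m + 2) * p t + 2 * k * q t - 2 * q t * ((q t + 2 * t) / 4) ^ 2) / (2 * z) - k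
        + ((z + 2 * t) / 4) ^ 2 + 3 / (4 * (z - q t) ^ 2)
        - (p t * q t + (2 * m + 1)) / (z * (z - q t))) ?_ ?_
    · filter_upwards [hne, hqz] with t ht htz
      have htz' := sub_ne_zero.2 htz.symm
      simp only [familyP4]
      field_simp
      ring
    · have hz0 : z - q 0 ≠ 0 := by rw [hq0, sub_zero]; exact hz
      have hqc := hqa.continuousAt
      have hpc := hpa.continuousAt
      refine tendsto_of_continuousAt (by fun_prop (disch := simp [hz0, hz])) ?_
      rw [hq0, hp0]
      field_simp
      ring

/-- As for P4, in the chart with `c = 1 - 3 m`. -/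
lemma isSymmetricWithLimit_P34 {m : ℂ} (h : 6 * m - 1 ≠ 0) :
    ∃ q : ℂ → ℂ, AnalyticAt ℂ q 0 ∧ q 0 = 0 ∧ deriv q 0 = 6 * m - 1 ∧
      (familyP34 ((6 * m - 1) ^ 2)).IsSymmetricWithLimit 3 1 q (potP34sym m) := by
  obtain ⟨U, q, p, hU, h0, hq0, hp0, hq, hp, hs⟩ := exists_P34_chart (1 - 3 * m)
  have hqa := analyticAt_of_hasDerivAt hU hq h0
  have hpa := analyticAt_of_hasDerivAt hU hp h0
  have hq' : HasDerivAt q (6 * m - 1) 0 :=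
    (hq 0 h0).congr_deriv (by rw [hq0]; ring)
  have hne : ∀ᶠ t in 𝓝[≠] 0, q t ≠ 0 := hq'.eventually_ne h
  have hmem : ∀ᶠ t in 𝓝[≠] (0 : ℂ), t ∈ U := nhdsWithin_le_nhds (hU.mem_nhds h0)
  have hqc : ContinuousOn q U := fun t ht => (hq t ht).continuousAt.continuousWithinAt
  have hU' : IsOpen (U ∩ q ⁻¹' {0}ᶜ) := hqc.isOpen_inter_preimage hU isOpen_compl_singleton
  refine ⟨q, hqa, hq0, hq'.deriv, hqa.meromorphicAt,
    fun ω hω => .of_forall (hs ω hω), fun t => p t + (1 - 3 * m) / q t,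
    hpa.meromorphicAt.add ((MeromorphicAt.const _ _).div hqa.meromorphicAt), ?_, fun z hz => ?_⟩
  · filter_upwards [hmem, hne] with t ht hqt
    refine familyP34_isSolutionAt hU' (fun τ hτ => hτ.2) (fun τ hτ => ?_) (fun τ hτ => ?_)
      ⟨ht, hqt⟩
    · have hτ0 : q τ ≠ 0 := hτ.2
      refine (hq τ hτ.1).congr_deriv ?_
      field_simp
      ring
    · have hτ0 : q τ ≠ 0 := hτ.2
      refine ((hp τ hτ.1).add
        (((hq τ hτ.1).fun_inv hτ0).const_mul (1 - 3 * m))).congr_deriv ?_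
      field_simp
      ring
  · have hqz : ∀ᶠ t in 𝓝[≠] 0, q t ≠ z := eventually_ne_of_zero hqa.continuousAt hq0 hz
    refine tendsto_eval (hqz.mono fun t ht => hasVal_familyP34 hz ht) (hasVal_potP34sym m hz)
      (w := fun t => z / 2 - t / 2 + ((6 * m - 1) ^ 2 - 1) / 4 / z ^ 2 - (-q t * p t ^ 2
        + (6 * m - 1) * p t + q t ^ 2 / 2 - t * q t / 2) / z
        + 3 / (4 * (z - q t) ^ 2)
        - (p t * q t + (1 - 3 * m)) / (z * (z - q t))) ?_ ?_
    · filter_upwards [hne, hqz] with t ht htz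
      have htz' := sub_ne_zero.2 htz.symm
      simp only [familyP34]
      field_simp
      ring
    · have hz0 : z - q 0 ≠ 0 := by rw [hq0, sub_zero]; exact hz
      have hqc := hqa.continuousAt
      have hpc := hpa.continuousAt
      refine tendsto_of_continuousAt (by fun_prop (disch := simp [hz0, hz])) ?_
      rw [hq0, hp0]
      field_simp
      ring

lemma isSymmetricWithLimit_P1 :
    ∃ q : ℂ → ℂ, AnalyticAt ℂ q 0 ∧ q 0 = 0 ∧ deriv q 0 = 0 ∧
      familyP1.IsSymmetricWithLimit 5 3 q potP1sym := by
  obtain ⟨U, q, p, hU, h0, hq0, hp0, hq, hp, hs⟩ := exists_P1_chart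
  have hqa := analyticAt_of_hasDerivAt hU hq h0
  have hpa := analyticAt_of_hasDerivAt hU hp h0
  have hmem : ∀ᶠ t in 𝓝[≠] (0 : ℂ), t ∈ U := nhdsWithin_le_nhds (hU.mem_nhds h0)
  refine ⟨q, hqa, hq0, by rw [(hq 0 h0).deriv, hp0], hqa.meromorphicAt,
    fun ω hω => .of_forall (hs ω hω), p, hpa.meromorphicAt,
    hmem.mono fun t ht => familyP1_isSolutionAt hU hq hp ht, fun z hz => ?_⟩
  have hqz : ∀ᶠ t in 𝓝[≠] 0, q t ≠ z := eventually_ne_of_zero hqa.continuousAt hq0 hz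
  refine tendsto_eval (hqz.mono fun t ht => hasVal_familyP1 ht) (hasVal_potP1sym hz)
    (.of_forall fun t => rfl) ?_
  have hz0 : z - q 0 ≠ 0 := by rw [hq0, sub_zero]; exact hz
  have hqc := hqa.continuousAt
  have hpc := hpa.continuousAt
  simp only [familyP1]
  refine tendsto_of_continuousAt (by fun_prop (disch := simp [hz0])) ?_
  rw [hq0, hp0]
  field_simp
  ring

lemma isSymmetricWithLimit_P2 (k : ℂ) :
    ∃ q : ℂ → ℂ, AnalyticAt ℂ q 0 ∧ q 0 = 0 ∧ deriv q 0 = 0 ∧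
      (familyP2 (-3 * k)).IsSymmetricWithLimit 3 2 q (potP2sym k) := by
  obtain ⟨U, q, r, hU, h0, hq0, hr0, hq, hr, hs⟩ := exists_P2_chart (1 / 2 - 3 * k)
  have hqa := analyticAt_of_hasDerivAt hU hq h0
  have hra := analyticAt_of_hasDerivAt hU hr h0
  have hmem : ∀ᶠ t in 𝓝[≠] (0 : ℂ), t ∈ U := nhdsWithin_le_nhds (hU.mem_nhds h0)
  have hp : ∀ t ∈ U, HasDerivAt (fun t => (1 / 2 - 3 * k) * r t - q t ^ 2 - t / 2)
      (2 * q t ^ 3 + t * q t + -3 * k) t := fun t ht =>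
    ((((hr t ht).const_mul (1 / 2 - 3 * k)).sub ((hq t ht).fun_pow 2)).sub
      ((hasDerivAt_id t).div_const 2)).congr_deriv (by norm_num; ring)
  refine ⟨q, hqa, hq0, by rw [(hq 0 h0).deriv, hq0, hr0]; ring, hqa.meromorphicAt,
    fun ω hω => .of_forall fun t => (hs ω hω t).1, _,
    (analyticAt_of_hasDerivAt hU hp h0).meromorphicAt,
    hmem.mono fun t ht => familyP2_isSolutionAt hU hq hp ht, fun z hz => ?_⟩
  have hqz : ∀ᶠ t in 𝓝[≠] 0, q t ≠ z := eventually_ne_of_zero hqa.continuousAt hq0 hz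
  refine tendsto_eval (hqz.mono fun t ht => hasVal_familyP2 ht) (hasVal_potP2sym k hz)
    (.of_forall fun t => rfl) ?_
  have hz0 : z - q 0 ≠ 0 := by rw [hq0, sub_zero]; exact hz
  have hqc := hqa.continuousAt
  have hrc := hra.continuousAt
  simp only [familyP2]
  refine tendsto_of_continuousAt (by fun_prop (disch := simp [hz0])) ?_
  rw [hq0, hr0]
  field_simp
  ring

/-- The solution with a pole is the Bäcklund transform `q + 1/r` of a solution that is analytic
at `0`. -/
lemma isSymmetricWithLimit_P2_pole (k : ℂ) :
    ∃ q : ℂ → ℂ, Tendsto (fun t => t * q t) (𝓝[≠] 0) (𝓝 1) ∧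
      (familyP2 (1 / 2 - 3 * k)).IsSymmetricWithLimit 3 2 q (potP2sym' k) := by
  obtain ⟨U, q, r, hU, h0, hq0, hr0, hq, hr, hs⟩ := exists_P2_chart (3 * k - 1)
  have hqa := analyticAt_of_hasDerivAt hU hq h0
  have hra := analyticAt_of_hasDerivAt hU hr h0
  have hqc := hqa.continuousAt
  have hrc := hra.continuousAt
  have hr' : HasDerivAt r 1 0 := (hr 0 h0).congr_deriv (by rw [hq0]; ring)
  have hne : ∀ᶠ t in 𝓝[≠] 0, r t ≠ 0 := hr'.eventually_ne one_ne_zero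
  have hmem : ∀ᶠ t in 𝓝[≠] (0 : ℂ), t ∈ U := nhdsWithin_le_nhds (hU.mem_nhds h0)
  have hrc' : ContinuousOn r U := fun t ht => (hr t ht).continuousAt.continuousWithinAt
  have hU' : IsOpen (U ∩ r ⁻¹' {0}ᶜ) := hrc'.isOpen_inter_preimage hU isOpen_compl_singleton
  set Q : ℂ → ℂ := fun t => q t + 1 / r t with hQ
  set P : ℂ → ℂ := fun t => (3 * k - 1) * r t - t / 2 - Q t ^ 2 with hP
  have hQ' : ∀ t ∈ U ∩ r ⁻¹' {0}ᶜ, HasDerivAt Q (P t) t := fun t ht => by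
    have hrt : r t ≠ 0 := ht.2
    refine ((hq t ht.1).add (((hr t ht.1).fun_inv hrt).const_mul 1)).congr_deriv ?_
    simp only [hP, hQ]
    field_simp
    ring
  have hP' : ∀ t ∈ U ∩ r ⁻¹' {0}ᶜ,
      HasDerivAt P (2 * Q t ^ 3 + t * Q t + (1 / 2 - 3 * k)) t := fun t ht => by
    have hrt : r t ≠ 0 := ht.2
    refine ((((hr t ht.1).const_mul (3 * k - 1)).sub ((hasDerivAt_id t).div_const 2)).sub
      ((hQ' t ht).fun_pow 2)).congr_deriv ?_
    have e : q t * r t = Q t * r t - 1 := by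
      simp only [hQ]
      field_simp
      ring
    simp only [hP, Nat.cast_ofNat, Nat.add_one_sub_one, pow_one]
    linear_combination (2 * (3 * k - 1)) * e
  have hQm : MeromorphicAt Q 0 :=
    hqa.meromorphicAt.add ((MeromorphicAt.const _ _).div hra.meromorphicAt)
  have hPm : MeromorphicAt P 0 :=
    (((MeromorphicAt.const (3 * k - 1) 0).mul hra.meromorphicAt).sub
      ((MeromorphicAt.id 0).div (MeromorphicAt.const 2 0))).sub (hQm.pow 2)
  refine ⟨Q, ?_, hQm, fun ω hω => .of_forall fun t => ?_, P, hPm, ?_, fun z hz => ?_⟩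
  · have h1 : Tendsto (fun t => r t / t) (𝓝[≠] 0) (𝓝 1) := by
      have := hr'.tendsto_slope
      refine this.congr fun t => ?_
      rw [slope_def_field, hr0, sub_zero, sub_zero]
    have h2 : Tendsto (fun t => t * q t) (𝓝[≠] 0) (𝓝 0) :=
      tendsto_of_continuousAt (by fun_prop) (zero_mul _)
    have h3 := h2.add (h1.inv₀ one_ne_zero)
    rw [zero_add, inv_one] at h3
    refine h3.congr fun t => ?_
    simp only [hQ]
    rw [inv_div]
    ring
  · simp only [hQ, (hs ω hω t).1, (hs ω hω t).2]
    have hω0 : ω ≠ 0 := by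
      rintro rfl
      norm_num at hω
    have : 1 / (ω * r t) = ω ^ 2 * (1 / r t) := by
      rw [← div_div, div_right_comm, div_eq_iff hω0]
      linear_combination (-(1 / r t)) * hω
    rw [this]
    ring
  · filter_upwards [hmem, hne] with t ht hrt
    exact familyP2_isSolutionAt hU' hQ' hP' ⟨ht, hrt⟩
  · -- In terms of `q` and `r` the apparent singularity is at `(q r + 1) / r`.
    have hrz : ContinuousAt (fun t => q t * r t + 1 - z * r t) 0 := by fun_prop
    have hr1 : q 0 * r 0 + 1 - z * r 0 ≠ 0 := by rw [hq0, hr0]; norm_num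
    have hqz : ∀ᶠ t in 𝓝[≠] 0, Q t ≠ z := by
      filter_upwards [hne, nhdsWithin_le_nhds (hrz.eventually_ne hr1)] with t ht h2 h3
      apply h2
      rw [← h3, hQ]
      field_simp
      ring
    refine tendsto_eval (hqz.mono fun t ht => hasVal_familyP2 ht) (hasVal_potP2sym' k z)
      (w := fun t => z ^ 4 + t * z ^ 2 + 2 * (1 / 2 - 3 * k) * z
        + 2 * (((3 * k - 1) * r t - t / 2) ^ 2 / 2 - (3 * k - 1) * (r t * q t ^ 2 + 2 * q t)
        - (1 / 2 - 3 * k) * q t) - q t - z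
        + 3 * r t ^ 2 / (4 * (q t * r t + 1 - z * r t) ^ 2)
        + (((3 * k - 1) * r t - t / 2 - z ^ 2) * r t) / (q t * r t + 1 - z * r t)) ?_ ?_
    · filter_upwards [hne, hqz] with t ht htz
      have htz' := sub_ne_zero.2 htz.symm
      have e1 : q t * r t + 1 - z * r t = -(z - Q t) * r t := by
        simp only [hQ]
        field_simp
        ring
      have e2 : q t = Q t - 1 / r t := by simp only [hQ]; ring
      rw [e1]
      simp only [familyP2, hP]
      rw [e2]
      field_simp
      ring
    · refine tendsto_of_continuousAt (by fun_prop (disch := simp [hr1])) ?_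
      rw [hq0, hr0]
      norm_num
      ring

/-- The coefficients of the solution `q = t⁻² + ∑ bₙ t ^ (5 n + 3)` of P1. -/
def p1Coeff : ℕ → ℂ
  | 0 => -1 / 6
  | n + 1 => 6 / ((5 * n + 4 : ℂ) * (5 * n + 11)) *
      ∑ l : Fin (n + 1), p1Coeff l * p1Coeff (n - l)

lemma p1Coeff_succ (n : ℕ) :
    ((5 * n + 4 : ℂ) * (5 * n + 11)) * p1Coeff (n + 1) =
      6 * ∑ lm ∈ Finset.HasAntidiagonal.antidiagonal n, p1Coeff lm.1 * p1Coeff lm.2 := by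
  have h1 : (5 * n + 4 : ℂ) ≠ 0 := by exact_mod_cast (by omega : 5 * n + 4 ≠ 0)
  have h2 : (5 * n + 11 : ℂ) ≠ 0 := by exact_mod_cast (by omega : 5 * n + 11 ≠ 0)
  rw [p1Coeff, ← mul_assoc, mul_div_cancel₀ _ (mul_ne_zero h1 h2)]
  simp only [Finset.Nat.sum_antidiagonal_eq_sum_range_succ_mk, Finset.sum_range]

lemma norm_p1Coeff_le (n : ℕ) : ‖p1Coeff n‖ ≤ 1 / 6 * 1 ^ n := by
  induction n using Nat.strong_induction_on with
  | _ n ih =>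
    cases n with
    | zero => rw [p1Coeff]; norm_num
    | succ n =>
      have h1 : ‖((5 * n + 4 : ℂ) * (5 * n + 11))‖ = (5 * n + 4) * (5 * n + 11) := by
        have := Complex.norm_natCast ((5 * n + 4) * (5 * n + 11))
        push_cast at this
        exact this
      have h2 := norm_antidiagonal_le (by norm_num : (0 : ℝ) ≤ 1 / 6) n
        (fun i hi => ih i (by omega)) (fun i hi => ih i (by omega)) zero_le_one
      have h3 := congrArg (‖·‖) (p1Coeff_succ n)
      simp only [norm_mul _ (p1Coeff (n + 1)), h1, norm_mul (6 : ℂ), Complex.norm_ofNat] at h3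
      have h4 : (0 : ℝ) < (5 * n + 4) * (5 * n + 11) := by positivity
      rw [one_pow] at h2 ⊢
      refine le_of_mul_le_mul_left ?_ h4
      rw [h3]
      have : (0 : ℝ) ≤ n := n.cast_nonneg
      nlinarith

/-- The pole solution of P1 comes from a holomorphic solution of this equation by
`q = t⁻² + t³ g(t⁵)`. -/
lemma exists_P1_series : ∃ g g₁ g₂ : ℂ → ℂ, ContinuousAt g₂ 0 ∧ ∀ τ : ℂ, 4 * ‖τ‖ < 1 →
    HasDerivAt g (g₁ τ) τ ∧ HasDerivAt g₁ (g₂ τ) τ ∧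
      25 * τ ^ 2 * g₂ τ + 50 * τ * g₁ τ - 6 * g τ = 1 + 6 * τ * g τ ^ 2 := by
  have b0 := norm_p1Coeff_le
  have b1 := norm_deriv_coeff_le b0
  have b2 := norm_deriv_coeff_le b1
  set c : ℕ → ℂ := p1Coeff with hc
  set c1 : ℕ → ℂ := fun n => (n + 1 : ℂ) * c (n + 1) with hc1
  set c2 : ℕ → ℂ := fun n => (n + 1 : ℂ) * c1 (n + 1) with hc2
  refine ⟨fun τ => ∑' n, c n * τ ^ n, fun τ => ∑' n, c1 n * τ ^ n, fun τ => ∑' n, c2 n * τ ^ n,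
    (hasDerivAt_tsum_pow (by norm_num) b2 (by norm_num)).2.continuousAt, fun τ hτ => ?_⟩
  have hn := norm_nonneg τ
  obtain ⟨s1, d1⟩ := hasDerivAt_tsum_pow (by norm_num) b0 (t := τ) (by linarith)
  obtain ⟨s2, d2⟩ := hasDerivAt_tsum_pow (by norm_num) b1 (t := τ) (by linarith)
  rw [← s1.tsum_eq] at d1 s1
  rw [← s2.tsum_eq] at d2 s2
  refine ⟨d1, d2, ?_⟩
  have s0 := hasSum_term zero_le_one b0 (t := τ) (by linarith)
  have s3 := hasSum_mul_term zero_le_one b0 b0 (t := τ) (by linarith)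
  change HasSum (fun n => c1 n * τ ^ n) (∑' n, c1 n * τ ^ n) at s1
  change HasSum (fun n => c2 n * τ ^ n) (∑' n, c2 n * τ ^ n) at s2
  change 25 * τ ^ 2 * (∑' n, c2 n * τ ^ n) + 50 * τ * (∑' n, c1 n * τ ^ n)
    - 6 * (∑' n, c n * τ ^ n) = 1 + 6 * τ * (∑' n, c n * τ ^ n) ^ 2
  generalize (∑' n, c n * τ ^ n) = G at *
  generalize (∑' n, c1 n * τ ^ n) = G1 at *
  generalize (∑' n, c2 n * τ ^ n) = G2 at *
  have t1 : HasSum (fun n : ℕ => (n : ℂ) * c n * τ ^ n) (τ * G1) := by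
    rw [← hasSum_nat_add_iff' 1]
    simp only [Finset.range_one, Finset.sum_singleton, Nat.cast_zero, zero_mul, sub_zero]
    refine (s1.mul_left τ).congr_fun fun n => ?_
    simp only [hc1]
    push_cast
    ring
  have t2 : HasSum (fun n : ℕ => (n : ℂ) * (n - 1) * c n * τ ^ n) (τ ^ 2 * G2) := by
    rw [← hasSum_nat_add_iff' 2]
    simp only [Finset.sum_range_succ, Finset.range_zero, Finset.sum_empty, Nat.cast_zero, zero_mul,
      Nat.cast_one, sub_self, mul_zero, add_zero, sub_zero]
    refine (s2.mul_left (τ ^ 2)).congr_fun fun n => ?_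
    simp only [hc1, hc2]
    push_cast
    ring
  have t3 := ((t2.mul_left 25).add (t1.mul_left 50)).sub (s0.mul_left 6)
  have t4 : HasSum (fun n : ℕ => 25 * ((n : ℂ) * (n - 1) * c n * τ ^ n) +
      50 * (n * c n * τ ^ n) - 6 * (c n * τ ^ n)) (1 + 6 * τ * G ^ 2) := by
    rw [← hasSum_nat_add_iff' 1]
    have e0 : c 0 = -1 / 6 := by rw [hc, p1Coeff]
    simp only [Finset.range_one, Finset.sum_singleton, Nat.cast_zero, zero_mul, pow_zero, e0]
    have := s3.mul_left (6 * τ)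
    rw [show 1 + 6 * τ * G ^ 2 - (25 * 0 + 50 * 0 - 6 * (-1 / 6 * 1)) = 6 * τ * (G * G) by ring]
    refine this.congr_fun fun n => ?_
    have e := p1Coeff_succ n
    rw [← hc] at e
    push_cast
    linear_combination τ ^ (n + 1) * e
  have := t3.unique t4
  linear_combination this

/-- The data of `exists_P1_series` composed with `τ = t⁵`. -/
lemma exists_P1_quintic_series : ∃ (U : Set ℂ) (G G₁ G₂ : ℂ → ℂ), IsOpen U ∧ 0 ∈ U ∧
    ContinuousAt G₂ 0 ∧ (∀ t ∈ U, HasDerivAt G (G₁ t * (5 * t ^ 4)) t) ∧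
    (∀ t ∈ U, HasDerivAt G₁ (G₂ t * (5 * t ^ 4)) t) ∧
    (∀ t ∈ U, 25 * t ^ 10 * G₂ t + 50 * t ^ 5 * G₁ t - 6 * G t = 1 + 6 * t ^ 5 * G t ^ 2) ∧
    ∀ ω : ℂ, ω ^ 5 = 1 → ∀ t, G (ω * t) = G t := by
  obtain ⟨g, g₁, g₂, hg₂, h⟩ := exists_P1_series
  have hp5 : ∀ t : ℂ, HasDerivAt (fun t : ℂ => t ^ 5) (5 * t ^ 4) t := fun t => by
    simpa using hasDerivAt_pow 5 t
  refine ⟨{t | 4 * ‖t ^ 5‖ < 1}, fun t => g (t ^ 5), fun t => g₁ (t ^ 5), fun t => g₂ (t ^ 5),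
    isOpen_lt (by fun_prop) continuous_const, by simp,
    ContinuousAt.comp (f := fun t : ℂ => t ^ 5) (by simpa using hg₂) (by fun_prop),
    fun t ht => (h (t ^ 5) ht).1.comp t (hp5 t), fun t ht => (h (t ^ 5) ht).2.1.comp t (hp5 t),
    fun t ht => ?_, fun ω hω t => ?_⟩
  · rw [← (h (t ^ 5) ht).2.2]
    ring
  · simp only [mul_pow, hω, one_mul]

/-- The solution `q = t⁻² + t³ G(t)`, where `G` is a power series in `t⁵`. -/
lemma isSymmetricWithLimit_P1_pole :
    ∃ q : ℂ → ℂ, Tendsto (fun t => t ^ 2 * q t) (𝓝[≠] 0) (𝓝 1) ∧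
      familyP1.IsSymmetricWithLimit 5 3 q potP1sym' := by
  obtain ⟨U, G, G₁, G₂, hU, h0, hG₂c, hG, hG₁, hode, hs⟩ := exists_P1_quintic_series
  have hU' : IsOpen (U ∩ {0}ᶜ) := hU.inter isOpen_compl_singleton
  have hmem : ∀ᶠ t in 𝓝[≠] (0 : ℂ), t ∈ U := nhdsWithin_le_nhds (hU.mem_nhds h0)
  have hne : ∀ᶠ t in 𝓝[≠] (0 : ℂ), t ≠ 0 := eventually_mem_nhdsWithin
  have hGa := analyticAt_of_hasDerivAt hU hG h0
  have hG₁a := analyticAt_of_hasDerivAt hU hG₁ h0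
  have hGc := hGa.continuousAt
  have hG₁c := hG₁a.continuousAt
  set q : ℂ → ℂ := fun t => 1 / t ^ 2 + t ^ 3 * G t with hq
  set p : ℂ → ℂ := fun t => -2 / t ^ 3 + 3 * t ^ 2 * G t + 5 * t ^ 7 * G₁ t with hp
  have hid : MeromorphicAt (fun t : ℂ => t) 0 := MeromorphicAt.id 0
  have hqm : MeromorphicAt q 0 := ((MeromorphicAt.const 1 0).div (hid.pow 2)).add
    ((hid.pow 3).mul hGa.meromorphicAt)
  have hpm : MeromorphicAt p 0 := (((MeromorphicAt.const (-2) 0).div (hid.pow 3)).add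
    (((MeromorphicAt.const 3 0).mul (hid.pow 2)).mul hGa.meromorphicAt)).add
    (((MeromorphicAt.const 5 0).mul (hid.pow 7)).mul hG₁a.meromorphicAt)
  have hpow : ∀ (n : ℕ) (t : ℂ), HasDerivAt (fun t : ℂ => t ^ n) (n * t ^ (n - 1)) t :=
    fun n t => hasDerivAt_pow n t
  have hq' : ∀ t ∈ U ∩ {0}ᶜ, HasDerivAt q (p t) t := fun t ht => by
    have ht0 : t ≠ 0 := ht.2
    refine ((((hpow 2 t).fun_inv (pow_ne_zero 2 ht0)).const_mul 1).add
      ((hpow 3 t).mul (hG t ht.1))).congr_deriv ?_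
    simp only [hp]
    norm_num
    field_simp
    ring
  have hp' : ∀ t ∈ U ∩ {0}ᶜ, HasDerivAt p (6 * q t ^ 2 + t) t := fun t ht => by
    have ht0 : t ≠ 0 := ht.2
    refine (((((hpow 3 t).fun_inv (pow_ne_zero 3 ht0)).const_mul (-2)).add
      (((hpow 2 t).const_mul 3).mul (hG t ht.1))).add
      (((hpow 7 t).const_mul 5).mul (hG₁ t ht.1))).congr_deriv ?_
    have ode := hode t ht.1
    simp only [hq]
    norm_num
    field_simp
    linear_combination (t ^ 5) * ode
  refine ⟨q, ?_, hqm, fun ω hω => .of_forall fun t => ?_, p, hpm, ?_, fun z hz => ?_⟩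
  · have h1 : Tendsto (fun t => 1 + t ^ 5 * G t) (𝓝[≠] 0) (𝓝 1) :=
      tendsto_of_continuousAt (by fun_prop) (by norm_num)
    refine h1.congr' ?_
    filter_upwards [hne] with t ht
    simp only [hq]
    field_simp
  · have hω0 : ω ≠ 0 := by
      rintro rfl
      norm_num at hω
    simp only [hq]
    have : 1 / (ω * t) ^ 2 = ω ^ 3 * (1 / t ^ 2) := by
      rw [mul_pow, ← div_div, div_right_comm, div_eq_iff (pow_ne_zero 2 hω0)]
      linear_combination (-(1 / t ^ 2)) * hω
    rw [this, mul_pow, hs ω hω]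
    ring
  · filter_upwards [hmem, hne] with t ht ht0
    exact familyP1_isSolutionAt hU' hq' hp' ⟨ht, ht0⟩
  · have hD : ContinuousAt (fun t => 1 + t ^ 5 * G t - z * t ^ 2) 0 := by fun_prop
    have hD0 : (1 : ℂ) + 0 ^ 5 * G 0 - z * 0 ^ 2 ≠ 0 := by norm_num
    have hDne : ∀ᶠ t in 𝓝[≠] (0 : ℂ), 1 + t ^ 5 * G t - z * t ^ 2 ≠ 0 :=
      nhdsWithin_le_nhds (hD.eventually_ne hD0)
    have hqz : ∀ᶠ t in 𝓝[≠] 0, q t ≠ z := by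
      filter_upwards [hne, hDne] with t ht h2 h3
      apply h2
      rw [← h3, hq]
      field_simp
      ring
    -- The Hamiltonian is `1 / t + O(t ^ 4)` and its pole cancels that of `p / (q - z)`.
    have hK : ∀ t ∈ U, t ≠ 0 → familyP1.hamiltonian t (q t) (p t) = 1 / t + t ^ 4 *
        (-2 * (25 * t ^ 5 * G₂ t + 50 * G₁ t - 6 * G t ^ 2) - 10 * G₁ t
        + (3 * G t + 5 * t ^ 5 * G₁ t) ^ 2 / 2 - 6 * G t ^ 2
        - 2 * t ^ 5 * G t ^ 3 - G t) := fun t ht ht0 => by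
      have ode := hode t ht
      simp only [familyP1, hq, hp]
      field_simp
      linear_combination 4 * t ^ 5 * ode
    refine tendsto_eval (hqz.mono fun t ht => hasVal_familyP1 ht) (hasVal_potP1sym' z)
      (w := fun t => 4 * z ^ 3 + 2 * t * z + 2 * (t ^ 4 *
        (-2 * (25 * t ^ 5 * G₂ t + 50 * G₁ t - 6 * G t ^ 2) - 10 * G₁ t
        + (3 * G t + 5 * t ^ 5 * G₁ t) ^ 2 / 2 - 6 * G t ^ 2
        - 2 * t ^ 5 * G t ^ 3 - G t))
        + 3 * t ^ 4 / (4 * (1 + t ^ 5 * G t - z * t ^ 2) ^ 2)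
        + (5 * t ^ 4 * G t - 2 * z * t + 5 * t ^ 9 * G₁ t) /
          (1 + t ^ 5 * G t - z * t ^ 2)) ?_ ?_
    · filter_upwards [hmem, hne, hDne] with t ht ht0 hD
      rw [hK t ht ht0]
      have e : z - q t = -(1 + t ^ 5 * G t - z * t ^ 2) / t ^ 2 := by
        simp only [hq]
        field_simp
        ring
      rw [e]
      simp only [hp]
      field_simp
      ring
    · refine tendsto_of_continuousAt (by fun_prop (disch := simp)) ?_
      norm_num

end

end FuchsCover

theorem mainTheorem1 :
    -- classification of the covers of the Whittaker equations
    (∀ x : RatFunc ℂ, 2 ≤ coverDegree x → ∀ k m : ℂ,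
      (IsPainleveOrConfluent (pullback x (W k m)) ↔
        ∃ T J, TableW k m (zeroType x) (poleType x) T J)) ∧
    -- classification of the covers of the degenerate Whittaker equations
    (∀ x : RatFunc ℂ, 2 ≤ coverDegree x → ∀ m : ℂ,
      (IsPainleveOrConfluent (pullback x (DW m)) ↔
        (∃ T J, TableDW m (zeroType x) (poleType x) T J) ∨
          ∃ y : RatFunc ℂ, x = y ^ 2 / 16 ∧
            ∃ T J, TableW 0 (2 * m) (zeroType y) (poleType y) T J)) ∧
    (∀ y : RatFunc ℂ, 1 ≤ coverDegree y → ∀ m : ℂ,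
      pullback (y ^ 2 / 16) (DW m) = pullback y (W 0 (2 * m))) ∧
    -- singularity type and sort of the transformed equation in each row
    (∀ (x : RatFunc ℂ) (k m : ℂ) (T : Multiset ℚ) (J : Target),
      TableW k m (zeroType x) (poleType x) T J →
        HasSingularityType (pullback x (W k m)) T ∧ J.Holds (pullback x (W k m))) ∧
    (∀ (x : RatFunc ℂ) (m : ℂ) (T : Multiset ℚ) (J : Target),
      TableDW m (zeroType x) (poleType x) T J →
        HasSingularityType (pullback x (DW m)) T ∧ J.Holds (pullback x (DW m))) ∧
    -- P4-sym
    (∀ k m : ℂ, pullback coverP4sym (W k m) = potP4sym k m ∧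
      (4 * m + 1 ≠ 0 → ∃ q : ℂ → ℂ, AnalyticAt ℂ q 0 ∧ q 0 = 0 ∧ deriv q 0 = 2 * (4 * m + 1) ∧
        (familyP4 (4 * k) (-2 * (4 * m + 1) ^ 2)).IsSymmetricWithLimit 2 1 q (potP4sym k m))) ∧
    -- Weber
    (∀ k : ℂ, pullback coverWeber (W k (1 / 4)) = potWeber k) ∧
    -- D6-alg
    (∀ (k : ℂ) (U : Set ℂ) (s : ℂ → ℂ), IsOpen U → DifferentiableOn ℂ s U →
      (∀ t ∈ U, t ≠ 0 ∧ s t ^ 2 = t) →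
      (familyP3 (-8 * k) (8 * k) 4 (-4)).RealizedOn U (fun t => -s t) (W k (1 / 4))
        (fun t => coverD6alg (s t)) (fun t => potD6alg k t (s t))) ∧
    -- P4-Her
    (familyP4 0 (-2)).RealizedOn {0}ᶜ (fun t => -2 * t) (W 0 (1 / 2)) coverP4Her potP4Her ∧
    -- Kummer
    (∀ m : ℂ, pullback coverKummer (DW m) = potKummer m ∧ potKummer m = W 0 (2 * m)) ∧
    -- P5-rat
    (∀ m h : ℂ, h ≠ 0 →
      (familyP5 (2 * m ^ 2) (-2 * m ^ 2) 0 (-2 * h)).RealizedOn {0}ᶜ (fun _ => -1) (DW m)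
        (coverP5rat h) (potP5rat m h)) ∧
    -- D8-alg
    (∀ (h : ℂ) (U : Set ℂ) (s : ℂ → ℂ), h ≠ 0 → IsOpen U → DifferentiableOn ℂ s U →
      (∀ t ∈ U, t ≠ 0 ∧ s t ^ 2 = t) →
      (familyP3 (8 * h) (-8 * h) 0 0).RealizedOn U (fun t => -s t) (DW (1 / 4))
        (fun t => coverD8alg h (s t)) (fun t => potD8alg h t (s t))) ∧
    -- P2-sym
    (∀ k : ℂ, pullback coverP2sym (W k (1 / 3)) = potP2sym k ∧
      ∃ q : ℂ → ℂ, AnalyticAt ℂ q 0 ∧ q 0 = 0 ∧ deriv q 0 = 0 ∧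
        (familyP2 (-3 * k)).IsSymmetricWithLimit 3 2 q (potP2sym k)) ∧
    (∀ k : ℂ, pullback coverP2sym (W k (1 / 6)) = potP2sym' k ∧
      ∃ q : ℂ → ℂ, Tendsto (fun t => t * q t) (𝓝[≠] 0) (𝓝 1) ∧
        (familyP2 (1 / 2 - 3 * k)).IsSymmetricWithLimit 3 2 q (potP2sym' k)) ∧
    -- P34-sym
    (∀ m : ℂ, pullback coverP34sym (DW m) = potP34sym m ∧
      (6 * m - 1 ≠ 0 → ∃ q : ℂ → ℂ, AnalyticAt ℂ q 0 ∧ q 0 = 0 ∧ deriv q 0 = 6 * m - 1 ∧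
        (familyP34 ((6 * m - 1) ^ 2)).IsSymmetricWithLimit 3 1 q (potP34sym m))) ∧
    -- Airy
    pullback coverAiry (DW (1 / 6)) = potAiry ∧
    -- P34-rat
    (familyP34 (1 / 4)).RealizedOn {0}ᶜ (fun t => t / 2) (DW (1 / 4)) coverP34rat potP34rat ∧
    -- D7-alg
    (∀ (U : Set ℂ) (s : ℂ → ℂ), IsOpen U → DifferentiableOn ℂ s U →
      (∀ t ∈ U, t ≠ 0 ∧ s t ^ 3 = t) →
      (familyP3 0 (-2) 2 0).RealizedOn U s (DW (1 / 6))
        (fun t => coverD7alg (s t)) (fun t => potD7alg t (s t))) ∧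
    -- P4-rat
    (familyP4 0 (-2 / 9)).RealizedOn {0}ᶜ (fun t => -2 * t / 3) (DW (1 / 6))
      coverP4rat potP4rat ∧
    -- P1-sym
    (pullback coverP1sym (DW (1 / 5)) = potP1sym ∧
      ∃ q : ℂ → ℂ, AnalyticAt ℂ q 0 ∧ q 0 = 0 ∧ deriv q 0 = 0 ∧
        familyP1.IsSymmetricWithLimit 5 3 q potP1sym) ∧
    (pullback coverP1sym (DW (1 / 10)) = potP1sym' ∧
      ∃ q : ℂ → ℂ, Tendsto (fun t => t ^ 2 * q t) (𝓝[≠] 0) (𝓝 1) ∧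
        familyP1.IsSymmetricWithLimit 5 3 q potP1sym') ∧
    -- P2-rat
    (familyP2 0).RealizedOn Set.univ (fun _ => 0) (DW (1 / 6)) coverP2rat potP2rat :=
  ⟨fun _ hd k m => isPainleveOrConfluent_W_iff hd k m,
    fun _ hd m => isPainleveOrConfluent_DW_iff hd m,
    fun _ hd m => pullback_sq_div (Nonconst.of_coverDegree hd) m,
    fun _ _ _ _ _ h => h.rowHolds,
    fun _ _ _ _ h => h.rowHolds,
    fun k m => ⟨pullback_coverP4sym k m, isSymmetricWithLimit_P4⟩,
    pullback_coverWeber,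
    realizedOn_D6alg,
    realizedOn_P4Her,
    fun m => ⟨pullback_coverKummer m, potKummer_eq m⟩,
    realizedOn_P5rat,
    realizedOn_D8alg,
    fun k => ⟨pullback_coverP2sym k, isSymmetricWithLimit_P2 k⟩,
    fun k => ⟨pullback_coverP2sym' k, isSymmetricWithLimit_P2_pole k⟩,
    fun m => ⟨pullback_coverP34sym m, isSymmetricWithLimit_P34⟩,
    pullback_coverAiry,
    realizedOn_P34rat,
    realizedOn_D7alg,
    realizedOn_P4rat,
    ⟨pullback_coverP1sym, isSymmetricWithLimit_P1⟩,
    ⟨pullback_coverP1sym', isSymmetricWithLimit_P1_pole⟩,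
    realizedOn_P2rat⟩
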